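/- Identify $\{0,1\}^d$ with the subsets of $[d]=\{1,\dots,d\}$ and let $B(\mathbf x,\mathbf y)=|\mathbf x\cap\mathbf y|/\max(|\mathbf x|,|\mathbf y|)$ denote Braun-Blanquet similarity (with $B(\emptyset,\emptyset)=0$). Fix constants $0<b_2<b_1<1$ and put $\rho=\log(1/b_1)/\log(1/b_2)$. (1) The $(b_1,b_2)$-approximate Braun-Blanquet similarity search problem can be solved by a randomized data structure with query time $O(|\mathbf q|\,n^{\rho}\log n)$ and space $O(n^{1+\rho}\log n+\sum_{\mathbf x\in P}|\mathbf x|)$ (in words). In detail: the model is the word RAM with word size $W=\Theta(\log n)$ (a sufficiently large multiple of $\log n$), unit-cost addition, subtraction, multiplication, bitwise operations, shifts, comparisons and memory accesses, and an instruction that generates a uniformly random word; the dimension satisfies $d\le n^{O(1)}$, so that elements of $[d]$ fit into words; sets are given as increasing lists of their elements, and the thresholds $b_1,b_2$ to $W$ binary digits. There are a preprocessing program and a query program such that for every $n\ge 2$ and every $P\subseteq\{0,1\}^d$ with $|P|=n$: the preprocessing of $P$ always halts; each query $\mathbf q\subseteq[d]$ halts after $O(\max(1,|\mathbf q|)\,n^{\rho}\log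 n)$ steps and leaves the data structure unchanged; both run in $O(n^{1+\rho}\log n+\sum_{\mathbf x\in P}|\mathbf x|)$ words of memory, for all outcomes of the random choices; and for each $\mathbf q$ for which some $\mathbf x\in P$ has $B(\mathbf x,\mathbf q)\ge b_1$, the query returns (the index of) some $\mathbf x'\in P$ with $B(\mathbf x',\mathbf q)>b_2$ with probability at least $1/2$ over the random choices of preprocessing and query. The constants in $O(\cdot)$ depend only on $b_1$, $b_2$ and the constants in $W=\Theta(\log n)$ and $d\le n^{O(1)}$. (2) The underlying family of maps is Chosen Path: for independent, uniformly random hash values $h_i(p)\in[0,1]$, $p\in[w]\times[d]^i$, let $M_0(\mathbf x)=[w]$ and $$M_i(\mathbf x)=\Big\{p\circ j \;:\; p\in M_{i-1}(\mathbf x),\ h_i(p\circ j)<\frac{\mathbf x_j}{b_1|\mathbf x|}\Big\}.$$ For all $n\ge 2$ and all $d$, with $k=\lceil \log n/\log(1/b_2)\rceil$ and $w=2k$, the random map $M=M_k$ satisfies, for all $\mathbf x,\mathbf y\in\{0,1\}^d$: $\mathrm E|M(\mathbf x)|\le n^{\rho}w/b_1$; if $B(\mathbf x,\mathbf y)\le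 b_2$ then $\mathrm E|M(\mathbf x)\cap M(\mathbf y)|\le n^{\rho-1}w$; and if $B(\mathbf x,\mathbf y)\ge b_1$ then $\Pr[M(\mathbf x)\cap M(\mathbf y)\ne\emptyset]\ge 1/2$. -/

import Mathlib

open MeasureTheory

/-! ### Sets, similarity, and families of maps -/

/-- Braun-Blanquet similarity of two subsets of a `d`-element universe; vectors in `{0,1}^d` are
identified with subsets. (Two empty sets get the value `0`.) -/
noncomputable def braunBlanquet {d : ℕ} (x y : Finset (Fin d)) : ℝ :=
  ((x ∩ y).card : ℝ) / (max x.card y.card : ℕ)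

/-- An `(s₁, s₂, m₁, m₂)`-sensitive family of maps for the similarity measure `Sim`: a random map
`M ω`, with `ω` distributed according to `μ`, from vectors to finite sets of keys in `R`. -/
structure IsSensitiveFamily {d : ℕ} {Ω R : Type} [MeasurableSpace Ω] [DecidableEq R]
    (Sim : Finset (Fin d) → Finset (Fin d) → ℝ) (s₁ s₂ m₁ m₂ : ℝ)
    (μ : Measure Ω) (M : Ω → Finset (Fin d) → Finset R) : Prop where
  isProbabilityMeasure : IsProbabilityMeasure μ
  expected_size : ∀ x, ∫⁻ ω, ((M ω x).card : ENNReal) ∂μ ≤ ENNReal.ofReal m₁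
  expected_collisions : ∀ x y, Sim x y ≤ s₂ →
    ∫⁻ ω, ((M ω x ∩ M ω y).card : ENNReal) ∂μ ≤ ENNReal.ofReal m₂
  collision_probability : ∀ x y, s₁ ≤ Sim x y →
    1 / 2 ≤ μ {ω | (M ω x ∩ M ω y).Nonempty}

/-! ### Chosen Path -/

/-- Paths of length `i`: a starting point in `[w]` and `i` vertices in `[d]`. -/
abbrev ChosenPath.Path (w d i : ℕ) : Type := Fin w × (Fin i → Fin d)

/-- A hash value in `[0,1]` for every path; the values at paths of length `i` form the hash
function `h_i : [w] × [d]^i → [0,1]`. -/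
abbrev ChosenPath.Hash (w d : ℕ) : Type := (Σ i : ℕ, ChosenPath.Path w d i) → unitInterval

/-- All hash values are independent and uniform on `[0,1]`. -/
noncomputable def ChosenPath.hashMeasure (w d : ℕ) : Measure (ChosenPath.Hash w d) :=
  Measure.infinitePi fun _ => (volume : Measure unitInterval)

open Classical in
/-- The paths of length `i` chosen by `x`: all starting points survive, and an extension `p ∘ j` of
a chosen path `p` is chosen if `h (p ∘ j) < x_j / (b₁ |x|)`. -/
noncomputable def ChosenPath.chosen {w d : ℕ} (b₁ : ℝ) (h : ChosenPath.Hash w d)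
    (x : Finset (Fin d)) : (i : ℕ) → Finset (ChosenPath.Path w d i)
  | 0 => Finset.univ
  | i + 1 => Finset.univ.filter fun p =>
      (p.1, Fin.init p.2) ∈ ChosenPath.chosen b₁ h x i ∧
        (h ⟨i + 1, p⟩ : ℝ) < (if p.2 (Fin.last i) ∈ x then 1 else 0) / (b₁ * (x.card : ℝ))

/-! ### The randomized word RAM -/

namespace WordRAM

/-- Binary operations on machine words, all unsigned and modulo `2 ^ W`. -/
inductive Op
  | add | sub | mul | and | or | xor | shl | shr | lt | eq

def Op.eval {W : ℕ} : Op → BitVec W → BitVec W → BitVec W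
  | .add, a, b => a + b
  | .sub, a, b => a - b
  | .mul, a, b => a * b
  | .and, a, b => a &&& b
  | .or, a, b => a ||| b
  | .xor, a, b => a ^^^ b
  | .shl, a, b => a <<< b
  | .shr, a, b => a >>> b
  | .lt, a, b => if a < b then 1#W else 0#W
  | .eq, a, b => if a = b then 1#W else 0#W

/-- The two read-write memories: the memory of the data structure and a working memory. -/
inductive Bank
  | data | work
  deriving DecidableEq

/-- Programs. Registers are named by natural numbers (a program mentions only finitely many), a
program is independent of the word size. -/
inductive Prog
  /-- `r := v` -/
  | const (r v : ℕ)
  /-- `r := a o b` -/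
  | op (o : Op) (r a b : ℕ)
  /-- `r := input[a]`; the input is read-only -/
  | input (r a : ℕ)
  /-- `r := m[a]` -/
  | load (m : Bank) (r a : ℕ)
  /-- `m[a] := r` -/
  | store (m : Bank) (a r : ℕ)
  /-- `r :=` a fresh uniformly random word -/
  | random (r : ℕ)
  | seq (p q : Prog)
  /-- if `r ≠ 0` then `p` else `q` -/
  | ite (r : ℕ) (p q : Prog)
  /-- while `r ≠ 0` do `p` -/
  | loop (r : ℕ) (p : Prog)

/-- Machine states for word size `W`; `used` counts the random words consumed so far. -/
structure State (W : ℕ) where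
  reg : ℕ → BitVec W
  mem : Bank → ℕ → BitVec W
  used : ℕ

namespace State

variable {W : ℕ}

def setReg (s : State W) (r : ℕ) (v : BitVec W) : State W :=
  { s with reg := Function.update s.reg r v }

def setMem (s : State W) (m : Bank) (a : ℕ) (v : BitVec W) : State W :=
  { s with mem := Function.update s.mem m (Function.update (s.mem m) a v) }

/-- The state in which a computation starts, given the content of the data memory. -/
def start (data : ℕ → BitVec W) : State W where
  reg := fun _ => 0#W
  mem := fun m a => match m with
    | .data => data a
    | .work => 0#W
  used := 0

end State

/-- `Exec S inp ω p s t s'`: on a machine whose data memory and working memory have `S` words each,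
with input `inp` and source of random words `ω`, program `p` started in state `s` halts in state
`s'` after exactly `t` steps. Every instruction and every test of a register costs one step. An
access to a memory address outside `[0, S)` aborts the computation: there is then no `s'`. -/
inductive Exec {W : ℕ} (S : ℕ) (inp : ℕ → BitVec W) (ω : ℕ → Fin (2 ^ W)) :
    Prog → State W → ℕ → State W → Prop
  | const (s : State W) (r v : ℕ) :
      Exec S inp ω (.const r v) s 1 (s.setReg r (BitVec.ofNat W v))
  | op (s : State W) (o : Op) (r a b : ℕ) :
      Exec S inp ω (.op o r a b) s 1 (s.setReg r (o.eval (s.reg a) (s.reg b)))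
  | input (s : State W) (r a : ℕ) :
      Exec S inp ω (.input r a) s 1 (s.setReg r (inp (s.reg a).toNat))
  | load (s : State W) (m : Bank) (r a : ℕ) (h : (s.reg a).toNat < S) :
      Exec S inp ω (.load m r a) s 1 (s.setReg r (s.mem m (s.reg a).toNat))
  | store (s : State W) (m : Bank) (a r : ℕ) (h : (s.reg a).toNat < S) :
      Exec S inp ω (.store m a r) s 1 (s.setMem m (s.reg a).toNat (s.reg r))
  | random (s : State W) (r : ℕ) :
      Exec S inp ω (.random r) s 1
        { s.setReg r (BitVec.ofFin (ω s.used)) with used := s.used + 1 }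
  | seq {p q : Prog} {s s' s'' : State W} {t t' : ℕ}
      (hp : Exec S inp ω p s t s') (hq : Exec S inp ω q s' t' s'') :
      Exec S inp ω (.seq p q) s (t + t') s''
  | ite_true {r : ℕ} {p q : Prog} {s s' : State W} {t : ℕ} (hr : s.reg r ≠ 0#W)
      (hp : Exec S inp ω p s t s') : Exec S inp ω (.ite r p q) s (t + 1) s'
  | ite_false {r : ℕ} {p q : Prog} {s s' : State W} {t : ℕ} (hr : s.reg r = 0#W)
      (hq : Exec S inp ω q s t s') : Exec S inp ω (.ite r p q) s (t + 1) s'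
  | loop_done {r : ℕ} {p : Prog} {s : State W} (hr : s.reg r = 0#W) :
      Exec S inp ω (.loop r p) s 1 s
  | loop_step {r : ℕ} {p : Prog} {s s' s'' : State W} {t t' : ℕ} (hr : s.reg r ≠ 0#W)
      (hp : Exec S inp ω p s t s') (hl : Exec S inp ω (.loop r p) s' t' s'') :
      Exec S inp ω (.loop r p) s (t + t' + 1) s''

/-- A computation has at most one outcome. -/
theorem Exec.unique {W S : ℕ} {inp : ℕ → BitVec W} {ω : ℕ → Fin (2 ^ W)} {p : Prog}
    {s s₁ s₂ : State W} {t₁ t₂ : ℕ} (h₁ : Exec S inp ω p s t₁ s₁) (h₂ : Exec S inp ω p s t₂ s₂) :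
    t₁ = t₂ ∧ s₁ = s₂ := by
  induction h₁ generalizing t₂ s₂ with
  | seq hp hq ihp ihq =>
    cases h₂ with
    | seq hp' hq' =>
      obtain ⟨rfl, rfl⟩ := ihp hp'
      obtain ⟨rfl, rfl⟩ := ihq hq'
      exact ⟨rfl, rfl⟩
  | ite_true hr hp ih =>
    cases h₂ with
    | ite_true hr' hp' => obtain ⟨rfl, rfl⟩ := ih hp'; exact ⟨rfl, rfl⟩
    | ite_false hr' hq' => exact absurd hr' hr
  | ite_false hr hp ih =>
    cases h₂ with
    | ite_true hr' hp' => exact absurd hr hr'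
    | ite_false hr' hq' => obtain ⟨rfl, rfl⟩ := ih hq'; exact ⟨rfl, rfl⟩
  | loop_done hr =>
    cases h₂ with
    | loop_done hr' => exact ⟨rfl, rfl⟩
    | loop_step hr' hp' hl' => exact absurd hr hr'
  | loop_step hr hp hl ihp ihl =>
    cases h₂ with
    | loop_done hr' => exact absurd hr' hr
    | loop_step hr' hp' hl' =>
      obtain ⟨rfl, rfl⟩ := ihp hp'
      obtain ⟨rfl, rfl⟩ := ihl hl'
      exact ⟨rfl, rfl⟩
  | _ => cases h₂; exact ⟨rfl, rfl⟩

/-- A list of words as input; positions beyond the end read `0`. -/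
def toInput {W : ℕ} (l : List (BitVec W)) : ℕ → BitVec W := fun i => l.getD i 0#W

/-- A sequence of independent, uniformly random words. -/
noncomputable def randomWords (W : ℕ) : Measure (ℕ → Fin (2 ^ W)) :=
  Measure.infinitePi fun _ => (PMF.uniformOfFintype (Fin (2 ^ W))).toMeasure

end WordRAM

/-! ### The approximate similarity search problem -/

open WordRAM

/-- A set is stored as its size followed by its elements in increasing order. -/
def encodeSet (W : ℕ) {d : ℕ} (x : Finset (Fin d)) : List (BitVec W) :=
  BitVec.ofNat W x.card :: (x.sort (· ≤ ·)).map fun j => BitVec.ofNat W j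

/-- The input of the preprocessing: the parameters `n`, `d`, `W`, the thresholds `b₁`, `b₂` rounded
down to `W` binary digits, and the data sets. -/
noncomputable def encodeData (W : ℕ) (b₁ b₂ : ℝ) {n d : ℕ} (P : Fin n → Finset (Fin d)) :
    List (BitVec W) :=
  [BitVec.ofNat W n, BitVec.ofNat W d, BitVec.ofNat W W,
    BitVec.ofNat W ⌊b₁ * 2 ^ W⌋₊, BitVec.ofNat W ⌊b₂ * 2 ^ W⌋₊] ++
  (List.ofFn fun i => encodeSet W (P i)).flatten

/-- `Preprocessed S pre b₁ b₂ P ω D`: the preprocessing program halts on the data sets `P` with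
random words `ω`, and `D` is the content of the data memory then. -/
def Preprocessed {W n d : ℕ} (S : ℕ) (pre : Prog) (b₁ b₂ : ℝ) (P : Fin n → Finset (Fin d))
    (ω : ℕ → Fin (2 ^ W)) (D : ℕ → BitVec W) : Prop :=
  ∃ t s, Exec S (toInput (encodeData W b₁ b₂ P)) ω pre (State.start fun _ => 0#W) t s ∧
    s.mem .data = D

/-- `Queried S qry D q ω t a`: on data memory `D`, the query program halts on the query set `q` with
random words `ω` after `t` steps, it leaves the data memory as it was, and it returns the answer
`a` (the content of register `0`). -/
def Queried {W d : ℕ} (S : ℕ) (qry : Prog) (D : ℕ → BitVec W) (q : Finset (Fin d))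
    (ω : ℕ → Fin (2 ^ W)) (t : ℕ) (a : BitVec W) : Prop :=
  ∃ s, Exec S (toInput (encodeSet W q)) ω qry (State.start D) t s ∧
    s.mem .data = D ∧ s.reg 0 = a

/-- On the data sets `P`, and on a word RAM with word size `W`, the programs `pre` and `qry` solve the
`(s₁, s₂)`-`Sim`-similarity search problem in a memory of `S` words with query time `T |q|`. The
bounds on space and query time hold for all outcomes of the random choices; every query that has
to be answered is answered correctly, by the index of a data set, with probability at least `1/2`
over the random choices of the preprocessing and of the query. -/
structure SolvesSearch (W : ℕ) {n d : ℕ} (Sim : Finset (Fin d) → Finset (Fin d) → ℝ) (s₁ s₂ : ℝ)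
    (P : Fin n → Finset (Fin d)) (pre qry : Prog) (S : ℕ) (T : ℕ → ℝ) : Prop where
  preprocessing : ∀ ω : ℕ → Fin (2 ^ W), ∃ D, Preprocessed S pre s₁ s₂ P ω D
  query_time : ∀ (ω : ℕ → Fin (2 ^ W)) (D : ℕ → BitVec W), Preprocessed S pre s₁ s₂ P ω D →
    ∀ (q : Finset (Fin d)) (ω' : ℕ → Fin (2 ^ W)),
      ∃ t a, Queried S qry D q ω' t a ∧ (t : ℝ) ≤ T q.card
  correct : ∀ q : Finset (Fin d), (∃ i, s₁ ≤ Sim (P i) q) →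
    1 / 2 ≤ ((randomWords W).prod (randomWords W))
      {ω | ∃ D t a, Preprocessed S pre s₁ s₂ P ω.1 D ∧ Queried S qry D q ω.2 t a ∧
        ∃ i : Fin n, a.toNat = i ∧ s₂ < Sim (P i) q}

/-! ### A small structured language over natural numbers, compiled to word RAM programs -/

/-! Chosen Path is a branching process. Every surviving path is extended independently, and the mean
number of extensions is the sum over all vertices of the survival probabilities, so expected sizes
are powers of this mean. For a single set the mean is at most `1 / b₁`. The common paths of two sets
form the same kind of process, with the pointwise minimum of the two thresholds; on `x ∩ y` this
minimum is `1 / (b₁ max(|x|, |y|))`, so the mean is at most `B(x, y) / b₁`. After `k` levels, `b₂ ^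
k ≤ 1 / n` and `b₁ = b₂ ^ ρ` give the bounds with `n ^ ρ` and `n ^ (ρ - 1)`. If `B(x, y) ≥ b₁`, the
common process has mean at least one. Iterating its generating function along the points `1 - 1 / (j
+ 1)` bounds the probability of extinction from `2 k` roots by `(1 + 1 / k) ^ (-2 k) ≤ 1 / 2`
(`lintegral_survivors_succ`, `lintegral_pow_survivors_le`).

The data structure replaces independent real hash values by multiply-shift hashing. A path is
represented by a key of `v` bits, and each level has three random words `A`, `B`, `C`. The top `u`
bits of `A κ + B j + C` decide whether the key `κ` may be extended by `j`, and the next `v` bits are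
the new key. Leading bits at two different arguments are independent (`sum_topBits_pair`), but
nothing is available beyond pairs, so second moments replace the generating function. Functions `p₁
+ p₂ [κ = κ']` on pairs of keys are bounded, after averaging over one level, by a function of the
same form; `Shape.grow` is the resulting map on coefficients (`Shape.expect_pairSum_iter_le`).
Started at `(1, 0)` it controls the second moment of the number of paths, and Chebyshev's inequality
with `16 k` roots shows that similar sets share a key with probability at least `13 / 16`. Started
at `(0, 1)` it bounds the number of equal keys of dissimilar sets: about `(b₂ / b₁) ^ k` per root
from common paths, plus accidental collisions, which a table with at least `n * cap` cells makes
harmless (`Shape.grow_near`, `Shape.grow_far`).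

With `r ≈ b₁ ^ (-k) = O(n ^ ρ)`, the queue of keys is cut off at `cap = K * 16 k * r = O(n ^ ρ log
n)`, and a query inspects at most `cap` candidates; hence time and space are bounded for every
outcome. By Markov's inequality, overflow of either relevant queue and an excess of dissimilar
candidates each have probability at most `1 / 16`, so the total failure probability is at most `3 /
8` (`half_le_chance_hasCandidate`). A candidate is checked by merging sorted lists, after sets much
longer than the query have been rejected by size, so each check costs `O(|q|)`.

All thresholds are rounded to `u = W / 4` binary digits. A word size that is a large multiple of
`log n` keeps the rounding errors, accumulated over the `O(log n)` levels, within constant factors.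
The programs are written in a structured language over natural numbers, whose compilation preserves
results and step counts exactly (`Run.exec`). -/

namespace WordRAM

/-- Program variables; `ans` is held in register `0`. -/
inductive Var
  | ans | n | u | k | z | y | r | w | cap | v | tb | sh1 | sh2 | mask | b1 | b2 | pw | lim
  | fp | i | p | m | c | j | lo | hi | tail | lev | ka | hA | hB | hC | ptr | xm | cnt | bud
  | e | T0 | key
  deriving DecidableEq

def Var.idx (x : Var) : ℕ := x.ctorIdx

theorem Var.idx_injective : Function.Injective Var.idx := fun x y h => by
  have hx := Var.ofNat_ctorIdx x
  have hy := Var.ofNat_ctorIdx y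
  rw [← hx, ← hy]; exact congrArg _ h

/-- Registers from 100 on are the scratch stack of expression evaluation, so evaluating an
expression never touches a variable. -/
theorem Var.idx_lt (x : Var) : x.idx < 100 := by cases x <;> decide

/-- Arithmetic on natural numbers; `addMod` and `mulMod` wrap around, the others must not. -/
inductive Arith
  | add | addMod | sub | mul | mulMod | and | shl | shr | lt | eq

namespace Arith

def op : Arith → Op
  | add => .add | addMod => .add | sub => .sub | mul => .mul | mulMod => .mul
  | and => .and | shl => .shl | shr => .shr | lt => .lt | eq => .eq

def val (W : ℕ) : Arith → ℕ → ℕ → ℕ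
  | add, x, y => x + y
  | addMod, x, y => (x + y) % 2 ^ W
  | sub, x, y => x - y
  | mul, x, y => x * y
  | mulMod, x, y => (x * y) % 2 ^ W
  | and, x, y => x &&& y
  | shl, x, y => x * 2 ^ y
  | shr, x, y => x / 2 ^ y
  | lt, x, y => if x < y then 1 else 0
  | eq, x, y => if x = y then 1 else 0

/-- The condition under which the machine operation, which works modulo `2 ^ W`, agrees with `val`.
Comparisons need `1 < 2 ^ W` because the truth value 1 would be 0 in a word of width zero. -/
def ok (W : ℕ) : Arith → ℕ → ℕ → Prop
  | add, x, y => x + y < 2 ^ W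
  | sub, x, y => y ≤ x
  | mul, x, y => x * y < 2 ^ W
  | shl, x, y => x * 2 ^ y < 2 ^ W
  | lt, _, _ => 1 < 2 ^ W
  | eq, _, _ => 1 < 2 ^ W
  | _, _, _ => True

theorem toNat_eval {W : ℕ} (o : Arith) (x y : BitVec W) (h : o.ok W x.toNat y.toNat) :
    (o.op.eval x y).toNat = o.val W x.toNat y.toNat := by
  cases o with
  | add => simpa [op, val, Op.eval] using Nat.mod_eq_of_lt h
  | addMod => simp [op, val, Op.eval]
  | sub =>
    have h' : y.toNat ≤ x.toNat := h
    have := x.isLt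
    simp only [op, val, Op.eval, BitVec.toNat_sub]
    rw [show 2 ^ W - y.toNat + x.toNat = x.toNat - y.toNat + 2 ^ W by have := y.isLt; omega,
      Nat.add_mod_right, Nat.mod_eq_of_lt (by omega)]
  | mul => simpa [op, val, Op.eval] using Nat.mod_eq_of_lt h
  | mulMod => simp [op, val, Op.eval]
  | and => simp [op, val, Op.eval]
  | shl =>
    have h' : x.toNat * 2 ^ y.toNat < 2 ^ W := h
    simp [op, val, Op.eval, Nat.shiftLeft_eq, Nat.mod_eq_of_lt h']
  | shr => simp [op, val, Op.eval, Nat.shiftRight_eq_div_pow]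
  | lt =>
    have h' : 1 < 2 ^ W := h
    simp only [op, val, Op.eval, BitVec.lt_def]
    split_ifs <;> simp [Nat.mod_eq_of_lt h']
  | eq =>
    have h' : 1 < 2 ^ W := h
    simp only [op, val, Op.eval, ← BitVec.toNat_inj]
    split_ifs <;> simp [Nat.mod_eq_of_lt h']

end Arith

/-- The environment of a computation, with all words read as natural numbers. -/
structure Env where
  W : ℕ
  S : ℕ
  inp : ℕ → ℕ
  rand : ℕ → ℕ

/-- Machine states seen as natural-number valued stores. -/
structure Store where
  var : Var → ℕ
  mem : Bank → ℕ → ℕ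
  used : ℕ

namespace Store

def set (a : Store) (x : Var) (v : ℕ) : Store := { a with var := Function.update a.var x v }

def put (a : Store) (m : Bank) (i v : ℕ) : Store :=
  { a with mem := Function.update a.mem m (Function.update (a.mem m) i v) }

def tick (a : Store) : Store := { a with used := a.used + 1 }

@[simp] theorem set_var (a : Store) (x : Var) (v : ℕ) (y : Var) :
    (a.set x v).var y = if y = x then v else a.var y := by
  simp [set, Function.update_apply]

@[simp] theorem set_mem (a : Store) (x : Var) (v : ℕ) : (a.set x v).mem = a.mem := rfl

@[simp] theorem set_used (a : Store) (x : Var) (v : ℕ) : (a.set x v).used = a.used := rfl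

@[simp] theorem put_var (a : Store) (m : Bank) (i v : ℕ) : (a.put m i v).var = a.var := rfl

theorem put_mem (a : Store) (m : Bank) (i v : ℕ) (m' : Bank) (i' : ℕ) :
    (a.put m i v).mem m' i' = if m' = m ∧ i' = i then v else a.mem m' i' := by
  by_cases h : m' = m
  · subst h; simp [put, Function.update_apply]
  · simp [put, h]

@[simp] theorem put_used (a : Store) (m : Bank) (i v : ℕ) : (a.put m i v).used = a.used := rfl

@[simp] theorem tick_var (a : Store) : a.tick.var = a.var := rfl

@[simp] theorem tick_mem (a : Store) : a.tick.mem = a.mem := rfl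

@[simp] theorem tick_used (a : Store) : a.tick.used = a.used + 1 := rfl

end Store

/-- Expressions. -/
inductive Expr
  | var (x : Var)
  | lit (c : ℕ)
  | bin (o : Arith) (a b : Expr)
  | inp (a : Expr)
  | ld (m : Bank) (a : Expr)

namespace Expr

def cost : Expr → ℕ
  | var _ => 1
  | lit _ => 1
  | bin _ a b => a.cost + b.cost + 1
  | inp a => a.cost + 1
  | ld _ a => a.cost + 1

def val (E : Env) (a : Store) : Expr → ℕ
  | var x => a.var x
  | lit c => c
  | bin o e f => o.val E.W (e.val E a) (f.val E a)
  | inp e => E.inp (e.val E a)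
  | ld m e => a.mem m (e.val E a)

def ok (E : Env) (a : Store) : Expr → Prop
  | var _ => True
  | lit c => c < 2 ^ E.W
  | bin o e f => e.ok E a ∧ f.ok E a ∧ o.ok E.W (e.val E a) (f.val E a)
  | inp e => e.ok E a
  | ld _ e => e.ok E a ∧ e.val E a < E.S

/-- Stack evaluation: the result at depth `d` lands in register `100 + d`, and right operands are
evaluated one register further up. The `or` of a register with itself is a move. -/
def compile : Expr → ℕ → Prog
  | var x, d => .op .or (100 + d) x.idx x.idx
  | lit c, d => .const (100 + d) c
  | bin o e f, d => .seq (e.compile d)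
      (.seq (f.compile (d + 1)) (.op o.op (100 + d) (100 + d) (100 + (d + 1))))
  | inp e, d => .seq (e.compile d) (.input (100 + d) (100 + d))
  | ld m e, d => .seq (e.compile d) (.load m (100 + d) (100 + d))

end Expr

/-! ### Simulation of the structured language by the machine -/

/-- The store `a` describes the machine state `s`. -/
structure Describes {W : ℕ} (s : State W) (a : Store) : Prop where
  var : ∀ x : Var, (s.reg x.idx).toNat = a.var x
  mem : ∀ m i, (s.mem m i).toNat = a.mem m i
  used : s.used = a.used

/-- The environment given by an input and a source of random words. -/
def env {W : ℕ} (S : ℕ) (inp : ℕ → BitVec W) (ω : ℕ → Fin (2 ^ W)) : Env where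
  W := W
  S := S
  inp := fun i => (inp i).toNat
  rand := fun i => ω i

section Simulation

variable {W S : ℕ} {inp : ℕ → BitVec W} {ω : ℕ → Fin (2 ^ W)}

/-- That all registers below `100 + d` are preserved is what keeps a left operand alive while the
right operand is evaluated. -/
theorem Expr.exec (e : Expr) (d : ℕ) (s : State W) (a : Store) (h : Describes s a)
    (hok : e.ok (env S inp ω) a) :
    ∃ s', Exec S inp ω (e.compile d) s e.cost s' ∧ (∀ r < 100 + d, s'.reg r = s.reg r) ∧
      s'.mem = s.mem ∧ s'.used = s.used ∧ (s'.reg (100 + d)).toNat = e.val (env S inp ω) a := by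
  induction e generalizing d s with
  | var x =>
    refine ⟨_, Exec.op _ _ _ _ _, ?_, rfl, rfl, ?_⟩
    · intro r hr
      simp [State.setReg, hr.ne]
    · simp [State.setReg, Op.eval, Expr.val, h.var]
  | lit c =>
    refine ⟨_, Exec.const _ _ _, ?_, rfl, rfl, ?_⟩
    · intro r hr
      simp [State.setReg, hr.ne]
    · have : c < 2 ^ W := hok
      simp [State.setReg, Expr.val, Nat.mod_eq_of_lt this]
  | bin o e f ihe ihf =>
    obtain ⟨he, hf, ho⟩ := hok
    obtain ⟨s₁, h₁, r₁, m₁, u₁, v₁⟩ := ihe d s h he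
    have hd₁ : Describes s₁ a :=
      ⟨fun x => by rw [r₁ _ (by have := x.idx_lt; omega)]; exact h.var x,
        fun m i => by rw [m₁]; exact h.mem m i, by rw [u₁]; exact h.used⟩
    obtain ⟨s₂, h₂, r₂, m₂, u₂, v₂⟩ := ihf (d + 1) s₁ hd₁ hf
    have H := Exec.seq h₁ (Exec.seq h₂ (Exec.op (S := S) (inp := inp) (ω := ω) s₂ o.op (100 + d)
      (100 + d) (100 + (d + 1))))
    rw [← Nat.add_assoc e.cost] at H
    refine ⟨_, H, ?_, ?_, ?_, ?_⟩
    · intro r hr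
      simp only [State.setReg, Function.update_apply, hr.ne, if_false]
      rw [r₂ r (by omega), r₁ r hr]
    · simp [State.setReg, m₁, m₂]
    · simp [State.setReg, u₁, u₂]
    · simp only [State.setReg, Function.update_self, Expr.val]
      rw [r₂ (100 + d) (by omega)]
      rw [Arith.toNat_eval _ _ _ (by rw [v₁, v₂]; exact ho), v₁, v₂]; rfl
  | inp e ih =>
    obtain ⟨s₁, h₁, r₁, m₁, u₁, v₁⟩ := ih d s h hok
    refine ⟨_, Exec.seq h₁ (Exec.input _ _ _), ?_, ?_, ?_, ?_⟩
    · intro r hr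
      simp only [State.setReg, Function.update_apply, hr.ne, if_false]
      exact r₁ r hr
    · simp [State.setReg, m₁]
    · simp [State.setReg, u₁]
    · simp [State.setReg, v₁, Expr.val, env]
  | ld m e ih =>
    obtain ⟨he, hS⟩ := hok
    obtain ⟨s₁, h₁, r₁, m₁, u₁, v₁⟩ := ih d s h he
    refine ⟨_, Exec.seq h₁ (Exec.load _ _ _ _ (by rw [v₁]; exact hS)), ?_, ?_, ?_, ?_⟩
    · intro r hr
      simp only [State.setReg, Function.update_apply, hr.ne, if_false]
      exact r₁ r hr
    · simp [State.setReg, m₁]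
    · simp [State.setReg, u₁]
    · simp [State.setReg, v₁, m₁, Expr.val, h.mem]

end Simulation

/-- Commands. -/
inductive Cmd
  | skip
  | asg (x : Var) (e : Expr)
  | sto (m : Bank) (a e : Expr)
  | rnd (x : Var)
  | seq (p q : Cmd)
  | ite (e : Expr) (p q : Cmd)
  | while (e : Expr) (p : Cmd)

namespace Cmd

/-- A machine loop tests a register, so the condition is evaluated once before the loop and again at
the end of every round; the step counts in `Run` match this exactly. -/
def compile : Cmd → Prog
  | skip => .const 100 0
  | asg x e => .seq (e.compile 0) (.op .or x.idx 100 100)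
  | sto m a e => .seq (a.compile 0) (.seq (e.compile 1) (.store m 100 101))
  | rnd x => .random x.idx
  | seq p q => .seq p.compile q.compile
  | ite e p q => .seq (e.compile 0) (.ite 100 p.compile q.compile)
  | .while e p => .seq (e.compile 0) (.loop 100 (.seq p.compile (e.compile 0)))

/-- Variables that a command may change. -/
def writes : Cmd → Var → Bool
  | skip, _ => false
  | asg x _, y => x = y
  | sto _ _ _, _ => false
  | rnd x, y => x = y
  | seq p q, y => p.writes y || q.writes y
  | ite _ p q, y => p.writes y || q.writes y
  | .while _ p, y => p.writes y

/-- Memories that a command may change. -/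
def stores : Cmd → Bank → Bool
  | skip, _ => false
  | asg _ _, _ => false
  | sto m _ _, m' => m = m'
  | rnd _, _ => false
  | seq p q, m => p.stores m || q.stores m
  | ite _ p q, m => p.stores m || q.stores m
  | .while _ p, m => p.stores m

/-- Whether a command may use random words. -/
def draws : Cmd → Bool
  | skip => false
  | asg _ _ => false
  | sto _ _ _ => false
  | rnd _ => true
  | seq p q => p.draws || q.draws
  | ite _ p q => p.draws || q.draws
  | .while _ p => p.draws

end Cmd

/-- `Run E c a t a'`: command `c` started in store `a` halts in store `a'` after `t` steps, without
arithmetic overflow. -/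
inductive Run (E : Env) : Cmd → Store → ℕ → Store → Prop
  | skip (a : Store) : Run E .skip a 1 a
  | asg (a : Store) (x : Var) (e : Expr) (h : e.ok E a) :
      Run E (.asg x e) a (e.cost + 1) (a.set x (e.val E a))
  | sto (a : Store) (m : Bank) (e f : Expr) (he : e.ok E a) (hf : f.ok E a)
      (h : e.val E a < E.S) :
      Run E (.sto m e f) a (e.cost + f.cost + 1) (a.put m (e.val E a) (f.val E a))
  | rnd (a : Store) (x : Var) : Run E (.rnd x) a 1 (a.set x (E.rand a.used)).tick
  | seq {p q : Cmd} {a a' a'' : Store} {t t' : ℕ} (hp : Run E p a t a') (hq : Run E q a' t' a'') :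
      Run E (.seq p q) a (t + t') a''
  | ite_true {e : Expr} {p q : Cmd} {a a' : Store} {t : ℕ} (he : e.ok E a) (h : e.val E a ≠ 0)
      (hp : Run E p a t a') : Run E (.ite e p q) a (e.cost + t + 1) a'
  | ite_false {e : Expr} {p q : Cmd} {a a' : Store} {t : ℕ} (he : e.ok E a) (h : e.val E a = 0)
      (hp : Run E q a t a') : Run E (.ite e p q) a (e.cost + t + 1) a'
  | while_done {e : Expr} {p : Cmd} {a : Store} (he : e.ok E a) (h : e.val E a = 0) :
      Run E (.while e p) a (e.cost + 1) a
  | while_step {e : Expr} {p : Cmd} {a a' a'' : Store} {t t' : ℕ} (he : e.ok E a)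
      (h : e.val E a ≠ 0) (hp : Run E p a t a') (hl : Run E (.while e p) a' t' a'') :
      Run E (.while e p) a (e.cost + t + t' + 1) a''

section Simulation

variable {W S : ℕ} {inp : ℕ → BitVec W} {ω : ℕ → Fin (2 ^ W)}

theorem Describes.of_scratch {s s' : State W} {a : Store} (h : Describes s a) {d : ℕ}
    (hr : ∀ r < 100 + d, s'.reg r = s.reg r) (hm : s'.mem = s.mem) (hu : s'.used = s.used) :
    Describes s' a :=
  ⟨fun x => by rw [hr _ (by have := x.idx_lt; omega)]; exact h.var x,
    fun m i => by rw [hm]; exact h.mem m i, by rw [hu]; exact h.used⟩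

theorem Describes.set {s : State W} {a : Store} (h : Describes s a) (x : Var) (b : BitVec W) :
    Describes (s.setReg x.idx b) (a.set x b.toNat) := by
  refine ⟨fun y => ?_, h.mem, h.used⟩
  by_cases hy : y = x
  · subst hy; simp [State.setReg]
  · have : y.idx ≠ x.idx := fun hh => hy (Var.idx_injective hh)
    simp [State.setReg, this, hy, h.var]

/-- Compiled commands do what the commands do. -/
theorem Run.exec {c : Cmd} {a a' : Store} {t : ℕ} (hrun : Run (env S inp ω) c a t a')
    (s : State W) (h : Describes s a) :
    ∃ s', Exec S inp ω c.compile s t s' ∧ Describes s' a' := by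
  induction hrun generalizing s with
  | skip a =>
    refine ⟨_, Exec.const _ _ _, h.of_scratch (d := 0) ?_ rfl rfl⟩
    intro r hr
    simp [State.setReg, (show r ≠ 100 by omega)]
  | asg a x e he =>
    obtain ⟨s₁, h₁, r₁, m₁, u₁, v₁⟩ := e.exec 0 s a h he
    refine ⟨_, Exec.seq h₁ (Exec.op _ _ _ _ _), ?_⟩
    rw [← v₁]
    have := (h.of_scratch r₁ m₁ u₁).set x (s₁.reg 100)
    simpa [Op.eval] using this
  | sto a m e f he hf hS =>
    obtain ⟨s₁, h₁, r₁, m₁, u₁, v₁⟩ := e.exec 0 s a h he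
    have hd₁ := h.of_scratch r₁ m₁ u₁
    obtain ⟨s₂, h₂, r₂, m₂, u₂, v₂⟩ := f.exec 1 s₁ a hd₁ hf
    have hd₂ := hd₁.of_scratch r₂ m₂ u₂
    have hv : (s₂.reg 100).toNat = e.val (env S inp ω) a := by
      rw [r₂ 100 (by omega)]; exact v₁
    have H := Exec.seq h₁ (Exec.seq h₂ (Exec.store (S := S) (inp := inp) (ω := ω) s₂ m 100 101
      (by rw [hv]; exact hS)))
    rw [← Nat.add_assoc e.cost] at H
    refine ⟨_, H, ?_⟩
    · refine ⟨hd₂.var, fun m' i => ?_, hd₂.used⟩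
      rw [Store.put_mem]
      by_cases hm : m' = m
      · subst hm
        by_cases hi : i = e.val (env S inp ω) a
        · subst hi
          simpa [State.setMem, hv] using v₂
        · simpa [State.setMem, hv, hi] using hd₂.mem m' i
      · simpa [State.setMem, hm] using hd₂.mem m' i
  | rnd a x =>
    refine ⟨_, Exec.random _ _, ?_⟩
    have := h.set x (BitVec.ofFin (ω s.used))
    refine ⟨fun y => ?_, this.mem, ?_⟩
    · have := this.var y
      rw [h.used] at this
      simpa [env, h.used] using this
    · simp [h.used]
  | seq hp hq ihp ihq =>
    obtain ⟨s₁, h₁, d₁⟩ := ihp s h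
    obtain ⟨s₂, h₂, d₂⟩ := ihq s₁ d₁
    exact ⟨s₂, h₁.seq h₂, d₂⟩
  | @ite_true e p q a a' t he hv hp ih =>
    obtain ⟨s₁, h₁, r₁, m₁, u₁, v₁⟩ := e.exec 0 s a h he
    obtain ⟨s₂, h₂, d₂⟩ := ih s₁ (h.of_scratch r₁ m₁ u₁)
    refine ⟨s₂, ?_, d₂⟩
    have hne : s₁.reg 100 ≠ 0#W := fun h0 => hv (by rw [← v₁]; simp [h0])
    rw [add_assoc]; exact Exec.seq h₁ (Exec.ite_true hne h₂)
  | @ite_false e p q a a' t he hv hp ih =>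
    obtain ⟨s₁, h₁, r₁, m₁, u₁, v₁⟩ := e.exec 0 s a h he
    obtain ⟨s₂, h₂, d₂⟩ := ih s₁ (h.of_scratch r₁ m₁ u₁)
    refine ⟨s₂, ?_, d₂⟩
    have hne : s₁.reg 100 = 0#W := BitVec.eq_of_toNat_eq (by simpa [hv] using v₁)
    rw [add_assoc]; exact Exec.seq h₁ (Exec.ite_false hne h₂)
  | @while_done e p a he hv =>
    obtain ⟨s₁, h₁, r₁, m₁, u₁, v₁⟩ := e.exec 0 s a h he
    have hne : s₁.reg 100 = 0#W := BitVec.eq_of_toNat_eq (by simpa [hv] using v₁)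
    exact ⟨s₁, Exec.seq h₁ (Exec.loop_done hne), h.of_scratch r₁ m₁ u₁⟩
  | @while_step e p a a' a'' t t' he hv hp hl ihp ihl =>
    obtain ⟨s₁, h₁, r₁, m₁, u₁, v₁⟩ := e.exec 0 s a h he
    have hne : s₁.reg 100 ≠ 0#W := fun h0 => hv (by rw [← v₁]; simp [h0])
    obtain ⟨s₂, h₂, d₂⟩ := ihp s₁ (h.of_scratch r₁ m₁ u₁)
    obtain ⟨s₃, h₃, d₃⟩ := ihl s₂ d₂
    refine ⟨s₃, ?_, d₃⟩
    -- The run of the remaining loop begins with an evaluation of the condition; it is regrouped as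
    -- the end of the round just executed.
    cases h₃ with
    | @seq _ _ _ s₄ _ tc tl hc hloop =>
      have := Exec.seq h₁ (Exec.loop_step hne (Exec.seq h₂ hc) hloop)
      have e1 : e.cost + t + (tc + tl) + 1 = e.cost + (t + tc + tl + 1) := by omega
      rw [e1]; exact this

end Simulation

theorem Run.var_eq {E : Env} {c : Cmd} {a a' : Store} {t : ℕ} (h : Run E c a t a') (x : Var)
    (hx : c.writes x = false) : a'.var x = a.var x := by
  induction h with
  | skip a => rfl
  | asg a y e he =>
    have : x ≠ y := fun hh => by simp [Cmd.writes, hh] at hx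
    simp [this]
  | sto => rfl
  | rnd a y =>
    have : x ≠ y := fun hh => by simp [Cmd.writes, hh] at hx
    simp [this]
  | seq _ _ ihp ihq =>
    simp only [Cmd.writes, Bool.or_eq_false_iff] at hx
    rw [ihq hx.2, ihp hx.1]
  | ite_true _ _ _ ih =>
    simp only [Cmd.writes, Bool.or_eq_false_iff] at hx
    exact ih hx.1
  | ite_false _ _ _ ih =>
    simp only [Cmd.writes, Bool.or_eq_false_iff] at hx
    exact ih hx.2
  | while_done => rfl
  | while_step _ _ _ _ ihp ihl =>
    rw [ihl hx, ihp (by simpa [Cmd.writes] using hx)]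

theorem Run.mem_eq {E : Env} {c : Cmd} {a a' : Store} {t : ℕ} (h : Run E c a t a') (m : Bank)
    (hm : c.stores m = false) : a'.mem m = a.mem m := by
  induction h with
  | skip a => rfl
  | asg a y e he => rfl
  | sto a m' e f =>
    have : m ≠ m' := fun hh => by simp [Cmd.stores, hh] at hm
    simp [Store.put, this]
  | rnd a y => rfl
  | seq _ _ ihp ihq =>
    simp only [Cmd.stores, Bool.or_eq_false_iff] at hm
    rw [ihq hm.2, ihp hm.1]
  | ite_true _ _ _ ih =>
    simp only [Cmd.stores, Bool.or_eq_false_iff] at hm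
    exact ih hm.1
  | ite_false _ _ _ ih =>
    simp only [Cmd.stores, Bool.or_eq_false_iff] at hm
    exact ih hm.2
  | while_done => rfl
  | while_step _ _ _ _ ihp ihl =>
    rw [ihl hm, ihp (by simpa [Cmd.stores] using hm)]

theorem Run.used_eq {E : Env} {c : Cmd} {a a' : Store} {t : ℕ} (h : Run E c a t a')
    (hc : c.draws = false) : a'.used = a.used := by
  induction h with
  | skip a => rfl
  | asg a y e he => rfl
  | sto a m' e f => rfl
  | rnd a y => cases hc
  | seq _ _ ihp ihq =>
    simp only [Cmd.draws, Bool.or_eq_false_iff] at hc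
    rw [ihq hc.2, ihp hc.1]
  | ite_true _ _ _ ih =>
    simp only [Cmd.draws, Bool.or_eq_false_iff] at hc
    exact ih hc.1
  | ite_false _ _ _ ih =>
    simp only [Cmd.draws, Bool.or_eq_false_iff] at hc
    exact ih hc.2
  | while_done => rfl
  | while_step _ _ _ _ ihp ihl =>
    rw [ihl hc, ihp (by simpa [Cmd.draws] using hc)]

/-! ### Total correctness with time -/

/-- Command `c` started in `a` halts, and time and final store satisfy `Q`. -/
def Wp (E : Env) (c : Cmd) (a : Store) (Q : ℕ → Store → Prop) : Prop :=
  ∃ t a', Run E c a t a' ∧ Q t a'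

/-- `a'` agrees with `a` on everything that `c` does not change. -/
structure Frame (c : Cmd) (a a' : Store) : Prop where
  var : ∀ x, c.writes x = false → a'.var x = a.var x
  mem : ∀ m, c.stores m = false → a'.mem m = a.mem m
  used : c.draws = false → a'.used = a.used

theorem Frame.refl (c : Cmd) (a : Store) : Frame c a a :=
  ⟨fun _ _ => rfl, fun _ _ => rfl, fun _ => rfl⟩

theorem Frame.trans {c : Cmd} {a a' a'' : Store} (h : Frame c a a') (h' : Frame c a' a'') :
    Frame c a a'' :=
  ⟨fun x hx => (h'.var x hx).trans (h.var x hx), fun m hm => (h'.mem m hm).trans (h.mem m hm),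
    fun hc => (h'.used hc).trans (h.used hc)⟩

theorem Run.frame {E : Env} {c : Cmd} {a a' : Store} {t : ℕ} (h : Run E c a t a') :
    Frame c a a' := ⟨fun x hx => h.var_eq x hx, fun m hm => h.mem_eq m hm, h.used_eq⟩

namespace Wp

variable {E : Env} {a : Store} {Q R : ℕ → Store → Prop} {c p q : Cmd}

theorem mono (h : Wp E c a Q) (hQ : ∀ t a', Q t a' → R t a') : Wp E c a R := by
  obtain ⟨t, a', hr, hq⟩ := h
  exact ⟨t, a', hr, hQ _ _ hq⟩

/-- What a command does not write, it leaves unchanged. -/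
theorem frame (h : Wp E c a Q) (hQ : ∀ t a', Q t a' → Frame c a a' → R t a') : Wp E c a R := by
  obtain ⟨t, a', hr, hq⟩ := h
  exact ⟨t, a', hr, hQ _ _ hq hr.frame⟩

theorem skip (h : Q 1 a) : Wp E .skip a Q := ⟨_, _, Run.skip a, h⟩

theorem asg {x : Var} {e : Expr} (he : e.ok E a) (h : Q (e.cost + 1) (a.set x (e.val E a))) :
    Wp E (.asg x e) a Q := ⟨_, _, Run.asg a x e he, h⟩

theorem sto {m : Bank} {e f : Expr} (he : e.ok E a) (hf : f.ok E a) (hS : e.val E a < E.S)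
    (h : Q (e.cost + f.cost + 1) (a.put m (e.val E a) (f.val E a))) : Wp E (.sto m e f) a Q :=
  ⟨_, _, Run.sto a m e f he hf hS, h⟩

theorem rnd {x : Var} (h : Q 1 (a.set x (E.rand a.used)).tick) : Wp E (.rnd x) a Q :=
  ⟨_, _, Run.rnd a x, h⟩

theorem seq (h : Wp E p a fun t a' => Wp E q a' fun t' a'' => Q (t + t') a'') :
    Wp E (.seq p q) a Q := by
  obtain ⟨t, a', h1, t', a'', h2, hq⟩ := h
  exact ⟨_, _, h1.seq h2, hq⟩

theorem ite {e : Expr} (he : e.ok E a)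
    (h1 : e.val E a ≠ 0 → Wp E p a fun t a' => Q (e.cost + t + 1) a')
    (h2 : e.val E a = 0 → Wp E q a fun t a' => Q (e.cost + t + 1) a') : Wp E (.ite e p q) a Q := by
  by_cases h : e.val E a = 0
  · obtain ⟨t, a', hr, hq⟩ := h2 h
    exact ⟨_, _, Run.ite_false he h hr, hq⟩
  · obtain ⟨t, a', hr, hq⟩ := h1 h
    exact ⟨_, _, Run.ite_true he h hr, hq⟩

/-- In the form of equivalences the rules can be used by `simp`: straight-line code is reduced to
its overflow and address conditions together with a claim about the final store. -/
theorem skip_iff : Wp E .skip a Q ↔ Q 1 a :=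
  ⟨fun ⟨_, _, hr, hq⟩ => by cases hr; exact hq, skip⟩

theorem asg_iff {x : Var} {e : Expr} :
    Wp E (.asg x e) a Q ↔ e.ok E a ∧ Q (e.cost + 1) (a.set x (e.val E a)) :=
  ⟨fun ⟨_, _, hr, hq⟩ => by cases hr with | asg _ _ _ h => exact ⟨h, hq⟩, fun h => asg h.1 h.2⟩

theorem sto_iff {m : Bank} {e f : Expr} :
    Wp E (.sto m e f) a Q ↔ e.ok E a ∧ f.ok E a ∧ e.val E a < E.S ∧
      Q (e.cost + f.cost + 1) (a.put m (e.val E a) (f.val E a)) :=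
  ⟨fun ⟨_, _, hr, hq⟩ => by cases hr with | sto _ _ _ _ h h' h'' => exact ⟨h, h', h'', hq⟩,
    fun h => sto h.1 h.2.1 h.2.2.1 h.2.2.2⟩

theorem rnd_iff {x : Var} : Wp E (.rnd x) a Q ↔ Q 1 (a.set x (E.rand a.used)).tick :=
  ⟨fun ⟨_, _, hr, hq⟩ => by cases hr; exact hq, rnd⟩

theorem seq_iff :
    Wp E (.seq p q) a Q ↔ Wp E p a fun t a' => Wp E q a' fun t' a'' => Q (t + t') a'' :=
  ⟨fun ⟨_, _, hr, hq⟩ => by cases hr with | seq h h' => exact ⟨_, _, h, _, _, h', hq⟩, seq⟩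

/-- Loop rule with an invariant indexed by a measure; each execution of the body decreases the
measure and takes time at most the decrease of the potential `Φ`. -/
theorem while_potential {e : Expr} {a₀ : Store} (Inv : ℕ → Store → Prop) (Φ : ℕ → Store → ℕ)
    (hok : ∀ l a, Frame p a₀ a → Inv l a → e.ok E a)
    (hbody : ∀ l a, Frame p a₀ a → Inv l a → e.val E a ≠ 0 →
      Wp E p a fun t a' => ∃ l' < l, Inv l' a' ∧ e.cost + t + 1 + Φ l' a' ≤ Φ l a)
    {l : ℕ} (h0 : Inv l a₀) (hQ : ∀ l' t a', Frame p a₀ a' → Inv l' a' → e.val E a' = 0 →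
      t + Φ l' a' ≤ Φ l a₀ + e.cost + 1 → Q t a') : Wp E (.while e p) a₀ Q := by
  suffices H : ∀ l a, Frame p a₀ a → Inv l a → ∃ l' t a', Run E (.while e p) a t a' ∧
      Frame p a₀ a' ∧ Inv l' a' ∧ e.val E a' = 0 ∧ t + Φ l' a' ≤ Φ l a + e.cost + 1 by
    obtain ⟨l', t, a', hr, hf, hi, hv, ht⟩ := H l a₀ (Frame.refl _ _) h0
    exact ⟨t, a', hr, hQ l' t a' hf hi hv ht⟩
  intro l
  induction l using Nat.strong_induction_on with
  | _ l ih =>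
    intro a hf ha
    by_cases hv : e.val E a = 0
    · exact ⟨l, _, a, Run.while_done (hok l a hf ha) hv, hf, ha, hv, by omega⟩
    · obtain ⟨t, a', hr, l', hl', hi, ht⟩ := hbody l a hf ha hv
      obtain ⟨l'', t', a'', hr', hf', hi', hv', ht'⟩ := ih l' hl' a' (hf.trans hr.frame) hi
      exact ⟨l'', _, a'', Run.while_step (hok l a hf ha) hv hr hr', hf', hi', hv', by omega⟩

/-- Loop rule with an invariant indexed by the number of remaining rounds, each of which takes time
at most `B`. -/
theorem while_count {e : Expr} {a₀ : Store} (Inv : ℕ → Store → Prop) (B : ℕ)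
    (hok : ∀ l a, Frame p a₀ a → Inv l a → e.ok E a)
    (hcond : ∀ l a, Frame p a₀ a → Inv l a → (e.val E a = 0 ↔ l = 0))
    (hbody : ∀ l a, Frame p a₀ a → Inv (l + 1) a → Wp E p a fun t a' => Inv l a' ∧ t ≤ B)
    {l : ℕ} (h0 : Inv l a₀)
    (hQ : ∀ t a', Frame p a₀ a' → Inv 0 a' → t ≤ (B + e.cost + 1) * l + e.cost + 1 → Q t a') :
    Wp E (.while e p) a₀ Q := by
  refine while_potential Inv (fun l _ => (B + e.cost + 1) * l) hok ?_ h0 ?_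
  · intro l a hf ha hv
    obtain ⟨l, rfl⟩ : ∃ l', l = l' + 1 :=
      Nat.exists_eq_succ_of_ne_zero fun h => hv ((hcond l a hf ha).2 h)
    refine (hbody l a hf ha).mono fun t a' h => ⟨l, by omega, h.1, ?_⟩
    have := h.2
    rw [Nat.mul_succ]; omega
  · intro l' t a' hf hi hv ht
    have := (hcond _ _ hf hi).1 hv
    subst this
    exact hQ t a' hf hi (by simpa using ht)

/-- Loop rule that ignores time. -/
theorem while_untimed {e : Expr} {a₀ : Store} (Inv : ℕ → Store → Prop)
    (hok : ∀ l a, Frame p a₀ a → Inv l a → e.ok E a)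
    (hcond : ∀ l a, Frame p a₀ a → Inv l a → (e.val E a = 0 ↔ l = 0))
    (hbody : ∀ l a, Frame p a₀ a → Inv (l + 1) a → Wp E p a fun _ a' => Inv l a')
    {l : ℕ} (h0 : Inv l a₀) (hQ : ∀ t a', Frame p a₀ a' → Inv 0 a' → Q t a') :
    Wp E (.while e p) a₀ Q := by
  suffices H : ∀ l a, Frame p a₀ a → Inv l a → ∃ t a', Run E (.while e p) a t a' ∧
      Frame p a₀ a' ∧ Inv 0 a' by
    obtain ⟨t, a', hr, hf, hi⟩ := H l a₀ (Frame.refl _ _) h0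
    exact ⟨t, a', hr, hQ t a' hf hi⟩
  intro l
  induction l with
  | zero =>
    exact fun a hf ha => ⟨_, a, Run.while_done (hok 0 a hf ha) ((hcond 0 a hf ha).2 rfl), hf, ha⟩
  | succ l ih =>
    intro a hf ha
    obtain ⟨t, a', hr, hi⟩ := hbody l a hf ha
    obtain ⟨t', a'', hr', hf', hi'⟩ := ih a' (hf.trans hr.frame) hi
    refine ⟨_, a'', Run.while_step (hok _ a hf ha) (fun h => ?_) hr hr', hf', hi'⟩
    simpa using (hcond _ a hf ha).1 h

end Wp

infixl:65 " +ₑ " => Expr.bin Arith.add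
infixl:65 " +ₘ " => Expr.bin Arith.addMod
infixl:65 " -ₑ " => Expr.bin Arith.sub
infixl:70 " *ₑ " => Expr.bin Arith.mul
infixl:70 " *ₘ " => Expr.bin Arith.mulMod
infixl:60 " &ₑ " => Expr.bin Arith.and
infixl:60 " <<ₑ " => Expr.bin Arith.shl
infixl:60 " >>ₑ " => Expr.bin Arith.shr
infix:50 " <ₑ " => Expr.bin Arith.lt
infix:50 " =ₑ " => Expr.bin Arith.eq
infix:40 " ≔ " => Cmd.asg
infixr:30 " ;; " => Cmd.seq

section Programs
open WordRAM.Expr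

/-! ### Programs -/

/-- Test one extension of the path with key `ka`, and append its key to the queue if it survives. -/
def expandElement : Cmd :=
  Var.z ≔ (var .hA *ₘ var .ka +ₘ var .hB *ₘ inp (var .p +ₑ lit 1 +ₑ var .j) +ₘ var .hC) ;;
  -- The key is written at the tail in any case; only the advance of the tail depends on survival
  -- and on free capacity. A full queue therefore overwrites cell `cap`, which has to exist.
  .sto .work (var .tail) ((var .z >>ₑ var .sh2) &ₑ var .mask) ;;
  Var.tail ≔ (var .tail +ₑ (var .tail <ₑ var .cap) *ₑ
    ((var .z >>ₑ var .sh1) *ₑ var .c <ₑ var .lim)) ;;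
  Var.j ≔ (var .j +ₑ lit 1)

def expandEntry : Cmd :=
  Var.ka ≔ ld .work (var .lo) ;;
  Var.j ≔ lit 0 ;;
  .while (var .j <ₑ var .m) expandElement ;;
  Var.lo ≔ (var .lo +ₑ lit 1)

def expandLevel : Cmd :=
  Var.hA ≔ ld .data (lit 16 +ₑ lit 3 *ₑ var .lev) ;;
  Var.hB ≔ ld .data (lit 17 +ₑ lit 3 *ₑ var .lev) ;;
  Var.hC ≔ ld .data (lit 18 +ₑ lit 3 *ₑ var .lev) ;;
  .while (var .lo <ₑ var .hi) expandEntry ;;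
  Var.hi ≔ var .tail ;;
  Var.lev ≔ (var .lev +ₑ lit 1)

/-- Compute the keys chosen by the set that starts at input position `p`; they end up in the
positions `lo, …, hi - 1` of the working memory. -/
def enumerate : Cmd :=
  Var.m ≔ inp (var .p) ;;
  Var.c ≔ (var .b1 *ₑ var .m) ;;
  Var.tail ≔ lit 0 ;;
  .while (var .tail <ₑ var .w)
    (.sto .work (var .tail) (var .tail) ;; Var.tail ≔ (var .tail +ₑ lit 1)) ;;
  Var.lo ≔ lit 0 ;;
  Var.hi ≔ var .w ;;
  Var.lev ≔ lit 0 ;;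
  .while (var .lev <ₑ var .k) expandLevel

/-- Copy the set at input position `p` to the data memory at `fp`. -/
def copySet : Cmd :=
  Var.j ≔ lit 0 ;;
  .while (var .j <ₑ var .m +ₑ lit 1)
    (.sto .data (var .fp) (inp (var .p +ₑ var .j)) ;;
     Var.fp ≔ (var .fp +ₑ lit 1) ;;
     Var.j ≔ (var .j +ₑ lit 1))

/-- Put an entry for set number `i`, stored at `ptr`, into the chain of each of its keys. -/
def insertKeys : Cmd :=
  .while (var .lo <ₑ var .hi)
    (Var.key ≔ (ld .work (var .lo) +ₑ var .T0) ;;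
     .sto .data (var .fp) (ld .data (var .key)) ;;
     .sto .data (var .fp +ₑ lit 1) (var .ptr) ;;
     .sto .data (var .fp +ₑ lit 2) (var .i) ;;
     .sto .data (var .key) (var .fp) ;;
     Var.fp ≔ (var .fp +ₑ lit 3) ;;
     Var.lo ≔ (var .lo +ₑ lit 1))

def insertSets : Cmd :=
  .while (var .i <ₑ var .n)
    (Var.ptr ≔ var .fp ;;
     enumerate ;;
     copySet ;;
     insertKeys ;;
     Var.p ≔ (var .p +ₑ var .m +ₑ lit 1) ;;
     Var.i ≔ (var .i +ₑ lit 1))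

/-- Compute the number of levels `k`, and `y ≈ b₁ ^ k` in fixed point arithmetic. -/
def computeLevels : Cmd :=
  Var.z ≔ var .pw ;;
  Var.y ≔ var .pw ;;
  Var.k ≔ lit 0 ;;
  .while (var .pw <ₑ var .z *ₑ var .n)
    (Var.z ≔ (var .z *ₑ var .b2 >>ₑ var .u) ;;
     Var.y ≔ (var .y *ₑ var .b1 >>ₑ var .u) ;;
     Var.k ≔ (var .k +ₑ lit 1))

/-- Compute `r = ⌈2 ^ u / y⌉`. -/
def computeRatio : Cmd :=
  Var.r ≔ lit 0 ;;
  .while (var .r *ₑ var .y <ₑ var .pw) (Var.r ≔ (var .r +ₑ lit 1))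

/-- Compute the least power of two `tb = 2 ^ v` that is at least `n * cap`. -/
def computeTableSize : Cmd :=
  Var.v ≔ lit 0 ;;
  Var.tb ≔ lit 1 ;;
  .while (var .tb <ₑ var .n *ₑ var .cap)
    (Var.tb ≔ (var .tb +ₑ var .tb) ;; Var.v ≔ (var .v +ₑ lit 1))

/-- Draw the coefficients of the hash functions. -/
def drawCoefficients : Cmd :=
  Var.lev ≔ lit 0 ;;
  .while (var .lev <ₑ lit 3 *ₑ var .k)
    (.rnd .hA ;;
     .sto .data (lit 16 +ₑ var .lev) (var .hA) ;;
     Var.lev ≔ (var .lev +ₑ lit 1))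

def readParameters : Cmd :=
  Var.n ≔ inp (lit 0) ;;
  Var.u ≔ (inp (lit 2) >>ₑ lit 2) ;;
  Var.sh1 ≔ (inp (lit 2) -ₑ var .u) ;;
  Var.pw ≔ (lit 1 <<ₑ var .u) ;;
  Var.lim ≔ (var .pw *ₑ var .pw) ;;
  Var.b1 ≔ (inp (lit 3) >>ₑ var .sh1) ;;
  Var.b2 ≔ (inp (lit 4) >>ₑ var .sh1)

def storeHeader : Cmd :=
  .sto .data (lit 0) (var .k) ;;
  .sto .data (lit 1) (var .w) ;;
  .sto .data (lit 2) (var .cap) ;;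
  .sto .data (lit 3) (var .sh1) ;;
  .sto .data (lit 4) (var .sh2) ;;
  .sto .data (lit 5) (var .mask) ;;
  .sto .data (lit 6) (var .b1) ;;
  .sto .data (lit 7) (var .lim) ;;
  .sto .data (lit 8) (var .b2 +ₑ lit 1) ;;
  .sto .data (lit 9) (var .pw) ;;
  .sto .data (lit 10) (var .T0)

/-- The preprocessing; `K` is the constant in the bound on the size of the queue. -/
def preprocess (K : ℕ) : Cmd :=
  readParameters ;;
  computeLevels ;;
  computeRatio ;;
  -- With `16 k` roots the variance term `2 k / w` of the second-moment bound is `1 / 8`.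
  Var.w ≔ lit 16 *ₑ var .k ;;
  Var.cap ≔ lit K *ₑ (var .w *ₑ var .r) ;;
  computeTableSize ;;
  Var.sh2 ≔ (var .sh1 -ₑ var .v) ;;
  Var.mask ≔ (var .tb -ₑ lit 1) ;;
  Var.T0 ≔ lit 16 +ₑ lit 3 *ₑ var .k ;;
  storeHeader ;;
  drawCoefficients ;;
  Var.fp ≔ (var .T0 +ₑ var .tb) ;;
  Var.p ≔ lit 5 ;;
  Var.i ≔ lit 0 ;;
  insertSets

def loadHeader : Cmd :=
  Var.k ≔ ld .data (lit 0) ;;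
  Var.w ≔ ld .data (lit 1) ;;
  Var.cap ≔ ld .data (lit 2) ;;
  Var.sh1 ≔ ld .data (lit 3) ;;
  Var.sh2 ≔ ld .data (lit 4) ;;
  Var.mask ≔ ld .data (lit 5) ;;
  Var.b1 ≔ ld .data (lit 6) ;;
  Var.lim ≔ ld .data (lit 7) ;;
  Var.b2 ≔ ld .data (lit 8) ;;
  Var.pw ≔ ld .data (lit 9) ;;
  Var.T0 ≔ ld .data (lit 10)

/-- Count the common elements of the query and the set stored at `ptr` by merging. -/
def countCommon : Cmd :=
  Var.cnt ≔ lit 0 ;;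
  Var.i ≔ lit 0 ;;
  Var.j ≔ lit 0 ;;
  .while ((var .i <ₑ var .xm) *ₑ (var .j <ₑ var .m))
    (Var.y ≔ ld .data (var .ptr +ₑ lit 1 +ₑ var .i) ;;
     Var.z ≔ inp (lit 1 +ₑ var .j) ;;
     Var.cnt ≔ (var .cnt +ₑ (var .y =ₑ var .z)) ;;
     -- The test `y < z + 1` encodes `y ≤ z`, so both positions advance when the two elements are
     -- equal.
     Var.i ≔ (var .i +ₑ (var .y <ₑ var .z +ₑ lit 1)) ;;
     Var.j ≔ (var .j +ₑ (var .z <ₑ var .y +ₑ lit 1)))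

/-- Check the candidate in entry `e`, and stop the search if it is similar to the query. -/
def checkCandidate : Cmd :=
  Var.ptr ≔ ld .data (var .e +ₑ lit 1) ;;
  Var.xm ≔ ld .data (var .ptr) ;;
  .ite (var .xm *ₑ var .b2 <ₑ var .m *ₑ var .pw +ₑ lit 1)
    (countCommon ;;
     .ite ((var .xm *ₑ var .b2 <ₑ var .cnt *ₑ var .pw +ₑ lit 1) *ₑ
        (var .m *ₑ var .b2 <ₑ var .cnt *ₑ var .pw +ₑ lit 1))
      -- `walkChain` decrements the budget after each candidate, so budget 1 becomes 0 and also
      -- stops the search in all later chains.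
      (Var.ans ≔ ld .data (var .e +ₑ lit 2) ;; Var.bud ≔ lit 1)
      .skip)
    .skip

def walkChain : Cmd :=
  .while ((lit 0 <ₑ var .e) *ₑ (lit 0 <ₑ var .bud))
    (checkCandidate ;;
     Var.e ≔ ld .data (var .e) ;;
     Var.bud ≔ (var .bud -ₑ lit 1))

/-- The query. -/
def query : Cmd :=
  loadHeader ;;
  Var.p ≔ lit 0 ;;
  enumerate ;;
  Var.bud ≔ var .cap ;;
  .while (var .lo <ₑ var .hi)
    (Var.e ≔ ld .data (var .T0 +ₑ ld .work (var .lo)) ;;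
     walkChain ;;
     Var.lo ≔ (var .lo +ₑ lit 1))

end Programs

/-! ### What the programs compute, in terms of lists of keys -/

/-- Word size `W`, hash values of `u` bits, keys of `v` bits. -/
structure Shape where
  W : ℕ
  u : ℕ
  v : ℕ

namespace Shape

variable (g : Shape)

/-- The multiply-shift hash before shifting. -/
def hash (t : ℕ × ℕ × ℕ) (κ j : ℕ) : ℕ := (t.1 * κ + t.2.1 * j + t.2.2) % 2 ^ g.W

/-- The extension of `κ` by `j` is chosen by a set with threshold parameter `c`. -/
def Survives (c : ℕ) (t : ℕ × ℕ × ℕ) (κ j : ℕ) : Prop :=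
  g.hash t κ j / 2 ^ (g.W - g.u) * c < 2 ^ (2 * g.u)

instance (c : ℕ) (t : ℕ × ℕ × ℕ) (κ j : ℕ) : Decidable (g.Survives c t κ j) :=
  inferInstanceAs (Decidable (_ < _))

/-- The key of the extension of `κ` by `j`. -/
def newKey (t : ℕ × ℕ × ℕ) (κ j : ℕ) : ℕ := g.hash t κ j / 2 ^ (g.W - g.u - g.v) % 2 ^ g.v

/-- Keys of the chosen extensions of `κ`. -/
def children (c : ℕ) (xs : List ℕ) (t : ℕ × ℕ × ℕ) (κ : ℕ) : List ℕ :=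
  (xs.filter (g.Survives c t κ)).map (g.newKey t κ)

/-- Keys of the chosen extensions of a list of keys. -/
def step (c : ℕ) (xs : List ℕ) (t : ℕ × ℕ × ℕ) (l : List ℕ) : List ℕ :=
  l.flatMap (g.children c xs t)

/-- Keys of all chosen extensions by `ts.length` elements. -/
def iter (c : ℕ) (xs : List ℕ) : List (ℕ × ℕ × ℕ) → List ℕ → List ℕ
  | [], l => l
  | t :: ts, l => iter c xs ts (g.step c xs t l)

/-- The number of keys on all levels. -/
def total (c : ℕ) (xs : List ℕ) : List (ℕ × ℕ × ℕ) → List ℕ → ℕ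
  | [], l => l.length
  | t :: ts, l => l.length + total c xs ts (g.step c xs t l)

/-- As `iter`, but the total number of keys is cut off at `cap`; `hi` keys are there already. -/
def cutIter (cap c : ℕ) (xs : List ℕ) : List (ℕ × ℕ × ℕ) → ℕ → List ℕ → List ℕ
  | [], _, l => l
  | t :: ts, hi, l =>
    cutIter cap c xs ts (hi + ((g.step c xs t l).take (cap - hi)).length)
      ((g.step c xs t l).take (cap - hi))

variable {g}

theorem step_sublist {c : ℕ} {xs : List ℕ} {t : ℕ × ℕ × ℕ} {l l' : List ℕ} (h : l.Sublist l') :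
    (g.step c xs t l).Sublist (g.step c xs t l') := h.flatMap _

theorem iter_sublist {c : ℕ} {xs : List ℕ} (ts : List (ℕ × ℕ × ℕ)) {l l' : List ℕ}
    (h : l.Sublist l') : (g.iter c xs ts l).Sublist (g.iter c xs ts l') := by
  induction ts generalizing l l' with
  | nil => exact h
  | cons t ts ih => exact ih (step_sublist h)

/-- Truncation only removes keys, so an upper bound on the candidates of the full process also holds
for the truncated one. -/
theorem cutIter_sublist {cap c : ℕ} {xs : List ℕ} (ts : List (ℕ × ℕ × ℕ)) (hi : ℕ) (l : List ℕ) :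
    (g.cutIter cap c xs ts hi l).Sublist (g.iter c xs ts l) := by
  induction ts generalizing hi l with
  | nil => exact List.Sublist.refl _
  | cons t ts ih => exact (ih _ _).trans (iter_sublist ts (List.take_sublist _ _))

theorem length_le_total {c : ℕ} {xs : List ℕ} (ts : List (ℕ × ℕ × ℕ)) (l : List ℕ) :
    l.length ≤ g.total c xs ts l := by
  cases ts <;> simp [total]

/-- `hi` counts the keys queued so far, those of `l` included. The hypothesis thus says that the
untruncated process never exceeds `cap`, and then no `take` removes anything. -/
theorem cutIter_eq {cap c : ℕ} {xs : List ℕ} (ts : List (ℕ × ℕ × ℕ)) (hi : ℕ) (l : List ℕ)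
    (h : hi + g.total c xs ts l ≤ cap + l.length) :
    g.cutIter cap c xs ts hi l = g.iter c xs ts l := by
  induction ts generalizing hi l with
  | nil => rfl
  | cons t ts ih =>
    simp only [total] at h
    have hle := length_le_total (g := g) (c := c) (xs := xs) ts (g.step c xs t l)
    have : (g.step c xs t l).take (cap - hi) = g.step c xs t l :=
      List.take_of_length_le (by omega)
    simp only [cutIter, iter, this]
    exact ih _ _ (by omega)

theorem cutIter_length_le {cap c : ℕ} {xs : List ℕ} (ts : List (ℕ × ℕ × ℕ)) (hi : ℕ)
    (l : List ℕ) (h : l.length ≤ cap) : (g.cutIter cap c xs ts hi l).length ≤ cap := by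
  induction ts generalizing hi l with
  | nil => exact h
  | cons t ts ih => exact ih _ _ (by simp only [List.length_take]; omega)

theorem newKey_lt (t : ℕ × ℕ × ℕ) (κ j : ℕ) : g.newKey t κ j < 2 ^ g.v :=
  Nat.mod_lt _ (by positivity)

theorem lt_of_mem_step {c : ℕ} {xs : List ℕ} {t : ℕ × ℕ × ℕ} {l : List ℕ} {κ : ℕ}
    (h : κ ∈ g.step c xs t l) : κ < 2 ^ g.v := by
  simp only [step, children, List.mem_flatMap, List.mem_map] at h
  obtain ⟨_, _, _, _, rfl⟩ := h
  exact newKey_lt _ _ _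

theorem lt_of_mem_cutIter {cap c : ℕ} {xs : List ℕ} (ts : List (ℕ × ℕ × ℕ)) (hi : ℕ)
    (l : List ℕ) (h : ∀ κ ∈ l, κ < 2 ^ g.v) : ∀ κ ∈ g.cutIter cap c xs ts hi l, κ < 2 ^ g.v := by
  induction ts generalizing hi l with
  | nil => exact h
  | cons t ts ih => exact ih _ _ fun κ hκ => lt_of_mem_step (List.mem_of_mem_take hκ)

end Shape

/-! ### Lists in memory -/

/-- The memory `f` holds the list `l` from address `p` on. -/
def Reads (f : ℕ → ℕ) (p : ℕ) (l : List ℕ) : Prop := ∀ i (h : i < l.length), f (p + i) = l[i]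

namespace Reads

variable {f f' : ℕ → ℕ} {p : ℕ} {l l' : List ℕ}

theorem nil : Reads f p [] := fun _ h => absurd h (Nat.not_lt_zero _)

theorem congr (h : Reads f p l) (hf : ∀ i < l.length, f' (p + i) = f (p + i)) : Reads f' p l :=
  fun i hi => (hf i hi).trans (h i hi)

theorem append_iff : Reads f p (l ++ l') ↔ Reads f p l ∧ Reads f (p + l.length) l' := by
  constructor
  · intro h
    refine ⟨fun i hi => ?_, fun i hi => ?_⟩
    · rw [h i (by simp; omega), List.getElem_append_left hi]
    · rw [add_assoc, h (l.length + i) (by simp; omega), List.getElem_append_right (by omega)]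
      simp
  · rintro ⟨h, h'⟩ i hi
    by_cases hl : i < l.length
    · rw [h i hl, List.getElem_append_left hl]
    · have := h' (i - l.length) (by simp at hi; omega)
      rw [List.getElem_append_right (by omega), ← this]
      congr 1; omega

theorem cons_iff {x : ℕ} : Reads f p (x :: l) ↔ f p = x ∧ Reads f (p + 1) l := by
  rw [← List.singleton_append, append_iff]
  simp [Reads]

end Reads

/-! ### Analysis of the enumeration of keys -/

/-- The variables and the memory contain what `enumerate` needs to compute the keys of the set
`xs`. -/
structure Ready (E : Env) (g : Shape) (ts : List (ℕ × ℕ × ℕ)) (xs : List ℕ) (a : Store) :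
    Prop where
  word : E.W = g.W
  sh1 : a.var .sh1 = g.W - g.u
  sh2 : a.var .sh2 = g.W - g.u - g.v
  mask : a.var .mask = 2 ^ g.v - 1
  lim : a.var .lim = 2 ^ (2 * g.u)
  k : a.var .k = ts.length
  coeff : ∀ i (h : i < ts.length), a.mem .data (16 + 3 * i) = ts[i].1 ∧
    a.mem .data (17 + 3 * i) = ts[i].2.1 ∧ a.mem .data (18 + 3 * i) = ts[i].2.2
  inp_card : E.inp (a.var .p) = xs.length
  inp_elems : Reads E.inp (a.var .p + 1) xs
  w_le : a.var .w ≤ a.var .cap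
  cap_lt : a.var .cap < E.S
  coeff_lt : 16 + 3 * ts.length ≤ E.S
  S_le : E.S ≤ 2 ^ g.W
  inp_lt : a.var .p + 1 + xs.length < 2 ^ g.W
  b1_lt : a.var .b1 < 2 ^ g.u
  card_le : xs.length ≤ 2 ^ g.u
  three_u : 3 * g.u ≤ g.W
  u_pos : 0 < g.u

section Enumerate

variable {E : Env} {g : Shape} {ts : List (ℕ × ℕ × ℕ)} {xs : List ℕ}

theorem Shape.hash_lt (g : Shape) (t : ℕ × ℕ × ℕ) (κ j : ℕ) : g.hash t κ j < 2 ^ g.W :=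
  Nat.mod_lt _ (by positivity)

theorem Ready.threshold_lt {a : Store} (h : Ready E g ts xs a) :
    a.var .b1 * xs.length < 2 ^ (2 * g.u) := by
  have h1 := h.b1_lt
  have h2 := h.card_le
  calc a.var .b1 * xs.length ≤ a.var .b1 * 2 ^ g.u := Nat.mul_le_mul_left _ h2
    _ < 2 ^ g.u * 2 ^ g.u := Nat.mul_lt_mul_of_pos_right h1 (by positivity)
    _ = 2 ^ (2 * g.u) := by rw [← pow_add]; congr 1; omega

/-- The survival test `H / 2 ^ u < 2 ^ u / c`, cleared of denominators, multiplies a hash value of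
`u` bits by a parameter `c` below `2 ^ (2 u)`; the product fits because `3 u ≤ W`. -/
theorem Ready.product_lt {a : Store} (h : Ready E g ts xs a) (t : ℕ × ℕ × ℕ) (κ j : ℕ) :
    g.hash t κ j / 2 ^ (g.W - g.u) * (a.var .b1 * xs.length) < 2 ^ g.W := by
  have h1 := g.hash_lt t κ j
  have h3 := h.three_u
  have h2 : g.hash t κ j / 2 ^ (g.W - g.u) < 2 ^ g.u := by
    rw [Nat.div_lt_iff_lt_mul (by positivity), ← pow_add]
    convert h1 using 2; omega
  calc g.hash t κ j / 2 ^ (g.W - g.u) * (a.var .b1 * xs.length)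
      ≤ g.hash t κ j / 2 ^ (g.W - g.u) * 2 ^ (2 * g.u) :=
        Nat.mul_le_mul_left _ h.threshold_lt.le
    _ < 2 ^ g.u * 2 ^ (2 * g.u) := Nat.mul_lt_mul_of_pos_right h2 (by positivity)
    _ = 2 ^ (3 * g.u) := by rw [← pow_add]; congr 1; omega
    _ ≤ 2 ^ g.W := Nat.pow_le_pow_right (by norm_num) h3

/-- Here `b` is the outcome of the survival test. Writing at the tail is harmless when the tail does
not move, and when it moves the written cell is the appended entry; a full queue ignores both. -/
theorem Reads.push {f f' : ℕ → ℕ} {hi N x : ℕ} {q : List ℕ} (b : Bool) (h : Reads f hi (q.take N))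
    (hf : ∀ i, f' i = if i = hi + (q.take N).length then x else f i) :
    Reads f' hi ((q ++ if b then [x] else []).take N) := by
  by_cases hN : q.length < N
  · have h1 : q.take N = q := List.take_of_length_le hN.le
    have h2 : (q ++ if b then [x] else []).take N = q ++ if b then [x] else [] :=
      List.take_of_length_le (by cases b <;> simp <;> omega)
    rw [h1] at h hf
    rw [h2, Reads.append_iff]
    refine ⟨h.congr fun i hi' => ?_, ?_⟩
    · rw [hf, if_neg (by omega)]
    · cases b
      · exact Reads.nil
      · intro i hi'
        obtain rfl : i = 0 := by simpa using hi'
        simp [hf]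
  · rw [List.take_append_of_le_length (by omega)]
    exact h.congr fun i hi' => by rw [hf, if_neg (by omega)]

theorem push_length {N x : ℕ} {q : List ℕ} (b : Bool) :
    ((q ++ if b then [x] else []).take N).length =
      (q.take N).length + if (q.take N).length < N ∧ b then 1 else 0 := by
  cases b
  · simp
  · simp only [List.length_take, List.length_append, if_true, List.length_singleton, and_true]
    split_ifs <;> omega

/-- `q` is the ideal, untruncated list of keys found so far on the current level; the queue holds
its first `cap - hi` entries from cell `hi` on. The new list `q'` enters through an equation so that
callers can present it in another form. -/
theorem wp_expandElement {a₀ a : Store} {t : ℕ × ℕ × ℕ} {κ hi j : ℕ} {q : List ℕ}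
    (hR : Ready E g ts xs a₀) (hf : Frame expandEntry a₀ a)
    (hA : a₀.var .hA = t.1) (hB : a₀.var .hB = t.2.1) (hC : a₀.var .hC = t.2.2)
    (hc : a₀.var .c = a₀.var .b1 * xs.length) (hka : a.var .ka = κ)
    (hhi : hi ≤ a₀.var .cap) (hj : a.var .j = j) (hjm : j < xs.length)
    (htail : a.var .tail = hi + (q.take (a₀.var .cap - hi)).length)
    (hq : Reads (a.mem .work) hi (q.take (a₀.var .cap - hi)))
    {Q : ℕ → Store → Prop}
    (hQ : ∀ T a', T ≤ 60 → a'.var .j = j + 1 → a'.var .ka = κ →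
      (∀ q', q' = q ++ (if g.Survives (a₀.var .b1 * xs.length) t κ xs[j] then
          [g.newKey t κ xs[j]] else []) →
        a'.var .tail = hi + (q'.take (a₀.var .cap - hi)).length ∧
        Reads (a'.mem .work) hi (q'.take (a₀.var .cap - hi))) →
      (∀ i < hi, a'.mem .work i = a.mem .work i) → Q T a') :
    Wp E expandElement a Q := by
  have e1 : a.var .hA = t.1 := (hf.var .hA rfl).trans hA
  have e2 : a.var .hB = t.2.1 := (hf.var .hB rfl).trans hB
  have e3 : a.var .hC = t.2.2 := (hf.var .hC rfl).trans hC
  have e4 : a.var .p = a₀.var .p := hf.var .p rfl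
  have e5 : a.var .sh1 = g.W - g.u := (hf.var .sh1 rfl).trans hR.sh1
  have e6 : a.var .sh2 = g.W - g.u - g.v := (hf.var .sh2 rfl).trans hR.sh2
  have e7 : a.var .mask = 2 ^ g.v - 1 := (hf.var .mask rfl).trans hR.mask
  have e8 : a.var .lim = 2 ^ (2 * g.u) := (hf.var .lim rfl).trans hR.lim
  have e9 : a.var .cap = a₀.var .cap := hf.var .cap rfl
  have e10 : a.var .c = a₀.var .b1 * xs.length := (hf.var .c rfl).trans hc
  have hx : E.inp (a₀.var .p + 1 + j) = xs[j] := hR.inp_elems j hjm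
  -- Intermediate reductions of the summands do not affect the result modulo `2 ^ W`.
  have hz : ((t.1 * κ % 2 ^ g.W + t.2.1 * xs[j] % 2 ^ g.W) % 2 ^ g.W + t.2.2) % 2 ^ g.W =
      g.hash t κ xs[j] := by simp [Shape.hash, Nat.add_mod]
  have hW := hR.word
  have hS := hR.S_le
  have hcap := hR.cap_lt
  have hlt := hR.inp_lt
  have hlen : (q.take (a₀.var .cap - hi)).length ≤ a₀.var .cap - hi := by simp
  have hprod := hR.product_lt t κ xs[j]
  have h1W : 1 < 2 ^ g.W := by
    have := hR.u_pos; have := hR.three_u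
    exact Nat.one_lt_two_pow (by omega)
  simp only [expandElement, Wp.seq_iff, Wp.asg_iff, Wp.sto_iff, Expr.ok, Expr.val, Arith.ok,
    Arith.val, Store.set_var, Store.put_var, reduceCtorEq, if_false, if_true, e1,
    e2, e3, e4, e5, e6, e7, e8, e9, e10, hka, hj, htail, hW, hx, hz, true_and,
    Nat.and_two_pow_sub_one_eq_mod, Expr.cost, and_true]
  refine ⟨by refine ⟨?_, ?_⟩ <;> omega, by omega, ⟨⟨h1W, ⟨hprod, h1W⟩, ?_⟩, ?_⟩, by omega, ?_⟩
  · split_ifs <;> omega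
  · split_ifs <;> omega
  · refine hQ _ _ (by norm_num) (by simp) (by simp [hka]) ?_ ?_
    · rintro q' rfl
      have hb : (if g.Survives (a₀.var .b1 * xs.length) t κ xs[j] then
          [g.newKey t κ xs[j]] else []) =
          (if decide (g.Survives (a₀.var .b1 * xs.length) t κ xs[j]) = true then
          [g.newKey t κ xs[j]] else []) := by simp
      rw [hb]
      refine ⟨?_, ?_⟩
      · rw [push_length]
        simp only [Store.set_var, reduceCtorEq, if_false, if_true, Shape.Survives]
        rw [← add_assoc]
        congr 1
        have : (hi + (q.take (a₀.var .cap - hi)).length < a₀.var .cap) ↔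
          (q.take (a₀.var .cap - hi)).length < a₀.var .cap - hi := by omega
        by_cases h1 : (q.take (a₀.var .cap - hi)).length < a₀.var .cap - hi <;>
        by_cases h2 : g.hash t κ xs[j] / 2 ^ (g.W - g.u) * (a₀.var .b1 * xs.length) <
            2 ^ (2 * g.u) <;>
          simp only [this, h1, h2] <;> simp
      · refine hq.push _ fun i => ?_
        simp only [Store.set_mem, Store.put_mem, true_and]
        rfl
    · intro i hi'
      simp only [Store.set_mem, Store.put_mem, true_and]
      rw [if_neg (by omega)]

theorem Frame.set {c : Cmd} {x : Var} (hx : c.writes x = true) (a : Store) (v : ℕ) :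
    Frame c a (a.set x v) :=
  ⟨fun y hy => by
    have : y ≠ x := fun h => by rw [h, hx] at hy; cases hy
    simp [this], fun _ _ => rfl, fun _ => rfl⟩

theorem Frame.mono {c c' : Cmd} {a a' : Store} (h : Frame c a a')
    (hw : ∀ x, c'.writes x = false → c.writes x = false)
    (hs : ∀ m, c'.stores m = false → c.stores m = false)
    (hd : c'.draws = false → c.draws = false) : Frame c' a a' :=
  ⟨fun x hx => h.var x (hw x hx), fun m hm => h.mem m (hs m hm), fun hc => h.used (hd hc)⟩

theorem wp_expandEntry {a₀ a : Store} {t : ℕ × ℕ × ℕ} {κ hi : ℕ} {q : List ℕ}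
    (hR : Ready E g ts xs a₀) (hf : Frame expandEntry a₀ a)
    (hA : a₀.var .hA = t.1) (hB : a₀.var .hB = t.2.1) (hC : a₀.var .hC = t.2.2)
    (hc : a₀.var .c = a₀.var .b1 * xs.length) (hm : a₀.var .m = xs.length)
    (hlo : a.var .lo < hi) (hka : a.mem .work (a.var .lo) = κ) (hhi : hi ≤ a₀.var .cap)
    (htail : a.var .tail = hi + (q.take (a₀.var .cap - hi)).length)
    (hq : Reads (a.mem .work) hi (q.take (a₀.var .cap - hi)))
    {Q : ℕ → Store → Prop}
    (hQ : ∀ T a', T ≤ 64 * xs.length + 20 → a'.var .lo = a.var .lo + 1 →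
      (∀ q', q' = q ++ g.children (a₀.var .b1 * xs.length) xs t κ →
        a'.var .tail = hi + (q'.take (a₀.var .cap - hi)).length ∧
        Reads (a'.mem .work) hi (q'.take (a₀.var .cap - hi))) →
      (∀ i < hi, a'.mem .work i = a.mem .work i) → Q T a') :
    Wp E expandEntry a Q := by
  have hW := hR.word
  have hS := hR.S_le
  have hcap := hR.cap_lt
  have hpos : 0 < 2 ^ g.W := by positivity
  have hu : 1 < 2 ^ g.W := by
    have := hR.u_pos; have := hR.three_u
    exact Nat.one_lt_two_pow (by omega)
  have hlt := hR.inp_lt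
  simp only [expandEntry, Wp.seq_iff, Wp.asg_iff, Expr.ok, Expr.val, hka, hW, true_and]
  refine ⟨by omega, by omega, ?_⟩
  set a₁ := (a.set .ka κ).set .j 0 with ha₁
  have hf₁ : Frame expandEntry a₀ a₁ :=
    hf.trans ((Frame.set rfl _ _).trans (Frame.set rfl _ _))
  refine Wp.while_count (fun l a' => l ≤ xs.length ∧ a'.var .j = xs.length - l ∧
    a'.var .ka = κ ∧
    (∀ q', q' = q ++ g.children (a₀.var .b1 * xs.length) (xs.take (xs.length - l)) t κ →
        a'.var .tail = hi + (q'.take (a₀.var .cap - hi)).length ∧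
        Reads (a'.mem .work) hi (q'.take (a₀.var .cap - hi))) ∧
    (∀ i < hi, a'.mem .work i = a.mem .work i)) 60 ?_ ?_ ?_ (l := xs.length) ?_ ?_
  · intro l a' _ _
    simp only [Expr.ok, Arith.ok, hW, true_and]; omega
  · intro l a' hf' ⟨h1, h2, _⟩
    have : a'.var .m = xs.length := ((hf'.var .m rfl).trans (hf₁.var .m rfl)).trans hm
    simp only [Expr.val, Arith.val, h2, this, ite_eq_right_iff, one_ne_zero, imp_false, not_lt]
    omega
  · intro l a' hf' ⟨h1, h2, h3, h4, h5⟩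
    have hf'' : Frame expandEntry a₀ a' :=
      hf₁.trans (hf'.mono (fun x hx => by revert hx; cases x <;> decide)
        (fun m hx => by revert hx; cases m <;> decide) (fun _ => rfl))
    obtain ⟨h6, h7⟩ := h4 _ rfl
    refine wp_expandElement hR hf'' hA hB hC hc h3 hhi h2 (by omega) h6 h7 ?_
    intro T a'' hT hj' hka' hq' hmem
    refine ⟨⟨by omega, by omega, hka', ?_, fun i hi' => (hmem i hi').trans (h5 i hi')⟩, hT⟩
    rintro q' rfl
    refine hq' _ ?_
    have : xs.length - l = (xs.length - (l + 1)) + 1 := by omega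
    rw [this, Shape.children, List.take_add_one, List.getElem?_eq_getElem (by omega),
      List.filter_append, List.map_append, ← List.append_assoc, Shape.children]
    congr 1
    by_cases hs : g.Survives (a₀.var .b1 * xs.length) t κ xs[xs.length - (l + 1)] <;> simp [hs]
  · refine ⟨le_rfl, by simp [ha₁], by simp [ha₁], ?_, by simp [ha₁]⟩
    rintro q' rfl
    simpa [ha₁, Shape.children, -List.length_take] using And.intro htail hq
  · intro T a' hf' ⟨_, h2, h3, h4, h5⟩ hT
    have hlo' : a'.var .lo = a.var .lo := (hf'.var .lo rfl).trans (by simp [ha₁])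
    simp only [Arith.val, Expr.cost, Arith.ok, hlo']
    refine ⟨by omega, hQ _ _ ?_ (by simp) ?_ ?_⟩
    · simp only [Expr.cost] at hT; omega
    · simpa using h4
    · simpa using h5

theorem Ready.of_frame {a a' : Store} (h : Ready E g ts xs a) (hf : Frame enumerate a a') :
    Ready E g ts xs a' := by
  have e1 := hf.var .sh1 rfl
  have e2 := hf.var .sh2 rfl
  have e3 := hf.var .mask rfl
  have e4 := hf.var .lim rfl
  have e5 := hf.var .k rfl
  have e6 := hf.var .p rfl
  have e7 := hf.var .w rfl
  have e8 := hf.var .cap rfl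
  have e9 := hf.var .b1 rfl
  have e10 := hf.mem .data rfl
  cases h
  constructor <;> first
    | assumption
    | (simp only [e1, e2, e3, e4, e5, e6, e7, e8, e9, e10]; assumption)

theorem wp_expandLevel {a : Store} {i lo : ℕ} {seg : List ℕ}
    (hR : Ready E g ts xs a) (hi : i < ts.length) (hlev : a.var .lev = i)
    (hc : a.var .c = a.var .b1 * xs.length) (hm : a.var .m = xs.length)
    (hlo : a.var .lo = lo) (hhi : a.var .hi = lo + seg.length)
    (htail : a.var .tail = lo + seg.length) (hcap : lo + seg.length ≤ a.var .cap)
    (hseg : Reads (a.mem .work) lo seg)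
    {Q : ℕ → Store → Prop}
    (hQ : ∀ T a' seg', T ≤ (64 * xs.length + 24) * seg.length + 50 → a'.var .lev = i + 1 →
      seg' = (g.step (a.var .b1 * xs.length) xs ts[i] seg).take (a.var .cap - (lo + seg.length)) →
      a'.var .lo = lo + seg.length → a'.var .hi = lo + seg.length + seg'.length →
      a'.var .tail = lo + seg.length + seg'.length →
      Reads (a'.mem .work) (lo + seg.length) seg' → Q T a') :
    Wp E expandLevel a Q := by
  have hW := hR.word
  have hS := hR.S_le
  have hcS := hR.coeff_lt
  have hcapS := hR.cap_lt
  obtain ⟨c1, c2, c3⟩ := hR.coeff i hi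
  have hpos : 1 < 2 ^ g.W := by
    have := hR.u_pos; have := hR.three_u
    exact Nat.one_lt_two_pow (by omega)
  simp only [expandLevel, Wp.seq_iff, Wp.asg_iff, Expr.ok, Expr.val, Arith.ok, Arith.val, hW,
    Store.set_var, Store.set_mem, reduceCtorEq, if_false, hlev, true_and, c1, c2, c3]
  refine ⟨by omega, by omega, by omega, ?_⟩
  set a₁ := ((a.set .hA ts[i].1).set .hB ts[i].2.1).set .hC ts[i].2.2 with ha₁
  have hf₁ : Frame enumerate a a₁ :=
    (Frame.set rfl _ _).trans ((Frame.set rfl _ _).trans (Frame.set rfl _ _))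
  have hR₁ := hR.of_frame hf₁
  have hcap₁ : a₁.var .cap = a.var .cap := hf₁.var .cap rfl
  have hb₁ : a₁.var .b1 = a.var .b1 := hf₁.var .b1 rfl
  refine Wp.while_count (fun l a' => l ≤ seg.length ∧ a'.var .lo = lo + (seg.length - l) ∧
    (∀ q', q' = g.step (a.var .b1 * xs.length) xs ts[i] (seg.take (seg.length - l)) →
        a'.var .tail = lo + seg.length + (q'.take (a.var .cap - (lo + seg.length))).length ∧
        Reads (a'.mem .work) (lo + seg.length) (q'.take (a.var .cap - (lo + seg.length)))) ∧
    Reads (a'.mem .work) lo seg) (64 * xs.length + 20) ?_ ?_ ?_ (l := seg.length) ?_ ?_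
  · intro l a' _ _
    simp only [Expr.ok, Arith.ok, hW, true_and]; omega
  · intro l a' hf' ⟨h1, h2, _⟩
    have : a'.var .hi = lo + seg.length := (hf'.var .hi rfl).trans (by simp [ha₁, hhi])
    simp only [Expr.val, Arith.val, h2, this, ite_eq_right_iff, one_ne_zero, imp_false, not_lt]
    omega
  · intro l a' hf' ⟨h1, h2, h3, h4⟩
    have hlt : seg.length - (l + 1) < seg.length := by omega
    have hread : a'.mem .work (a'.var .lo) = seg[seg.length - (l + 1)] := by rw [h2]; exact h4 _ hlt
    obtain ⟨h5, h6⟩ := h3 _ rfl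
    refine wp_expandEntry hR₁ hf' (t := ts[i]) (by simp [ha₁]) (by simp [ha₁]) (by simp [ha₁])
      (by simp [ha₁, hc]) (by simp [ha₁, hm]) (hi := lo + seg.length) (by omega) hread
      (by omega) (by rw [hcap₁]; exact h5) (by rw [hcap₁]; exact h6) ?_
    intro T a'' hT hlo'' hq'' hmem
    refine ⟨⟨by omega, by omega, ?_, h4.congr fun i hi' => hmem _ (by omega)⟩, hT⟩
    rintro q' rfl
    rw [hcap₁, hb₁] at hq''
    refine hq'' _ ?_
    have : seg.length - l = (seg.length - (l + 1)) + 1 := by omega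
    rw [this, Shape.step, List.take_add_one, List.getElem?_eq_getElem (by omega),
      List.flatMap_append, Shape.step]
    simp
  · refine ⟨le_rfl, by simp [ha₁, hlo], ?_, by simpa [ha₁] using hseg⟩
    rintro q' rfl
    simp [ha₁, Shape.step, htail, Reads.nil]
  · intro T a' hf' ⟨_, h2, h3, h4⟩ hT
    obtain ⟨h5, h6⟩ := h3 _ rfl
    have hlev' : a'.var .lev = i := (hf'.var .lev rfl).trans (by simp [ha₁, hlev])
    have hle : ts.length < 2 ^ g.W := by omega
    simp only [Nat.sub_zero, List.take_length] at h5 h6 h2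
    simp only [hlev', Expr.cost] at hT ⊢
    refine ⟨by omega, hQ _ _ _ ?_ (by simp) rfl (by simp [h2]) (by simp [h5])
      (by simp [h5]) (by simpa using h6)⟩
    rw [show 64 * xs.length + 20 + (1 + 1 + 1) + 1 = 64 * xs.length + 24 by omega] at hT
    omega

/-- `enumerate` computes the (cut-off) list of keys of a set. -/
theorem wp_enumerate {a : Store} (hR : Ready E g ts xs a) {Q : ℕ → Store → Prop}
    (hQ : ∀ T a' l, T ≤ (64 * xs.length + 24) * a.var .cap + 60 * ts.length +
        20 * a.var .w + 60 → Frame enumerate a a' → a'.var .m = xs.length →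
      l = g.cutIter (a.var .cap) (a.var .b1 * xs.length) xs ts (a.var .w) (List.range (a.var .w)) →
      a'.var .hi = a'.var .lo + l.length → a'.var .hi ≤ a.var .cap →
      Reads (a'.mem .work) (a'.var .lo) l → Q T a') :
    Wp E enumerate a Q := by
  have hW := hR.word
  have hS := hR.S_le
  have hcS := hR.coeff_lt
  have hcapS := hR.cap_lt
  have hinp := hR.inp_lt
  have hwcap := hR.w_le
  have hthr := hR.threshold_lt
  have hpos : 2 ^ (2 * g.u) ≤ 2 ^ g.W := by
    have := hR.three_u
    exact Nat.pow_le_pow_right (by norm_num) (by omega)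
  have hpos' : 1 < 2 ^ (2 * g.u) := Nat.one_lt_two_pow (by have := hR.u_pos; omega)
  refine Wp.frame (Q := fun T a' => Frame enumerate a a' → Q T a') ?_ fun t a' h hf => h hf
  simp only [enumerate, Wp.seq_iff, Wp.asg_iff, Expr.ok, Expr.val, Arith.ok, Arith.val, hW,
    Store.set_var, reduceCtorEq, if_false, if_true, true_and, hR.inp_card]
  refine ⟨by omega, by omega, ?_⟩
  set a₁ := ((a.set .m xs.length).set .c (a.var .b1 * xs.length)).set .tail 0 with ha₁
  have hf₁ : Frame enumerate a a₁ :=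
    (Frame.set rfl _ _).trans ((Frame.set rfl _ _).trans (Frame.set rfl _ _))
  refine Wp.while_count (fun l a' => l ≤ a.var .w ∧ a'.var .tail = a.var .w - l ∧
    ∀ i < a.var .w - l, a'.mem .work i = i) 15 ?_ ?_ ?_ (l := a.var .w) ?_ ?_
  · intro l a' _ _
    simp only [Expr.ok, Arith.ok, hW, true_and]; omega
  · intro l a' hf' ⟨h1, h2, _⟩
    have : a'.var .w = a.var .w := (hf'.var .w rfl).trans (by simp [ha₁])
    simp only [Expr.val, Arith.val, h2, this, ite_eq_right_iff, one_ne_zero, imp_false, not_lt]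
    omega
  · intro l a' hf' ⟨h1, h2, h3⟩
    simp only [Wp.seq_iff, Wp.asg_iff, Wp.sto_iff, Expr.ok, Expr.val, Arith.ok, Arith.val, hW,
      Store.put_var, h2, Expr.cost, true_and]
    refine ⟨by omega, by omega, ⟨by omega, by simp; omega, ?_⟩, by norm_num⟩
    intro i hi
    simp only [Store.set_mem, Store.put_mem, true_and]
    split_ifs with h
    · exact h.symm
    · exact h3 i (by omega)
  · simp [ha₁]
  · intro T a₂ hf₂ ⟨_, htail₂, hmem₂⟩ hT
    have hw₂ : a₂.var .w = a.var .w := (hf₂.var .w rfl).trans (by simp [ha₁])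
    simp only [hw₂, Nat.sub_zero] at htail₂ hmem₂ ⊢
    refine ⟨by omega, by omega, ?_⟩
    set a₃ := ((a₂.set .lo 0).set .hi (a.var .w)).set .lev 0 with ha₃
    have hf₃ : Frame enumerate a a₃ :=
      (hf₁.trans (hf₂.mono (fun x hx => by revert hx; cases x <;> decide)
        (fun m hx => by revert hx; cases m <;> decide) (fun _ => rfl))).trans
      ((Frame.set rfl _ _).trans ((Frame.set rfl _ _).trans (Frame.set rfl _ _)))
    have hcap₃ : a₃.var .cap = a.var .cap := hf₃.var .cap rfl
    have hb₃ : a₃.var .b1 = a.var .b1 := hf₃.var .b1 rfl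
    have hm₃ : a₃.var .m = xs.length := by
      simp only [ha₃, Store.set_var, reduceCtorEq, if_false]
      exact (hf₂.var .m rfl).trans (by simp [ha₁])
    have hc₃ : a₃.var .c = a.var .b1 * xs.length := by
      simp only [ha₃, Store.set_var, reduceCtorEq, if_false]
      exact (hf₂.var .c rfl).trans (by simp [ha₁])
    -- Invariant: finishing the remaining levels from the current segment yields the final list. In
    -- the potential every queue cell from `lo` on is charged once, since `lo` only advances and
    -- stays below `cap`; the cost is proportional to `cap` in total and not to `cap` per level.
    refine Wp.while_potential (fun l a' => l ≤ ts.length ∧ a'.var .lev = ts.length - l ∧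
      ∃ seg, g.cutIter (a.var .cap) (a.var .b1 * xs.length) xs (ts.drop (ts.length - l))
          (a'.var .hi) seg =
        g.cutIter (a.var .cap) (a.var .b1 * xs.length) xs ts (a.var .w) (List.range (a.var .w)) ∧
        a'.var .hi = a'.var .lo + seg.length ∧ a'.var .tail = a'.var .hi ∧
        a'.var .hi ≤ a.var .cap ∧ Reads (a'.mem .work) (a'.var .lo) seg)
      (fun l a' => 60 * l + (64 * xs.length + 24) * (a.var .cap - a'.var .lo)) ?_ ?_
      (l := ts.length) ?_ ?_
    · intro l a' _ _
      simp only [Expr.ok, Arith.ok, hW, true_and]; omega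
    · intro l a' hf' ⟨h1, h2, seg, h3, h4, h5, h6, h7⟩ hv
      have hf'' : Frame enumerate a₃ a' :=
        hf'.mono (fun x hx => by revert hx; cases x <;> decide)
          (fun m hx => by revert hx; cases m <;> decide) (fun _ => rfl)
      have hR' := (hR.of_frame hf₃).of_frame hf''
      have hk : a'.var .k = ts.length := hR'.k
      simp only [Expr.val, Arith.val, h2, hk, ne_eq, ite_eq_right_iff, one_ne_zero, imp_false,
        not_lt, not_le] at hv
      have hcap' : a'.var .cap = a.var .cap := (hf''.var .cap rfl).trans hcap₃
      have hb' : a'.var .b1 = a.var .b1 := (hf''.var .b1 rfl).trans hb₃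
      refine wp_expandLevel hR' hv h2 (by rw [hb', hf'.var .c rfl, hc₃])
        (by rw [hf'.var .m rfl, hm₃]) rfl h4 (h5.trans h4) (by omega) h7 ?_
      intro T' a'' seg' hT' hlev' hseg' hlo' hhi' htail' hreads'
      rw [hcap', hb'] at hseg'
      refine ⟨l - 1, by omega, ⟨by omega, by omega, seg', ?_, by omega, by omega, ?_, ?_⟩, ?_⟩
      · rw [← h3]
        have e1 : ts.length - (l - 1) = (ts.length - l) + 1 := by omega
        rw [e1, List.drop_eq_getElem_cons hv, Shape.cutIter, h4, ← hseg', hhi']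
      · rw [hhi', hseg', List.length_take]; omega
      · rw [hlo']; exact hreads'
      · rw [hlo']
        have e1 : a.var .cap - a'.var .lo =
          (a.var .cap - (a'.var .lo + seg.length)) + seg.length := by omega
        rw [e1, Nat.mul_add]
        simp only [Expr.cost]
        omega
    · refine ⟨le_rfl, by simp [ha₃], List.range (a.var .w), ?_, ?_, ?_, ?_, ?_⟩
      · simp [ha₃]
      · simp [ha₃]
      · simp [ha₃, htail₂]
      · simp [ha₃, hwcap]
      · intro i hi
        simp only [List.length_range] at hi
        simp [ha₃, hmem₂ i hi]
    · intro l T' a' hf' ⟨h1, h2, seg, h3, h4, h5, h6, h7⟩ hv hT' hF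
      have hk : a'.var .k = ts.length :=
        ((hf'.var .k rfl).trans (hf₃.var .k rfl)).trans hR.k
      simp only [Expr.val, Arith.val, h2, hk, ite_eq_right_iff, one_ne_zero, imp_false,
        not_lt] at hv
      obtain rfl : l = 0 := by omega
      have hm' : a'.var .m = xs.length := (hf'.var .m rfl).trans hm₃
      simp only [Nat.sub_zero, List.drop_length, Shape.cutIter] at h3
      refine hQ _ _ seg ?_ hF hm' h3 h4 h6 h7
      have hlo₃ : a₃.var .lo = 0 := by simp [ha₃]
      rw [hlo₃] at hT'
      simp only [Expr.cost, Nat.sub_zero] at hT' hT ⊢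
      omega

end Enumerate

/-! ### Intersections of sorted lists -/

/-- The number of common elements. -/
def common (x q : List ℕ) : ℕ := (x.filter (· ∈ q)).length

theorem common_nil_left (q : List ℕ) : common [] q = 0 := rfl

theorem common_nil_right (x : List ℕ) : common x [] = 0 := by simp [common]

/-- This and the next two lemmas are the cases of a merge step. Sortedness ensures that the smaller
head has no partner in the other list, and that equal heads match only each other. -/
theorem common_cons_cons_of_eq {a : ℕ} {x q : List ℕ} (hx : (a :: x).Pairwise (· < ·)) :
    common (a :: x) (a :: q) = common x q + 1 := by
  simp only [common]
  rw [List.filter_cons_of_pos (by simp), List.length_cons]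
  congr 2
  refine List.filter_congr fun b hb => ?_
  have := (List.pairwise_cons.1 hx).1 b hb
  simp [this.ne']

theorem common_cons_cons_of_lt {a b : ℕ} {x q : List ℕ} (hq : (b :: q).Pairwise (· < ·))
    (h : a < b) : common (a :: x) (b :: q) = common x (b :: q) := by
  simp only [common]
  rw [List.filter_cons_of_neg]
  have : a ∉ q := fun ha => by have := (List.pairwise_cons.1 hq).1 a ha; omega
  simp [this, h.ne]

theorem common_cons_cons_of_gt {a b : ℕ} {x q : List ℕ} (hx : (a :: x).Pairwise (· < ·))
    (h : b < a) : common (a :: x) (b :: q) = common (a :: x) q := by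
  simp only [common]
  congr 1
  refine List.filter_congr fun c hc => ?_
  have : b < c := by
    rcases List.mem_cons.1 hc with rfl | hc
    · exact h
    · exact h.trans ((List.pairwise_cons.1 hx).1 c hc)
  simp [this.ne']

theorem common_le_right {x q : List ℕ} (hx : x.Nodup) : common x q ≤ q.length := by
  refine List.Subperm.length_le ?_
  refine (List.subperm_of_subset (hx.filter _) fun a ha => ?_)
  simpa using (List.mem_filter.1 ha).2

/-! ### The data structure -/

/-- The linked list that starts at `e` consists of entries for the sets with the given numbers; all
entries and sets are stored between the addresses `lb` and `ub`. -/
def Chain (mem : ℕ → ℕ) (X : ℕ → List ℕ) (lb ub : ℕ) : ℕ → List ℕ → Prop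
  | e, [] => e = 0
  | e, i :: l => lb ≤ e ∧ e + 3 ≤ ub ∧ mem (e + 2) = i ∧
      (lb ≤ mem (e + 1) ∧ mem (e + 1) + 1 + (X i).length ≤ ub ∧
        Reads mem (mem (e + 1)) ((X i).length :: X i)) ∧ Chain mem X lb ub (mem e) l

/-- All cells of a chain lie between `lb` and `ub`, so changes to the table heads below `lb` and to
fresh memory from `ub` on leave it intact. -/
theorem Chain.congr {mem mem' : ℕ → ℕ} {X : ℕ → List ℕ} {lb ub ub' e : ℕ} {l : List ℕ}
    (h : Chain mem X lb ub e l) (hmem : ∀ i, lb ≤ i → i < ub → mem' i = mem i) (hub : ub ≤ ub') :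
    Chain mem' X lb ub' e l := by
  induction l generalizing e with
  | nil => exact h
  | cons i l ih =>
    obtain ⟨h1, h2, h3, ⟨h4, h5, h6⟩, h7⟩ := h
    have e0 := hmem e h1 (by omega)
    have e1 := hmem (e + 1) (by omega) (by omega)
    have e2 := hmem (e + 2) (by omega) (by omega)
    refine ⟨h1, by omega, by rw [e2, h3], ⟨by rw [e1]; exact h4, by rw [e1]; omega, ?_⟩, ?_⟩
    · rw [e1]
      exact h6.congr fun j hj => hmem _ (by omega) (by simp at hj; omega)
    · rw [e0]; exact ih h7

/-- The content of the data memory after the preprocessing of the sets `X 0, …, X (n - 1)`. -/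
structure Stored (g : Shape) (ts : List (ℕ × ℕ × ℕ)) (w cap b1 b2 n : ℕ) (X : ℕ → List ℕ)
    (fp : ℕ) (chains : ℕ → List ℕ) (D : ℕ → ℕ) : Prop where
  header : Reads D 0 [ts.length, w, cap, g.W - g.u, g.W - g.u - g.v, 2 ^ g.v - 1, b1, 2 ^ (2 * g.u),
    b2 + 1, 2 ^ g.u, 16 + 3 * ts.length]
  coeff : ∀ i (h : i < ts.length), D (16 + 3 * i) = ts[i].1 ∧
    D (17 + 3 * i) = ts[i].2.1 ∧ D (18 + 3 * i) = ts[i].2.2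
  chain : ∀ c < 2 ^ g.v, Chain D X (16 + 3 * ts.length + 2 ^ g.v) fp
    (D (16 + 3 * ts.length + c)) (chains c)
  lt_of_mem : ∀ c < 2 ^ g.v, ∀ i ∈ chains c, i < n

/-- The test whether the sets `x` and `q` are similar, with threshold `b / N`. -/
def Similar (b N : ℕ) (q x : List ℕ) : Prop :=
  x.length * b ≤ common x q * N ∧ q.length * b ≤ common x q * N

/-- Some set among the first `bud` candidates passes the test `P`. -/
def HasCandidate (P : ℕ → Prop) (l : List ℕ) (bud : ℕ) : Prop := ∃ i ∈ l.take bud, P i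

/-! ### Analysis of the query program -/

section Query

variable {E : Env}

theorem ite_mul_ite_le (p q : Prop) [Decidable p] [Decidable q] :
    (if p then 1 else 0) * (if q then 1 else 0) ≤ 1 := by split_ifs <;> simp

theorem wp_countCommon {a : Store} {x q : List ℕ} (hx : x.Pairwise (· < ·))
    (hq : q.Pairwise (· < ·)) (hxm : a.var .xm = x.length) (hm : a.var .m = q.length)
    (hreadx : Reads (a.mem .data) (a.var .ptr + 1) x) (hreadq : Reads E.inp 1 q)
    (hptr : a.var .ptr + 1 + x.length ≤ E.S) (hS : E.S ≤ 2 ^ E.W) (hqW : q.length + 1 < 2 ^ E.W)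
    (hxe : ∀ b ∈ x, b + 1 < 2 ^ E.W) (hqe : ∀ b ∈ q, b + 1 < 2 ^ E.W)
    {Q : ℕ → Store → Prop}
    (hQ : ∀ T a', T ≤ 60 * (x.length + q.length) + 20 → Frame countCommon a a' →
      a'.var .cnt = common x q → Q T a') : Wp E countCommon a Q := by
  have h1W : 1 < 2 ^ E.W := by omega
  refine Wp.frame (Q := fun T a' => Frame countCommon a a' → Q T a') ?_ fun t a' h hf => h hf
  simp only [countCommon, Wp.seq_iff, Wp.asg_iff, Expr.ok, Expr.val]
  refine ⟨by omega, by omega, by omega, ?_⟩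
  -- The count plus the number of matches between the unread tails is constant, and each round
  -- shortens at least one tail.
  refine Wp.while_potential (fun l a' => ∃ i j, l = (x.length - i) + (q.length - j) ∧
      i ≤ x.length ∧ j ≤ q.length ∧ a'.var .i = i ∧ a'.var .j = j ∧
      a'.var .cnt + common (x.drop i) (q.drop j) = common x q ∧ a'.var .cnt ≤ i)
    (fun l _ => 60 * l) ?_ ?_ (l := x.length + q.length) ?_ ?_
  · rintro l a' hf ⟨i, j, rfl, hi, hj, e1, e2, e3⟩
    simp only [Expr.ok, Arith.ok, Arith.val, Expr.val, true_and]
    exact ⟨h1W, h1W, (ite_mul_ite_le _ _).trans_lt h1W⟩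
  · rintro l a' hf ⟨i, j, rfl, hi, hj, e1, e2, e3, e4⟩ hv
    have exm : a'.var .xm = x.length := (hf.var .xm rfl).trans (by simp [hxm])
    have em : a'.var .m = q.length := (hf.var .m rfl).trans (by simp [hm])
    have eptr : a'.var .ptr = a.var .ptr := (hf.var .ptr rfl).trans (by simp)
    have emem : a'.mem .data = a.mem .data := (hf.mem .data rfl).trans (by simp)
    simp only [Expr.val, Arith.val, e1, e2, exm, em, ne_eq, mul_eq_zero, ite_eq_right_iff,
      one_ne_zero, imp_false, not_lt, not_or, not_le] at hv
    obtain ⟨hi', hj'⟩ := hv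
    have ex : a.mem .data (a.var .ptr + 1 + i) = x[i] := hreadx i hi'
    have eq : E.inp (1 + j) = q[j] := hreadq j hj'
    simp only [Wp.seq_iff, Wp.asg_iff, Expr.ok, Expr.val, Arith.ok, Arith.val, Expr.cost,
      Store.set_var, reduceCtorEq, if_false, if_true, e1, e2, eptr, emem, ex, eq,
      true_and]
    have hd1 : x.drop i = x[i] :: x.drop (i + 1) := List.drop_eq_getElem_cons hi'
    have hd2 : q.drop j = q[j] :: q.drop (j + 1) := List.drop_eq_getElem_cons hj'
    have hx' : (x[i] :: x.drop (i + 1)).Pairwise (· < ·) := hd1 ▸ hx.drop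
    have hq' : (q[j] :: q.drop (j + 1)).Pairwise (· < ·) := hd2 ▸ hq.drop
    rw [hd1, hd2] at e3
    have hwx := hxe _ (List.getElem_mem hi')
    have hwq := hqe _ (List.getElem_mem hj')
    refine ⟨by omega, by omega, ⟨h1W, by split_ifs <;> omega⟩, ⟨⟨⟨h1W, hwq⟩, h1W⟩,
      by split_ifs <;> omega⟩, ⟨⟨⟨h1W, hwx⟩, h1W⟩, by split_ifs <;> omega⟩, ?_⟩
    rcases lt_trichotomy x[i] q[j] with h | h | h
    · rw [common_cons_cons_of_lt hq' h, ← hd2] at e3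
      refine ⟨_, ?_, ⟨i + 1, j, rfl, hi', hj, ?_, ?_, ?_, ?_⟩, ?_⟩
      · omega
      · simp [show x[i] < q[j] + 1 by omega]
      · simp [show ¬ q[j] < x[i] + 1 by omega]
      · simpa [h.ne] using e3
      · simp [h.ne]; omega
      · omega
    · rw [← h] at hq'
      rw [← h, common_cons_cons_of_eq hx'] at e3
      refine ⟨_, ?_, ⟨i + 1, j + 1, rfl, hi', hj', ?_, ?_, ?_, ?_⟩, ?_⟩
      · omega
      · simp [show x[i] < q[j] + 1 by omega]
      · simp [show q[j] < x[i] + 1 by omega]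
      · simp [h]; omega
      · simp [h]; omega
      · omega
    · rw [common_cons_cons_of_gt hx' h, ← hd1] at e3
      refine ⟨_, ?_, ⟨i, j + 1, rfl, hi, hj', ?_, ?_, ?_, ?_⟩, ?_⟩
      · omega
      · simp [show ¬ x[i] < q[j] + 1 by omega]
      · simp [show q[j] < x[i] + 1 by omega]
      · simpa [h.ne'] using e3
      · simp [h.ne']; omega
      · omega
  · exact ⟨0, 0, rfl, by omega, by omega, by simp, by simp, by simp, by simp⟩
  · rintro l T a' hf ⟨i, j, rfl, hi, hj, e1, e2, e3, e4⟩ hv hT hF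
    have exm : a'.var .xm = x.length := (hf.var .xm rfl).trans (by simp [hxm])
    have em : a'.var .m = q.length := (hf.var .m rfl).trans (by simp [hm])
    simp only [Expr.val, Arith.val, e1, e2, exm, em, mul_eq_zero, ite_eq_right_iff,
      one_ne_zero, imp_false, not_lt] at hv
    refine hQ _ _ ?_ hF ?_
    · simp only [Expr.cost] at hT ⊢; omega
    · rcases hv with h | h
      · rw [List.drop_of_length_le h, common_nil_left] at e3; exact e3
      · rw [List.drop_of_length_le h, common_nil_right] at e3; exact e3

/-- `checkCandidate` accepts the set `x` if it is similar to the query `q`, with a time bound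
proportional to the size of `q`: long sets are rejected at once. -/
theorem wp_checkCandidate {a : Store} {x q : List ℕ} {i b N R : ℕ} (hx : x.Pairwise (· < ·))
    (hq : q.Pairwise (· < ·)) (hm : a.var .m = q.length) (hb : a.var .b2 = b)
    (hN : a.var .pw = N) (he : a.var .e + 3 ≤ E.S) (hi : a.mem .data (a.var .e + 2) = i)
    (hread : Reads (a.mem .data) (a.mem .data (a.var .e + 1)) (x.length :: x))
    (hreadq : Reads E.inp 1 q) (hptr : a.mem .data (a.var .e + 1) + 1 + x.length ≤ E.S)
    (hS : E.S ≤ 2 ^ E.W) (hqN : q.length ≤ N) (hxN : x.length ≤ N) (hbN : b ≤ N)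
    (hNW : N * N + 1 < 2 ^ E.W) (hRN : N ≤ R * b) (hb0 : 0 < b)
    (hqW : q.length + 1 < 2 ^ E.W)
    (hxe : ∀ b ∈ x, b + 1 < 2 ^ E.W) (hqe : ∀ b ∈ q, b + 1 < 2 ^ E.W)
    {Q : ℕ → Store → Prop}
    (hQ : ∀ T a', T ≤ 60 * ((R + 1) * q.length) + 80 → Frame checkCandidate a a' →
      (Similar b N q x → a'.var .ans = i ∧ a'.var .bud = 1) →
      (¬ Similar b N q x → a'.var .ans = a.var .ans ∧ a'.var .bud = a.var .bud) → Q T a') :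
    Wp E checkCandidate a Q := by
  obtain ⟨hxm, hreadx⟩ := Reads.cons_iff.1 hread
  have h1W : 1 < 2 ^ E.W := by omega
  have hqm : q.length * N ≤ N * N := Nat.mul_le_mul_right _ hqN
  have hxb : x.length * b ≤ N * N := Nat.mul_le_mul hxN hbN
  have hqb : q.length * b ≤ N * N := Nat.mul_le_mul hqN hbN
  have hcom := common_le_right (q := q) (hx.imp (fun h => h.ne))
  have hcN : common x q * N ≤ q.length * N := Nat.mul_le_mul_right _ hcom
  refine Wp.frame (Q := fun T a' => Frame checkCandidate a a' → Q T a') ?_ fun t a' h hf => h hf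
  simp only [checkCandidate, Wp.seq_iff, Wp.asg_iff, Expr.ok, Expr.val, Arith.ok, Arith.val,
    Store.set_var, Store.set_mem, if_true, true_and, hxm]
  refine ⟨by omega, by omega, Wp.ite ?_ ?_ ?_⟩
  · simp only [Expr.ok, Expr.val, Arith.ok, Arith.val, Store.set_var, reduceCtorEq, if_false,
      if_true, hm, hb, hN, true_and]
    omega
  · intro hv
    simp only [Expr.val, Arith.val, Store.set_var, reduceCtorEq, if_false, if_true, hb, hm, hN,
      ne_eq, ite_eq_right_iff, one_ne_zero, imp_false, not_not, Nat.lt_succ_iff] at hv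
    -- A set that passes the size test is at most `R` times as long as the query, because `N ≤ R *
    -- b`; merging then costs `O(|q|)`.
    have hlen : x.length ≤ R * q.length := by
      refine Nat.le_of_mul_le_mul_right ?_ hb0
      calc x.length * b ≤ q.length * N := hv
        _ ≤ q.length * (R * b) := Nat.mul_le_mul_left _ hRN
        _ = R * q.length * b := by ring
    refine Wp.seq (wp_countCommon hx hq (by simp) (by simp [hm]) (by simpa using hreadx) hreadq
      (by simpa using hptr) hS hqW hxe hqe ?_)
    intro T a₁ hT hf₁ hcnt
    have e1 : a₁.var .xm = x.length := (hf₁.var .xm rfl).trans (by simp)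
    have e2 : a₁.var .m = q.length := (hf₁.var .m rfl).trans (by simp [hm])
    have e3 : a₁.var .b2 = b := (hf₁.var .b2 rfl).trans (by simp [hb])
    have e4 : a₁.var .pw = N := (hf₁.var .pw rfl).trans (by simp [hN])
    have e5 : a₁.var .e = a.var .e := (hf₁.var .e rfl).trans (by simp)
    have e6 : a₁.var .ans = a.var .ans := (hf₁.var .ans rfl).trans (by simp)
    have e7 : a₁.var .bud = a.var .bud := (hf₁.var .bud rfl).trans (by simp)
    have e8 : a₁.mem .data = a.mem .data := (hf₁.mem .data rfl).trans (by simp)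
    have hTx : 60 * (x.length + q.length) ≤ 60 * ((R + 1) * q.length) := by
      rw [Nat.add_mul, one_mul]; omega
    refine Wp.ite ?_ ?_ ?_
    · simp only [Expr.ok, Expr.val, Arith.ok, Arith.val, e1, e2, e3, e4, hcnt, true_and]
      refine ⟨?_, ?_, (ite_mul_ite_le _ _).trans_lt h1W⟩ <;> omega
    · intro hv'
      simp only [Expr.val, Arith.val, e1, e2, e3, e4, hcnt, ne_eq, mul_eq_zero, ite_eq_right_iff,
        one_ne_zero, imp_false, not_lt, not_or, not_le, Nat.lt_succ_iff] at hv'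
      simp only [Wp.seq_iff, Wp.asg_iff, Expr.ok, Expr.val, Arith.ok, Arith.val, e5, e8, hi,
        true_and]
      refine ⟨by omega, by omega, fun hF => hQ _ _ ?_ hF (by simp) fun h => absurd hv' h⟩
      simp only [Expr.cost]; omega
    · intro hv'
      simp only [Expr.val, Arith.val, e1, e2, e3, e4, hcnt, mul_eq_zero, ite_eq_right_iff,
        one_ne_zero, imp_false, not_lt] at hv'
      rw [Wp.skip_iff]
      refine fun hF => hQ _ _ ?_ hF (fun h => ?_) fun _ => ⟨e6, e7⟩
      · simp only [Expr.cost]; omega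
      · obtain ⟨h1, h2⟩ := h; omega
  · intro hv
    simp only [Expr.val, Arith.val, Store.set_var, reduceCtorEq, if_false, if_true, hb, hm, hN,
      ite_eq_right_iff, one_ne_zero, imp_false, not_lt] at hv
    rw [Wp.skip_iff]
    refine fun hF => hQ _ _ ?_ hF (fun h => ?_) fun _ => ⟨by simp, by simp⟩
    · simp only [Expr.cost]; omega
    · have := h.1; omega

end Query

section Query

variable {E : Env}

/-- Sizes of the data sets `X i`, `i < n`, of the query `q` and of the machine words that make the
query program work. -/
structure Bounds (E : Env) (g : Shape) (w cap b1 b2 n k : ℕ) (X : ℕ → List ℕ) (q : List ℕ)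
    (fp R : ℕ) : Prop where
  word : E.W = g.W
  S_le : E.S ≤ 2 ^ g.W
  fp_le : fp ≤ E.S
  w_le : w ≤ cap
  cap_lt : cap < E.S
  cells_le : 16 + 3 * k + 2 ^ g.v ≤ E.S
  three_u : 3 * g.u ≤ g.W
  u_pos : 0 < g.u
  b1_lt : b1 < 2 ^ g.u
  b2_lt : b2 < 2 ^ g.u
  ratio : 2 ^ g.u ≤ R * (b2 + 1)
  w_le_cells : w ≤ 2 ^ g.v
  sorted : ∀ i < n, (X i).Pairwise (· < ·)
  card_le : ∀ i < n, (X i).length ≤ 2 ^ g.u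
  elem_lt : ∀ i < n, ∀ b ∈ X i, b < 2 ^ g.u
  q_sorted : q.Pairwise (· < ·)
  q_card_le : q.length ≤ 2 ^ g.u
  q_elem_lt : ∀ b ∈ q, b < 2 ^ g.u
  inp : Reads E.inp 0 (q.length :: q)

variable {g : Shape} {ts : List (ℕ × ℕ × ℕ)} {w cap b1 b2 n k fp R : ℕ} {X : ℕ → List ℕ}
  {q : List ℕ} {chains : ℕ → List ℕ} {D : ℕ → ℕ}

theorem Bounds.sq_lt (h : Bounds E g w cap b1 b2 n k X q fp R) :
    2 ^ g.u * 2 ^ g.u + 1 < 2 ^ g.W := by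
  have h1 := h.three_u
  have h2 := h.u_pos
  have h3 : 2 ^ (3 * g.u) ≤ 2 ^ g.W := Nat.pow_le_pow_right (by norm_num) h1
  have h4 : 2 ^ 1 ≤ 2 ^ g.u := Nat.pow_le_pow_right (by norm_num) h2
  have h5 : 2 ^ (3 * g.u) = 2 ^ g.u * 2 ^ g.u * 2 ^ g.u := by
    rw [← pow_add, ← pow_add]; congr 1; omega
  have h6 : 2 ^ g.u * 2 ^ g.u * 2 ≤ 2 ^ g.u * 2 ^ g.u * 2 ^ g.u := Nat.mul_le_mul_left _ h4
  have h7 : 2 * 2 ≤ 2 ^ g.u * 2 ^ g.u := Nat.mul_le_mul h4 h4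
  omega

theorem Bounds.two_lt (h : Bounds E g w cap b1 b2 n k X q fp R) :
    2 ^ g.u + 1 < 2 ^ g.W := by
  have := h.sq_lt
  have h4 : 2 ^ 0 ≤ 2 ^ g.u := Nat.pow_le_pow_right (by norm_num) (Nat.zero_le _)
  have h6 : 2 ^ g.u * 1 ≤ 2 ^ g.u * 2 ^ g.u := Nat.mul_le_mul_left _ h4
  omega

/-- The state of the search: either an answer has been found, or the remaining candidates `l`
contain a good one within the budget, provided that this was so initially. -/
def Searching (P : ℕ → Prop) (H : Prop) (l : List ℕ) (a : Store) : Prop :=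
  (P (a.var .ans) ∧ a.var .bud = 0) ∨ (H → HasCandidate P l (a.var .bud))

/-- The potential is the remaining budget times the cost of one candidate. The budget is shared by
all chains, so the total cost is that of `cap` candidates, however long the chains are. `rest`
stands for the candidates in chains not yet visited. -/
theorem wp_walkChain (hB : Bounds E g w cap b1 b2 n k X q fp R) {a : Store} {H : Prop}
    {lb : ℕ} {l rest : List ℕ} (hlb : 0 < lb) (hD : a.mem .data = D)
    (hm : a.var .m = q.length) (hb : a.var .b2 = b2 + 1) (hpw : a.var .pw = 2 ^ g.u)
    (hchain : Chain D X lb fp (a.var .e) l) (hn : ∀ i ∈ l, i < n)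
    (hs : Searching (fun i => i < n ∧ Similar (b2 + 1) (2 ^ g.u) q (X i)) H (l ++ rest) a)
    {Q : ℕ → Store → Prop}
    (hQ : ∀ T a', T + (60 * ((R + 1) * q.length) + 100) * a'.var .bud ≤
        (60 * ((R + 1) * q.length) + 100) * a.var .bud + 20 → Frame walkChain a a' →
      Searching (fun i => i < n ∧ Similar (b2 + 1) (2 ^ g.u) q (X i)) H rest a' → Q T a') :
    Wp E walkChain a Q := by
  set P := fun i => i < n ∧ Similar (b2 + 1) (2 ^ g.u) q (X i) with hP
  have hW := hB.word
  have h1 := hB.sq_lt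
  have h2 := hB.two_lt
  have hS := hB.S_le
  have hfp := hB.fp_le
  refine Wp.frame (Q := fun T a' => Frame walkChain a a' → Q T a') ?_ fun t a' h hf => h hf
  refine Wp.while_potential (fun r a' => ∃ l', r = l'.length ∧ Chain D X lb fp (a'.var .e) l' ∧
      (∀ i ∈ l', i < n) ∧ Searching P H (l' ++ rest) a')
    (fun _ a' => (60 * ((R + 1) * q.length) + 100) * a'.var .bud) ?_ ?_ (l := l.length) ?_ ?_
  · intro r a' _ _
    simp only [Expr.ok, Arith.ok, Arith.val, Expr.val, true_and, hW]
    exact ⟨⟨by omega, by omega⟩, ⟨by omega, by omega⟩, (ite_mul_ite_le _ _).trans_lt (by omega)⟩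
  · rintro r a' hf ⟨l', rfl, hch, hl', hs'⟩ hv
    have he : 0 < a'.var .e := by
      by_contra h0
      exact hv (by simp [Expr.val, Arith.val, show a'.var .e = 0 by omega])
    have hbud : 0 < a'.var .bud := by
      by_contra h0
      exact hv (by simp [Expr.val, Arith.val, show a'.var .bud = 0 by omega])
    cases l' with
    | nil => exact absurd hch (by simp only [Chain]; omega)
    | cons i l' =>
      obtain ⟨c1, c2, c3, ⟨c4, c5, c6⟩, c7⟩ := hch
      have hD' : a'.mem .data = D := (hf.mem .data rfl).trans hD
      have hin : i < n := hl' i (by simp)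
      have hs'' : H → HasCandidate P (i :: l' ++ rest) (a'.var .bud) := by
        rcases hs' with h | h
        · omega
        · exact h
      refine Wp.seq (wp_checkCandidate (hB.sorted i hin) hB.q_sorted (b := b2 + 1) (i := i)
        ((hf.var .m rfl).trans hm) ((hf.var .b2 rfl).trans hb) ((hf.var .pw rfl).trans hpw)
        (by omega) (by rw [hD', c3]) (by rw [hD']; exact c6) (Reads.cons_iff.1 hB.inp).2
        (by rw [hD']; omega) (by rw [hW]; exact hS) hB.q_card_le (hB.card_le i hin) hB.b2_lt
        (by rw [hW]; exact h1) hB.ratio (by omega)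
        (by rw [hW]; have := hB.q_card_le; omega)
        (fun b hb => by rw [hW]; have := hB.elem_lt i hin b hb; omega)
        (fun b hb => by rw [hW]; have := hB.q_elem_lt b hb; omega) ?_)
      intro T a₁ hT hf₁ hacc hrej
      have e1 : a₁.var .e = a'.var .e := hf₁.var .e rfl
      have e2 : a₁.mem .data = D := (hf₁.mem .data rfl).trans hD'
      by_cases hsim : Similar (b2 + 1) (2 ^ g.u) q (X i)
      · obtain ⟨h3, h4⟩ := hacc hsim
        simp only [Wp.seq_iff, Wp.asg_iff, Expr.ok, Expr.val, Arith.ok, Arith.val,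
          Store.set_var, reduceCtorEq, if_false, if_true, e1, e2, h4, hW, true_and]
        refine ⟨by omega, ⟨by omega, le_rfl⟩, l'.length, by simp, ⟨l', rfl, by simpa using c7,
          fun j hj => hl' j (by simp [hj]), Or.inl ⟨?_, by simp⟩⟩, ?_⟩
        · simpa [h3] using ⟨hin, hsim⟩
        · simp only [Expr.cost]
          have : (60 * ((R + 1) * q.length) + 100) * 1 ≤
            (60 * ((R + 1) * q.length) + 100) * a'.var .bud := Nat.mul_le_mul_left _ hbud
          omega
      · obtain ⟨h3, h4⟩ := hrej hsim
        simp only [Wp.seq_iff, Wp.asg_iff, Expr.ok, Expr.val, Arith.ok, Arith.val,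
          Store.set_var, reduceCtorEq, if_false, if_true, e1, e2, h4, hW, true_and]
        refine ⟨by omega, ⟨by omega, by omega⟩, l'.length, by simp, ⟨l', rfl, by simpa using c7,
          fun j hj => hl' j (by simp [hj]), Or.inr fun hH => ?_⟩, ?_⟩
        · obtain ⟨j, hj, hPj⟩ := hs'' hH
          obtain ⟨b, hb'⟩ : ∃ b, a'.var .bud = b + 1 := Nat.exists_eq_succ_of_ne_zero (by omega)
          rw [hb', List.cons_append, List.take_succ_cons, List.mem_cons] at hj
          rcases hj with rfl | hj
          · exact absurd hPj.2 hsim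
          · exact ⟨j, by simpa [hb'] using hj, hPj⟩
        · simp only [Expr.cost]
          obtain ⟨b, hb'⟩ : ∃ b, a'.var .bud = b + 1 := Nat.exists_eq_succ_of_ne_zero (by omega)
          rw [hb', Nat.add_sub_cancel, Nat.mul_succ]
          omega
  · exact ⟨l, rfl, hchain, hn, hs⟩
  · rintro r T a' hf ⟨l', rfl, hch, hl', hs'⟩ hv hT hF
    refine hQ _ _ (hT.trans (by simp [Expr.cost])) hF ?_
    replace hv : a'.var .e = 0 ∨ a'.var .bud = 0 := by
      by_contra h0
      have h3 : 0 < a'.var .e ∧ 0 < a'.var .bud := by omega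
      simp [Expr.val, Arith.val, h3] at hv
    rcases hs' with h | h
    · exact Or.inl h
    · refine Or.inr fun hH => ?_
      have := h hH
      -- The walk stopped at the end of the chain, which leaves `rest`, or with budget zero, and
      -- then no candidate lies within the budget.
      rcases hv with hv | hv
      · cases l' with
        | nil => exact this
        | cons i l' => have := hch.1; omega
      · obtain ⟨j, hj, _⟩ := this
        simp [hv] at hj

/-- The query program finds a similar set if there is one among the first `cap` candidates, and does
so in time proportional to `cap` and the size of the query. -/
theorem wp_query (hB : Bounds E g w cap b1 b2 n ts.length X q fp R) {a : Store}
    (hD : a.mem .data = D) (hst : Stored g ts w cap b1 b2 n X fp chains D)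
    {Q : ℕ → Store → Prop}
    (hQ : ∀ T a', T ≤ (300 * (R + 2)) * (q.length + 1) * (cap + 1) + 60 * ts.length →
      a'.mem .data = D →
      (HasCandidate (fun i => i < n ∧ Similar (b2 + 1) (2 ^ g.u) q (X i))
        ((g.cutIter cap (b1 * q.length) q ts w (List.range w)).flatMap chains) cap →
        a'.var .ans < n ∧ Similar (b2 + 1) (2 ^ g.u) q (X (a'.var .ans))) → Q T a') :
    Wp E query a Q := by
  have hW := hB.word
  have h1 := hB.sq_lt
  have h2 := hB.two_lt
  have hS := hB.S_le
  have hfp := hB.fp_le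
  have hcells := hB.cells_le
  have hwcap := hB.w_le
  have hq := hB.q_card_le
  obtain ⟨hinp0, hinp1⟩ := Reads.cons_iff.1 hB.inp
  have hh := hst.header
  have d0 : D 0 = ts.length := hh 0 (by simp)
  have d1 : D 1 = w := hh 1 (by simp)
  have d2 : D 2 = cap := hh 2 (by simp)
  have d3 : D 3 = g.W - g.u := hh 3 (by simp)
  have d4 : D 4 = g.W - g.u - g.v := hh 4 (by simp)
  have d5 : D 5 = 2 ^ g.v - 1 := hh 5 (by simp)
  have d6 : D 6 = b1 := hh 6 (by simp)
  have d7 : D 7 = 2 ^ (2 * g.u) := hh 7 (by simp)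
  have d8 : D 8 = b2 + 1 := hh 8 (by simp)
  have d9 : D 9 = 2 ^ g.u := hh 9 (by simp)
  have d10 : D 10 = 16 + 3 * ts.length := hh 10 (by simp)
  refine Wp.frame (Q := fun T a' => Frame query a a' → Q T a') ?_ fun t a' h hf => h hf
  simp only [query, loadHeader, Wp.seq_iff, Wp.asg_iff, Expr.ok, Expr.val, Store.set_mem, hD, hW,
    d0, d1, d2, d3, d4, d5, d6, d7, d8, d9, d10, true_and, Expr.cost]
  have hv0 : 0 < 2 ^ g.v := by positivity
  have hlt : ∀ i < 16, i < 2 ^ g.W ∧ i < E.S := fun i hi => ⟨by omega, by omega⟩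
  refine ⟨hlt 0 (by norm_num), hlt 1 (by norm_num), hlt 2 (by norm_num), hlt 3 (by norm_num),
    hlt 4 (by norm_num), hlt 5 (by norm_num), hlt 6 (by norm_num), hlt 7 (by norm_num),
    hlt 8 (by norm_num), hlt 9 (by norm_num), hlt 10 (by norm_num), by positivity, ?_⟩
  set a₁ := Store.set _ Var.p 0 with ha₁
  have hR : Ready E g ts q a₁ := by
    refine ⟨hW, by simp [ha₁], by simp [ha₁], by simp [ha₁], by simp [ha₁], by simp [ha₁], ?_, ?_,
      ?_, by simpa [ha₁] using hwcap, by simpa [ha₁] using hB.cap_lt, by omega, hS, ?_,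
      by simpa [ha₁] using hB.b1_lt, hq, hB.three_u, hB.u_pos⟩
    · simpa [ha₁, hD] using hst.coeff
    · simpa [ha₁] using hinp0
    · simpa [ha₁] using hinp1
    · simp [ha₁]; omega
  have w1 : a₁.var .w = w := by simp [ha₁]
  have w2 : a₁.var .cap = cap := by simp [ha₁]
  have w3 : a₁.var .b1 = b1 := by simp [ha₁]
  have w4 : a₁.var .b2 = b2 + 1 := by simp [ha₁]
  have w5 : a₁.var .pw = 2 ^ g.u := by simp [ha₁]
  have w6 : a₁.var .T0 = 16 + 3 * ts.length := by simp [ha₁]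
  have w7 : a₁.mem .data = D := by simp [ha₁, hD]
  clear_value a₁
  refine wp_enumerate hR ?_
  intro T₂ a₂ L hT₂ hf₂ hm₂ hL hhi hhicap hreads
  rw [w1, w2, w3] at hL
  rw [w1, w2] at hT₂
  rw [w2] at hhicap
  have v1 : a₂.var .cap = cap := (hf₂.var .cap rfl).trans w2
  have v2 : a₂.var .b2 = b2 + 1 := (hf₂.var .b2 rfl).trans w4
  have v3 : a₂.var .pw = 2 ^ g.u := (hf₂.var .pw rfl).trans w5
  have v4 : a₂.var .T0 = 16 + 3 * ts.length := (hf₂.var .T0 rfl).trans w6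
  have v5 : a₂.mem .data = D := (hf₂.mem .data rfl).trans w7
  have hLlt : ∀ κ ∈ L, κ < 2 ^ g.v := by
    rw [hL]
    refine Shape.lt_of_mem_cutIter _ _ _ fun κ hκ => ?_
    have := hB.w_le_cells
    simp only [List.mem_range] at hκ; omega
  have hcapS := hB.cap_lt
  rw [← hL] at hQ
  set a₃ := a₂.set .bud (a₂.var .cap) with ha₃
  set P := fun i => i < n ∧ Similar (b2 + 1) (2 ^ g.u) q (X i) with hP
  have hlo₃ : a₃.var .lo = a₂.var .lo := by simp [ha₃]
  -- The cost of the candidates is paid from the common budget; each key adds only a constant for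
  -- the visit of its table cell.
  refine Wp.while_potential (fun r a' => r ≤ L.length ∧ a'.var .lo = a₂.var .lo + (L.length - r) ∧
      Searching P (HasCandidate P (L.flatMap chains) cap)
        ((L.drop (L.length - r)).flatMap chains) a')
    (fun r a' => (60 * ((R + 1) * q.length) + 100) * a'.var .bud + 50 * r) ?_ ?_
    (l := L.length) ?_ ?_
  · intro r a' _ _
    simp only [Expr.ok, Arith.ok, hW, true_and]; omega
  · rintro r a' hf ⟨hr, hlo, hs⟩ hv
    have u1 : a'.var .hi = a₂.var .lo + L.length := by
      rw [hf.var .hi rfl, ← hhi]; simp [ha₃]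
    simp only [Expr.val, Arith.val, hlo, u1, ne_eq, ite_eq_right_iff, one_ne_zero, imp_false,
      not_not] at hv
    have hr' : L.length - r < L.length := by omega
    have u2 : a'.var .T0 = 16 + 3 * ts.length := by rw [hf.var .T0 rfl, ← v4]; simp [ha₃]
    have u3 : a'.mem .data = D := by rw [hf.mem .data rfl, ← v5]; simp [ha₃]
    have u4 : a'.mem .work (a₂.var .lo + (L.length - r)) = L[L.length - r] := by
      rw [hf.mem .work rfl, ← hreads _ hr']; simp [ha₃]
    have u5 := hLlt _ (List.getElem_mem hr')
    have u6 : a'.var .m = q.length := by rw [hf.var .m rfl, ← hm₂]; simp [ha₃]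
    have u7 : a'.var .b2 = b2 + 1 := by rw [hf.var .b2 rfl, ← v2]; simp [ha₃]
    have u8 : a'.var .pw = 2 ^ g.u := by rw [hf.var .pw rfl, ← v3]; simp [ha₃]
    simp only [Wp.seq_iff, Wp.asg_iff, Expr.ok, Expr.val, Arith.ok, Arith.val, hlo, u2, u3, u4,
      hW, true_and]
    refine ⟨⟨⟨by omega, by omega⟩, by omega⟩, ?_⟩
    refine wp_walkChain hB (D := D) (n := n) (H := HasCandidate P (L.flatMap chains) cap)
      (lb := 16 + 3 * ts.length + 2 ^ g.v) (l := chains L[L.length - r])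
      (rest := (L.drop (L.length - (r - 1))).flatMap chains) (by omega) (by simpa using u3)
      (by simpa using u6) (by simpa using u7) (by simpa using u8)
      (by simpa using hst.chain _ u5) (hst.lt_of_mem _ u5) ?_ ?_
    · have e1 : L.length - (r - 1) = L.length - r + 1 := by omega
      rw [List.drop_eq_getElem_cons hr', List.flatMap_cons] at hs
      rw [e1]
      simpa [Searching] using hs
    · intro T' a'' hT' hf' hs'
      have hlo' : a''.var .lo = a₂.var .lo + (L.length - r) :=
        (hf'.var .lo rfl).trans (by simp [hlo])
      simp only [hlo', Store.set_var, reduceCtorEq, if_false] at hT' ⊢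
      refine ⟨⟨by omega, by omega⟩, r - 1, by omega, ⟨by omega, by simp; omega, ?_⟩, ?_⟩
      · simpa [Searching] using hs'
      · simp only [Expr.cost]; omega
  · refine ⟨le_rfl, by simp [ha₃], Or.inr fun h => ?_⟩
    simpa [ha₃, v1] using h
  · rintro r T' a' hf ⟨hr, hlo, hs⟩ hv hT' hF
    have u1 : a'.var .hi = a₂.var .lo + L.length := by
      rw [hf.var .hi rfl, ← hhi]; simp [ha₃]
    have u3 : a'.mem .data = D := by rw [hf.mem .data rfl, ← v5]; simp [ha₃]
    simp only [Expr.val, Arith.val, hlo, u1, ite_eq_right_iff, one_ne_zero, imp_false,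
      not_lt] at hv
    have hbud : a₃.var .bud = cap := by simp [ha₃, v1]
    refine hQ _ _ ?_ u3 fun hH => ?_
    · rw [hbud] at hT'
      simp only [Expr.cost] at hT' ⊢
      have e0 : L.length ≤ cap := by omega
      have e1 : (60 * ((R + 1) * q.length) + 100) * cap =
          60 * ((R + 1) * q.length * cap) + 100 * cap := by ring
      have e2 : (64 * q.length + 24) * cap = 64 * (q.length * cap) + 24 * cap := by ring
      have e3 : 300 * (R + 2) * (q.length + 1) * (cap + 1) =
        300 * ((R + 1) * q.length * cap) + 300 * (q.length * cap) + 300 * (R + 2) * (q.length) +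
          300 * R * cap + 600 * cap + 300 * R + 600 := by ring
      rw [e1] at hT'
      rw [e2] at hT₂
      rw [e3]
      have e4 := Nat.zero_le (300 * (R + 2) * q.length)
      have e5 := Nat.zero_le (300 * R * cap)
      omega
    · rcases hs with h | h
      · exact h.1
      · obtain ⟨j, hj, _⟩ := h hH
        rw [show L.length - r = L.length by omega] at hj
        simp at hj

end Query

/-! ### Analysis of the preprocessing program -/

/-- Powers in fixed point arithmetic with `u` binary digits, rounded down. -/
def fixPow (u b : ℕ) : ℕ → ℕ
  | 0 => 2 ^ u
  | i + 1 => fixPow u b i * b / 2 ^ u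

theorem fixPow_le {u b : ℕ} (hb : b ≤ 2 ^ u) (i : ℕ) : fixPow u b i ≤ 2 ^ u := by
  induction i with
  | zero => exact le_rfl
  | succ i ih =>
    refine Nat.div_le_of_le_mul ?_
    rw [mul_comm]
    exact Nat.mul_le_mul hb ih

/-- The chains after the insertion of the sets `0, …, m - 1` with the lists of keys `L i`. -/
def chainsOf (L : ℕ → List ℕ) : ℕ → ℕ → List ℕ
  | 0, _ => []
  | m + 1, c => List.replicate ((L m).count c) m ++ chainsOf L m c

theorem lt_of_mem_chainsOf {L : ℕ → List ℕ} {m c i : ℕ} (h : i ∈ chainsOf L m c) : i < m := by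
  induction m with
  | zero => simp [chainsOf] at h
  | succ m ih =>
    rcases List.mem_append.1 h with h | h
    · have := List.eq_of_mem_replicate h; omega
    · have := ih h; omega

section Preprocess

variable {E : Env}

theorem wp_computeLevels {a : Store} {u b1 b2 n k : ℕ} (hu : a.var .u = u)
    (hpw : a.var .pw = 2 ^ u) (hb1 : a.var .b1 = b1) (hb2 : a.var .b2 = b2) (hn : a.var .n = n)
    (hb1u : b1 ≤ 2 ^ u) (hb2u : b2 ≤ 2 ^ u) (huW : 2 ^ u * 2 ^ u < 2 ^ E.W)
    (hnW : 2 ^ u * n < 2 ^ E.W) (hk : ∀ i < k, 2 ^ u < fixPow u b2 i * n)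
    (hk' : fixPow u b2 k * n ≤ 2 ^ u) (hkW : k + 1 < 2 ^ E.W) {Q : ℕ → Store → Prop}
    (hQ : ∀ T a', Frame computeLevels a a' → a'.var .k = k → a'.var .y = fixPow u b1 k → Q T a') :
    Wp E computeLevels a Q := by
  have hz : ∀ i, fixPow u b2 i * n < 2 ^ E.W := fun i =>
    (Nat.mul_le_mul_right _ (fixPow_le hb2u i)).trans_lt hnW
  have hzb : ∀ i, fixPow u b2 i * b2 < 2 ^ E.W := fun i =>
    (Nat.mul_le_mul (fixPow_le hb2u i) hb2u).trans_lt huW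
  have hyb : ∀ i, fixPow u b1 i * b1 < 2 ^ E.W := fun i =>
    (Nat.mul_le_mul (fixPow_le hb1u i) hb1u).trans_lt huW
  refine Wp.frame (Q := fun T a' => Frame computeLevels a a' → Q T a') ?_ fun t a' h hf => h hf
  simp only [computeLevels, Wp.seq_iff, Wp.asg_iff, Expr.ok, Expr.val, true_and]
  refine ⟨by omega, ?_⟩
  refine Wp.while_untimed (fun l a' => ∃ i, i + l = k ∧ a'.var .z = fixPow u b2 i ∧
    a'.var .y = fixPow u b1 i ∧ a'.var .k = i) ?_ ?_ ?_ (l := k) ?_ ?_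
  · rintro l a' hf ⟨i, hi, h1, h2, h3⟩
    have e1 : a'.var .n = n := (hf.var .n rfl).trans (by simp [hn])
    simp only [Expr.ok, Arith.ok, Expr.val, h1, e1, true_and]
    exact ⟨hz i, by omega⟩
  · rintro l a' hf ⟨i, hi, h1, h2, h3⟩
    have e1 : a'.var .n = n := (hf.var .n rfl).trans (by simp [hn])
    have e2 : a'.var .pw = 2 ^ u := (hf.var .pw rfl).trans (by simp [hpw])
    simp only [Expr.val, Arith.val, h1, e1, e2, ite_eq_right_iff, one_ne_zero, imp_false, not_lt]
    constructor
    · intro h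
      by_contra hl
      have := hk i (by omega)
      omega
    · rintro rfl
      obtain rfl : i = k := by omega
      exact hk'
  · rintro l a' hf ⟨i, hi, h1, h2, h3⟩
    have e1 : a'.var .u = u := (hf.var .u rfl).trans (by simp [hu])
    have e2 : a'.var .b1 = b1 := (hf.var .b1 rfl).trans (by simp [hb1])
    have e3 : a'.var .b2 = b2 := (hf.var .b2 rfl).trans (by simp [hb2])
    simp only [Wp.seq_iff, Wp.asg_iff, Expr.ok, Expr.val, Arith.ok, Arith.val, Store.set_var,
      reduceCtorEq, if_false, if_true, h1, h2, h3, e1, e2, e3, true_and, and_true]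
    exact ⟨hzb i, hyb i, ⟨by omega, by omega⟩, i + 1, by omega, rfl, rfl, rfl⟩
  · exact ⟨0, by omega, by simp [fixPow, hpw], by simp [fixPow, hpw], by simp⟩
  · rintro T a' hf ⟨i, hi, h1, h2, h3⟩ hF
    obtain rfl : i = k := by omega
    exact hQ _ _ hF h3 h2

theorem wp_computeRatio {a : Store} {y N r : ℕ} (hy : a.var .y = y) (hN : a.var .pw = N)
    (hr : ∀ i < r, i * y < N) (hr' : N ≤ r * y) (hNW : N + y < 2 ^ E.W) (hrW : r + 1 < 2 ^ E.W)
    {Q : ℕ → Store → Prop}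
    (hQ : ∀ T a', Frame computeRatio a a' → a'.var .r = r → Q T a') :
    Wp E computeRatio a Q := by
  have hmul : ∀ i ≤ r, i * y < 2 ^ E.W := by
    intro i hi
    rcases i with _ | i
    · simp
    · have := hr i (by omega)
      rw [Nat.succ_mul]; omega
  refine Wp.frame (Q := fun T a' => Frame computeRatio a a' → Q T a') ?_ fun t a' h hf => h hf
  simp only [computeRatio, Wp.seq_iff, Wp.asg_iff, Expr.ok, Expr.val]
  refine ⟨by omega, ?_⟩
  refine Wp.while_untimed (fun l a' => ∃ i, i + l = r ∧ a'.var .r = i) ?_ ?_ ?_ (l := r) ?_ ?_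
  · rintro l a' hf ⟨i, hi, h1⟩
    have e1 : a'.var .y = y := (hf.var .y rfl).trans (by simp [hy])
    simp only [Expr.ok, Arith.ok, Expr.val, h1, e1, true_and]
    exact ⟨hmul i (by omega), by omega⟩
  · rintro l a' hf ⟨i, hi, h1⟩
    have e1 : a'.var .y = y := (hf.var .y rfl).trans (by simp [hy])
    have e2 : a'.var .pw = N := (hf.var .pw rfl).trans (by simp [hN])
    simp only [Expr.val, Arith.val, h1, e1, e2, ite_eq_right_iff, one_ne_zero, imp_false, not_lt]
    constructor
    · intro h
      by_contra hl
      have := hr i (by omega)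
      omega
    · rintro rfl
      obtain rfl : i = r := by omega
      exact hr'
  · rintro l a' hf ⟨i, hi, h1⟩
    simp only [Wp.asg_iff, Expr.ok, Expr.val, Arith.ok, Arith.val, h1, true_and]
    exact ⟨⟨by omega, by omega⟩, i + 1, by omega, by simp⟩
  · exact ⟨0, by omega, by simp⟩
  · rintro T a' hf ⟨i, hi, h1⟩ hF
    obtain rfl : i = r := by omega
    exact hQ _ _ hF h1

theorem wp_computeTableSize {a : Store} {N n cap v : ℕ} (hn : a.var .n = n)
    (hcap : a.var .cap = cap) (hN : n * cap = N) (hv : ∀ i < v, 2 ^ i < N) (hv' : N ≤ 2 ^ v)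
    (hvW : 2 ^ v < 2 ^ E.W) (hNW : N < 2 ^ E.W) (h1W : 1 < 2 ^ E.W) {Q : ℕ → Store → Prop}
    (hQ : ∀ T a', Frame computeTableSize a a' → a'.var .v = v → a'.var .tb = 2 ^ v → Q T a') :
    Wp E computeTableSize a Q := by
  refine Wp.frame (Q := fun T a' => Frame computeTableSize a a' → Q T a') ?_ fun t a' h hf => h hf
  simp only [computeTableSize, Wp.seq_iff, Wp.asg_iff, Expr.ok, Expr.val]
  refine ⟨by omega, by omega, ?_⟩
  refine Wp.while_untimed (fun l a' => ∃ i, i + l = v ∧ a'.var .v = i ∧ a'.var .tb = 2 ^ i)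
    ?_ ?_ ?_ (l := v) ?_ ?_
  · rintro l a' hf ⟨i, hi, h1, h2⟩
    have e1 : a'.var .n = n := (hf.var .n rfl).trans (by simp [hn])
    have e2 : a'.var .cap = cap := (hf.var .cap rfl).trans (by simp [hcap])
    simp only [Expr.ok, Arith.ok, Expr.val, e1, e2, hN, true_and]
    exact ⟨hNW, h1W⟩
  · rintro l a' hf ⟨i, hi, h1, h2⟩
    have e1 : a'.var .n = n := (hf.var .n rfl).trans (by simp [hn])
    have e2 : a'.var .cap = cap := (hf.var .cap rfl).trans (by simp [hcap])
    simp only [Expr.val, Arith.val, h2, e1, e2, hN, ite_eq_right_iff, one_ne_zero, imp_false,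
      not_lt]
    constructor
    · intro h
      by_contra hl
      have := hv i (by omega)
      omega
    · rintro rfl
      obtain rfl : i = v := by omega
      exact hv'
  · rintro l a' hf ⟨i, hi, h1, h2⟩
    have h3 : 2 ^ i + 2 ^ i ≤ 2 ^ v := by
      rw [← Nat.mul_two, ← pow_succ]; exact Nat.pow_le_pow_right (by norm_num) (by omega)
    have h4 : i < 2 ^ i := Nat.lt_two_pow_self
    simp only [Wp.seq_iff, Wp.asg_iff, Expr.ok, Expr.val, Arith.ok, Arith.val, Store.set_var,
      reduceCtorEq, if_false, h1, h2, true_and]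
    exact ⟨by omega, ⟨by omega, by omega⟩, i + 1, by omega, by simp, by simp [pow_succ]; omega⟩
  · exact ⟨0, by omega, by simp, by simp⟩
  · rintro T a' hf ⟨i, hi, h1, h2⟩ hF
    obtain rfl : i = v := by omega
    exact hQ _ _ hF h1 h2

theorem wp_drawCoefficients {a : Store} {k : ℕ} (hk : a.var .k = k) (hS : 16 + 3 * k ≤ E.S)
    (hSW : E.S ≤ 2 ^ E.W) {Q : ℕ → Store → Prop}
    (hQ : ∀ T a', Frame drawCoefficients a a' →
      (∀ i < 3 * k, a'.mem .data (16 + i) = E.rand (a.used + i)) →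
      (∀ i, ¬ (16 ≤ i ∧ i < 16 + 3 * k) → a'.mem .data i = a.mem .data i) → Q T a') :
    Wp E drawCoefficients a Q := by
  refine Wp.frame (Q := fun T a' => Frame drawCoefficients a a' → Q T a') ?_ fun t a' h hf => h hf
  simp only [drawCoefficients, Wp.seq_iff, Wp.asg_iff, Expr.ok, Expr.val]
  refine ⟨by omega, ?_⟩
  refine Wp.while_untimed (fun l a' => ∃ j, j + l = 3 * k ∧ a'.var .lev = j ∧
    a'.used = a.used + j ∧ (∀ i < j, a'.mem .data (16 + i) = E.rand (a.used + i)) ∧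
      (∀ i, ¬ (16 ≤ i ∧ i < 16 + 3 * k) → a'.mem .data i = a.mem .data i))
    ?_ ?_ ?_ (l := 3 * k) ?_ ?_
  · rintro l a' hf ⟨j, hj, h1, h2, h3, h4⟩
    have e1 : a'.var .k = k := (hf.var .k rfl).trans (by simp [hk])
    simp only [Expr.ok, Arith.ok, Expr.val, e1, true_and]
    omega
  · rintro l a' hf ⟨j, hj, h1, h2, h3, h4⟩
    have e1 : a'.var .k = k := (hf.var .k rfl).trans (by simp [hk])
    simp only [Expr.val, Arith.val, h1, e1, ite_eq_right_iff, one_ne_zero, imp_false, not_lt]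
    omega
  · rintro l a' hf ⟨j, hj, h1, h2, h3, h4⟩
    simp only [Wp.seq_iff, Wp.asg_iff, Wp.sto_iff, Wp.rnd_iff, Expr.ok, Expr.val, Arith.ok,
      Arith.val, Store.set_var, Store.put_var, Store.tick_var, reduceCtorEq, if_false, if_true, h1,
      h2, true_and]
    refine ⟨by omega, by omega, by omega, j + 1, by omega, by simp, by simp [h2]; omega, ?_, ?_⟩
    · intro i hi
      simp only [Store.set_mem, Store.put_mem, Store.tick_mem, true_and]
      split_ifs with h
      · congr 1; omega
      · exact h3 i (by omega)
    · intro i hi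
      simp only [Store.set_mem, Store.put_mem, Store.tick_mem, true_and]
      rw [if_neg (by omega)]
      exact h4 i hi
  · exact ⟨0, by omega, by simp, by simp, by simp, by simp⟩
  · rintro T a' hf ⟨j, hj, h1, h2, h3, h4⟩ hF
    obtain rfl : j = 3 * k := by omega
    exact hQ _ _ hF h3 h4

theorem wp_copySet {a : Store} {fp p : ℕ} {x : List ℕ} (hm : a.var .m = x.length)
    (hfp : a.var .fp = fp) (hp : a.var .p = p) (hread : Reads E.inp p (x.length :: x))
    (hS : fp + x.length + 1 ≤ E.S) (hSW : E.S < 2 ^ E.W) (hpW : p + x.length + 1 < 2 ^ E.W)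
    {Q : ℕ → Store → Prop}
    (hQ : ∀ T a', Frame copySet a a' → a'.var .fp = fp + x.length + 1 →
      Reads (a'.mem .data) fp (x.length :: x) →
      (∀ i < fp, a'.mem .data i = a.mem .data i) → Q T a') :
    Wp E copySet a Q := by
  refine Wp.frame (Q := fun T a' => Frame copySet a a' → Q T a') ?_ fun t a' h hf => h hf
  simp only [copySet, Wp.seq_iff, Wp.asg_iff, Expr.ok, Expr.val]
  refine ⟨by omega, ?_⟩
  refine Wp.while_untimed (fun l a' => ∃ j, j + l = x.length + 1 ∧ a'.var .j = j ∧
    a'.var .fp = fp + j ∧ (∀ i < j, a'.mem .data (fp + i) = E.inp (p + i)) ∧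
      (∀ i < fp, a'.mem .data i = a.mem .data i)) ?_ ?_ ?_ (l := x.length + 1) ?_ ?_
  · rintro l a' hf ⟨j, hj, h1, h2, h3, h4⟩
    have e1 : a'.var .m = x.length := (hf.var .m rfl).trans (by simp [hm])
    simp only [Expr.ok, Arith.ok, Expr.val, e1, true_and]
    omega
  · rintro l a' hf ⟨j, hj, h1, h2, h3, h4⟩
    have e1 : a'.var .m = x.length := (hf.var .m rfl).trans (by simp [hm])
    simp only [Expr.val, Arith.val, h1, e1, ite_eq_right_iff, one_ne_zero, imp_false, not_lt]
    omega
  · rintro l a' hf ⟨j, hj, h1, h2, h3, h4⟩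
    have e1 : a'.var .p = p := (hf.var .p rfl).trans (by simp [hp])
    simp only [Wp.seq_iff, Wp.asg_iff, Wp.sto_iff, Expr.ok, Expr.val, Arith.ok,
      Arith.val, Store.set_var, Store.put_var, reduceCtorEq, if_false, h1, h2, e1, true_and]
    refine ⟨by omega, by omega, by omega, by omega, j + 1, by omega, by simp, by simp; omega,
      ?_, ?_⟩
    · intro i hi
      simp only [Store.set_mem, Store.put_mem, true_and]
      split_ifs with h
      · congr 1; omega
      · exact h3 i (by omega)
    · intro i hi
      simp only [Store.set_mem, Store.put_mem, true_and]
      rw [if_neg (by omega)]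
      exact h4 i hi
  · exact ⟨0, by omega, by simp, by simp [hfp], by simp, by simp⟩
  · rintro T a' hf ⟨j, hj, h1, h2, h3, h4⟩ hF
    obtain rfl : j = x.length + 1 := by omega
    refine hQ _ _ hF (by omega) ?_ h4
    intro i hi
    rw [h3 i (by simpa using hi)]
    exact hread i hi

/-- Push at the front of a linked list: the new entry points to the old head, and the table cell of
its key to the entry. The cells written are one table head, below `T0 + tb`, and three fresh cells,
so all other chains survive. -/
theorem insertEntry_spec {D D₀ D' : ℕ → ℕ} {X chains : ℕ → List ℕ} {l : List ℕ}
    {T0 tb fp i ptr j : ℕ} (hT0 : 0 < T0) (hjl : j < l.length) (hκ : l[j] < tb)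
    (hread : Reads D ptr ((X i).length :: X i)) (h1 : T0 + tb ≤ ptr)
    (h2 : ptr + 1 + (X i).length ≤ fp + 3 * j)
    (hchain : ∀ c < tb, Chain D X (T0 + tb) (fp + 3 * j) (D (T0 + c))
      (List.replicate ((l.take j).count c) i ++ chains c))
    (hlow : ∀ x < T0, D x = D₀ x) (e1 : D' (T0 + l[j]) = fp + 3 * j)
    (e2 : D' (fp + 3 * j) = D (T0 + l[j])) (e3 : D' (fp + 3 * j + 1) = ptr)
    (e4 : D' (fp + 3 * j + 2) = i)
    (e5 : ∀ x, x ≠ T0 + l[j] → (x < fp + 3 * j ∨ fp + 3 * j + 3 ≤ x) → D' x = D x) :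
    (∀ c < tb, Chain D' X (T0 + tb) (fp + 3 * (j + 1)) (D' (T0 + c))
      (List.replicate ((l.take (j + 1)).count c) i ++ chains c)) ∧
    Reads D' ptr ((X i).length :: X i) ∧ ∀ x < T0, D' x = D₀ x := by
  have hread' : Reads D' ptr ((X i).length :: X i) := hread.congr fun x hx => by
    simp only [List.length_cons] at hx
    exact e5 _ (by omega) (by omega)
  refine ⟨fun c hc => ?_, hread', fun x hx => ?_⟩
  · have hold : Chain D' X (T0 + tb) (fp + 3 * (j + 1)) (D (T0 + c))
        (List.replicate ((l.take j).count c) i ++ chains c) :=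
      (hchain c hc).congr (fun x hx1 hx2 => e5 x (by omega) (by omega)) (by omega)
    have htake : l.take (j + 1) = l.take j ++ [l[j]] := by
      rw [List.take_add_one, List.getElem?_eq_getElem hjl]; rfl
    rw [htake, List.count_append]
    by_cases hcκ : c = l[j]
    · subst hcκ
      have : List.count l[j] [l[j]] = 1 := by simp
      rw [this, List.replicate_succ, List.cons_append, e1]
      refine ⟨by omega, by omega, e4, ⟨by rw [e3]; exact h1, by rw [e3]; omega, ?_⟩, ?_⟩
      · rw [e3]; exact hread'
      · rw [e2]; simpa using hold
    · have : List.count c [l[j]] = 0 := by simp [Ne.symm hcκ]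
      rw [this, Nat.add_zero, e5 _ (by omega) (by omega)]
      exact hold
  · rw [e5 x (by omega) (by omega)]; exact hlow x hx

theorem wp_insertKeys {a : Store} {X chains : ℕ → List ℕ} {l : List ℕ} {T0 tb fp i ptr lo : ℕ}
    (hfp : a.var .fp = fp) (hT0 : a.var .T0 = T0) (hptr : a.var .ptr = ptr) (hi : a.var .i = i)
    (hlo : a.var .lo = lo) (hhi : a.var .hi = lo + l.length) (hread : Reads (a.mem .work) lo l)
    (hl : ∀ κ ∈ l, κ < tb) (hT0pos : 0 < T0)
    (hset : T0 + tb ≤ ptr ∧ ptr + 1 + (X i).length ≤ fp ∧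
      Reads (a.mem .data) ptr ((X i).length :: X i))
    (hchain : ∀ c < tb, Chain (a.mem .data) X (T0 + tb) fp (a.mem .data (T0 + c)) (chains c))
    (hS : fp + 3 * l.length ≤ E.S) (hSW : E.S < 2 ^ E.W) (hloS : lo + l.length ≤ E.S)
    {Q : ℕ → Store → Prop}
    (hQ : ∀ T a', Frame insertKeys a a' → a'.var .fp = fp + 3 * l.length →
      (∀ c < tb, Chain (a'.mem .data) X (T0 + tb) (fp + 3 * l.length) (a'.mem .data (T0 + c))
        (List.replicate (l.count c) i ++ chains c)) →
      (∀ i < T0, a'.mem .data i = a.mem .data i) → Q T a') :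
    Wp E insertKeys a Q := by
  refine Wp.frame (Q := fun T a' => Frame insertKeys a a' → Q T a') ?_ fun t a' h hf => h hf
  refine Wp.while_untimed (fun r a' => ∃ j, j + r = l.length ∧ a'.var .lo = lo + j ∧
    a'.var .fp = fp + 3 * j ∧
      (∀ c < tb, Chain (a'.mem .data) X (T0 + tb) (fp + 3 * j) (a'.mem .data (T0 + c))
        (List.replicate ((l.take j).count c) i ++ chains c)) ∧
      Reads (a'.mem .data) ptr ((X i).length :: X i) ∧
      (∀ i < T0, a'.mem .data i = a.mem .data i)) ?_ ?_ ?_ (l := l.length) ?_ ?_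
  · rintro r a' hf ⟨j, hj, h1, h2, h3, h4, h5⟩
    simp only [Expr.ok, Arith.ok, true_and]
    omega
  · rintro r a' hf ⟨j, hj, h1, h2, h3, h4, h5⟩
    have e1 : a'.var .hi = lo + l.length := (hf.var .hi rfl).trans hhi
    simp only [Expr.val, Arith.val, h1, e1, ite_eq_right_iff, one_ne_zero, imp_false, not_lt]
    omega
  · rintro r a' hf ⟨j, hj, h1, h2, h3, h4, h5⟩
    have hjl : j < l.length := by omega
    have e1 : a'.var .T0 = T0 := (hf.var .T0 rfl).trans hT0
    have e2 : a'.var .ptr = ptr := (hf.var .ptr rfl).trans hptr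
    have e3 : a'.var .i = i := (hf.var .i rfl).trans hi
    have e4 : a'.mem .work (lo + j) = l[j] := by rw [hf.mem .work rfl]; exact hread j hjl
    have hκ := hl _ (List.getElem_mem hjl)
    set κ := l[j] with hκdef
    simp only [Wp.seq_iff, Wp.asg_iff, Wp.sto_iff, Expr.ok, Expr.val, Arith.ok,
      Arith.val, Store.set_var, Store.put_var, Store.set_mem, reduceCtorEq, if_false, if_true, h1,
      h2, e1, e2, e3, e4, true_and]
    refine ⟨by omega, by omega, by omega, by omega, by omega, by omega, by omega, by omega,
      by omega, by omega, j + 1, by omega, by omega, by omega, ?_⟩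
    set D := a'.mem .data with hD
    obtain ⟨s1, s2, s3⟩ := hset
    refine insertEntry_spec hT0pos hjl hκ h4 s1 (s2.trans (by omega)) h3 h5 ?_ ?_ ?_ ?_ ?_ <;>
      simp only [Store.set_mem, Store.put_mem, true_and]
    · rw [if_pos (by omega)]
    · rw [if_neg (by omega), if_neg (by omega), if_neg (by omega), if_pos trivial]
      congr 1; omega
    · rw [if_neg (by omega), if_neg (by omega), if_pos trivial]
    · rw [if_neg (by omega), if_pos trivial]
    · intro x hx1 hx2
      rw [if_neg (by omega), if_neg (by omega), if_neg (by omega), if_neg (by omega)]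
  · exact ⟨0, by omega, by simp [hlo], by simp [hfp], by simpa using hchain, hset.2.2, by simp⟩
  · rintro T a' hf ⟨j, hj, h1, h2, h3, h4, h5⟩ hF
    obtain rfl : j = l.length := by omega
    exact hQ _ _ hF h2 (by simpa using h3) h5

end Preprocess

section Preprocess

variable {E : Env}

/-- The keys found for the set `x`. -/
def keysOf (g : Shape) (ts : List (ℕ × ℕ × ℕ)) (w cap b1 : ℕ) (x : List ℕ) : List ℕ :=
  g.cutIter cap (b1 * x.length) x ts w (List.range w)

/-- The input position of set number `i`. -/
def inputPos (X : ℕ → List ℕ) (i : ℕ) : ℕ := 5 + ∑ j ∈ Finset.range i, ((X j).length + 1)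

theorem keysOf_length_le {g : Shape} {ts : List (ℕ × ℕ × ℕ)} {w cap b1 : ℕ} {x : List ℕ}
    (h : w ≤ cap) : (keysOf g ts w cap b1 x).length ≤ cap :=
  Shape.cutIter_length_le _ _ _ (by simpa using h)

/-- In the data memory, `enumerate` reads only the coefficients below `T0`, which insertion never
changes; so all sets are hashed with the same coefficients. -/
theorem wp_insertSets {g : Shape} {ts : List (ℕ × ℕ × ℕ)} {w cap b1 n T0 : ℕ} {X : ℕ → List ℕ}
    {a : Store} (hW : E.W = g.W) (hsh1 : a.var .sh1 = g.W - g.u)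
    (hsh2 : a.var .sh2 = g.W - g.u - g.v) (hmask : a.var .mask = 2 ^ g.v - 1)
    (hlim : a.var .lim = 2 ^ (2 * g.u)) (hk : a.var .k = ts.length) (hb1 : a.var .b1 = b1)
    (hw : a.var .w = w) (hcap : a.var .cap = cap) (hn : a.var .n = n) (hT0 : a.var .T0 = T0)
    (hT0eq : T0 = 16 + 3 * ts.length) (hi : a.var .i = 0) (hp : a.var .p = 5)
    (hfp : a.var .fp = T0 + 2 ^ g.v)
    (hcoeff : ∀ i (h : i < ts.length), a.mem .data (16 + 3 * i) = ts[i].1 ∧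
      a.mem .data (17 + 3 * i) = ts[i].2.1 ∧ a.mem .data (18 + 3 * i) = ts[i].2.2)
    (hzero : ∀ i, T0 ≤ i → a.mem .data i = 0)
    (hinp : ∀ i < n, Reads E.inp (inputPos X i) ((X i).length :: X i))
    (hwcap : w ≤ cap) (hwv : w ≤ 2 ^ g.v) (hcapS : cap < E.S) (hSW : E.S < 2 ^ g.W)
    (hS : T0 + 2 ^ g.v + ∑ i ∈ Finset.range n, ((X i).length + 1 + 3 * cap) ≤ E.S)
    (hpS : inputPos X n < E.S) (hb1u : b1 < 2 ^ g.u) (hcard : ∀ i < n, (X i).length ≤ 2 ^ g.u)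
    (h3u : 3 * g.u ≤ g.W) (hu : 0 < g.u) {Q : ℕ → Store → Prop}
    (hQ : ∀ T a' fp, fp ≤ E.S → (∀ i < T0, a'.mem .data i = a.mem .data i) →
      (∀ c < 2 ^ g.v, Chain (a'.mem .data) X (T0 + 2 ^ g.v) fp (a'.mem .data (T0 + c))
        (chainsOf (fun i => keysOf g ts w cap b1 (X i)) n c)) → Q T a') :
    Wp E insertSets a Q := by
  set L := fun i => keysOf g ts w cap b1 (X i) with hL
  set fpAt := fun i => T0 + 2 ^ g.v + ∑ j ∈ Finset.range i, ((X j).length + 1 + 3 * (L j).length)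
    with hfpAt
  have hLcap : ∀ i, (L i).length ≤ cap := fun i => keysOf_length_le hwcap
  have hfpS : ∀ i ≤ n, fpAt i ≤ E.S := by
    intro i hi
    refine le_trans ?_ hS
    refine Nat.add_le_add_left ?_ _
    calc ∑ j ∈ Finset.range i, ((X j).length + 1 + 3 * (L j).length)
        ≤ ∑ j ∈ Finset.range i, ((X j).length + 1 + 3 * cap) :=
          Finset.sum_le_sum fun j _ => by have := hLcap j; omega
      _ ≤ _ := Finset.sum_le_sum_of_subset (Finset.range_subset_range.2 hi)
  have hpos : ∀ i ≤ n, inputPos X i ≤ inputPos X n := fun i hi =>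
    Nat.add_le_add_left (Finset.sum_le_sum_of_subset (Finset.range_subset_range.2 hi)) _
  have h1W : 1 < 2 ^ g.W := Nat.one_lt_two_pow (by omega)
  refine Wp.while_untimed (fun l a' => ∃ i, i + l = n ∧ a'.var .i = i ∧
    a'.var .p = inputPos X i ∧ a'.var .fp = fpAt i ∧ (∀ x < T0, a'.mem .data x = a.mem .data x) ∧
    ∀ c < 2 ^ g.v, Chain (a'.mem .data) X (T0 + 2 ^ g.v) (fpAt i) (a'.mem .data (T0 + c))
      (chainsOf L i c)) ?_ ?_ ?_ (l := n) ?_ ?_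
  · rintro l a' hf ⟨i, hi, h1, h2, h3, h4, h5⟩
    simp only [Expr.ok, Arith.ok, hW, true_and]; exact h1W
  · rintro l a' hf ⟨i, hi, h1, h2, h3, h4, h5⟩
    have e1 : a'.var .n = n := (hf.var .n rfl).trans hn
    simp only [Expr.val, Arith.val, h1, e1, ite_eq_right_iff, one_ne_zero, imp_false, not_lt]
    omega
  · rintro l a' hf ⟨i, hi, h1, h2, h3, h4, h5⟩
    have hin : i < n := by omega
    have hreadi := hinp i hin
    obtain ⟨hri, hre⟩ := Reads.cons_iff.1 hreadi
    have hpi : inputPos X (i + 1) = inputPos X i + ((X i).length + 1) := by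
      rw [inputPos, inputPos, Finset.sum_range_succ, add_assoc]
    have hfi : fpAt (i + 1) = fpAt i + ((X i).length + 1 + 3 * (L i).length) := by
      simp only [hfpAt]; rw [Finset.sum_range_succ]; omega
    have hpn := hpos (i + 1) hin
    have hfn := hfpS (i + 1) hin
    have hfge : T0 + 2 ^ g.v ≤ fpAt i := Nat.le_add_right _ _
    simp only [Wp.seq_iff, Wp.asg_iff, Expr.ok, Expr.val, h3, true_and]
    set a₁ := a'.set .ptr (fpAt i) with ha₁
    have hR : Ready E g ts (X i) a₁ := by
      refine ⟨hW, ?_, ?_, ?_, ?_, ?_, ?_, ?_, ?_, ?_, ?_, by omega, hSW.le, ?_, ?_, hcard i hin,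
        h3u, hu⟩ <;> simp only [ha₁, Store.set_var, reduceCtorEq, if_false, Store.set_mem]
      · exact (hf.var .sh1 rfl).trans hsh1
      · exact (hf.var .sh2 rfl).trans hsh2
      · exact (hf.var .mask rfl).trans hmask
      · exact (hf.var .lim rfl).trans hlim
      · exact (hf.var .k rfl).trans hk
      · intro j hj
        rw [h4 _ (by omega), h4 _ (by omega), h4 _ (by omega)]
        exact hcoeff j hj
      · rw [h2]; exact hri
      · rw [h2]; exact hre
      · rw [hf.var .w rfl, hf.var .cap rfl, hw, hcap]; exact hwcap
      · rw [hf.var .cap rfl, hcap]; exact hcapS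
      · rw [h2]; omega
      · rw [hf.var .b1 rfl, hb1]; exact hb1u
    refine wp_enumerate hR ?_
    intro T₂ a₂ l₂ _ hf₂ hm₂ hl₂ hhi₂ hcap₂ hread₂
    have w1 : a₁.var .cap = cap := by
      simp only [ha₁, Store.set_var, reduceCtorEq, if_false]; exact (hf.var .cap rfl).trans hcap
    have w2 : a₁.var .w = w := by
      simp only [ha₁, Store.set_var, reduceCtorEq, if_false]; exact (hf.var .w rfl).trans hw
    have w3 : a₁.var .b1 = b1 := by
      simp only [ha₁, Store.set_var, reduceCtorEq, if_false]; exact (hf.var .b1 rfl).trans hb1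
    rw [w1, w2, w3] at hl₂
    replace hl₂ : l₂ = L i := hl₂
    subst hl₂
    rw [w1] at hcap₂
    have v1 : a₂.var .fp = fpAt i := (hf₂.var .fp rfl).trans (by simp [ha₁, h3])
    have v2 : a₂.var .p = inputPos X i := (hf₂.var .p rfl).trans (by simp [ha₁, h2])
    have v3 : a₂.mem .data = a'.mem .data := (hf₂.mem .data rfl).trans (by simp [ha₁])
    refine wp_copySet hm₂ v1 v2 hreadi (by omega) (by rw [hW]; exact hSW)
      (by rw [hW]; omega) ?_
    intro T₃ a₃ hf₃ hfp₃ hread₃ hmem₃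
    have u1 : a₃.var .T0 = T0 := by
      rw [hf₃.var .T0 rfl, hf₂.var .T0 rfl, ← hT0, ← hf.var .T0 rfl]; simp [ha₁]
    have u2 : a₃.var .ptr = fpAt i := by
      rw [hf₃.var .ptr rfl, hf₂.var .ptr rfl]; simp [ha₁]
    have u3 : a₃.var .i = i := by
      rw [hf₃.var .i rfl, hf₂.var .i rfl]; simp [ha₁, h1]
    have u4 : a₃.var .lo = a₂.var .lo := hf₃.var .lo rfl
    have u5 : a₃.var .hi = a₂.var .lo + (L i).length := (hf₃.var .hi rfl).trans hhi₂
    have u6 : a₃.mem .work = a₂.mem .work := hf₃.mem .work rfl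
    have u7 : a₃.var .p = inputPos X i := (hf₃.var .p rfl).trans v2
    have u8 : a₃.var .m = (X i).length := (hf₃.var .m rfl).trans hm₂
    refine wp_insertKeys (X := X) (chains := chainsOf L i) (l := L i) (tb := 2 ^ g.v) hfp₃ u1 u2 u3
      u4 u5 (by rw [u6]; exact hread₂) ?_ (by omega) ⟨hfge, by omega, hread₃⟩ ?_ (by omega)
      (by rw [hW]; exact hSW) (by omega) ?_
    · exact Shape.lt_of_mem_cutIter _ _ _ fun κ hκ => by
        simp only [List.mem_range] at hκ; omega
    · intro c hc
      rw [hmem₃ _ (by omega), v3]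
      refine (h5 c hc).congr (fun x hx1 hx2 => ?_) (by omega)
      rw [hmem₃ _ hx2, v3]
    · intro T₄ a₄ hf₄ hfp₄ hch₄ hmem₄
      have x1 : a₄.var .p = inputPos X i := (hf₄.var .p rfl).trans u7
      have x2 : a₄.var .m = (X i).length := (hf₄.var .m rfl).trans u8
      have x3 : a₄.var .i = i := (hf₄.var .i rfl).trans u3
      simp only [Arith.ok, Arith.val, x1, x2, x3, hW, Store.set_var,
        reduceCtorEq, if_false]
      have hin' : i ≤ fpAt i := by
        refine le_trans ?_ (Nat.le_add_left _ _)
        calc i = ∑ j ∈ Finset.range i, 1 := by simp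
          _ ≤ _ := Finset.sum_le_sum fun j _ => by omega
      refine ⟨by omega, by omega, i + 1, by omega, by simp,
        by simp [hpi]; omega, by simp [hfp₄, hfi]; omega, ?_, ?_⟩
      · intro x hx
        simp only [Store.set_mem]
        rw [hmem₄ x hx, hmem₃ x (by omega), v3, h4 x hx]
      · intro c hc
        simp only [Store.set_mem]
        have := hch₄ c hc
        rw [hfi]
        rw [show fpAt i + ((X i).length + 1 + 3 * (L i).length) =
          fpAt i + (X i).length + 1 + 3 * (L i).length by omega]
        exact this
  · refine ⟨0, by omega, hi, by simp [hp, inputPos], by simp [hfp, hfpAt], by simp, ?_⟩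
    intro c hc
    -- Untouched memory is zero, and zero is the null pointer: every chain starts empty.
    exact hzero _ (by omega)
  · rintro T a' hf ⟨i, hi, h1, h2, h3, h4, h5⟩
    obtain rfl : i = n := by omega
    exact hQ _ _ _ (hfpS i le_rfl) h4 h5

/-- Storing the header. -/
theorem wp_storeHeader {a : Store} (hS : 16 ≤ E.S) (hW : E.S ≤ 2 ^ E.W)
    (hb2 : a.var .b2 + 1 < 2 ^ E.W) {Q : ℕ → Store → Prop}
    (hQ : ∀ T a', Frame storeHeader a a' → a'.used = a.used →
      Reads (a'.mem .data) 0 [a.var .k, a.var .w, a.var .cap, a.var .sh1, a.var .sh2, a.var .mask,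
        a.var .b1, a.var .lim, a.var .b2 + 1, a.var .pw, a.var .T0] →
      (∀ i, 16 ≤ i → a'.mem .data i = a.mem .data i) → Q T a') :
    Wp E storeHeader a Q := by
  refine Wp.frame (Q := fun T a' => Frame storeHeader a a' → Q T a') ?_ fun t a' h hf => h hf
  simp only [storeHeader, Wp.seq_iff, Wp.sto_iff, Expr.ok, Expr.val, Arith.ok, Arith.val,
    Store.put_var, true_and]
  refine ⟨by omega, by omega, by omega, by omega, by omega, by omega, by omega, by omega, by omega,
    by omega, by omega, by omega, by omega, by omega, by omega, by omega, by omega, by omega,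
    by omega, by omega, by omega, by omega, by omega, ?_⟩
  intro hf
  refine hQ _ _ hf rfl ?_ ?_
  · simp only [Reads.cons_iff, Store.put_mem, zero_add, true_and]
    norm_num
    exact Reads.nil
  · intro i hi
    simp only [Store.put_mem, true_and]
    repeat rw [if_neg (by omega)]

/-- The parameters computed by the preprocessing, and the conditions under which it works. -/
structure Parameters (E : Env) (g : Shape) (K n k r w cap b1 b2 : ℕ) (X : ℕ → List ℕ) : Prop where
  word : E.W = g.W
  u_eq : g.u = g.W / 4
  u_pos : 0 < g.u
  inp_n : E.inp 0 = n
  inp_W : E.inp 2 = g.W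
  inp_b1 : E.inp 3 / 2 ^ (g.W - g.u) = b1
  inp_b2 : E.inp 4 / 2 ^ (g.W - g.u) = b2
  inp_sets : ∀ i < n, Reads E.inp (inputPos X i) ((X i).length :: X i)
  b1_lt : b1 < 2 ^ g.u
  b2_lt : b2 < 2 ^ g.u
  n_lt : n ≤ 2 ^ g.u
  k_min : ∀ i < k, 2 ^ g.u < fixPow g.u b2 i * n
  k_spec : fixPow g.u b2 k * n ≤ 2 ^ g.u
  r_min : ∀ i < r, i * fixPow g.u b1 k < 2 ^ g.u
  r_spec : 2 ^ g.u ≤ r * fixPow g.u b1 k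
  w_eq : w = 16 * k
  cap_eq : cap = K * (w * r)
  w_le : w ≤ cap
  r_le : r ≤ cap
  K_le : K ≤ cap
  v_min : ∀ i < g.v, 2 ^ i < n * cap
  v_spec : n * cap ≤ 2 ^ g.v
  v_le : g.v ≤ g.u
  cap_le : cap ≤ n * cap
  k_le : 16 * k ≤ cap
  cap_lt : cap < E.S
  S_lt : E.S < 2 ^ g.W
  S_ge : 16 + 3 * k + 2 ^ g.v + ∑ i ∈ Finset.range n, ((X i).length + 1 + 3 * cap) ≤ E.S
  pos_lt : inputPos X n < E.S
  card_le : ∀ i < n, (X i).length ≤ 2 ^ g.u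

/-- The triples of random words that the preprocessing uses as coefficients. -/
def coefficients (rand : ℕ → ℕ) (k : ℕ) : List (ℕ × ℕ × ℕ) :=
  (List.range k).map fun i => (rand (3 * i), rand (3 * i + 1), rand (3 * i + 2))

/-- The preprocessing builds the data structure. -/
theorem wp_preprocess {g : Shape} {K n k r w cap b1 b2 : ℕ} {X : ℕ → List ℕ}
    (h : Parameters E g K n k r w cap b1 b2 X) {a : Store} (hD : ∀ i, a.mem .data i = 0)
    (hused : a.used = 0) {Q : ℕ → Store → Prop}
    (hQ : ∀ T a' fp, fp ≤ E.S →
      Stored g (coefficients E.rand k) w cap b1 b2 n X fp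
        (chainsOf (fun i => keysOf g (coefficients E.rand k) w cap b1 (X i)) n) (a'.mem .data) →
      Q T a') :
    Wp E (preprocess K) a Q := by
  obtain ⟨hW, hueq, hu, i0, i2, i3, i4, hsets, hb1, hb2, hn, hk, hk', hr, hr', hw, hcap, hwcap,
    hrcap, hKcap, hv, hv', hvu, hcapn, hkcap, hcapS, hSW, hS, hpS, hcard⟩ := h
  have h4u : 4 * g.u ≤ g.W := by omega
  have p1 : 2 ^ g.u * 2 ^ g.u < 2 ^ g.W := by
    rw [← pow_add]; exact Nat.pow_lt_pow_right (by norm_num) (by omega)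
  have p2 : 2 ^ g.u * n ≤ 2 ^ g.u * 2 ^ g.u := Nat.mul_le_mul_left _ hn
  have p3 : 2 ^ g.v ≤ 2 ^ g.u := Nat.pow_le_pow_right (by norm_num) hvu
  have p4 : 2 ≤ 2 ^ g.u := by
    calc 2 = 2 ^ 1 := rfl
      _ ≤ 2 ^ g.u := Nat.pow_le_pow_right (by norm_num) hu
  have p5 : 2 ^ g.u * 2 ≤ 2 ^ g.u * 2 ^ g.u := Nat.mul_le_mul_left _ p4
  have p6 : g.W < 2 ^ g.W := Nat.lt_two_pow_self
  have p7 := fixPow_le hb1.le k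
  have p8 : 0 < 2 ^ g.v := by positivity
  have p9 : w * r ≤ cap := by
    rcases Nat.eq_zero_or_pos K with h0 | h0
    · have : cap = 0 := by simp [hcap, h0]
      have : w = 0 := by omega
      simp [this]
    · rw [hcap]; exact Nat.le_mul_of_pos_left _ h0
  set D₀ := a.mem .data with hD₀
  have hlt : ∀ i < 16, i < 2 ^ g.W ∧ i < E.S := fun i hi => ⟨by omega, by omega⟩
  have q0 := hlt 0 (by norm_num)
  have q1 := hlt 1 (by norm_num)
  have q2 := hlt 2 (by norm_num)
  have q3 := hlt 3 (by norm_num)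
  have q4 := hlt 4 (by norm_num)
  have q5 := hlt 5 (by norm_num)
  have q6 := hlt 6 (by norm_num)
  have q7 := hlt 7 (by norm_num)
  have q8 := hlt 8 (by norm_num)
  have q9 := hlt 9 (by norm_num)
  have q10 := hlt 10 (by norm_num)
  have q16 : 16 < 2 ^ g.W := by omega
  have hu4 : g.W / 2 ^ 2 = g.u := by rw [hueq]; norm_num
  rw [preprocess]
  simp only [readParameters, Wp.seq_iff, Wp.asg_iff, Expr.ok, Expr.val, Arith.ok, Arith.val,
    Store.set_var, reduceCtorEq, if_false, if_true, hW, i0, i2, hu4, i3, i4, one_mul, true_and,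
    and_true, q0.1, q1.1, q2.1, q3.1, q4.1]
  refine ⟨by omega, by omega, p1, ?_⟩
  set a₁ := Store.set _ Var.b2 b2 with ha₁
  have s1 : a₁.var .n = n := by simp [ha₁]
  have s2 : a₁.var .u = g.u := by simp [ha₁]
  have s3 : a₁.var .sh1 = g.W - g.u := by simp [ha₁]
  have s4 : a₁.var .pw = 2 ^ g.u := by simp [ha₁]
  have s5 : a₁.var .lim = 2 ^ g.u * 2 ^ g.u := by simp [ha₁]
  have s6 : a₁.var .b1 = b1 := by simp [ha₁]
  have s7 : a₁.var .b2 = b2 := by simp [ha₁]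
  have s8 : a₁.mem .data = D₀ := by simp [ha₁, hD₀]
  have s9 : a₁.used = 0 := by simp [ha₁, hused]
  clear_value a₁
  refine wp_computeLevels (u := g.u) s2 s4 s6 s7 s1 hb1.le hb2.le (by rw [hW]; exact p1)
    (by rw [hW]; omega) hk hk' (by rw [hW]; omega) ?_
  intro _ a₂ f₂ k₂ y₂
  refine wp_computeRatio (N := 2 ^ g.u) (r := r) y₂ ((f₂.var .pw rfl).trans s4) hr hr'
    (by rw [hW]; omega) (by rw [hW]; omega) ?_
  intro _ a₃ f₃ r₃
  have k₃ : a₃.var .k = k := (f₃.var .k rfl).trans k₂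
  simp only [k₃, r₃, ← hw, ← hcap]
  refine ⟨by omega, by omega, ?_⟩
  set a₄ := (a₃.set Var.w w).set Var.cap cap with ha₄
  have n₄ : a₄.var .n = n := by
    simp only [ha₄, Store.set_var, reduceCtorEq, if_false]
    rw [f₃.var .n rfl, f₂.var .n rfl, s1]
  refine wp_computeTableSize (v := g.v) n₄ (cap := cap) (by simp [ha₄]) rfl hv hv'
    (by rw [hW]; omega) (by rw [hW]; omega) (by rw [hW]; omega) ?_
  intro _ a₅ f₅ v₅ tb₅
  have sh₅ : a₅.var .sh1 = g.W - g.u := by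
    rw [f₅.var .sh1 rfl]
    simp only [ha₄, Store.set_var, reduceCtorEq, if_false]
    rw [f₃.var .sh1 rfl, f₂.var .sh1 rfl, s3]
  have k₅ : a₅.var .k = k := by
    rw [f₅.var .k rfl]; simp [ha₄, k₃]
  simp only [v₅, tb₅, sh₅, k₅]
  refine ⟨by omega, by omega, by omega, ?_⟩
  set a₆ := ((a₅.set Var.sh2 (g.W - g.u - g.v)).set Var.mask (2 ^ g.v - 1)).set Var.T0
    (16 + 3 * k) with ha₆
  have data₆ : a₆.mem .data = D₀ := by
    simp only [ha₆, Store.set_mem]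
    rw [f₅.mem .data rfl]
    simp only [ha₄, Store.set_mem]
    rw [f₃.mem .data rfl, f₂.mem .data rfl, s8]
  have used₆ : a₆.used = 0 := by
    simp only [ha₆, Store.set_used]
    rw [f₅.used rfl]
    simp only [ha₄, Store.set_used]
    rw [f₃.used rfl, f₂.used rfl, s9]
  have b1₆ : a₆.var .b1 = b1 := by
    simp only [ha₆, Store.set_var, reduceCtorEq, if_false]
    rw [f₅.var .b1 rfl]
    simp only [ha₄, Store.set_var, reduceCtorEq, if_false]
    rw [f₃.var .b1 rfl, f₂.var .b1 rfl, s6]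
  have b2₆ : a₆.var .b2 = b2 := by
    simp only [ha₆, Store.set_var, reduceCtorEq, if_false]
    rw [f₅.var .b2 rfl]
    simp only [ha₄, Store.set_var, reduceCtorEq, if_false]
    rw [f₃.var .b2 rfl, f₂.var .b2 rfl, s7]
  have pw₆ : a₆.var .pw = 2 ^ g.u := by
    simp only [ha₆, Store.set_var, reduceCtorEq, if_false]
    rw [f₅.var .pw rfl]
    simp only [ha₄, Store.set_var, reduceCtorEq, if_false]
    rw [f₃.var .pw rfl, f₂.var .pw rfl, s4]
  have lim₆ : a₆.var .lim = 2 ^ (2 * g.u) := by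
    simp only [ha₆, Store.set_var, reduceCtorEq, if_false]
    rw [f₅.var .lim rfl]
    simp only [ha₄, Store.set_var, reduceCtorEq, if_false]
    rw [f₃.var .lim rfl, f₂.var .lim rfl, s5, two_mul, pow_add]
  have n₆ : a₆.var .n = n := by
    simp only [ha₆, Store.set_var, reduceCtorEq, if_false]
    rw [f₅.var .n rfl, n₄]
  have w₆ : a₆.var .w = w := by
    simp only [ha₆, Store.set_var, reduceCtorEq, if_false]
    rw [f₅.var .w rfl]; simp [ha₄]
  have cap₆ : a₆.var .cap = cap := by
    simp only [ha₆, Store.set_var, reduceCtorEq, if_false]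
    rw [f₅.var .cap rfl]; simp [ha₄]
  have k₆ : a₆.var .k = k := by simp [ha₆, k₅]
  have sh1₆ : a₆.var .sh1 = g.W - g.u := by simp [ha₆, sh₅]
  have sh2₆ : a₆.var .sh2 = g.W - g.u - g.v := by simp [ha₆]
  have mask₆ : a₆.var .mask = 2 ^ g.v - 1 := by simp [ha₆]
  have T0₆ : a₆.var .T0 = 16 + 3 * k := by simp [ha₆]
  have tb₆ : a₆.var .tb = 2 ^ g.v := by simp [ha₆, tb₅]
  clear_value a₆
  refine wp_storeHeader (by omega) (by rw [hW]; exact hSW.le) (by rw [hW, b2₆]; omega) ?_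
  intro _ a₇ f₇ used₇ head₇ mem₇
  rw [k₆, w₆, cap₆, sh1₆, sh2₆, mask₆, b1₆, lim₆, b2₆, pw₆, T0₆] at head₇
  refine wp_drawCoefficients ((f₇.var .k rfl).trans k₆) (by omega) (by rw [hW]; exact hSW.le) ?_
  intro _ a₈ f₈ draw₈ mem₈
  rw [used₇, used₆] at draw₈
  simp only [zero_add] at draw₈
  have T0₈ : a₈.var .T0 = 16 + 3 * k := by rw [f₈.var .T0 rfl, f₇.var .T0 rfl, T0₆]
  have tb₈ : a₈.var .tb = 2 ^ g.v := by rw [f₈.var .tb rfl, f₇.var .tb rfl, tb₆]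
  simp only [T0₈, tb₈]
  refine ⟨by omega, by omega, ?_⟩
  have hlen : (coefficients E.rand k).length = k := by simp [coefficients]
  have hcoeff : ∀ i (h : i < (coefficients E.rand k).length),
      a₈.mem .data (16 + 3 * i) = (coefficients E.rand k)[i].1 ∧
      a₈.mem .data (17 + 3 * i) = (coefficients E.rand k)[i].2.1 ∧
      a₈.mem .data (18 + 3 * i) = (coefficients E.rand k)[i].2.2 := by
    intro i hi
    have hik : i < k := by omega
    simp only [coefficients, List.getElem_map, List.getElem_range]
    refine ⟨draw₈ (3 * i) (by omega), ?_, ?_⟩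
    · rw [← draw₈ (3 * i + 1) (by omega)]; congr 1; omega
    · rw [← draw₈ (3 * i + 2) (by omega)]; congr 1; omega
  have hzero : ∀ i, 16 + 3 * k ≤ i → a₈.mem .data i = 0 := by
    intro i hi
    rw [mem₈ i (by omega), mem₇ i (by omega), data₆, hD]
  refine wp_insertSets (g := g) (ts := coefficients E.rand k) (w := w) (cap := cap) (b1 := b1)
    (n := n) (T0 := 16 + 3 * k) (X := X) hW ?_ ?_ ?_ ?_ ?_ ?_ ?_ ?_ ?_ ?_ (by rw [hlen]) ?_ ?_ ?_ ?_
    ?_ hsets hwcap (by omega) hcapS hSW hS hpS hb1 hcard (by omega) hu ?_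
  any_goals simp only [Store.set_var, reduceCtorEq, if_false, if_true, Store.set_mem]
  · rw [f₈.var .sh1 rfl, f₇.var .sh1 rfl, sh1₆]
  · rw [f₈.var .sh2 rfl, f₇.var .sh2 rfl, sh2₆]
  · rw [f₈.var .mask rfl, f₇.var .mask rfl, mask₆]
  · rw [f₈.var .lim rfl, f₇.var .lim rfl, lim₆]
  · rw [f₈.var .k rfl, f₇.var .k rfl, k₆, hlen]
  · rw [f₈.var .b1 rfl, f₇.var .b1 rfl, b1₆]
  · rw [f₈.var .w rfl, f₇.var .w rfl, w₆]
  · rw [f₈.var .cap rfl, f₇.var .cap rfl, cap₆]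
  · rw [f₈.var .n rfl, f₇.var .n rfl, n₆]
  · exact T0₈
  · exact hcoeff
  · exact hzero
  · intro T a' fp hfp hlow hchain
    refine hQ _ _ fp hfp ⟨?_, ?_, ?_, fun c _ i hi => lt_of_mem_chainsOf hi⟩
    · rw [hlen]
      refine head₇.congr fun i hi => ?_
      simp only [List.length_cons, List.length_nil] at hi
      rw [hlow _ (by omega)]
      exact mem₈ _ (by omega)
    · intro i hi
      have := hcoeff i hi
      rw [hlow _ (by omega), hlow _ (by omega), hlow _ (by omega)]
      exact this
    · rw [hlen]; exact hchain

end Preprocess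

/-! ### Multiply-shift hashing -/

/-- All triples of words. -/
def triples (W : ℕ) : Finset (ℕ × ℕ × ℕ) :=
  Finset.range (2 ^ W) ×ˢ Finset.range (2 ^ W) ×ˢ Finset.range (2 ^ W)

theorem card_triples (W : ℕ) : (triples W).card = (2 ^ W) ^ 3 := by
  simp [triples, pow_succ, mul_assoc]

theorem triples_nonempty (W : ℕ) : (triples W).Nonempty := by
  rw [← Finset.card_pos, card_triples]; positivity

theorem sum_range_eq_sum_zmod {N : ℕ} [NeZero N] (f : ℕ → ℝ) :
    ∑ a ∈ Finset.range N, f a = ∑ z : ZMod N, f z.val := by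
  symm
  refine Finset.sum_nbij (fun z => z.val) (fun z _ => Finset.mem_range.2 z.val_lt)
    (fun z _ z' _ h => ZMod.val_injective N h) ?_ fun _ _ => rfl
  intro a ha
  exact ⟨a, by simp, ZMod.val_cast_of_lt (by simpa using ha)⟩

/-- Sums over words become sums over a finite abelian group, where they are invariant under
translations. -/
theorem sum_triples {W : ℕ} (f : ℕ × ℕ × ℕ → ℝ) :
    ∑ t ∈ triples W, f t =
      ∑ z : ZMod (2 ^ W) × ZMod (2 ^ W) × ZMod (2 ^ W), f (z.1.val, z.2.1.val, z.2.2.val) := by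
  simp only [triples, Finset.sum_product, Fintype.sum_prod_type]
  rw [sum_range_eq_sum_zmod (N := 2 ^ W) fun a =>
    ∑ b ∈ Finset.range (2 ^ W), ∑ c ∈ Finset.range (2 ^ W), f (a, b, c)]
  refine Finset.sum_congr rfl fun a _ => ?_
  rw [sum_range_eq_sum_zmod (N := 2 ^ W) fun b => ∑ c ∈ Finset.range (2 ^ W), f (a.val, b, c)]
  refine Finset.sum_congr rfl fun b _ => ?_
  exact sum_range_eq_sum_zmod (N := 2 ^ W) _

/-- If a translation of the probability space adds `1` to `Q` and does not change `R`, then `Q` is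
uniformly distributed and independent of `R`. -/
theorem sum_eq_of_translation {G α : Type*} [AddCommGroup G] [Fintype G] {M : ℕ} [NeZero M]
    (Q : G → ZMod M) (R : G → α) (δ : G) (hQ : ∀ t, Q (t + δ) = Q t + 1)
    (hR : ∀ t, R (t + δ) = R t) (F : α → ZMod M → ℝ) :
    M * ∑ t, F (R t) (Q t) = ∑ t, ∑ β, F (R t) β := by
  -- Translating `m` times replaces `Q` by `Q + m`; summing over all residues `m` makes `Q` uniform
  -- while `R` stays fixed.
  have key : ∀ m : ℕ, ∑ t, F (R t) (Q t + m) = ∑ t, F (R t) (Q t) := by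
    intro m
    induction m with
    | zero => simp
    | succ m ih =>
      rw [← ih]
      conv_rhs => rw [← Equiv.sum_comp (Equiv.addRight δ)]
      refine Finset.sum_congr rfl fun t _ => ?_
      simp only [Equiv.coe_addRight, hQ, hR]
      congr 1; push_cast; ring
  have h2 : ∑ m : ZMod M, ∑ t, F (R t) (Q t + m) = M * ∑ t, F (R t) (Q t) := by
    rw [Finset.sum_congr rfl (g := fun _ => ∑ t, F (R t) (Q t))]
    · simp [ZMod.card]
    · intro m _
      rw [← key m.val]; simp
  rw [← h2, Finset.sum_comm]
  refine Finset.sum_congr rfl fun t _ => ?_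
  exact Equiv.sum_comp (Equiv.addLeft (Q t)) _

/-- The leading `s` bits of a word. -/
def topBits (W s : ℕ) (z : ZMod (2 ^ W)) : ZMod (2 ^ s) :=
  ((z.val / 2 ^ (W - s) : ℕ) : ZMod (2 ^ s))

/-- Adding `2 ^ (W - s)` leaves the lower bits alone, and wrapping around modulo `2 ^ W` becomes
wrapping around modulo `2 ^ s` in the leading bits. -/
theorem topBits_add {W s : ℕ} (hs : s ≤ W) (z : ZMod (2 ^ W)) :
    topBits W s (z + (2 ^ (W - s) : ℕ)) = topBits W s z + 1 := by
  have h (x : ℕ) : x % 2 ^ W / 2 ^ (W - s) = x / 2 ^ (W - s) % 2 ^ s := by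
    have hW : 2 ^ W = 2 ^ (W - s) * 2 ^ s := by rw [← pow_add]; congr 1; omega
    rw [hW, Nat.mod_mul_right_div_self]
  rw [topBits, topBits, ZMod.val_add, ZMod.val_natCast, Nat.add_mod_mod, h,
    Nat.add_div_right _ (by positivity)]
  simp

theorem val_topBits {W s : ℕ} (hs : s ≤ W) (z : ZMod (2 ^ W)) :
    (topBits W s z).val = z.val / 2 ^ (W - s) := by
  have hW : 2 ^ W = 2 ^ (W - s) * 2 ^ s := by rw [← pow_add]; congr 1; omega
  rw [topBits, ZMod.val_natCast, Nat.mod_eq_of_lt]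
  rw [Nat.div_lt_iff_lt_mul (by positivity), mul_comm, ← hW]
  exact z.val_lt

/-- The linear functions used for hashing. -/
def linear {W : ℕ} (z : ZMod (2 ^ W) × ZMod (2 ^ W) × ZMod (2 ^ W)) (κ j : ℕ) : ZMod (2 ^ W) :=
  z.1 * κ + z.2.1 * j + z.2.2

/-- A number with at most `e` bits divides `2 ^ e` modulo powers of two. -/
theorem exists_mul_sub_eq {W e x y : ℕ} (hx : x < 2 ^ e) (hy : y < 2 ^ e) (hxy : x ≠ y) :
    ∃ a : ZMod (2 ^ W), a * ((y : ZMod (2 ^ W)) - x) = (2 ^ e : ℕ) := by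
  wlog h : x < y generalizing x y
  · obtain ⟨a, ha⟩ := this hy hx hxy.symm (by omega)
    exact ⟨-a, by rw [← ha]; ring⟩
  -- The difference is `2 ^ f` times an odd number, where `f ≤ e` by size, and the odd factor is
  -- invertible modulo `2 ^ W`.
  obtain ⟨f, m, hm, hd⟩ := Nat.exists_eq_two_pow_mul_odd (n := y - x) (by omega)
  have hf : f ≤ e := by
    by_contra! hc
    have h1 : 2 ^ e ≤ 2 ^ f := Nat.pow_le_pow_right (by norm_num) hc.le
    have h2 : 2 ^ f ≤ 2 ^ f * m := Nat.le_mul_of_pos_right _ hm.pos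
    omega
  have hunit : IsUnit (m : ZMod (2 ^ W)) := by
    rw [ZMod.isUnit_iff_coprime]
    exact Nat.Coprime.pow_right _ (Nat.coprime_two_right.2 hm)
  obtain ⟨b, hb⟩ := hunit.exists_left_inv
  refine ⟨(2 ^ (e - f) : ℕ) * b, ?_⟩
  have : (y : ZMod (2 ^ W)) - x = ((2 ^ f * m : ℕ) : ZMod (2 ^ W)) := by
    rw [← hd, Nat.cast_sub h.le]
  rw [this, Nat.cast_mul]
  calc _ = ((2 ^ (e - f) : ℕ) : ZMod (2 ^ W)) * (2 ^ f : ℕ) * (b * m) := by ring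
    _ = _ := by rw [hb, mul_one, ← Nat.cast_mul, ← pow_add]; congr 2; omega

/-- The leading bits of one hash value are uniform. -/
theorem sum_topBits {W s : ℕ} (hs : s ≤ W) (κ j : ℕ) (F : ZMod (2 ^ s) → ℝ) :
    (2 ^ s : ℕ) * ∑ z, F (topBits W s (linear z κ j)) = ((2 ^ W) ^ 3 : ℕ) * ∑ β, F β := by
  have := sum_eq_of_translation (fun z => topBits W s (linear z κ j)) (fun _ => ())
    (0, 0, ((2 ^ (W - s) : ℕ) : ZMod (2 ^ W))) (fun t => by
      rw [← topBits_add hs]; simp only [linear, Prod.fst_add, Prod.snd_add]; congr 1; ring)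
    (fun _ => rfl) (fun _ => F)
  rw [this]
  simp [Finset.card_univ, ZMod.card]
  left; ring

/-- The leading bits of two hash values are uniform and independent. -/
theorem sum_topBits_pair {W s e κ κ' j j' : ℕ} (hs : s + e ≤ W) (hκ : κ < 2 ^ e) (hκ' : κ' < 2 ^ e)
    (hj : j < 2 ^ e) (hj' : j' < 2 ^ e) (hne : (κ, j) ≠ (κ', j'))
    (F : ZMod (2 ^ s) → ZMod (2 ^ s) → ℝ) :
    (2 ^ s : ℕ) * ((2 ^ s : ℕ) *
        ∑ z, F (topBits W s (linear z κ j)) (topBits W s (linear z κ' j'))) =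
      ((2 ^ W) ^ 3 : ℕ) * ∑ α, ∑ β, F α β := by
  -- Translate the coefficient of a coordinate in which the two arguments differ, and compensate in
  -- the constant term: the first value is unchanged while the leading bits of the second gain one
  -- unit. The condition `s + e ≤ W` leaves room for the factor `2 ^ e` from `exists_mul_sub_eq`.
  obtain ⟨δ, h1, h2⟩ : ∃ δ, (∀ z, linear (z + δ) κ j = linear z κ j) ∧
      ∀ z, linear (z + δ) κ' j' = linear z κ' j' + ((2 ^ (W - s) : ℕ) : ZMod (2 ^ W)) := by
    have hpow : ((2 ^ (W - s) : ℕ) : ZMod (2 ^ W)) = (2 ^ (W - s - e) : ℕ) * (2 ^ e : ℕ) := by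
      rw [← Nat.cast_mul, ← pow_add]; congr 2; omega
    by_cases hk : κ = κ'
    · have hjj : j ≠ j' := fun h => hne (by rw [hk, h])
      obtain ⟨b, hb⟩ := exists_mul_sub_eq (W := W) hj hj' hjj
      refine ⟨(0, (2 ^ (W - s - e) : ℕ) * b, -((2 ^ (W - s - e) : ℕ) * b * j)), fun z => ?_,
        fun z => ?_⟩
      · simp only [linear, Prod.fst_add, Prod.snd_add]; ring
      · rw [hpow, ← hb]
        simp only [linear, Prod.fst_add, Prod.snd_add]; ring
    · obtain ⟨b, hb⟩ := exists_mul_sub_eq (W := W) hκ hκ' hk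
      refine ⟨((2 ^ (W - s - e) : ℕ) * b, 0, -((2 ^ (W - s - e) : ℕ) * b * κ)), fun z => ?_,
        fun z => ?_⟩
      · simp only [linear, Prod.fst_add, Prod.snd_add]; ring
      · rw [hpow, ← hb]
        simp only [linear, Prod.fst_add, Prod.snd_add]; ring
  rw [sum_eq_of_translation (fun z => topBits W s (linear z κ' j'))
    (fun z => topBits W s (linear z κ j)) δ (fun z => by rw [h2, topBits_add (by omega)])
    (fun z => by rw [h1]) F]
  exact sum_topBits (by omega) κ j fun α => ∑ β, F α β

theorem Shape.hash_eq_linear (g : Shape)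
    (z : ZMod (2 ^ g.W) × ZMod (2 ^ g.W) × ZMod (2 ^ g.W)) (κ j : ℕ) :
    g.hash (z.1.val, z.2.1.val, z.2.2.val) κ j = (linear z κ j).val := by
  have : linear z κ j = ((z.1.val * κ + z.2.1.val * j + z.2.2.val : ℕ) : ZMod (2 ^ g.W)) := by
    simp [linear]
  rw [this, ZMod.val_natCast]; rfl

/-- The leading bits of the hash value, which determine survival and new key. -/
def Shape.top (g : Shape) (t : ℕ × ℕ × ℕ) (κ j : ℕ) : ℕ :=
  g.hash t κ j / 2 ^ (g.W - (g.u + g.v))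

theorem Shape.top_div {g : Shape} (hs : g.u + g.v ≤ g.W) (t : ℕ × ℕ × ℕ) (κ j : ℕ) :
    g.hash t κ j / 2 ^ (g.W - g.u) = g.top t κ j / 2 ^ g.v := by
  rw [Shape.top, Nat.div_div_eq_div_mul, ← pow_add]; congr 2; omega

theorem Shape.newKey_eq (g : Shape) (t : ℕ × ℕ × ℕ) (κ j : ℕ) :
    g.newKey t κ j = g.top t κ j % 2 ^ g.v := by
  rw [Shape.newKey, Shape.top, Nat.sub_sub]

theorem expect_top {g : Shape} (hs : g.u + g.v ≤ g.W) (κ j : ℕ) (F : ℕ → ℝ) :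
    (triples g.W).expect (fun t => F (g.top t κ j)) =
      (Finset.range (2 ^ (g.u + g.v))).expect F := by
  rw [Finset.expect_eq_sum_div_card, Finset.expect_eq_sum_div_card, card_triples, sum_triples,
    Finset.card_range, sum_range_eq_sum_zmod]
  rw [div_eq_div_iff (by positivity) (by positivity), mul_comm, mul_comm (∑ _, _)]
  rw [← sum_topBits hs κ j fun β => F β.val]
  congr 1
  refine Finset.sum_congr rfl fun z _ => ?_
  rw [val_topBits hs, Shape.top, Shape.hash_eq_linear]

theorem expect_top_pair {g : Shape} {e κ κ' j j' : ℕ} (hs : g.u + g.v + e ≤ g.W) (hκ : κ < 2 ^ e)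
    (hκ' : κ' < 2 ^ e) (hj : j < 2 ^ e) (hj' : j' < 2 ^ e) (hne : (κ, j) ≠ (κ', j'))
    (F : ℕ → ℕ → ℝ) :
    (triples g.W).expect (fun t => F (g.top t κ j) (g.top t κ' j')) =
      (Finset.range (2 ^ (g.u + g.v))).expect fun α =>
        (Finset.range (2 ^ (g.u + g.v))).expect fun β => F α β := by
  simp only [Finset.expect_eq_sum_div_card, card_triples, sum_triples, Finset.card_range,
    ← Finset.sum_div]
  rw [sum_range_eq_sum_zmod fun α => ∑ β ∈ Finset.range (2 ^ (g.u + g.v)), F α β]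
  rw [div_div, div_eq_div_iff (by positivity) (by positivity), mul_comm, mul_comm (∑ _, _)]
  simp only [sum_range_eq_sum_zmod]
  rw [← sum_topBits_pair hs hκ hκ' hj hj' hne fun α β => F α.val β.val, mul_assoc]
  congr 2
  refine Finset.sum_congr rfl fun z _ => ?_
  rw [val_topBits (by omega), val_topBits (by omega), Shape.top, Shape.top, Shape.hash_eq_linear,
    Shape.hash_eq_linear]

/-! ### Sums over lists of keys -/

/-- Sum of a function over a list. -/
def lsum (l : List ℕ) (f : ℕ → ℝ) : ℝ := (l.map f).sum

@[simp] theorem lsum_nil (f : ℕ → ℝ) : lsum [] f = 0 := rfl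

@[simp] theorem lsum_cons (a : ℕ) (l : List ℕ) (f : ℕ → ℝ) :
    lsum (a :: l) f = f a + lsum l f := by simp [lsum]

theorem lsum_append (l l' : List ℕ) (f : ℕ → ℝ) : lsum (l ++ l') f = lsum l f + lsum l' f := by
  simp [lsum]

theorem lsum_congr {l : List ℕ} {f f' : ℕ → ℝ} (h : ∀ a ∈ l, f a = f' a) :
    lsum l f = lsum l f' := by
  rw [lsum, lsum, List.map_congr_left h]

theorem lsum_mono {l : List ℕ} {f f' : ℕ → ℝ} (h : ∀ a ∈ l, f a ≤ f' a) :
    lsum l f ≤ lsum l f' := List.sum_le_sum h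

theorem lsum_nonneg {l : List ℕ} {f : ℕ → ℝ} (h : ∀ a ∈ l, 0 ≤ f a) : 0 ≤ lsum l f := by
  refine List.sum_nonneg fun x hx => ?_
  obtain ⟨a, ha, rfl⟩ := List.mem_map.1 hx
  exact h a ha

theorem lsum_le_of_sublist {l l' : List ℕ} {f : ℕ → ℝ} (h : l.Sublist l') (hf : ∀ a, 0 ≤ f a) :
    lsum l f ≤ lsum l' f := by
  induction h with
  | slnil => exact le_rfl
  | cons a h ih => rw [lsum_cons]; linarith [hf a]
  | cons_cons a h ih => rw [lsum_cons, lsum_cons]; linarith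

theorem lsum_add (l : List ℕ) (f f' : ℕ → ℝ) :
    lsum l (fun a => f a + f' a) = lsum l f + lsum l f' := by
  induction l with
  | nil => simp
  | cons a l ih => simp only [lsum_cons, ih]; ring

theorem lsum_mul (l : List ℕ) (f : ℕ → ℝ) (c : ℝ) : lsum l (fun a => c * f a) = c * lsum l f := by
  induction l with
  | nil => simp
  | cons a l ih => simp only [lsum_cons, ih]; ring

theorem lsum_const (l : List ℕ) (c : ℝ) : lsum l (fun _ => c) = l.length * c := by
  induction l with
  | nil => simp
  | cons a l ih => simp only [lsum_cons, ih, List.length_cons]; push_cast; ring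

theorem lsum_comm (l l' : List ℕ) (f : ℕ → ℕ → ℝ) :
    lsum l (fun a => lsum l' (f a)) = lsum l' fun b => lsum l fun a => f a b := by
  induction l with
  | nil => simp [lsum_const]
  | cons a l ih => simp only [lsum_cons, ih, lsum_add]

theorem expect_lsum {ι : Type*} (s : Finset ι) (l : List ℕ) (f : ι → ℕ → ℝ) :
    s.expect (fun i => lsum l (f i)) = lsum l fun a => s.expect fun i => f i a := by
  induction l with
  | nil => simp
  | cons a l ih => simp only [lsum_cons, Finset.expect_add_distrib, ih]

theorem lsum_ite_eq (l : List ℕ) (a : ℕ) :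
    lsum l (fun b => if a = b then 1 else 0) = l.count a := by
  induction l with
  | nil => simp
  | cons b l ih =>
    rw [lsum_cons, ih, List.count_cons]
    by_cases h : a = b
    · simp [h, add_comm]
    · simp [h, Ne.symm h]

theorem lsum_lsum_ite_eq {l l' : List ℕ} (h : l'.Nodup) :
    lsum l (fun a => lsum l' fun b => if a = b then 1 else 0) = common l l' := by
  simp only [lsum_ite_eq]
  induction l with
  | nil => simp [common]
  | cons a l ih =>
    rw [lsum_cons, ih, common, common, List.filter_cons]
    by_cases ha : a ∈ l'
    · simp [ha, List.count_eq_one_of_mem h ha, add_comm]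
    · simp [ha, List.count_eq_zero_of_not_mem ha]

/-! ### Expected numbers of paths and of pairs of paths -/

namespace Shape

variable {g : Shape}

/-- Survival, depending on the leading bits of the hash value. -/
noncomputable def surv (g : Shape) (c q : ℕ) : ℝ := if q / 2 ^ g.v * c < 2 ^ (2 * g.u) then 1 else 0

/-- The key, depending on the leading bits of the hash value. -/
def key (g : Shape) (q : ℕ) : ℕ := q % 2 ^ g.v

theorem surv_nonneg (c q : ℕ) : 0 ≤ g.surv c q := by
  unfold surv; split_ifs <;> simp

/-- The probability of survival. -/
noncomputable def prob (g : Shape) (c : ℕ) : ℝ :=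
  (Finset.range (2 ^ g.u)).expect fun H => if H * c < 2 ^ (2 * g.u) then (1 : ℝ) else 0

theorem prob_nonneg (c : ℕ) : 0 ≤ g.prob c :=
  Finset.expect_nonneg fun _ _ => by split_ifs <;> simp

/-- Survival and new key depend on a hash value only through its leading `u + v` bits, so sums over
children become sums of functions of `top`, whose joint law is known. -/
theorem lsum_step (hs : g.u + g.v ≤ g.W) (c : ℕ) (xs : List ℕ) (t : ℕ × ℕ × ℕ) (l : List ℕ)
    (f : ℕ → ℝ) : lsum (g.step c xs t l) f =
      lsum l fun κ => lsum xs fun j => g.surv c (g.top t κ j) * f (g.key (g.top t κ j)) := by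
  induction l with
  | nil => rfl
  | cons κ l ih =>
    rw [lsum_cons, ← ih, step, List.flatMap_cons, lsum_append]
    congr 1
    simp only [children]
    clear ih
    induction xs with
    | nil => rfl
    | cons j xs ih =>
      rw [lsum_cons, ← ih, List.filter_cons, Shape.key, ← newKey_eq]
      by_cases h : g.Survives c t κ j
      · have : g.surv c (g.top t κ j) = 1 := by
          rw [surv, ← top_div hs]; exact if_pos h
        simp [h, this]
      · have : g.surv c (g.top t κ j) = 0 := by
          rw [surv, ← top_div hs]; exact if_neg h
        simp [h, this]

/-- High and low bits are independent. -/
theorem expect_range_mul (g : Shape) (F : ℕ → ℕ → ℝ) :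
    (Finset.range (2 ^ (g.u + g.v))).expect (fun q => F (q / 2 ^ g.v) (g.key q)) =
      (Finset.range (2 ^ g.u)).expect fun H => (Finset.range (2 ^ g.v)).expect fun K => F H K := by
  rw [← Finset.expect_product']
  have h0 : 0 < 2 ^ g.v := by positivity
  refine Finset.expect_nbij' (fun q => (q / 2 ^ g.v, q % 2 ^ g.v)) (fun p => p.1 * 2 ^ g.v + p.2)
    ?_ ?_ ?_ ?_ ?_
  · intro q hq
    simp only [Finset.mem_range, Finset.mem_product] at hq ⊢
    exact ⟨by rw [Nat.div_lt_iff_lt_mul h0, ← pow_add]; exact hq, Nat.mod_lt _ h0⟩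
  · rintro ⟨H, K⟩ hp
    simp only [Finset.mem_range, Finset.mem_product] at hp ⊢
    calc H * 2 ^ g.v + K < (H + 1) * 2 ^ g.v := by rw [Nat.succ_mul]; omega
      _ ≤ 2 ^ g.u * 2 ^ g.v := Nat.mul_le_mul_right _ hp.1
      _ = _ := (pow_add _ _ _).symm
  · intro q _
    simp only
    rw [mul_comm]; exact Nat.div_add_mod _ _
  · rintro ⟨H, K⟩ hp
    simp only [Finset.mem_range, Finset.mem_product] at hp ⊢
    rw [mul_comm, Nat.mul_add_div h0, Nat.mul_add_mod, Nat.div_eq_of_lt hp.2, Nat.mod_eq_of_lt hp.2,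
      add_zero]
  · intro q _; rfl

theorem expect_surv (c : ℕ) :
    (Finset.range (2 ^ (g.u + g.v))).expect (g.surv c) = g.prob c := by
  have := expect_range_mul g fun H _ => if H * c < 2 ^ (2 * g.u) then (1 : ℝ) else 0
  simp only [Finset.expect_const (Finset.nonempty_range_iff.2 (pow_ne_zero _ two_ne_zero))] at this
  exact this

/-- A kernel on pairs of keys. -/
def kernel (p : ℝ × ℝ) (κ κ' : ℕ) : ℝ := p.1 + p.2 * if κ = κ' then 1 else 0

/-- For two independent uniform values, survival is decided by the high `u` bits and the key by the
low `v` bits of each. All four parts are independent, and the two keys agree with probability `2 ^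
(-v)`. -/
theorem expect_kernel (c c' : ℕ) (p : ℝ × ℝ) :
    (Finset.range (2 ^ (g.u + g.v))).expect (fun α =>
      (Finset.range (2 ^ (g.u + g.v))).expect fun β =>
        g.surv c α * (g.surv c' β * kernel p (g.key α) (g.key β))) =
      g.prob c * g.prob c' * (p.1 + p.2 / 2 ^ g.v) := by
  have h0 : (Finset.range (2 ^ g.v)).Nonempty :=
    Finset.nonempty_range_iff.2 (pow_ne_zero _ two_ne_zero)
  have h1 (K : ℕ) (hK : K ∈ Finset.range (2 ^ g.v)) :
      (Finset.range (2 ^ g.v)).expect (fun K' => kernel p K K') = p.1 + p.2 / 2 ^ g.v := by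
    simp only [kernel]
    rw [Finset.expect_add_distrib, Finset.expect_const h0, ← Finset.mul_expect,
      Finset.expect_eq_sum_div_card, Finset.sum_ite_eq, if_pos hK]
    simp [div_eq_mul_inv]
  have h2 (K : ℕ) (hK : K ∈ Finset.range (2 ^ g.v)) :
      (Finset.range (2 ^ (g.u + g.v))).expect (fun β => g.surv c' β * kernel p K (g.key β)) =
        g.prob c' * (p.1 + p.2 / 2 ^ g.v) := by
    have := expect_range_mul g fun H K' =>
      (if H * c' < 2 ^ (2 * g.u) then (1 : ℝ) else 0) * kernel p K K'
    simp only [← Finset.mul_expect, h1 K hK, ← Finset.expect_mul] at this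
    exact this
  have h3 : ∀ α, (Finset.range (2 ^ (g.u + g.v))).expect (fun β =>
        g.surv c α * (g.surv c' β * kernel p (g.key α) (g.key β))) =
      g.surv c α * (g.prob c' * (p.1 + p.2 / 2 ^ g.v)) := by
    intro α
    rw [← Finset.mul_expect, h2 (g.key α) (Finset.mem_range.2 (Nat.mod_lt _ (by positivity)))]
  simp only [h3]
  rw [← Finset.expect_mul]
  have := expect_surv (g := g) c
  rw [show (fun i => g.surv c i) = g.surv c from rfl, this]; ring

/-- Sum of a function over pairs of keys. -/
def pairSum (l l' : List ℕ) (φ : ℕ → ℕ → ℝ) : ℝ := lsum l fun κ => lsum l' fun κ' => φ κ κ'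

theorem pairSum_step (hs : g.u + g.v ≤ g.W) (c c' : ℕ) (xs xs' : List ℕ) (t : ℕ × ℕ × ℕ)
    (l l' : List ℕ) (φ : ℕ → ℕ → ℝ) :
    pairSum (g.step c xs t l) (g.step c' xs' t l') φ =
      pairSum l l' fun κ κ' => lsum xs fun j => lsum xs' fun j' => g.surv c (g.top t κ j) *
        (g.surv c' (g.top t κ' j') * φ (g.key (g.top t κ j)) (g.key (g.top t κ' j'))) := by
  simp only [pairSum, lsum_step hs, ← lsum_mul]
  refine lsum_congr fun κ _ => ?_
  rw [lsum_comm xs l']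

/-- Different arguments give independent hash values and the first summand. Equal arguments give a
single hash value: both survive with probability at most the minimum, and the new keys coincide, so
the kernel takes the value `p.1 + p.2`. Adding the two summands gives one bound for all pairs. -/
theorem expect_surv_pair_le {κ κ' j j' : ℕ} (h3 : g.u + g.v + g.u ≤ g.W) (hκ : κ < 2 ^ g.u)
    (hκ' : κ' < 2 ^ g.u) (hj : j < 2 ^ g.u) (hj' : j' < 2 ^ g.u) (c c' : ℕ) {p : ℝ × ℝ}
    (hp1 : 0 ≤ p.1) (hp2 : 0 ≤ p.2) :
    (triples g.W).expect (fun t => g.surv c (g.top t κ j) *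
      (g.surv c' (g.top t κ' j') * kernel p (g.key (g.top t κ j)) (g.key (g.top t κ' j')))) ≤
    g.prob c * g.prob c' * (p.1 + p.2 / 2 ^ g.v) +
      (min (g.prob c) (g.prob c') * (p.1 + p.2)) *
        ((if κ = κ' then 1 else 0) * if j = j' then 1 else 0) := by
  by_cases h : (κ, j) = (κ', j')
  · simp only [Prod.mk.injEq] at h
    obtain ⟨rfl, rfl⟩ := h
    have hnn := prob_nonneg (g := g)
    refine le_trans ?_ (le_add_of_nonneg_left (mul_nonneg (mul_nonneg (hnn c) (hnn c'))
      (by positivity)))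
    simp only [if_true, mul_one]
    have hk (q : ℕ) : kernel p (g.key q) (g.key q) = p.1 + p.2 := by simp [kernel]
    rw [expect_top (by omega) κ j fun q =>
      g.surv c q * (g.surv c' q * kernel p (g.key q) (g.key q))]
    simp only [hk, ← mul_assoc]
    rw [← Finset.expect_mul]
    refine mul_le_mul_of_nonneg_right (le_min ?_ ?_) (by positivity)
    · rw [← expect_surv c]
      refine Finset.expect_le_expect fun q _ => mul_le_of_le_one_right (surv_nonneg _ _) ?_
      unfold surv; split_ifs <;> simp
    · rw [← expect_surv c']
      refine Finset.expect_le_expect fun q _ => mul_le_of_le_one_left (surv_nonneg _ _) ?_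
      unfold surv; split_ifs <;> simp
  · have h' : (if κ = κ' then (1 : ℝ) else 0) * (if j = j' then 1 else 0) = 0 := by
      by_cases hκκ : κ = κ'
      · have : j ≠ j' := fun hjj => h (by rw [hκκ, hjj])
        simp [this]
      · simp [hκκ]
    rw [h', mul_zero, add_zero, ← expect_kernel]
    exact (expect_top_pair h3 hκ hκ' hj hj' h fun α β => g.surv c α *
      (g.surv c' β * kernel p (g.key α) (g.key β))).le

/-- Growth of the coefficients of a kernel in one step. -/
noncomputable def grow (g : Shape) (c c' : ℕ) (xs xs' : List ℕ) (p : ℝ × ℝ) : ℝ × ℝ :=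
  (xs.length * g.prob c * (xs'.length * g.prob c') * (p.1 + p.2 / 2 ^ g.v),
    common xs xs' * min (g.prob c) (g.prob c') * (p.1 + p.2))

/-- Sum `expect_surv_pair_le` over the elements of both sets. The diagonal terms are counted by the
common elements, which produces the second component of `grow`; thus kernels reproduce themselves
under averaging, up to an inequality. -/
theorem expect_pairSum_step_le (h3 : g.u + g.v + g.u ≤ g.W) {c c' : ℕ} {xs xs' l l' : List ℕ}
    (hxs : ∀ j ∈ xs, j < 2 ^ g.u) (hxs' : ∀ j ∈ xs', j < 2 ^ g.u) (hnd : xs'.Nodup)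
    (hl : ∀ κ ∈ l, κ < 2 ^ g.u) (hl' : ∀ κ ∈ l', κ < 2 ^ g.u) {p : ℝ × ℝ} (hp1 : 0 ≤ p.1)
    (hp2 : 0 ≤ p.2) :
    (triples g.W).expect (fun t => pairSum (g.step c xs t l) (g.step c' xs' t l') (kernel p)) ≤
      pairSum l l' (kernel (g.grow c c' xs xs' p)) := by
  simp only [pairSum_step (show g.u + g.v ≤ g.W by omega)]
  simp only [pairSum, expect_lsum]
  refine lsum_mono fun κ hκ => lsum_mono fun κ' hκ' => ?_
  refine (lsum_mono fun j hj => lsum_mono fun j' hj' => expect_surv_pair_le h3 (hl κ hκ)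
    (hl' κ' hκ') (hxs j hj) (hxs' j' hj') c c' hp1 hp2).trans (le_of_eq ?_)
  simp only [lsum_add, lsum_const, lsum_mul, lsum_lsum_ite_eq hnd, kernel, grow]
  ring

/-- All lists of `k` triples of words. -/
def tripleLists (W : ℕ) : ℕ → Finset (List (ℕ × ℕ × ℕ))
  | 0 => {[]}
  | k + 1 => (triples W ×ˢ tripleLists W k).image fun p => p.1 :: p.2

theorem expect_tripleLists_succ (W k : ℕ) (F : List (ℕ × ℕ × ℕ) → ℝ) :
    (tripleLists W (k + 1)).expect F =
      (triples W).expect fun t => (tripleLists W k).expect fun ts => F (t :: ts) := by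
  rw [tripleLists, Finset.expect_image, ← Finset.expect_product']
  rintro ⟨t, ts⟩ _ ⟨t', ts'⟩ _ h
  simpa using h

theorem tripleLists_nonempty (W k : ℕ) : (tripleLists W k).Nonempty := by
  induction k with
  | zero => simp [tripleLists]
  | succ k ih => exact ((triples_nonempty W).product ih).image _

theorem grow_nonneg {c c' : ℕ} {xs xs' : List ℕ} {p : ℝ × ℝ} (hp : 0 ≤ p.1 ∧ 0 ≤ p.2) :
    0 ≤ (g.grow c c' xs xs' p).1 ∧ 0 ≤ (g.grow c c' xs xs' p).2 := by
  have h1 := prob_nonneg (g := g) c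
  have h2 := prob_nonneg (g := g) c'
  obtain ⟨h3, h4⟩ := hp
  have h5 : 0 ≤ min (g.prob c) (g.prob c') := le_min h1 h2
  exact ⟨by simp only [grow]; positivity, by simp only [grow]; positivity⟩

/-- Average over the first level last and apply the induction hypothesis to the other levels. After
one level the keys have `v ≤ u` bits and are again admissible arguments of the hash function. -/
theorem expect_pairSum_iter_le (h3 : g.u + g.v + g.u ≤ g.W) (hv : g.v ≤ g.u) {c c' : ℕ}
    {xs xs' l l' : List ℕ} (hxs : ∀ j ∈ xs, j < 2 ^ g.u) (hxs' : ∀ j ∈ xs', j < 2 ^ g.u)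
    (hnd : xs'.Nodup) (hl : ∀ κ ∈ l, κ < 2 ^ g.u) (hl' : ∀ κ ∈ l', κ < 2 ^ g.u) {p : ℝ × ℝ}
    (hp : 0 ≤ p.1 ∧ 0 ≤ p.2) (k : ℕ) :
    (tripleLists g.W k).expect
      (fun ts => pairSum (g.iter c xs ts l) (g.iter c' xs' ts l') (kernel p)) ≤
      pairSum l l' (kernel ((g.grow c c' xs xs')^[k] p)) := by
  induction k generalizing l l' with
  | zero => simp [tripleLists, iter]
  | succ k ih =>
    have hvu : 2 ^ g.v ≤ 2 ^ g.u := Nat.pow_le_pow_right (by norm_num) hv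
    have hnn : ∀ k, 0 ≤ ((g.grow c c' xs xs')^[k] p).1 ∧ 0 ≤ ((g.grow c c' xs xs')^[k] p).2 := by
      intro k
      induction k with
      | zero => exact hp
      | succ k ih' => rw [Function.iterate_succ_apply']; exact grow_nonneg ih'
    rw [expect_tripleLists_succ]
    refine (Finset.expect_le_expect fun t _ => ih (fun κ hκ => (lt_of_mem_step hκ).trans_le hvu)
      (fun κ hκ => (lt_of_mem_step hκ).trans_le hvu)).trans ?_
    refine (expect_pairSum_step_le h3 hxs hxs' hnd hl hl' (hnn k).1 (hnn k).2).trans (le_of_eq ?_)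
    rw [Function.iterate_succ_apply']

/-- The expected number of keys. -/
theorem expect_length_iter (hs : g.u + g.v ≤ g.W) (c : ℕ) (xs l : List ℕ) (k : ℕ) :
    (tripleLists g.W k).expect (fun ts => ((g.iter c xs ts l).length : ℝ)) =
      (xs.length * g.prob c) ^ k * l.length := by
  have hlen (l : List ℕ) : (l.length : ℝ) = lsum l fun _ => 1 := by rw [lsum_const, mul_one]
  induction k generalizing l with
  | zero => simp [tripleLists, iter]
  | succ k ih =>
    rw [expect_tripleLists_succ]
    simp only [iter, ih]
    rw [← Finset.mul_expect, pow_succ, mul_assoc]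
    congr 1
    simp only [hlen (g.step _ _ _ _), lsum_step hs, mul_one, expect_lsum]
    rw [lsum_congr (f' := fun _ => lsum xs fun _ => g.prob c)]
    · simp only [lsum_const]; ring
    · intro κ _
      refine lsum_congr fun j _ => ?_
      rw [expect_top hs κ j (g.surv c), ← expect_surv]

/-- The expected number of keys on all levels. -/
theorem expect_total (hs : g.u + g.v ≤ g.W) (c : ℕ) (xs l : List ℕ) (k : ℕ) :
    (tripleLists g.W k).expect (fun ts => ((g.total c xs ts l : ℕ) : ℝ)) =
      (∑ i ∈ Finset.range (k + 1), (xs.length * g.prob c) ^ i) * l.length := by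
  have h1 (l : List ℕ) : (triples g.W).expect (fun t => ((g.step c xs t l).length : ℝ)) =
      (xs.length * g.prob c) * l.length := by
    have := expect_length_iter hs c xs l 1
    rw [expect_tripleLists_succ] at this
    simpa [tripleLists, iter] using this
  induction k generalizing l with
  | zero => simp [tripleLists, total]
  | succ k ih =>
    rw [expect_tripleLists_succ]
    simp only [total, Nat.cast_add, Finset.expect_add_distrib, ih,
      Finset.expect_const (tripleLists_nonempty _ _), Finset.expect_const (triples_nonempty _)]
    rw [← Finset.mul_expect, h1, Finset.sum_range_succ' _ (k + 1)]
    simp only [pow_succ, ← Finset.sum_mul, pow_zero]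
    ring

end Shape

/-! ### Probabilities over lists of coefficients -/

open Classical in
/-- The probability of an event that depends on `k` random triples of words. -/
noncomputable def chance (W k : ℕ) (p : List (ℕ × ℕ × ℕ) → Prop) : ℝ :=
  (Shape.tripleLists W k).expect fun ts => if p ts then 1 else 0

theorem chance_mono {W k : ℕ} {p q : List (ℕ × ℕ × ℕ) → Prop} (h : ∀ ts, p ts → q ts) :
    chance W k p ≤ chance W k q := by
  refine Finset.expect_le_expect fun ts _ => ?_
  by_cases hp : p ts
  · simp [hp, h ts hp]
  · simp only [hp, if_false]; split_ifs <;> simp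

theorem chance_or_le (W k : ℕ) (p q : List (ℕ × ℕ × ℕ) → Prop) :
    chance W k (fun ts => p ts ∨ q ts) ≤ chance W k p + chance W k q := by
  rw [chance, chance, chance, ← Finset.expect_add_distrib]
  refine Finset.expect_le_expect fun ts _ => ?_
  by_cases hp : p ts <;> by_cases hq : q ts <;> simp [hp, hq]

theorem chance_not (W k : ℕ) (p : List (ℕ × ℕ × ℕ) → Prop) :
    chance W k (fun ts => ¬ p ts) = 1 - chance W k p := by
  rw [eq_sub_iff_add_eq, chance, chance, ← Finset.expect_add_distrib]
  rw [← Finset.expect_const (Shape.tripleLists_nonempty W k) (1 : ℝ)]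
  refine Finset.expect_congr rfl fun ts _ => ?_
  rw [Finset.expect_const (Shape.tripleLists_nonempty W k)]
  by_cases hp : p ts <;> simp [hp]

/-- Markov's inequality. -/
theorem chance_le_div {W k : ℕ} {f : List (ℕ × ℕ × ℕ) → ℝ} (hf : ∀ ts, 0 ≤ f ts) {c m : ℝ}
    (hc : 0 < c) (hm : (Shape.tripleLists W k).expect f ≤ m) :
    chance W k (fun ts => c ≤ f ts) ≤ m / c := by
  rw [le_div_iff₀ hc, chance, Finset.expect_mul]
  refine (Finset.expect_le_expect fun ts _ => ?_).trans hm
  by_cases h : c ≤ f ts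
  · simp [h]
  · simpa [h] using hf ts

/-- Chebyshev's inequality, for the event that a random variable vanishes. -/
theorem chance_eq_zero_le {W k : ℕ} {f : List (ℕ × ℕ × ℕ) → ℝ} {m δ : ℝ} (hm : 0 < m)
    (h1 : (Shape.tripleLists W k).expect f = m)
    (h2 : (Shape.tripleLists W k).expect (fun ts => f ts ^ 2) ≤ m ^ 2 * (1 + δ)) :
    chance W k (fun ts => f ts = 0) ≤ δ := by
  have h3 : (Shape.tripleLists W k).expect (fun ts => (f ts - m) ^ 2) ≤ m ^ 2 * δ := by
    have : (Shape.tripleLists W k).expect (fun ts => (f ts - m) ^ 2) =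
        (Shape.tripleLists W k).expect (fun ts => f ts ^ 2) -
          2 * m * (Shape.tripleLists W k).expect f + m ^ 2 := by
      rw [Finset.mul_expect, ← Finset.expect_sub_distrib,
        ← Finset.expect_const (Shape.tripleLists_nonempty W k) (m ^ 2),
        ← Finset.expect_add_distrib]
      exact Finset.expect_congr rfl fun ts _ => by ring
    rw [this, h1]; nlinarith
  refine (chance_mono (q := fun ts => m ^ 2 ≤ (f ts - m) ^ 2) fun ts h => by rw [h]; simp).trans ?_
  refine (chance_le_div (fun ts => sq_nonneg _) (by positivity) h3).trans (le_of_eq ?_)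
  field_simp

namespace Shape

variable {g : Shape}

/-! ### The survival probability -/

theorem prob_eq (c : ℕ) : g.prob c =
    ((Finset.range (2 ^ g.u)).filter fun H => H * c < 2 ^ (2 * g.u)).card / 2 ^ g.u := by
  rw [prob, Finset.expect_eq_sum_div_card, Finset.card_range, Finset.sum_boole]; norm_cast

/-- The surviving values of the top `u` bits are those below `2 ^ (2 u) / c`. Rounding adds at most
one value to the ideal number and takes none away, apart from the cap at probability one
(`le_prob`); so the growth rate for similar sets does not fall below one. -/
theorem prob_le {c : ℕ} (hc : 0 < c) : g.prob c ≤ 2 ^ g.u / c + 1 / 2 ^ g.u := by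
  have hc' : (0 : ℝ) < c := by exact_mod_cast hc
  have h : ((Finset.range (2 ^ g.u)).filter fun H => H * c < 2 ^ (2 * g.u)).card ≤
      2 ^ (2 * g.u) / c + 1 := by
    rw [← Finset.card_range (2 ^ (2 * g.u) / c + 1)]
    refine Finset.card_le_card fun H hH => ?_
    simp only [Finset.mem_filter, Finset.mem_range] at hH ⊢
    exact Nat.lt_succ_of_le ((Nat.le_div_iff_mul_le hc).2 hH.2.le)
  rw [prob_eq, div_le_iff₀ (by positivity), add_mul, one_div_mul_cancel (by positivity)]
  calc _ ≤ ((2 ^ (2 * g.u) / c + 1 : ℕ) : ℝ) := by exact_mod_cast h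
    _ ≤ (2 ^ (2 * g.u) : ℕ) / (c : ℝ) + 1 := by
      rw [Nat.cast_add_one]; exact add_le_add_left Nat.cast_div_le _
    _ = _ := by rw [two_mul, pow_add]; push_cast; ring

theorem le_prob {c : ℕ} (hc : 0 < c) : min 1 ((2 : ℝ) ^ g.u / c) ≤ g.prob c := by
  have hc' : (0 : ℝ) < c := by exact_mod_cast hc
  rw [prob_eq]
  by_cases h : 2 ^ g.u ≤ ⌈(2 ^ (2 * g.u) : ℝ) / c⌉₊
  · refine (min_le_left _ _).trans ?_
    rw [le_div_iff₀ (by positivity), one_mul, Finset.filter_true_of_mem]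
    · simp
    · intro H hH
      have : H < ⌈(2 ^ (2 * g.u) : ℝ) / c⌉₊ := (Finset.mem_range.1 hH).trans_le h
      rw [Nat.lt_ceil, lt_div_iff₀ hc'] at this
      exact_mod_cast this
  · refine (min_le_right _ _).trans ?_
    rw [le_div_iff₀ (by positivity)]
    calc (2 : ℝ) ^ g.u / c * 2 ^ g.u = 2 ^ (2 * g.u) / c := by rw [two_mul, pow_add]; ring
      _ ≤ (⌈(2 ^ (2 * g.u) : ℝ) / c⌉₊ : ℝ) := Nat.le_ceil _
      _ ≤ _ := by
        rw [← Finset.card_range ⌈(2 ^ (2 * g.u) : ℝ) / c⌉₊]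
        refine Nat.cast_le.2 (Finset.card_le_card fun H hH => ?_)
        have hH := Finset.mem_range.1 hH
        refine Finset.mem_filter.2 ⟨Finset.mem_range.2 (by omega), ?_⟩
        rw [Nat.lt_ceil, lt_div_iff₀ hc'] at hH
        exact_mod_cast hH

/-! ### Growth of kernels -/

theorem pairSum_range (w : ℕ) (p : ℝ × ℝ) :
    pairSum (List.range w) (List.range w) (kernel p) = p.1 * w ^ 2 + p.2 * w := by
  simp only [pairSum, kernel, lsum_add, lsum_const, lsum_mul, lsum_ite_eq]
  rw [lsum_congr (f' := fun _ => 1)]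
  · simp only [lsum_const, List.length_range]; ring
  · intro a ha
    rw [List.count_eq_one_of_mem List.nodup_range ha]; simp

theorem common_self (l : List ℕ) : common l l = l.length := by
  rw [common, List.filter_eq_self.2]; simp

/-- The kernel `(1, 0)` counts ordered pairs of paths. The first coefficient is the squared mean,
inflated only by accidental collisions of keys. The second is the surplus for pairs that start from
the same key; because the mean `μ` is at least one, it stays within `2 * i` times the squared mean.
-/
theorem grow_near {c k : ℕ} {xs : List ℕ} (hμ : 1 ≤ xs.length * g.prob c)
    (hk : (k : ℝ) ^ 2 ≤ 2 ^ g.v) {i : ℕ} (hi : i ≤ k) :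
    (((g.grow c c xs xs)^[i]) (1, 0)).1 ≤
      (xs.length * g.prob c) ^ (2 * i) * (1 + i ^ 2 / 2 ^ g.v) ∧
    (((g.grow c c xs xs)^[i]) (1, 0)).2 ≤ (xs.length * g.prob c) ^ (2 * i) * (2 * i) := by
  induction i with
  | zero => simp
  | succ i ih =>
    obtain ⟨h1, h2⟩ := ih (by omega)
    rw [Function.iterate_succ_apply']
    set p := (g.grow c c xs xs)^[i] (1, 0)
    simp only [grow, common_self, min_self]
    set μ : ℝ := xs.length * g.prob c
    set ε : ℝ := 1 / 2 ^ g.v with hε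
    have hε0 : 0 ≤ ε := by positivity
    have hik : (i : ℝ) ^ 2 * ε ≤ 1 := by
      rw [hε, mul_one_div, div_le_one (by positivity)]
      refine le_trans ?_ hk
      have : (i : ℝ) ≤ k := by exact_mod_cast (by omega : i ≤ k)
      gcongr
    have e (x : ℝ) : x / 2 ^ g.v = x * ε := by rw [hε]; ring
    simp only [e] at *
    have hμ0 : 0 ≤ μ ^ (2 * i) := by positivity
    have hpow : μ ^ (2 * (i + 1)) = μ ^ (2 * i) * μ ^ 2 := by ring
    rw [hpow]
    push_cast
    constructor
    · calc μ * μ * (p.1 + p.2 * ε)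
          ≤ μ * μ * (μ ^ (2 * i) * (1 + i ^ 2 * ε) + μ ^ (2 * i) * (2 * i) * ε) := by gcongr
        _ = μ ^ (2 * i) * μ ^ 2 * (1 + (i ^ 2 + 2 * i) * ε) := by ring
        _ ≤ _ := by gcongr; linarith
    · calc μ * (p.1 + p.2)
          ≤ μ * (μ ^ (2 * i) * (1 + i ^ 2 * ε) + μ ^ (2 * i) * (2 * i)) := by gcongr
        _ = μ ^ (2 * i) * μ * (1 + i ^ 2 * ε + 2 * i) := by ring
        _ ≤ μ ^ (2 * i) * μ ^ 2 * (1 + 1 + 2 * i) := by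
          gcongr
          nlinarith
        _ = _ := by ring

/-- The kernel `(0, 1)` counts pairs of equal keys. Common paths contribute `lam ^ i`; all other
coincidences stem from one of about `M ^ (2 i)` pairs of paths and cost a factor `2 ^ (-v)`. `D`
bounds the geometric sums over the level at which the collision happens. -/
theorem grow_far {c c' k : ℕ} {xs xs' : List ℕ} {M lam D : ℝ} (h1 : xs.length * g.prob c ≤ M)
    (h2 : xs'.length * g.prob c' ≤ M)
    (h3 : common xs xs' * min (g.prob c) (g.prob c') ≤ lam) (hlam0 : 0 ≤ lam) (hlam : lam ≤ 1)
    (hM : 1 ≤ M) (hD : 0 ≤ D) (hDM : 1 ≤ D * (M - 1)) (hk : k * ((2 + D) * D) ≤ 2 ^ g.v)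
    {i : ℕ} (hi : i ≤ k) :
    (((g.grow c c' xs xs')^[i]) (0, 1)).1 ≤ (2 + D) / 2 ^ g.v * M ^ (2 * i) ∧
    (((g.grow c c' xs xs')^[i]) (0, 1)).2 ≤ lam ^ i + (2 + D) * D / 2 ^ g.v * M ^ (2 * i) := by
  set ε : ℝ := 1 / 2 ^ g.v with hε
  have hε0 : 0 < ε := by positivity
  have e (x : ℝ) : x / 2 ^ g.v = x * ε := by rw [hε]; ring
  simp only [e]
  set η : ℝ := (2 + D) * D * ε with hη
  have hη0 : 0 ≤ η := by positivity
  have hkη : k * η ≤ 1 := by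
    rw [hη, ← mul_assoc, hε, mul_one_div, div_le_one (by positivity)]; exact hk
  have hM2 : 1 ≤ D * (M ^ 2 - 1) := by nlinarith
  have hp0 := prob_nonneg (g := g) c
  have hp0' := prob_nonneg (g := g) c'
  have hpm : 0 ≤ min (g.prob c) (g.prob c') := le_min hp0 hp0'
  have hnn : ∀ k, 0 ≤ ((g.grow c c' xs xs')^[k] (0, 1)).1 ∧
      0 ≤ ((g.grow c c' xs xs')^[k] (0, 1)).2 := by
    intro k
    induction k with
    | zero => simp
    | succ k ih' => rw [Function.iterate_succ_apply']; exact grow_nonneg ih'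
  have aux : ∀ i ≤ k, ε * ((1 + D) * (M ^ (2 * i) - 1) + i * η * M ^ (2 * i)) ≤
      (2 + D) * ε * M ^ (2 * i) := by
    intro i hi
    have hMi : 0 ≤ M ^ (2 * i) := by positivity
    have : i * η ≤ 1 := le_trans (by gcongr) hkη
    have h4 : i * η * M ^ (2 * i) ≤ 1 * M ^ (2 * i) := by gcongr
    calc _ ≤ ε * ((1 + D) * M ^ (2 * i) + 1 * M ^ (2 * i)) := by gcongr; linarith
      _ = _ := by ring
  -- These bounds reproduce themselves. By `D * (M ^ 2 - 1) ≥ 1` the subtracted `1 + D` absorbs the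
  -- inflow of first collisions in each level, and `η * M ^ 2 ≥ η + (2 + D) * ε`. The term `i * η`
  -- accounts for keys that already coincide by accident.
  suffices H : (((g.grow c c' xs xs')^[i]) (0, 1)).1 ≤
      ε * ((1 + D) * (M ^ (2 * i) - 1) + i * η * M ^ (2 * i)) ∧
      (((g.grow c c' xs xs')^[i]) (0, 1)).2 ≤ lam ^ i + η * M ^ (2 * i) from
    ⟨H.1.trans (aux i hi), H.2⟩
  induction i with
  | zero => simp [hη0]
  | succ i ih =>
    obtain ⟨ha, hb⟩ := ih (by omega)
    obtain ⟨ha0, hb0⟩ := hnn i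
    rw [Function.iterate_succ_apply']
    set p := (g.grow c c' xs xs')^[i] (0, 1)
    simp only [grow, e]
    have hMi : 0 ≤ M ^ (2 * i) := by positivity
    have hMi' : M ^ (2 * (i + 1)) = M ^ (2 * i) * M ^ 2 := by ring
    have hli : lam ^ i ≤ 1 := pow_le_one₀ hlam0 hlam
    have hα : xs.length * g.prob c * (xs'.length * g.prob c') ≤ M ^ 2 := by
      rw [sq]; gcongr
    constructor
    · calc _ ≤ M ^ 2 * (p.1 + p.2 * ε) := by gcongr
        _ ≤ M ^ 2 * (ε * ((1 + D) * (M ^ (2 * i) - 1) + i * η * M ^ (2 * i)) +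
            (1 + η * M ^ (2 * i)) * ε) := by
          gcongr
          linarith
        _ = ε * ((1 + D) * M ^ (2 * (i + 1)) - ((1 + D) * M ^ 2 - M ^ 2) +
            (i + 1) * η * M ^ (2 * (i + 1))) := by rw [hMi']; ring
        _ ≤ _ := by
          push_cast
          refine mul_le_mul_of_nonneg_left ?_ hε0.le
          nlinarith
    · have := aux i (by omega)
      calc _ ≤ lam * (p.1 + p.2) := by gcongr
        _ ≤ lam * ((2 + D) * ε * M ^ (2 * i) + (lam ^ i + η * M ^ (2 * i))) := by
          gcongr; linarith
        _ = lam ^ (i + 1) + lam * (((2 + D) * ε + η) * M ^ (2 * i)) := by ring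
        _ ≤ lam ^ (i + 1) + 1 * (((2 + D) * ε + η) * M ^ (2 * i)) := by gcongr
        _ ≤ lam ^ (i + 1) + η * M ^ (2 * (i + 1)) := by
          rw [hMi', one_mul, ← mul_assoc, mul_right_comm]
          gcongr lam ^ (i + 1) + ?_ * _
          have : (2 + D) * ε * 1 ≤ (2 + D) * ε * (D * (M ^ 2 - 1)) := by gcongr
          rw [hη]
          nlinarith

/-- A geometric sum is dominated by its last term; `D` plays the role of `1 / (M - 1)`. -/
theorem sum_pow_le {M D : ℝ} (hM : 0 ≤ M) (hD : 0 ≤ D) (hDM : 1 ≤ D * (M - 1)) (k : ℕ) :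
    ∑ i ∈ Finset.range (k + 1), M ^ i ≤ (1 + D) * M ^ k := by
  induction k with
  | zero => simpa using hD
  | succ k ih =>
    rw [Finset.sum_range_succ, pow_succ]
    have : 0 ≤ M ^ k := by positivity
    nlinarith

/-- All sets are filtered by the same hash values, so fewer elements or a larger threshold parameter
leave fewer survivors. Hence the keys of `q ∩ x`, computed with the parameter of the larger set,
occur for both sets. -/
theorem step_subset {c c' : ℕ} {xs xs' l l' : List ℕ} (hc : c' ≤ c) (hxs : xs ⊆ xs') (hl : l ⊆ l')
    (t : ℕ × ℕ × ℕ) : g.step c xs t l ⊆ g.step c' xs' t l' := by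
  intro κ hκ
  simp only [step, children, List.mem_flatMap, List.mem_map, List.mem_filter,
    decide_eq_true_eq] at hκ ⊢
  obtain ⟨a, ha, j, ⟨hj, hs⟩, rfl⟩ := hκ
  exact ⟨a, hl ha, j, ⟨hxs hj, (Nat.mul_le_mul_left _ hc).trans_lt hs⟩, rfl⟩

theorem iter_subset {c c' : ℕ} {xs xs' l l' : List ℕ} (hc : c' ≤ c) (hxs : xs ⊆ xs') (hl : l ⊆ l')
    (ts : List (ℕ × ℕ × ℕ)) : g.iter c xs ts l ⊆ g.iter c' xs' ts l' := by
  induction ts generalizing l l' with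
  | nil => exact hl
  | cons t ts ih => exact ih (step_subset hc hxs hl t)

end Shape

/-! ### The success probability of the data structure -/

theorem hasCandidate_of_countP {P : ℕ → Prop} [DecidablePred P] {l : List ℕ} {bud : ℕ}
    (h : ∃ i ∈ l, P i) (hl : l.countP (fun i => ¬ P i) < bud) : HasCandidate P l bud := by
  by_contra hc
  have hall : ∀ i ∈ l.take bud, ¬ P i := fun i hi hp => hc ⟨i, hi, hp⟩
  by_cases hlen : l.length ≤ bud
  · obtain ⟨i, hi, hp⟩ := h
    exact hall i (by rwa [List.take_of_length_le hlen]) hp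
  · have h1 : (l.take bud).countP (fun i => ¬ P i) = (l.take bud).length :=
      List.countP_eq_length.2 fun i hi => by simpa using hall i hi
    have h2 := (List.take_sublist bud l).countP_le (p := fun i => ¬ P i)
    rw [h1, List.length_take] at h2
    omega

theorem countP_chainsOf (L : ℕ → List ℕ) (P : ℕ → Prop) [DecidablePred P] (m c : ℕ) :
    (chainsOf L m c).countP (fun i => P i) = ∑ i ∈ (Finset.range m).filter P, (L i).count c := by
  induction m with
  | zero => simp [chainsOf]
  | succ m ih =>
    rw [chainsOf, List.countP_append, ih, List.countP_replicate, Finset.range_add_one,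
      Finset.filter_insert]
    by_cases h : P m <;> simp [h]

theorem mem_chainsOf {L : ℕ → List ℕ} {m c i : ℕ} (hi : i < m) (h : c ∈ L i) :
    i ∈ chainsOf L m c := by
  induction m with
  | zero => omega
  | succ m ih =>
    rw [chainsOf, List.mem_append]
    by_cases him : i = m
    · left
      subst him
      exact List.mem_replicate.2 ⟨(List.count_pos_iff.2 h).ne', rfl⟩
    · right; exact ih (by omega)

/-- A chain lists a set once for each occurrence of the key. Candidates counted with multiplicity
are therefore pairs of equal keys, which is what the kernel `(0, 1)` measures. -/
theorem countP_flatMap_chainsOf (L : ℕ → List ℕ) (P : ℕ → Prop) [DecidablePred P] (m : ℕ)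
    (l : List ℕ) :
    ((l.flatMap (chainsOf L m)).countP (fun i => P i) : ℝ) =
      ∑ i ∈ (Finset.range m).filter P, Shape.pairSum l (L i) (Shape.kernel (0, 1)) := by
  induction l with
  | nil => simp [Shape.pairSum]
  | cons c l ih =>
    rw [List.flatMap_cons, List.countP_append, Nat.cast_add, ih, countP_chainsOf, Nat.cast_sum,
      ← Finset.sum_add_distrib]
    refine Finset.sum_congr rfl fun i _ => ?_
    simp only [Shape.pairSum, Shape.kernel, lsum_cons, zero_add, one_mul, lsum_ite_eq]

namespace Shape

variable {g : Shape}

theorem kernel_nonneg (κ κ' : ℕ) : 0 ≤ kernel (0, 1) κ κ' := by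
  unfold kernel; split_ifs <;> simp

theorem pairSum_kernel_mono {l l' m m' : List ℕ} (h : l.Sublist m) (h' : l'.Sublist m') :
    pairSum l l' (kernel (0, 1)) ≤ pairSum m m' (kernel (0, 1)) :=
  (lsum_mono fun _ _ => lsum_le_of_sublist h' fun _ => kernel_nonneg _ _).trans
    (lsum_le_of_sublist h fun _ => lsum_nonneg fun _ _ => kernel_nonneg _ _)

/-- Similar sets share a key with high probability. -/
theorem chance_iter_eq_nil_le (h3 : g.u + g.v + g.u ≤ g.W) (hv : g.v ≤ g.u) {c k w : ℕ}
    {xs : List ℕ} (hxs : ∀ j ∈ xs, j < 2 ^ g.u) (hnd : xs.Nodup) (hw : w ≤ 2 ^ g.u) (hw0 : 0 < w)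
    (hμ : 1 ≤ xs.length * g.prob c) (hk : (k : ℝ) ^ 2 ≤ 2 ^ g.v) :
    chance g.W k (fun ts => g.iter c xs ts (List.range w) = []) ≤
      k ^ 2 / 2 ^ g.v + 2 * k / w := by
  have hw0' : (0 : ℝ) < w := by exact_mod_cast hw0
  have hr : ∀ κ ∈ List.range w, κ < 2 ^ g.u := fun κ hκ => (List.mem_range.1 hκ).trans_le hw
  refine (chance_mono (q := fun ts => ((g.iter c xs ts (List.range w)).length : ℝ) = 0)
    fun ts h => by simp [h]).trans ?_
  refine chance_eq_zero_le (m := (xs.length * g.prob c) ^ k * w) (by positivity) ?_ ?_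
  · simpa using expect_length_iter (by omega) c xs (List.range w) k
  · have h := expect_pairSum_iter_le (p := (1, 0)) (c := c) (c' := c) h3 hv hxs hxs hnd hr hr
      (by simp) k
    obtain ⟨h1, h2⟩ := grow_near hμ hk le_rfl
    rw [pairSum_range] at h
    have e (l : List ℕ) : pairSum l l (kernel (1, 0)) = (l.length : ℝ) ^ 2 := by
      simp only [pairSum, kernel, zero_mul, add_zero, lsum_const]; ring
    simp only [e] at h
    refine h.trans ?_
    calc _ ≤ (xs.length * g.prob c) ^ (2 * k) * (1 + k ^ 2 / 2 ^ g.v) * w ^ 2 +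
          (xs.length * g.prob c) ^ (2 * k) * (2 * k) * w := by gcongr
      _ = _ := by field_simp; ring

/-- The number of levels of the queue that fit into memory is exceeded with small probability. -/
theorem chance_lt_total_le (hs : g.u + g.v ≤ g.W) {c k w cap : ℕ} {xs : List ℕ} {M D δ : ℝ}
    (hM : xs.length * g.prob c ≤ M) (hD : 0 ≤ D) (hDM : 1 ≤ D * (M - 1)) (hM0 : 0 ≤ M)
    (hcap : 0 < cap) (h : (1 + D) * M ^ k * w ≤ δ * cap) :
    chance g.W k (fun ts => cap < g.total c xs ts (List.range w)) ≤ δ := by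
  have hcap' : (0 : ℝ) < cap := by exact_mod_cast hcap
  have hp := prob_nonneg (g := g) c
  refine (chance_mono (q := fun ts => (cap : ℝ) ≤ ((g.total c xs ts (List.range w) : ℕ) : ℝ))
    fun ts h => by exact_mod_cast h.le).trans ?_
  refine (chance_le_div (m := δ * cap) (fun _ => by positivity) hcap' ?_).trans (le_of_eq ?_)
  · rw [expect_total hs, List.length_range]
    refine le_trans ?_ h
    refine mul_le_mul_of_nonneg_right ?_ (by positivity)
    refine le_trans (Finset.sum_le_sum fun i _ => ?_) (sum_pow_le hM0 hD hDM k)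
    gcongr
  · field_simp

/-- Few pairs of equal keys are expected from two sets that are not similar. -/
theorem expect_pairSum_far_le (h3 : g.u + g.v + g.u ≤ g.W) (hv : g.v ≤ g.u) {c c' k w : ℕ}
    {xs xs' : List ℕ} (hxs : ∀ j ∈ xs, j < 2 ^ g.u) (hxs' : ∀ j ∈ xs', j < 2 ^ g.u)
    (hnd : xs'.Nodup) (hw : w ≤ 2 ^ g.u) (hw0 : 0 < w) {M lam D : ℝ}
    (h1 : xs.length * g.prob c ≤ M) (h2 : xs'.length * g.prob c' ≤ M)
    (h4 : common xs xs' * min (g.prob c) (g.prob c') ≤ lam) (hlam0 : 0 ≤ lam) (hlam : lam ≤ 1)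
    (hM : 1 ≤ M) (hD : 0 ≤ D) (hDM : 1 ≤ D * (M - 1)) (hk : k * ((2 + D) * D) ≤ 2 ^ g.v) :
    (tripleLists g.W k).expect (fun ts => pairSum (g.iter c xs ts (List.range w))
      (g.iter c' xs' ts (List.range w)) (kernel (0, 1))) ≤
      lam ^ k * w + (2 + D) * (1 + D) / 2 ^ g.v * M ^ (2 * k) * w ^ 2 := by
  have hr : ∀ κ ∈ List.range w, κ < 2 ^ g.u := fun κ hκ => (List.mem_range.1 hκ).trans_le hw
  have hw1 : (1 : ℝ) ≤ w := by exact_mod_cast hw0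
  refine (expect_pairSum_iter_le h3 hv hxs hxs' hnd hr hr (by simp) k).trans ?_
  obtain ⟨ha, hb⟩ := grow_far h1 h2 h4 hlam0 hlam hM hD hDM hk le_rfl
  rw [pairSum_range]
  have hww : (w : ℝ) ≤ w ^ 2 := by nlinarith
  have h0 : 0 ≤ (2 + D) * D / 2 ^ g.v * M ^ (2 * k) := by positivity
  calc _ ≤ (2 + D) / 2 ^ g.v * M ^ (2 * k) * w ^ 2 +
        (lam ^ k + (2 + D) * D / 2 ^ g.v * M ^ (2 * k)) * w := by gcongr
    _ = (2 + D) / 2 ^ g.v * M ^ (2 * k) * w ^ 2 + lam ^ k * w +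
        (2 + D) * D / 2 ^ g.v * M ^ (2 * k) * w := by ring
    _ ≤ (2 + D) / 2 ^ g.v * M ^ (2 * k) * w ^ 2 + lam ^ k * w +
        (2 + D) * D / 2 ^ g.v * M ^ (2 * k) * w ^ 2 := by gcongr
    _ = _ := by ring

end Shape

/-- The query finds a similar set with probability at least `1 / 2`. -/
theorem half_le_chance_hasCandidate {g : Shape} (h3 : g.u + g.v + g.u ≤ g.W) (hv : g.v ≤ g.u)
    {w cap b1 b n N k i₀ : ℕ} {X : ℕ → List ℕ} {q : List ℕ} (hw : w ≤ 2 ^ g.u) (hw0 : 0 < w)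
    (hcap : 0 < cap) (hX : ∀ i < n, ∀ j ∈ X i, j < 2 ^ g.u) (hXnd : ∀ i < n, (X i).Nodup)
    (hq : ∀ j ∈ q, j < 2 ^ g.u) (hqnd : q.Nodup) {M lam D : ℝ}
    (hMX : ∀ i < n, (X i).length * g.prob (b1 * (X i).length) ≤ M)
    (hMq : q.length * g.prob (b1 * q.length) ≤ M) (hM : 1 ≤ M) (hD : 0 ≤ D)
    (hDM : 1 ≤ D * (M - 1)) (hlam0 : 0 ≤ lam) (hlam : lam ≤ 1)
    (hfar : ∀ i < n, ¬ Similar b N q (X i) → common q (X i) *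
      min (g.prob (b1 * q.length)) (g.prob (b1 * (X i).length)) ≤ lam)
    (hi₀ : i₀ < n) (hsim : Similar b N q (X i₀))
    (hnear : 1 ≤ common q (X i₀) * g.prob (b1 * max q.length (X i₀).length))
    (hk : (k : ℝ) ^ 2 / 2 ^ g.v + 2 * k / w ≤ 3 / 16) (hkD : k * ((2 + D) * D) ≤ 2 ^ g.v)
    (htot : (1 + D) * M ^ k * w ≤ 1 / 16 * cap)
    (hbad : n * (lam ^ k * w + (2 + D) * (1 + D) / 2 ^ g.v * M ^ (2 * k) * w ^ 2) ≤ 1 / 16 * cap) :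
    1 / 2 ≤ chance g.W k fun ts => HasCandidate (fun i => i < n ∧ Similar b N q (X i))
      ((keysOf g ts w cap b1 q).flatMap
        (chainsOf (fun i => keysOf g ts w cap b1 (X i)) n)) cap := by
  classical
  have hcap' : (0 : ℝ) < cap := by exact_mod_cast hcap
  have hs : g.u + g.v ≤ g.W := by omega
  set P : ℕ → Prop := fun i => i < n ∧ Similar b N q (X i) with hP
  set xs := q.filter (· ∈ X i₀) with hxs
  set cm := b1 * max q.length (X i₀).length with hcm
  set r := List.range w with hr
  have hkv : (k : ℝ) ^ 2 ≤ 2 ^ g.v := by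
    have h2 : (k : ℝ) ^ 2 / 2 ^ g.v ≤ 1 := by
      have : (0 : ℝ) ≤ 2 * k / w := by positivity
      linarith
    rwa [div_le_one (by positivity)] at h2
  -- Defined by the untruncated lists, whose expectation is under control; truncation can only lower
  -- the count.
  set bad : List (ℕ × ℕ × ℕ) → ℝ := fun ts => ∑ i ∈ (Finset.range n).filter fun i => ¬ P i,
    Shape.pairSum (g.iter (b1 * q.length) q ts r) (g.iter (b1 * (X i).length) (X i) ts r)
      (Shape.kernel (0, 1)) with hbaddef
  have hbad0 : ∀ ts, 0 ≤ bad ts := fun ts => Finset.sum_nonneg fun i _ =>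
    lsum_nonneg fun _ _ => lsum_nonneg fun _ _ => Shape.kernel_nonneg _ _
  have p1 : chance g.W k (fun ts => g.iter cm xs ts r = []) ≤ 3 / 16 :=
    (Shape.chance_iter_eq_nil_le h3 hv (fun j hj => hq j (List.mem_of_mem_filter hj))
      (hqnd.filter _) hw hw0 hnear hkv).trans hk
  have p2 : chance g.W k (fun ts => cap < g.total (b1 * q.length) q ts r) ≤ 1 / 16 :=
    Shape.chance_lt_total_le hs hMq hD hDM (by linarith) hcap htot
  have p3 : chance g.W k (fun ts => cap < g.total (b1 * (X i₀).length) (X i₀) ts r) ≤ 1 / 16 :=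
    Shape.chance_lt_total_le hs (hMX _ hi₀) hD hDM (by linarith) hcap htot
  have p4 : chance g.W k (fun ts => (cap : ℝ) ≤ bad ts) ≤ 1 / 16 := by
    refine (chance_le_div (m := 1 / 16 * cap) hbad0 hcap' ?_).trans (le_of_eq (by field_simp))
    refine le_trans ?_ hbad
    rw [hbaddef, Finset.expect_sum_comm]
    calc _ ≤ ∑ i ∈ (Finset.range n).filter fun i => ¬ P i,
          (lam ^ k * w + (2 + D) * (1 + D) / 2 ^ g.v * M ^ (2 * k) * w ^ 2) := by
          refine Finset.sum_le_sum fun i hi => ?_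
          obtain ⟨hin, hiP⟩ := Finset.mem_filter.1 hi
          have hin := Finset.mem_range.1 hin
          exact Shape.expect_pairSum_far_le h3 hv hq (hX i hin) (hXnd i hin) hw hw0 hMq (hMX i hin)
            (hfar i hin fun h => hiP ⟨hin, h⟩) hlam0 hlam hM hD hDM hkD
      _ ≤ _ := by
          rw [Finset.sum_const, nsmul_eq_mul]
          refine mul_le_mul_of_nonneg_right ?_ (by positivity)
          exact_mod_cast (Finset.card_filter_le _ _).trans (Finset.card_range n).le
  -- The failure probabilities `3 / 16`, `1 / 16`, `1 / 16` and `1 / 16` add up to `3 / 8`.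
  have hsum : chance g.W k (fun ts => ((g.iter cm xs ts r = [] ∨
      cap < g.total (b1 * q.length) q ts r) ∨ cap < g.total (b1 * (X i₀).length) (X i₀) ts r) ∨
      (cap : ℝ) ≤ bad ts) ≤ 1 / 2 := by
    refine (chance_or_le _ _ _ _).trans ?_
    have h1 := chance_or_le g.W k (fun ts => g.iter cm xs ts r = [] ∨
      cap < g.total (b1 * q.length) q ts r) fun ts => cap < g.total (b1 * (X i₀).length) (X i₀) ts r
    have h2 := chance_or_le g.W k (fun ts => g.iter cm xs ts r = [])
      fun ts => cap < g.total (b1 * q.length) q ts r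
    linarith
  have hnot := chance_not g.W k (fun ts => ((g.iter cm xs ts r = [] ∨
      cap < g.total (b1 * q.length) q ts r) ∨ cap < g.total (b1 * (X i₀).length) (X i₀) ts r) ∨
      (cap : ℝ) ≤ bad ts)
  refine le_trans (by linarith) (hnot.symm.le.trans (chance_mono fun ts h => ?_))
  simp only [not_or, not_lt, not_le] at h
  obtain ⟨⟨⟨e1, e2⟩, e3⟩, e4⟩ := h
  have hwr : r.length = w := by simp [hr]
  have k1 : keysOf g ts w cap b1 q = g.iter (b1 * q.length) q ts r :=
    Shape.cutIter_eq ts w r (by omega)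
  have k2 : keysOf g ts w cap b1 (X i₀) = g.iter (b1 * (X i₀).length) (X i₀) ts r :=
    Shape.cutIter_eq ts w r (by omega)
  refine hasCandidate_of_countP ?_ ?_
  · obtain ⟨κ, hκ⟩ := List.exists_mem_of_ne_nil _ e1
    refine ⟨i₀, List.mem_flatMap.2 ⟨κ, ?_, mem_chainsOf hi₀ ?_⟩, hi₀, hsim⟩
    · rw [k1]
      exact Shape.iter_subset (Nat.mul_le_mul_left _ (le_max_left _ _)) (List.filter_subset_self _)
        (List.Subset.refl _) ts hκ
    · rw [k2]
      refine Shape.iter_subset (Nat.mul_le_mul_left _ (le_max_right _ _)) ?_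
        (List.Subset.refl _) ts hκ
      intro j hj
      simpa using (List.mem_filter.1 hj).2
  · have : ((((keysOf g ts w cap b1 q).flatMap
        (chainsOf (fun i => keysOf g ts w cap b1 (X i)) n)).countP fun i => ¬ P i : ℕ) : ℝ) ≤
        bad ts := by
      rw [countP_flatMap_chainsOf _ (fun i => ¬ P i)]
      exact Finset.sum_le_sum fun i _ => Shape.pairSum_kernel_mono (Shape.cutIter_sublist _ _ _)
        (Shape.cutIter_sublist _ _ _)
    exact_mod_cast this.trans_lt e4

/-! ### The parameters of the data structure -/

theorem fixPow_le_pow {u B : ℕ} {b : ℝ} (hB : (B : ℝ) ≤ b * 2 ^ u) (i : ℕ) :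
    (fixPow u B i : ℝ) ≤ 2 ^ u * b ^ i := by
  induction i with
  | zero => simp [fixPow]
  | succ i ih =>
    have hb : 0 ≤ b := by
      have : (0 : ℝ) ≤ b * 2 ^ u := le_trans (by positivity) hB
      exact nonneg_of_mul_nonneg_left this (by positivity)
    calc (fixPow u B (i + 1) : ℝ) ≤ ((fixPow u B i * B : ℕ) : ℝ) / ((2 ^ u : ℕ) : ℝ) :=
          Nat.cast_div_le
      _ ≤ (2 ^ u * b ^ i) * (b * 2 ^ u) / 2 ^ u := by push_cast; gcongr
      _ = _ := by field_simp; ring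

/-- Each step loses at most 1 by the rounding of `B` and at most 1 by the division, and
multiplication by `b ≤ 1` does not enlarge earlier losses. -/
theorem pow_le_fixPow {u B : ℕ} {b : ℝ} (hb0 : 0 ≤ b) (hb1 : b ≤ 1) (hB : b * 2 ^ u - 1 ≤ B)
    (hB1 : B ≤ 2 ^ u) (i : ℕ) : 2 ^ u * b ^ i - 2 * i ≤ (fixPow u B i : ℝ) := by
  induction i with
  | zero => simp [fixPow]
  | succ i ih =>
    have h1 : ((fixPow u B i * B : ℕ) : ℝ) / ((2 ^ u : ℕ) : ℝ) - 1 ≤ (fixPow u B (i + 1) : ℝ) := by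
      rw [fixPow, sub_le_iff_le_add, div_le_iff₀ (by positivity)]
      have := Nat.lt_div_mul_add (a := fixPow u B i * B) (b := 2 ^ u) (by positivity)
      calc ((fixPow u B i * B : ℕ) : ℝ) ≤
          ((fixPow u B i * B / 2 ^ u * 2 ^ u + 2 ^ u : ℕ) : ℝ) := by exact_mod_cast this.le
        _ = _ := by push_cast; ring
    have h2 : (fixPow u B i : ℝ) ≤ 2 ^ u := by exact_mod_cast fixPow_le hB1 i
    have hN : (0 : ℝ) < 2 ^ u := by positivity
    have h3 : (fixPow u B i : ℝ) * b - 1 ≤ ((fixPow u B i * B : ℕ) : ℝ) / ((2 ^ u : ℕ) : ℝ) := by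
      rw [le_div_iff₀ (by positivity)]
      push_cast
      have h0 : (0 : ℝ) ≤ fixPow u B i := by positivity
      nlinarith
    have h4 : (2 ^ u * b ^ i - 2 * i) * b ≤ fixPow u B i * b := by gcongr
    have h5 : 2 * (i : ℝ) * b ≤ 2 * i * 1 := by gcongr
    rw [pow_succ]
    push_cast
    nlinarith

/-! ### Number of levels and blow-up factor -/

section Levels

variable {b₁ b₂ ρ : ℝ}

/-- The number of levels is at most `levelConst b₂ * log n`. -/
noncomputable def levelConst (b₂ : ℝ) : ℝ := 1 / Real.log (1 / b₂) + 1 / Real.log 2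

theorem log_inv_pos (hb₂ : 0 < b₂) (h : b₂ < 1) : 0 < Real.log (1 / b₂) :=
  Real.log_pos (by rw [one_div]; exact one_lt_inv₀ hb₂ |>.2 h)

theorem levelConst_pos (hb₂ : 0 < b₂) (h : b₂ < 1) : 0 < levelConst b₂ := by
  have := log_inv_pos hb₂ h
  have h2 : 0 < Real.log 2 := Real.log_pos (by norm_num)
  unfold levelConst; positivity

/-- The second summand of `levelConst` pays for rounding up, because `log n ≥ log 2`. -/
theorem ceil_le_levelConst (hb₂ : 0 < b₂) (h : b₂ < 1) {n : ℕ} (hn : 2 ≤ n) :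
    (⌈Real.log n / Real.log (1 / b₂)⌉₊ : ℝ) ≤ levelConst b₂ * Real.log n := by
  have h1 := log_inv_pos hb₂ h
  have h2 : 0 < Real.log 2 := Real.log_pos (by norm_num)
  have hn' : (2 : ℝ) ≤ n := by exact_mod_cast hn
  have h3 : Real.log 2 ≤ Real.log n := Real.log_le_log (by norm_num) hn'
  have h4 := Nat.ceil_lt_add_one (a := Real.log n / Real.log (1 / b₂)) (by positivity)
  have h5 : 1 ≤ 1 / Real.log 2 * Real.log n := by
    rw [one_div, inv_mul_eq_div, le_div_iff₀ h2]; linarith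
  unfold levelConst
  rw [add_mul, one_div_mul_eq_div]
  linarith

theorem pow_ceil_le (hb₂ : 0 < b₂) (h : b₂ < 1) {n : ℕ} (hn : 2 ≤ n) :
    b₂ ^ ⌈Real.log n / Real.log (1 / b₂)⌉₊ ≤ 1 / n := by
  have h1 := log_inv_pos hb₂ h
  have hn' : (0 : ℝ) < n := by positivity
  have e1 : Real.log b₂ = -Real.log (1 / b₂) := by rw [one_div, Real.log_inv]; ring
  have e2 : Real.log (1 / n) = -Real.log n := by rw [one_div, Real.log_inv]
  rw [← Real.log_le_log_iff (by positivity) (by positivity), Real.log_pow, e1, e2]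
  have := Nat.le_ceil (Real.log n / Real.log (1 / b₂))
  rw [div_le_iff₀ h1] at this
  linarith

/-- `b₁ ^ (log n / log (1 / b₂)) = n ^ (-ρ)`, and rounding the exponent up costs at most one factor
`b₁`. -/
theorem le_pow_ceil (hb₁ : 0 < b₁) (h₁ : b₁ < 1) (hb₂ : 0 < b₂) (h : b₂ < 1)
    (hρ : ρ = Real.log (1 / b₁) / Real.log (1 / b₂)) {n : ℕ} (hn : 2 ≤ n) :
    b₁ / (n : ℝ) ^ ρ ≤ b₁ ^ ⌈Real.log n / Real.log (1 / b₂)⌉₊ := by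
  have h1 := log_inv_pos hb₂ h
  have h2 := log_inv_pos hb₁ h₁
  have hn' : (0 : ℝ) < n := by positivity
  have hl : 0 ≤ Real.log n := Real.log_natCast_nonneg n
  have hp : 0 < (n : ℝ) ^ ρ := Real.rpow_pos_of_pos hn' _
  rw [← Real.log_le_log_iff (by positivity) (by positivity), Real.log_pow,
    Real.log_div hb₁.ne' hp.ne', Real.log_rpow hn']
  have h4 := Nat.ceil_lt_add_one (a := Real.log n / Real.log (1 / b₂)) (by positivity)
  have e1 : Real.log b₁ = -Real.log (1 / b₁) := by rw [one_div, Real.log_inv]; ring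
  have e2 : ρ * Real.log n = Real.log n / Real.log (1 / b₂) * Real.log (1 / b₁) := by
    rw [hρ]; ring
  rw [e1, e2]
  nlinarith

theorem rho_mem (hb₂ : 0 < b₂) (hb : b₂ < b₁) (hb₁ : b₁ < 1)
    (hρ : ρ = Real.log (1 / b₁) / Real.log (1 / b₂)) : 0 < ρ ∧ ρ ≤ 1 := by
  have h1 := log_inv_pos hb₂ (hb.trans hb₁)
  have h2 := log_inv_pos (hb₂.trans hb) hb₁
  rw [hρ]
  refine ⟨by positivity, ?_⟩
  rw [div_le_one h1]
  exact Real.log_le_log (by have := hb₂.trans hb; positivity) (one_div_le_one_div_of_le hb₂ hb.le)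

end Levels

/-- Relative rounding errors of at most `1 / (2 k)` in each of `k` levels accumulate to a factor of
at most `exp (1 / 2) ≤ 2`. -/
theorem one_add_pow_le {x : ℝ} {k : ℕ} (hx : 0 ≤ x) (h : k * x ≤ 1 / 2) : (1 + x) ^ k ≤ 2 := by
  have h1 : (1 + x) ^ k ≤ Real.exp (k * x) := by
    rw [Real.exp_nat_mul]
    exact pow_le_pow_left₀ (by positivity) (by rw [add_comm]; exact Real.add_one_le_exp x) _
  refine h1.trans ((Real.exp_le_exp.2 h).trans ?_)
  have h2 : Real.exp (1 / 2) ^ 2 ≤ 2 ^ 2 := by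
    rw [← Real.exp_nat_mul]
    norm_num
    linarith [Real.exp_one_lt_d9]
  exact (pow_le_pow_iff_left₀ (by positivity) (by norm_num) (by norm_num)).1 h2

/-- `k` levels and blow-up factor `r`, for `n` sets and thresholds `B₁ / 2 ^ u` and `B₂ / 2 ^ u`. -/
structure Levels (b₁ b₂ ρ : ℝ) (n u B₁ B₂ k r : ℕ) : Prop where
  k_pos : 0 < k
  k_min : ∀ i < k, 2 ^ u < fixPow u B₂ i * n
  k_spec : fixPow u B₂ k * n ≤ 2 ^ u
  k_le : (k : ℝ) ≤ levelConst b₂ * Real.log n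
  r_min : ∀ i < r, i * fixPow u B₁ k < 2 ^ u
  r_spec : 2 ^ u ≤ r * fixPow u B₁ k
  r_le : (r : ℝ) ≤ 3 / b₁ * (n : ℝ) ^ ρ
  le_r : 1 ≤ b₁ ^ k * r
  pow_le : b₂ ^ k ≤ 2 / n

/-- `k` and `r` are the first values at which the loops of the program stop. Rounding down lets the
loop for `k` stop no later than the ideal number of levels; the accumulated loss of `2 * k` is at
most `2 ^ u / n`, so that still `b₂ ^ k ≤ 2 / n`. -/
theorem exists_levels {b₁ b₂ ρ : ℝ} (hb₂ : 0 < b₂) (hb : b₂ < b₁) (hb₁ : b₁ < 1)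
    (hρ : ρ = Real.log (1 / b₁) / Real.log (1 / b₂)) {n u B₁ B₂ : ℕ} (hn : 2 ≤ n)
    (hB₁ : (B₁ : ℝ) ≤ b₁ * 2 ^ u) (hB₁' : b₁ * 2 ^ u - 1 ≤ B₁) (hB₂ : (B₂ : ℝ) ≤ b₂ * 2 ^ u)
    (hB₂' : b₂ * 2 ^ u - 1 ≤ B₂) (hN : 4 * levelConst b₂ / b₁ * (n : ℝ) ^ 2 ≤ 2 ^ u) :
    ∃ k r, Levels b₁ b₂ ρ n u B₁ B₂ k r := by
  classical
  have hb₁0 := hb₂.trans hb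
  have hb₂1 := hb.trans hb₁
  set κ := ⌈Real.log n / Real.log (1 / b₂)⌉₊ with hκ
  have hn' : (2 : ℝ) ≤ n := by exact_mod_cast hn
  have hN0 : (0 : ℝ) < 2 ^ u := by positivity
  have hB₁N : B₁ ≤ 2 ^ u := by
    have : (B₁ : ℝ) ≤ 2 ^ u := hB₁.trans (by nlinarith)
    exact_mod_cast this
  have hB₂N : B₂ ≤ 2 ^ u := by
    have : (B₂ : ℝ) ≤ 2 ^ u := hB₂.trans (by nlinarith)
    exact_mod_cast this
  have hex : fixPow u B₂ κ * n ≤ 2 ^ u := by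
    have h1 := fixPow_le_pow hB₂ κ
    have h2 := pow_ceil_le hb₂ hb₂1 hn
    have : (fixPow u B₂ κ : ℝ) * n ≤ 2 ^ u := by
      calc _ ≤ 2 ^ u * (1 / n) * (n : ℝ) := by gcongr; exact h1.trans (by gcongr)
        _ = _ := by field_simp
    exact_mod_cast this
  have hex' : ∃ k, fixPow u B₂ k * n ≤ 2 ^ u := ⟨κ, hex⟩
  set k := Nat.find hex' with hk
  have hkspec : fixPow u B₂ k * n ≤ 2 ^ u := Nat.find_spec hex'
  have hkκ : k ≤ κ := Nat.find_min' hex' hex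
  have hkle : (k : ℝ) ≤ levelConst b₂ * Real.log n :=
    le_trans (by exact_mod_cast hkκ) (ceil_le_levelConst hb₂ hb₂1 hn)
  have hk0 : 0 < k := by
    rw [Nat.pos_iff_ne_zero]
    intro h0
    rw [h0] at hkspec
    simp only [fixPow] at hkspec
    have : 2 ^ u * 2 ≤ 2 ^ u * n := Nat.mul_le_mul_left _ hn
    have : 0 < 2 ^ u := by positivity
    omega
  have hC := levelConst_pos hb₂ hb₂1
  have hlog : Real.log n ≤ n := (Real.log_le_sub_one_of_pos (by positivity)).trans (by linarith)
  have hkn : (k : ℝ) ≤ levelConst b₂ * n := hkle.trans (by gcongr)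
  obtain ⟨hρ0, hρ1⟩ := rho_mem hb₂ hb hb₁ hρ
  have hnρ : (n : ℝ) ^ ρ ≤ n := by
    calc (n : ℝ) ^ ρ ≤ (n : ℝ) ^ (1 : ℝ) := Real.rpow_le_rpow_of_exponent_le (by linarith) hρ1
      _ = n := Real.rpow_one _
  have hnρ0 : 0 < (n : ℝ) ^ ρ := by positivity
  have hpow : b₁ / (n : ℝ) ^ ρ ≤ b₁ ^ k :=
    (le_pow_ceil hb₁0 hb₁ hb₂ hb₂1 hρ hn).trans (pow_le_pow_of_le_one hb₁0.le hb₁.le hkκ)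
  have hbk : 0 < b₁ ^ k := by positivity
  -- The rounding loss `2 * k` is at most half of `2 ^ u * b₁ ^ k`. So `y` is at least half its
  -- ideal value, and minimality of `r` gives `r * b₁ ^ k ≤ 2 + b₁ ^ k ≤ 3`.
  have h4k : 4 * (k : ℝ) ≤ 2 ^ u * b₁ ^ k := by
    calc 4 * (k : ℝ) ≤ 4 * (levelConst b₂ * n) := by gcongr
      _ = 4 * levelConst b₂ / b₁ * n ^ 2 * (b₁ / n) := by field_simp
      _ ≤ 2 ^ u * (b₁ / (n : ℝ) ^ ρ) := by gcongr
      _ ≤ _ := by gcongr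
  set y := fixPow u B₁ k with hy
  have hy1 : 2 ^ u * b₁ ^ k / 2 ≤ (y : ℝ) := by
    have := pow_le_fixPow hb₁0.le hb₁.le hB₁' hB₁N k
    linarith
  have hy2 : (y : ℝ) ≤ 2 ^ u * b₁ ^ k := fixPow_le_pow hB₁ k
  have hy0 : (0 : ℝ) < y := lt_of_lt_of_le (by positivity) hy1
  have hy0' : 0 < y := by exact_mod_cast hy0
  have hexr : ∃ r, 2 ^ u ≤ r * y := ⟨2 ^ u, Nat.le_mul_of_pos_right _ hy0'⟩
  set r := Nat.find hexr with hr
  have hrspec : 2 ^ u ≤ r * y := Nat.find_spec hexr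
  have hrmin : ∀ i < r, i * y < 2 ^ u := fun i hi => not_le.1 (Nat.find_min hexr hi)
  have hr0 : 0 < r := by
    rw [Nat.pos_iff_ne_zero]
    intro h0
    rw [h0, zero_mul] at hrspec
    have : 0 < 2 ^ u := by positivity
    omega
  refine ⟨k, r, hk0, fun i hi => not_le.1 (Nat.find_min hex' hi), hkspec, hkle, hrmin, hrspec,
    ?_, ?_, ?_⟩
  · have h1 : ((r - 1 : ℕ) : ℝ) * y ≤ 2 ^ u := by exact_mod_cast (hrmin (r - 1) (by omega)).le
    rw [Nat.cast_sub hr0, Nat.cast_one] at h1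
    have h2 : ((r : ℝ) - 1) * (2 ^ u * b₁ ^ k / 2) ≤ 2 ^ u := by
      refine le_trans ?_ h1
      have : (1 : ℝ) ≤ r := by exact_mod_cast hr0
      gcongr
    have h3 : ((r : ℝ) - 1) * b₁ ^ k ≤ 2 := by
      have : (((r : ℝ) - 1) * b₁ ^ k) * 2 ^ u ≤ 2 * 2 ^ u := by nlinarith
      exact le_of_mul_le_mul_right this hN0
    have h4 : (r : ℝ) * b₁ ^ k ≤ 3 := by
      have : b₁ ^ k ≤ 1 := pow_le_one₀ hb₁0.le hb₁.le
      nlinarith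
    calc (r : ℝ) ≤ 3 / b₁ ^ k := by rw [le_div_iff₀ hbk]; exact h4
      _ ≤ 3 / (b₁ / (n : ℝ) ^ ρ) := by gcongr
      _ = _ := by field_simp
  · have h1 : (2 : ℝ) ^ u ≤ r * y := by exact_mod_cast hrspec
    have h2 : (2 : ℝ) ^ u * 1 ≤ 2 ^ u * (b₁ ^ k * r) := by
      calc (2 : ℝ) ^ u * 1 ≤ r * y := by linarith
        _ ≤ r * (2 ^ u * b₁ ^ k) := by gcongr
        _ = _ := by ring
    exact le_of_mul_le_mul_left h2 hN0
  · have h1 := pow_le_fixPow hb₂.le hb₂1.le hB₂' hB₂N k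
    have h2 : (fixPow u B₂ k : ℝ) * n ≤ 2 ^ u := by exact_mod_cast hkspec
    rw [le_div_iff₀ (by positivity)]
    have h3 : 2 * (k : ℝ) * n ≤ 2 ^ u := by
      calc 2 * (k : ℝ) * n ≤ 2 * (levelConst b₂ * n) * n := by gcongr
        _ ≤ 4 * levelConst b₂ / b₁ * n ^ 2 := by
          have : 2 * levelConst b₂ ≤ 4 * levelConst b₂ / b₁ := by
            rw [le_div_iff₀ hb₁0]; nlinarith
          calc 2 * (levelConst b₂ * n) * (n : ℝ) = 2 * levelConst b₂ * n ^ 2 := by ring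
            _ ≤ _ := by gcongr
        _ ≤ _ := hN
    have h5 : (2 ^ u * b₂ ^ k - 2 * k) * n ≤ fixPow u B₂ k * n := by gcongr
    have h4 : 2 ^ u * (b₂ ^ k * n) ≤ 2 ^ u * 2 := by
      have : (2 ^ u * b₂ ^ k - 2 * k) * (n : ℝ) = 2 ^ u * (b₂ ^ k * n) - 2 * k * n := by ring
      linarith
    exact le_of_mul_le_mul_left h4 hN0

/-- The least power of two that is at least `m`. -/
theorem exists_least_pow {m : ℕ} (hm : 0 < m) :
    ∃ v, (∀ i < v, 2 ^ i < m) ∧ m ≤ 2 ^ v ∧ 2 ^ v ≤ 2 * m := by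
  have hex : ∃ v, m ≤ 2 ^ v := ⟨m, Nat.lt_two_pow_self.le⟩
  refine ⟨Nat.find hex, fun i hi => not_le.1 (Nat.find_min hex hi), Nat.find_spec hex, ?_⟩
  rcases h : Nat.find hex with _ | i
  · simp; omega
  · have := not_le.1 (Nat.find_min hex (m := i) (by omega))
    rw [pow_succ]; omega

/-! ### Growth rates under rounding, and the choice of constants -/

/-- The bound on the expected growth of the number of paths in one level. -/
noncomputable def growth (u B₁ m : ℕ) : ℝ := 2 ^ u / B₁ + m / 2 ^ u

/-- The bound on the expected growth of the number of collisions in one level. -/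
noncomputable def collisionGrowth (u B₁ B₂ m : ℕ) : ℝ := (B₂ + 1) / 2 ^ u * growth u B₁ m

section Growth

variable {b₁ b₂ : ℝ} {u B₁ B₂ m k : ℕ}

theorem growth_mul_le (hb₁0 : 0 < b₁) (hb₁ : b₁ < 1) (hB₁' : b₁ * 2 ^ u - 1 ≤ B₁)
    (h2 : 2 / b₁ ≤ 2 ^ u) : growth u B₁ m * b₁ ≤ 1 + (2 / b₁ + m) / 2 ^ u := by
  have hN : (0 : ℝ) < 2 ^ u := by positivity
  have h3 : 2 ≤ b₁ * 2 ^ u := by rw [div_le_iff₀ hb₁0] at h2; linarith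
  have hB : (0 : ℝ) < B₁ := by linarith
  have h4 : 2 ^ u / B₁ * b₁ ≤ 1 + 2 / b₁ / 2 ^ u := by
    rw [div_mul_eq_mul_div, div_le_iff₀ hB]
    set z := b₁ * 2 ^ u with hz
    have e1 : (2 : ℝ) / b₁ / 2 ^ u = 2 / z := by rw [hz]; field_simp
    have e2 : 2 / z * z = 2 := by field_simp
    have e3 : 2 / z ≤ 1 := by rw [div_le_one (by linarith)]; exact h3
    have e4 : 0 ≤ 2 / z := by positivity
    rw [e1]
    calc 2 ^ u * b₁ = z := by rw [hz]; ring
      _ ≤ (1 + 2 / z) * (z - 1) := by nlinarith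
      _ ≤ _ := by gcongr
  have h5 : m / 2 ^ u * b₁ ≤ m / 2 ^ u := mul_le_of_le_one_right (by positivity) hb₁.le
  rw [growth, add_mul, add_div]
  linarith

theorem one_div_le_growth (hb₁0 : 0 < b₁) (hB₁ : (B₁ : ℝ) ≤ b₁ * 2 ^ u) (hB₁0 : 0 < B₁) :
    1 / b₁ ≤ growth u B₁ m := by
  have hB : (0 : ℝ) < B₁ := by exact_mod_cast hB₁0
  have : 1 / b₁ ≤ 2 ^ u / B₁ := by
    rw [div_le_div_iff₀ hb₁0 hB]; linarith
  have h2 : (0 : ℝ) ≤ m / 2 ^ u := by positivity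
  unfold growth; linarith

theorem growth_nonneg : 0 ≤ growth u B₁ m := by unfold growth; positivity

theorem collisionGrowth_nonneg : 0 ≤ collisionGrowth u B₁ B₂ m :=
  mul_nonneg (by positivity) growth_nonneg

theorem growth_pow_le (hb₁0 : 0 < b₁) (hb₁ : b₁ < 1) (hB₁' : b₁ * 2 ^ u - 1 ≤ B₁)
    (h2 : 2 / b₁ ≤ 2 ^ u) (hk : 2 * k * (2 / b₁ + m) ≤ 2 ^ u) :
    growth u B₁ m ^ k ≤ 2 * (1 / b₁ ^ k) := by
  have h := growth_mul_le (m := m) hb₁0 hb₁ hB₁' h2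
  have h1 : (growth u B₁ m * b₁) ^ k ≤ 2 := by
    refine (pow_le_pow_left₀ (mul_nonneg growth_nonneg hb₁0.le) h k).trans
      (one_add_pow_le (by positivity) ?_)
    rw [← mul_div_assoc, div_le_iff₀ (by positivity)]; linarith
  rw [mul_pow] at h1
  rw [mul_one_div, le_div_iff₀ (by positivity)]; exact h1

theorem collisionGrowth_le (hb₁0 : 0 < b₁) (hb₁ : b₁ < 1) (hb₂ : 0 < b₂)
    (hB₁' : b₁ * 2 ^ u - 1 ≤ B₁) (hB₂ : (B₂ : ℝ) ≤ b₂ * 2 ^ u) (h2 : 2 / b₁ ≤ 2 ^ u) :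
    collisionGrowth u B₁ B₂ m ≤
      b₂ * (1 + 1 / (2 ^ u * b₂)) * ((1 + (2 / b₁ + m) / 2 ^ u) * (1 / b₁)) := by
  have h := growth_mul_le (m := m) hb₁0 hb₁ hB₁' h2
  have h1 : ((B₂ : ℝ) + 1) / 2 ^ u ≤ b₂ * (1 + 1 / (2 ^ u * b₂)) := by
    have : b₂ * (1 + 1 / (2 ^ u * b₂)) = (b₂ * 2 ^ u + 1) / 2 ^ u := by field_simp
    rw [this]; gcongr
  have h3 : growth u B₁ m ≤ (1 + (2 / b₁ + m) / 2 ^ u) * (1 / b₁) := by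
    rw [mul_one_div, le_div_iff₀ hb₁0]; exact h
  unfold collisionGrowth
  exact mul_le_mul h1 h3 growth_nonneg (by positivity)

/-- Two rounding factors of at most `1 + δ / 3` with `δ = b₁ - b₂` do not close the gap between the
thresholds: `b₂ * (1 + δ / 3) ^ 2 ≤ b₂ + δ = b₁`, since `b₂` and `δ` are below one. -/
theorem collisionGrowth_le_one (hb₂ : 0 < b₂) (hb : b₂ < b₁) (hb₁ : b₁ < 1)
    (hB₁' : b₁ * 2 ^ u - 1 ≤ B₁) (hB₂ : (B₂ : ℝ) ≤ b₂ * 2 ^ u) (h2 : 2 / b₁ ≤ 2 ^ u)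
    (h3 : 3 / (b₁ - b₂) * (2 / b₁ + m) ≤ 2 ^ u) (h4 : 3 / ((b₁ - b₂) * b₂) ≤ 2 ^ u) :
    collisionGrowth u B₁ B₂ m ≤ 1 := by
  have hb₁0 := hb₂.trans hb
  have hd : 0 < b₁ - b₂ := by linarith
  have hN : (0 : ℝ) < 2 ^ u := by positivity
  refine (collisionGrowth_le hb₁0 hb₁ hb₂ hB₁' hB₂ h2).trans ?_
  have e1 : (2 / b₁ + m) / 2 ^ u ≤ (b₁ - b₂) / 3 := by
    rw [div_mul_eq_mul_div, div_le_iff₀ hd] at h3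
    rw [div_le_iff₀ hN]; linarith
  have e2 : 1 / (2 ^ u * b₂) ≤ (b₁ - b₂) / 3 := by
    rw [div_le_iff₀ (by positivity)] at h4 ⊢
    linarith
  calc _ ≤ b₂ * (1 + (b₁ - b₂) / 3) * ((1 + (b₁ - b₂) / 3) * (1 / b₁)) := by gcongr
    _ = b₂ * (1 + (b₁ - b₂) / 3) ^ 2 / b₁ := by ring
    _ ≤ 1 := by
      rw [div_le_one hb₁0]
      nlinarith [mul_pos hb₂ hd]

theorem collisionGrowth_pow_le (hb₁0 : 0 < b₁) (hb₁ : b₁ < 1) (hb₂ : 0 < b₂)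
    (hB₁' : b₁ * 2 ^ u - 1 ≤ B₁) (hB₂ : (B₂ : ℝ) ≤ b₂ * 2 ^ u) (h2 : 2 / b₁ ≤ 2 ^ u)
    (hk : 2 * k * (2 / b₁ + m) ≤ 2 ^ u) (hk' : 2 * k / b₂ ≤ 2 ^ u) :
    collisionGrowth u B₁ B₂ m ^ k ≤ 4 * b₂ ^ k * (1 / b₁ ^ k) := by
  have hN : (0 : ℝ) < 2 ^ u := by positivity
  refine (pow_le_pow_left₀ collisionGrowth_nonneg
    (collisionGrowth_le hb₁0 hb₁ hb₂ hB₁' hB₂ h2) k).trans ?_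
  have e1 : (1 + (2 / b₁ + m) / 2 ^ u) ^ k ≤ 2 := by
    refine one_add_pow_le (by positivity) ?_
    rw [← mul_div_assoc, div_le_iff₀ hN]; linarith
  have e2 : (1 + 1 / (2 ^ u * b₂)) ^ k ≤ 2 := by
    refine one_add_pow_le (by positivity) ?_
    rw [mul_one_div, div_le_iff₀ (by positivity)]
    rw [div_le_iff₀ hb₂] at hk'; linarith
  rw [mul_pow, mul_pow, mul_pow, one_div_pow]
  calc _ ≤ b₂ ^ k * 2 * (2 * (1 / b₁ ^ k)) := by gcongr
    _ = _ := by ring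

end Growth

/-- The constant in the bound on the size of the queue. -/
noncomputable def queueConst (b₁ b₂ : ℝ) : ℕ :=
  -- With `D = 1 / (1 - b₁)`: `levelConst` ensures `16 * k ^ 2 ≤ 2 ^ v`, `192 = 16 * (8 + 4)` covers
  -- the expected number of dissimilar candidates, `32 * (1 + D)` the expected length of the queue,
  -- and `(2 + D) * (1 + D)` the accidental collisions of keys.
  ⌈levelConst b₂ + 192 + 32 * (1 + 1 / (1 - b₁)) +
    (2 + 1 / (1 - b₁)) * (1 + 1 / (1 - b₁))⌉₊

/-- The word size is large enough for the data structure. -/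
structure Large (b₁ b₂ : ℝ) (n u m : ℕ) : Prop where
  inv_le : 2 / b₁ ≤ 2 ^ u
  mul_le : 2 * (levelConst b₂ * Real.log n) * (2 / b₁ + m) ≤ 2 ^ u
  div_le : 2 * (levelConst b₂ * Real.log n) / b₂ ≤ 2 ^ u
  gap_le : 3 / (b₁ - b₂) * (2 / b₁ + m) ≤ 2 ^ u
  gap_le' : 3 / ((b₁ - b₂) * b₂) ≤ 2 ^ u
  sq_le : 4 * levelConst b₂ / b₁ * (n : ℝ) ^ 2 ≤ 2 ^ u
  table_le : 48 * queueConst b₁ b₂ * levelConst b₂ / b₁ * (n : ℝ) ^ 3 ≤ 2 ^ u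
  sets_le : 2 * (n : ℝ) * (m + 1) ≤ 2 ^ u
  sixteen_le : 16 ≤ 2 ^ u

/-- All parameters of the data structure. -/
structure Tuned (b₁ b₂ ρ : ℝ) (n u m B₁ B₂ k r v : ℕ) : Prop extends
    Levels b₁ b₂ ρ n u B₁ B₂ k r where
  le_B₁ : b₁ * 2 ^ u - 1 ≤ B₁
  B₁_le : (B₁ : ℝ) ≤ b₁ * 2 ^ u
  B₂_le : (B₂ : ℝ) ≤ b₂ * 2 ^ u
  v_min : ∀ i < v, 2 ^ i < n * (queueConst b₁ b₂ * (16 * k * r))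
  v_spec : n * (queueConst b₁ b₂ * (16 * k * r)) ≤ 2 ^ v
  pow_v_le : 2 ^ v ≤ 2 * (n * (queueConst b₁ b₂ * (16 * k * r)))
  v_le : v ≤ u
  cap_le : ((queueConst b₁ b₂ * (16 * k * r) : ℕ) : ℝ) ≤
    48 * queueConst b₁ b₂ * levelConst b₂ / b₁ * ((n : ℝ) ^ ρ * Real.log n)
  cap_pos : 0 < queueConst b₁ b₂ * (16 * k * r)

theorem queueConst_pos (b₁ b₂ : ℝ) (hb₂ : 0 < b₂) (hb₂1 : b₂ < 1) (hb₁ : b₁ < 1) :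
    0 < queueConst b₁ b₂ := by
  have := levelConst_pos hb₂ hb₂1
  have h2 : 0 < 1 - b₁ := by linarith
  exact Nat.ceil_pos.2 (by positivity)

/-- The exponent of the table size stays within `u` because `n * cap` is at most a constant times `n
^ 3`, by `ρ ≤ 1` and `log n ≤ n`. -/
theorem exists_tuned {b₁ b₂ ρ : ℝ} (hb₂ : 0 < b₂) (hb : b₂ < b₁) (hb₁ : b₁ < 1)
    (hρ : ρ = Real.log (1 / b₁) / Real.log (1 / b₂)) {n u m B₁ B₂ : ℕ} (hn : 2 ≤ n)
    (hB₁ : (B₁ : ℝ) ≤ b₁ * 2 ^ u) (hB₁' : b₁ * 2 ^ u - 1 ≤ B₁) (hB₂ : (B₂ : ℝ) ≤ b₂ * 2 ^ u)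
    (hB₂' : b₂ * 2 ^ u - 1 ≤ B₂) (hL : Large b₁ b₂ n u m) :
    ∃ k r v, Tuned b₁ b₂ ρ n u m B₁ B₂ k r v := by
  obtain ⟨k, r, h⟩ := exists_levels hb₂ hb hb₁ hρ hn hB₁ hB₁' hB₂ hB₂' hL.sq_le
  have hK := queueConst_pos b₁ b₂ hb₂ (hb.trans hb₁) hb₁
  have hb₁0 := hb₂.trans hb
  have hC := levelConst_pos hb₂ (hb.trans hb₁)
  have hr : 0 < r := by
    rw [Nat.pos_iff_ne_zero]
    rintro rfl
    have := h.le_r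
    simp at this; linarith
  have hk := h.k_pos
  have hcap : 0 < queueConst b₁ b₂ * (16 * k * r) := by positivity
  have hn' : (2 : ℝ) ≤ n := by exact_mod_cast hn
  have hlog : 0 ≤ Real.log n := Real.log_natCast_nonneg n
  have hle : ((queueConst b₁ b₂ * (16 * k * r) : ℕ) : ℝ) ≤
      48 * queueConst b₁ b₂ * levelConst b₂ / b₁ * ((n : ℝ) ^ ρ * Real.log n) := by
    push_cast
    calc (queueConst b₁ b₂ : ℝ) * (16 * k * r)
        ≤ queueConst b₁ b₂ * (16 * (levelConst b₂ * Real.log n) * (3 / b₁ * (n : ℝ) ^ ρ)) := by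
          gcongr
          · exact h.k_le
          · exact h.r_le
      _ = _ := by ring
  obtain ⟨v, h1, h2, h3⟩ := exists_least_pow (m := n * (queueConst b₁ b₂ * (16 * k * r)))
    (by positivity)
  refine ⟨k, r, v, { h with
    le_B₁ := hB₁', B₁_le := hB₁, B₂_le := hB₂, v_min := h1, v_spec := h2,
    pow_v_le := h3, v_le := ?_, cap_le := hle, cap_pos := hcap }⟩
  by_contra! hc
  have h4 : ((n * (queueConst b₁ b₂ * (16 * k * r)) : ℕ) : ℝ) ≤ 2 ^ u := by
    have hl : Real.log n ≤ n := (Real.log_le_sub_one_of_pos (by positivity)).trans (by linarith)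
    have hnρ : (n : ℝ) ^ ρ ≤ n := by
      calc (n : ℝ) ^ ρ ≤ (n : ℝ) ^ (1 : ℝ) :=
            Real.rpow_le_rpow_of_exponent_le (by linarith) (rho_mem hb₂ hb hb₁ hρ).2
        _ = n := Real.rpow_one _
    rw [Nat.cast_mul]
    calc (n : ℝ) * _ ≤ n * (48 * queueConst b₁ b₂ * levelConst b₂ / b₁ * (n * n)) := by
          gcongr
          exact hle.trans (by gcongr)
      _ = 48 * queueConst b₁ b₂ * levelConst b₂ / b₁ * (n : ℝ) ^ 3 := by ring
      _ ≤ _ := hL.table_le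
  have h5 := h1 u hc
  have h6 : n * (queueConst b₁ b₂ * (16 * k * r)) ≤ 2 ^ u := by exact_mod_cast h4
  omega

/-- The conditions for the success of the query. -/
theorem Tuned.estimates {b₁ b₂ ρ : ℝ} (hb₂ : 0 < b₂) (hb : b₂ < b₁) (hb₁ : b₁ < 1)
    {n u m B₁ B₂ k r v : ℕ} (hn : 2 ≤ n) (hL : Large b₁ b₂ n u m)
    (h : Tuned b₁ b₂ ρ n u m B₁ B₂ k r v) {w cap : ℕ} {M lam D : ℝ} (hw : w = 16 * k)
    (hcap : cap = queueConst b₁ b₂ * (16 * k * r)) (hM : M = growth u B₁ m)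
    (hlam : lam = collisionGrowth u B₁ B₂ m) (hD : D = 1 / (1 - b₁)) :
    0 < B₁ ∧ 1 ≤ M ∧ 0 ≤ D ∧ 1 ≤ D * (M - 1) ∧ 0 ≤ lam ∧ lam ≤ 1 ∧
    (k : ℝ) ^ 2 / 2 ^ v + 2 * k / w ≤ 3 / 16 ∧ k * ((2 + D) * D) ≤ 2 ^ v ∧
    (1 + D) * M ^ k * w ≤ 1 / 16 * cap ∧
    n * (lam ^ k * w + (2 + D) * (1 + D) / 2 ^ v * M ^ (2 * k) * w ^ 2) ≤ 1 / 16 * cap := by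
  have hb₁0 := hb₂.trans hb
  have hk0 : (0 : ℝ) < k := by exact_mod_cast h.k_pos
  have hd : 0 < 1 - b₁ := by linarith
  have hD0 : 0 < D := by rw [hD]; positivity
  have hn' : (2 : ℝ) ≤ n := by exact_mod_cast hn
  have hC := levelConst_pos hb₂ (hb.trans hb₁)
  have hN : (0 : ℝ) < 2 ^ u := by positivity
  have hB₁ : (0 : ℝ) < B₁ := by
    have h1 := hL.inv_le
    rw [div_le_iff₀ hb₁0] at h1
    have := h.le_B₁
    linarith
  have hMge : 1 / b₁ ≤ M := by
    rw [hM]; exact one_div_le_growth hb₁0 h.B₁_le (by exact_mod_cast hB₁)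
  have hinv : 1 < 1 / b₁ := by rw [one_div]; exact (one_lt_inv₀ hb₁0).2 hb₁
  have hM1 : 1 ≤ M := by linarith
  have hDM : 1 ≤ D * (M - 1) := by
    have h1 : (1 - b₁) / b₁ ≤ M - 1 := by
      have : (1 - b₁) / b₁ = 1 / b₁ - 1 := by field_simp
      linarith
    calc (1 : ℝ) ≤ 1 / b₁ := hinv.le
      _ = D * ((1 - b₁) / b₁) := by rw [hD]; field_simp
      _ ≤ _ := by gcongr
  have hkm : 2 * k * (2 / b₁ + m) ≤ (2 : ℝ) ^ u := by
    refine le_trans ?_ hL.mul_le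
    have := h.k_le
    gcongr
  have hkb : 2 * k / b₂ ≤ (2 : ℝ) ^ u := by
    refine le_trans ?_ hL.div_le
    have := h.k_le
    gcongr
  have hbk : 0 < b₁ ^ k := by positivity
  have hrb : 1 / b₁ ^ k ≤ r := by
    rw [div_le_iff₀ hbk]; linarith [h.le_r]
  have hMk : M ^ k ≤ 2 * r := by
    rw [hM]
    refine (growth_pow_le hb₁0 hb₁ h.le_B₁ hL.inv_le hkm).trans ?_
    gcongr
  -- Rounding contributes 4, `b₂ ^ k` at most `2 / n`, and `1 / b₁ ^ k` at most `r`.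
  have hlk : lam ^ k ≤ 8 * r / n := by
    rw [hlam]
    refine (collisionGrowth_pow_le hb₁0 hb₁ hb₂ h.le_B₁ h.B₂_le hL.inv_le hkm hkb).trans ?_
    calc 4 * b₂ ^ k * (1 / b₁ ^ k) ≤ 4 * (2 / n) * r := by
          have := h.pow_le
          gcongr
      _ = _ := by ring
  set K : ℝ := (queueConst b₁ b₂ : ℝ) with hK
  have hKge : levelConst b₂ + 192 + 32 * (1 + D) + (2 + D) * (1 + D) ≤ K := by
    rw [hD]; exact Nat.le_ceil _
  have hr0 : (0 : ℝ) < r := lt_of_lt_of_le (by positivity) hrb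
  have hr1 : (1 : ℝ) ≤ r := by
    have : 0 < r := by exact_mod_cast hr0
    exact_mod_cast this
  have hcapR : (cap : ℝ) = K * (16 * k * r) := by rw [hcap]; push_cast; rfl
  have hwR : (w : ℝ) = 16 * k := by rw [hw]; push_cast; rfl
  have hv : n * (K * (16 * k * r)) ≤ (2 : ℝ) ^ v := by
    have : ((n * (queueConst b₁ b₂ * (16 * k * r)) : ℕ) : ℝ) ≤ ((2 ^ v : ℕ) : ℝ) :=
      Nat.cast_le.2 h.v_spec
    push_cast at this
    exact this
  have hDD : 0 ≤ (2 + D) * (1 + D) := by positivity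
  have hK0 : 0 < K := by
    linarith [mul_nonneg (by positivity : (0:ℝ) ≤ 32) (by positivity : 0 ≤ 1 + D)]
  have hkn : (k : ℝ) ≤ levelConst b₂ * n := by
    have hl : Real.log n ≤ n := (Real.log_le_sub_one_of_pos (by positivity)).trans (by linarith)
    exact h.k_le.trans (by gcongr)
  refine ⟨by exact_mod_cast hB₁, hM1, hD0.le, hDM, by rw [hlam]; exact collisionGrowth_nonneg, ?_,
    ?_, ?_, ?_, ?_⟩
  · rw [hlam]
    exact collisionGrowth_le_one hb₂ hb hb₁ h.le_B₁ h.B₂_le hL.inv_le hL.gap_le hL.gap_le'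
  · have h1 : (k : ℝ) ^ 2 / 2 ^ v ≤ 1 / 16 := by
      rw [div_le_iff₀ (by positivity)]
      have : 16 * (k : ℝ) ^ 2 ≤ 2 ^ v := by
        calc 16 * (k : ℝ) ^ 2 = 16 * k * k := by ring
          _ ≤ 16 * k * (levelConst b₂ * n) := by gcongr
          _ ≤ 16 * k * (K * n) := by
            gcongr
            have : (0 : ℝ) ≤ 32 * (1 + D) := by positivity
            linarith
          _ = n * (K * (16 * k * 1)) := by ring
          _ ≤ n * (K * (16 * k * r)) := by gcongr
          _ ≤ _ := hv
      linarith
    have h2 : 2 * (k : ℝ) / w = 1 / 8 := by rw [hwR]; field_simp; norm_num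
    rw [h2]; linarith
  · calc k * ((2 + D) * D) ≤ k * K := by
          gcongr
          have : (0 : ℝ) ≤ 32 * (1 + D) := by positivity
          nlinarith
      _ = 1 * (K * (1 * k * 1)) := by ring
      _ ≤ n * (K * (16 * k * r)) := by
          gcongr
          · linarith
          · norm_num
      _ ≤ _ := hv
  · rw [hcapR, hwR]
    calc (1 + D) * M ^ k * (16 * k) ≤ (1 + D) * (2 * r) * (16 * k) := by gcongr
      _ = 1 / 16 * ((32 * (1 + D)) * (16 * k * r)) := by ring
      _ ≤ _ := by
        gcongr
        linarith
  · rw [hcapR, hwR]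
    have h1 : n * (lam ^ k * (16 * k)) ≤ 8 * (16 * k * r) := by
      calc n * (lam ^ k * (16 * k)) ≤ n * (8 * r / n * (16 * k)) := by gcongr
        _ = _ := by field_simp
    have h2 : n * ((2 + D) * (1 + D) / 2 ^ v * M ^ (2 * k) * (16 * k) ^ 2) ≤
        4 * (16 * k * r) := by
      have e1 : M ^ (2 * k) ≤ 4 * r ^ 2 := by
        calc M ^ (2 * k) = (M ^ k) ^ 2 := by ring
          _ ≤ (2 * r) ^ 2 := by gcongr
          _ = _ := by ring
      have e2 : (2 + D) * (1 + D) / 2 ^ v ≤ K / (n * (K * (16 * k * r))) := by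
        gcongr
        linarith [mul_nonneg (by positivity : (0:ℝ) ≤ 32) (by positivity : 0 ≤ 1 + D)]
      calc n * ((2 + D) * (1 + D) / 2 ^ v * M ^ (2 * k) * (16 * k) ^ 2)
          ≤ n * (K / (n * (K * (16 * k * r))) * (4 * r ^ 2) * (16 * k) ^ 2) := by gcongr
        _ = _ := by field_simp
    have h3 : 192 ≤ K := by
      linarith [mul_nonneg (by positivity : (0:ℝ) ≤ 32) (by positivity : 0 ≤ 1 + D)]
    refine (mul_add (n : ℝ) _ _).le.trans ((add_le_add h1 h2).trans ?_)
    calc 8 * (16 * (k : ℝ) * r) + 4 * (16 * (k : ℝ) * r) = 1 / 16 * (192 * (16 * (k : ℝ) * r)) := by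
          ring
      _ ≤ _ := by gcongr

/-- A word size of a large multiple of `log n` is large enough. -/
theorem exists_large {b₁ b₂ : ℝ} (hb₂ : 0 < b₂) (hb : b₂ < b₁) (hb₁ : b₁ < 1) (a : ℕ) :
    ∃ c₀ : ℝ, 0 < c₀ ∧ ∀ n W m : ℕ, 2 ≤ n → m ≤ n ^ a → c₀ * Real.logb 2 n ≤ W →
      Large b₁ b₂ n (W / 4) m := by
  have hb₁0 := hb₂.trans hb
  have hd : 0 < b₁ - b₂ := by linarith
  have hC := levelConst_pos hb₂ (hb.trans hb₁)
  have hK : (0 : ℝ) < queueConst b₁ b₂ := by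
    exact_mod_cast queueConst_pos b₁ b₂ hb₂ (hb.trans hb₁) hb₁
  set C := levelConst b₂ with hCdef
  set K : ℝ := (queueConst b₁ b₂ : ℝ) with hKdef
  -- `Γ` exceeds every coefficient that occurs in `Large`, so all conditions follow from `Γ * n ^ (a
  -- + 3) ≤ 2 ^ (W / 4)`.
  set Γ : ℝ := 2 / b₁ + 2 * C * (2 / b₁ + 1) + 2 * C / b₂ + 3 / (b₁ - b₂) * (2 / b₁ + 1) +
    3 / ((b₁ - b₂) * b₂) + 4 * C / b₁ + 48 * K * C / b₁ + 4 + 16 with hΓ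
  have g1 : 0 < 2 / b₁ := by positivity
  have g2 : 0 < 2 * C * (2 / b₁ + 1) := by positivity
  have g3 : 0 < 2 * C / b₂ := by positivity
  have g4 : 0 < 3 / (b₁ - b₂) * (2 / b₁ + 1) := by positivity
  have g5 : 0 < 3 / ((b₁ - b₂) * b₂) := by positivity
  have g6 : 0 < 4 * C / b₁ := by positivity
  have g7 : 0 < 48 * K * C / b₁ := by positivity
  have hΓ1 : 1 ≤ Γ := by linarith
  have hl : 0 ≤ Real.logb 2 (2 * Γ) := Real.logb_nonneg (by norm_num) (by linarith)
  -- The factor 4 reflects `u = W / 4`, and the 2 in `2 * Γ` compensates for the rounding in this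
  -- division.
  refine ⟨4 * ((a + 3 : ℕ) + Real.logb 2 (2 * Γ)), by push_cast; positivity, ?_⟩
  intro n W m hn hm hW
  have hn' : (2 : ℝ) ≤ n := by exact_mod_cast hn
  have hn0 : (0 : ℝ) < n := by linarith
  have hn1 : (1 : ℝ) ≤ n := by linarith
  have hlogn : 1 ≤ Real.logb 2 n := by
    rw [Real.le_logb_iff_rpow_le (by norm_num) hn0]; simpa using hn'
  have hbig : Γ * (n : ℝ) ^ (a + 3) ≤ 2 ^ (W / 4) := by
    have h1 : ((W / 4 : ℕ) : ℝ) ≥ (a + 3 : ℕ) * Real.logb 2 n + Real.logb 2 (2 * Γ) - 1 := by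
      have : (W : ℝ) ≤ 4 * ((W / 4 : ℕ) : ℝ) + 3 := by exact_mod_cast (by omega)
      nlinarith
    have h2 : (2 : ℝ) ^ ((a + 3 : ℕ) * Real.logb 2 n + Real.logb 2 (2 * Γ) - 1) ≤
        2 ^ ((W / 4 : ℕ) : ℝ) := Real.rpow_le_rpow_of_exponent_le (by norm_num) h1
    rw [Real.rpow_natCast] at h2
    refine le_trans (le_of_eq ?_) h2
    rw [Real.rpow_sub (by norm_num), Real.rpow_add (by norm_num),
      Real.rpow_logb (by norm_num) (by norm_num) (by linarith), mul_comm ((a + 3 : ℕ) : ℝ),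
      Real.rpow_mul (by norm_num), Real.rpow_logb (by norm_num) (by norm_num) hn0,
      Real.rpow_natCast, Real.rpow_one]
    ring
  have hlog : Real.log n ≤ n := (Real.log_le_sub_one_of_pos (by positivity)).trans (by linarith)
  have hm' : (m : ℝ) ≤ (n : ℝ) ^ a := by exact_mod_cast hm
  have hna : (1 : ℝ) ≤ (n : ℝ) ^ a := one_le_pow₀ hn1
  have key (c : ℝ) (j : ℕ) (x : ℝ) (hj : j ≤ a + 3) (hc0 : 0 ≤ c) (hc : c ≤ Γ)
      (hx : x ≤ c * (n : ℝ) ^ j) : x ≤ 2 ^ (W / 4) := by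
    refine hx.trans (le_trans ?_ hbig)
    gcongr
  have hma : 2 / b₁ + m ≤ (2 / b₁ + 1) * (n : ℝ) ^ a := by nlinarith
  refine ⟨?_, ?_, ?_, ?_, ?_, ?_, ?_, ?_, ?_⟩
  · exact key (2 / b₁) 0 _ (by omega) g1.le (by linarith) (by simp)
  · refine key (2 * C * (2 / b₁ + 1)) (a + 1) _ (by omega) g2.le (by linarith) ?_
    calc 2 * (C * Real.log n) * (2 / b₁ + m) ≤ 2 * (C * n) * ((2 / b₁ + 1) * (n : ℝ) ^ a) := by
          gcongr
      _ = _ := by ring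
  · refine key (2 * C / b₂) 1 _ (by omega) g3.le (by linarith) ?_
    calc 2 * (C * Real.log n) / b₂ ≤ 2 * (C * n) / b₂ := by gcongr
      _ = _ := by ring
  · refine key (3 / (b₁ - b₂) * (2 / b₁ + 1)) a _ (by omega) g4.le (by linarith) ?_
    calc 3 / (b₁ - b₂) * (2 / b₁ + m) ≤ 3 / (b₁ - b₂) * ((2 / b₁ + 1) * (n : ℝ) ^ a) := by gcongr
      _ = _ := by ring
  · exact key (3 / ((b₁ - b₂) * b₂)) 0 _ (by omega) g5.le (by linarith) (by simp)
  · exact key (4 * C / b₁) 2 _ (by omega) g6.le (by linarith) le_rfl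
  · exact key (48 * K * C / b₁) 3 _ (by omega) g7.le (by linarith) le_rfl
  · refine key 4 (a + 1) _ (by omega) (by norm_num) (by linarith) ?_
    calc 2 * (n : ℝ) * (m + 1) ≤ 2 * n * ((n : ℝ) ^ a + (n : ℝ) ^ a) := by gcongr
      _ = _ := by ring
  · have := key 16 0 16 (by omega) (by norm_num) (by linarith) (by simp)
    exact_mod_cast this

/-! ### Sets as lists -/

/-- The elements of a set in increasing order. -/
def elems {d : ℕ} (x : Finset (Fin d)) : List ℕ := (x.sort (· ≤ ·)).map Fin.val

section Elems

variable {d : ℕ} (x y : Finset (Fin d))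

@[simp] theorem length_elems : (elems x).length = x.card := by simp [elems]

theorem mem_elems {j : ℕ} : j ∈ elems x ↔ ∃ h : j < d, (⟨j, h⟩ : Fin d) ∈ x := by
  simp only [elems, List.mem_map, Finset.mem_sort]
  constructor
  · rintro ⟨i, hi, rfl⟩; exact ⟨i.2, hi⟩
  · rintro ⟨h, hi⟩; exact ⟨_, hi, rfl⟩

theorem lt_of_mem_elems {j : ℕ} (h : j ∈ elems x) : j < d := ((mem_elems x).1 h).1

theorem pairwise_elems : (elems x).Pairwise (· < ·) := by
  rw [elems, List.pairwise_map]
  exact (Finset.sortedLT_sort x).pairwise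

theorem nodup_elems : (elems x).Nodup := (pairwise_elems x).imp fun h => h.ne

theorem common_elems : common (elems x) (elems y) = (x ∩ y).card := by
  rw [common, elems.eq_1 x, List.filter_map, List.length_map]
  have : (x ∩ y) = ((x.sort (· ≤ ·)).filter fun i => (Fin.val i : ℕ) ∈ elems y).toFinset := by
    ext i
    simp [mem_elems]
  rw [this, List.toFinset_card_of_nodup ((Finset.sort_nodup _ _).filter _)]
  rfl

end Elems

theorem common_le_left (x q : List ℕ) : common x q ≤ x.length := List.length_filter_le _ _

theorem common_eq_card {x q : List ℕ} (hx : x.Nodup) :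
    common x q = (x.toFinset ∩ q.toFinset).card := by
  rw [common, ← List.toFinset_card_of_nodup (hx.filter _)]
  congr 1
  ext i; simp

theorem common_comm {x q : List ℕ} (hx : x.Nodup) (hq : q.Nodup) : common x q = common q x := by
  rw [common_eq_card hx, common_eq_card hq, Finset.inter_comm]

/-! ### Similarity thresholds in integer arithmetic -/

section Thresholds

variable {g : Shape} {b₁ b₂ : ℝ} {B₁ B₂ m : ℕ} {x q : List ℕ}

theorem length_mul_prob_le (hB₁ : 0 < B₁) (hx : x.length ≤ m) :
    x.length * g.prob (B₁ * x.length) ≤ growth g.u B₁ m := by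
  rcases Nat.eq_zero_or_pos x.length with h0 | h0
  · rw [h0]; simpa using growth_nonneg
  · have h1 := Shape.prob_le (g := g) (c := B₁ * x.length) (by positivity)
    have hx0 : (0 : ℝ) < x.length := by exact_mod_cast h0
    have hB : (0 : ℝ) < B₁ := by exact_mod_cast hB₁
    calc x.length * g.prob (B₁ * x.length)
        ≤ x.length * (2 ^ g.u / (B₁ * x.length : ℕ) + 1 / 2 ^ g.u) := by gcongr
      _ = 2 ^ g.u / B₁ + x.length / 2 ^ g.u := by push_cast; field_simp
      _ ≤ _ := by unfold growth; gcongr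

/-- If the test fails, the intersection is small relative to one of the two sets. The survival
probability of that set bounds the minimum, which gives a rate of about `b₂ / b₁`. -/
theorem common_mul_prob_le (hxs : x.Nodup) (hqs : q.Nodup) (hB₁ : 0 < B₁) (hx : x.length ≤ m)
    (hq : q.length ≤ m)
    (h : ¬ Similar (B₂ + 1) (2 ^ g.u) q x) :
    common q x * min (g.prob (B₁ * q.length)) (g.prob (B₁ * x.length)) ≤
      collisionGrowth g.u B₁ B₂ m := by
  have main (y : List ℕ) (hy : y.length ≤ m) (h : common q x * 2 ^ g.u < y.length * (B₂ + 1)) :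
      common q x * g.prob (B₁ * y.length) ≤ collisionGrowth g.u B₁ B₂ m := by
    have h1 : (common q x : ℝ) ≤ (B₂ + 1) / 2 ^ g.u * y.length := by
      rw [div_mul_eq_mul_div, le_div_iff₀ (by positivity)]
      have : ((common q x * 2 ^ g.u : ℕ) : ℝ) ≤ ((y.length * (B₂ + 1) : ℕ) : ℝ) :=
        Nat.cast_le.2 h.le
      push_cast at this
      linarith
    calc common q x * g.prob (B₁ * y.length)
        ≤ (B₂ + 1) / 2 ^ g.u * y.length * g.prob (B₁ * y.length) :=
          mul_le_mul_of_nonneg_right h1 (Shape.prob_nonneg _)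
      _ = (B₂ + 1) / 2 ^ g.u * (y.length * g.prob (B₁ * y.length)) := by ring
      _ ≤ _ := mul_le_mul_of_nonneg_left (length_mul_prob_le hB₁ hy) (by positivity)
  simp only [Similar, not_and_or, not_le] at h
  rcases h with h | h
  · refine le_trans ?_ (main x hx (by rwa [common_comm hxs hqs] at h))
    exact mul_le_mul_of_nonneg_left (min_le_right _ _) (by positivity)
  · refine le_trans ?_ (main q hq (by rwa [common_comm hxs hqs] at h))
    exact mul_le_mul_of_nonneg_left (min_le_left _ _) (by positivity)

/-- Since `B₁` is rounded down, an element survives with probability at least `min 1 (1 / (b₁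
max))`, where `max` is the larger size. In the second case `b₁ max` common elements give mean one;
in the first a single common element suffices. -/
theorem one_le_common_mul_prob (hb₁0 : 0 < b₁) (hB₁ : 0 < B₁) (hB₁' : (B₁ : ℝ) ≤ b₁ * 2 ^ g.u)
    (hpos : 0 < max q.length x.length)
    (h : b₁ * (max q.length x.length : ℕ) ≤ common q x) :
    1 ≤ common q x * g.prob (B₁ * max q.length x.length) := by
  set y := max q.length x.length with hy
  have hy0 : (0 : ℝ) < y := by exact_mod_cast hpos
  have hB : (0 : ℝ) < B₁ := by exact_mod_cast hB₁
  have hc : (0 : ℝ) < common q x := lt_of_lt_of_le (by positivity) h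
  have hc1 : (1 : ℝ) ≤ common q x := by
    have : 0 < common q x := by exact_mod_cast hc
    exact_mod_cast this
  refine le_trans ?_ (mul_le_mul_of_nonneg_left
    (Shape.le_prob (g := g) (c := B₁ * y) (by positivity)) hc.le)
  rw [mul_min_of_nonneg _ _ hc.le, mul_one]
  refine le_min hc1 ?_
  rw [← mul_div_assoc, le_div_iff₀ (by positivity), one_mul]
  push_cast
  calc (B₁ : ℝ) * y ≤ b₁ * 2 ^ g.u * y := by gcongr
    _ = b₁ * y * 2 ^ g.u := by ring
    _ ≤ _ := by gcongr

/-- Completeness of the test. It is applied with `s = b₁` and `b = B₂ + 1`, where the gap between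
the thresholds absorbs the rounding. -/
theorem similar_of_le (hxs : x.Nodup) (hqs : q.Nodup) {b N : ℕ} {s : ℝ}
    (hb : (b : ℝ) ≤ s * N)
    (h : s * (max q.length x.length : ℕ) ≤ common q x) : Similar b N q x := by
  have main (y : ℕ) (hy : y ≤ max q.length x.length) (hs : 0 ≤ s ∨ N = 0) :
      y * b ≤ common q x * N := by
    rcases hs with hs | hs
    · have hy' : (y : ℝ) ≤ (max q.length x.length : ℕ) := by exact_mod_cast hy
      have : (y : ℝ) * b ≤ common q x * N := by
        calc (y : ℝ) * b ≤ (max q.length x.length : ℕ) * (s * N) := by gcongr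
          _ = s * (max q.length x.length : ℕ) * N := by ring
          _ ≤ _ := by gcongr
      exact_mod_cast this
    · have : b = 0 := by
        rw [hs] at hb
        have : (b : ℝ) ≤ 0 := by simpa using hb
        exact_mod_cast le_antisymm this (by positivity)
      simp [this]
  -- A negative `s` contradicts `0 ≤ b ≤ s * N` unless `N = 0`.
  have hs : 0 ≤ s ∨ N = 0 := by
    by_contra! hc
    have h1 : (0 : ℝ) < N := by exact_mod_cast Nat.pos_of_ne_zero hc.2
    have h2 : (0 : ℝ) ≤ s * N := le_trans (by positivity) hb
    have := nonneg_of_mul_nonneg_left h2 h1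
    linarith [hc.1]
  refine ⟨?_, ?_⟩
  · rw [common_comm hxs hqs]; exact main _ (le_max_right _ _) hs
  · rw [common_comm hxs hqs]; exact main _ (le_max_left _ _) hs

/-- Soundness of the test. The integer threshold `b` lies strictly above `s * N`, which yields the
strict inequality demanded of an answer. -/
theorem lt_of_similar (hxs : x.Nodup) (hqs : q.Nodup) {b N : ℕ} {s : ℝ} (hN : 0 < N)
    (hb : s * N < b) (hq : 0 < q.length)
    (h : Similar b N q x) : s * (max q.length x.length : ℕ) < common q x := by
  have h1 : max q.length x.length * b ≤ common q x * N := by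
    rcases max_cases q.length x.length with ⟨h', _⟩ | ⟨h', _⟩ <;> rw [h']
    · rw [common_comm hqs hxs]; exact h.2
    · rw [common_comm hqs hxs]; exact h.1
  have hN' : (0 : ℝ) < N := by exact_mod_cast hN
  have h2 : (0 : ℝ) < (max q.length x.length : ℕ) := by
    exact_mod_cast hq.trans_le (le_max_left _ _)
  have h3 : ((max q.length x.length : ℕ) : ℝ) * b ≤ common q x * N := by exact_mod_cast h1
  have h4 : (max q.length x.length : ℕ) * (s * N) < (max q.length x.length : ℕ) * (b : ℝ) := by
    gcongr
  have h5 : s * (max q.length x.length : ℕ) * N < common q x * N := by linarith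
  exact lt_of_mul_lt_mul_right h5 hN'.le

end Thresholds

/-- The data structure succeeds with probability at least `1 / 2`. -/
theorem Tuned.half_le_chance {b₁ b₂ ρ : ℝ} (hb₂ : 0 < b₂) (hb : b₂ < b₁) (hb₁ : b₁ < 1)
    {g : Shape} {n m B₁ B₂ k r : ℕ} (hn : 2 ≤ n) (hL : Large b₁ b₂ n g.u m)
    (h : Tuned b₁ b₂ ρ n g.u m B₁ B₂ k r g.v) (h4 : 4 * g.u ≤ g.W) (hm : m ≤ 2 ^ g.u)
    {w cap : ℕ} (hw : w = 16 * k) (hcap : cap = queueConst b₁ b₂ * (16 * k * r))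
    (hw2 : w ≤ 2 ^ g.u) {X : ℕ → List ℕ} {q : List ℕ} (hX : ∀ i < n, ∀ j ∈ X i, j < m)
    (hXs : ∀ i < n, (X i).Nodup) (hXm : ∀ i < n, (X i).length ≤ m)
    (hq : ∀ j ∈ q, j < m) (hqs : q.Nodup) (hqm : q.length ≤ m) {i₀ : ℕ} (hi₀ : i₀ < n)
    (hsim : b₁ * (max q.length (X i₀).length : ℕ) ≤ common q (X i₀)) (hq0 : 0 < q.length) :
    1 / 2 ≤ chance g.W k fun ts =>
      HasCandidate (fun i => i < n ∧ Similar (B₂ + 1) (2 ^ g.u) q (X i))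
        ((keysOf g ts w cap B₁ q).flatMap
          (chainsOf (fun i => keysOf g ts w cap B₁ (X i)) n)) cap := by
  obtain ⟨e1, e2, e3, e4, e5, e6, e7, e8, e9, e10⟩ :=
    h.estimates hb₂ hb hb₁ hn hL hw hcap rfl rfl rfl
  have hvu := h.v_le
  have hd : 0 < b₁ - b₂ := by linarith
  refine half_le_chance_hasCandidate (by omega) hvu hw2 (by have := h.k_pos; omega)
    (by rw [hcap]; exact h.cap_pos) (fun i hi j hj => (hX i hi j hj).trans_le hm) hXs
    (fun j hj => (hq j hj).trans_le hm) hqs (fun i hi => length_mul_prob_le e1 (hXm i hi))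
    (length_mul_prob_le e1 hqm) e2 e3 e4 e5 e6
    (fun i hi hs => common_mul_prob_le (hXs i hi) hqs e1 (hXm i hi) hqm hs) hi₀ ?_ ?_ e7 e8 e9 e10
  · refine similar_of_le (hXs _ hi₀) hqs (s := b₁) ?_ hsim
    push_cast
    have h1 := hL.gap_le
    have h2 : 1 / (b₁ - b₂) ≤ 3 / (b₁ - b₂) * (2 / b₁ + m) := by
      have hbb : 1 ≤ 2 / b₁ := by rw [le_div_iff₀ (hb₂.trans hb)]; linarith
      have hm0 : (0 : ℝ) ≤ m := by positivity
      rw [div_mul_eq_mul_div]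
      gcongr
      linarith
    have h3 := h2.trans h1
    rw [div_le_iff₀ hd] at h3
    have := h.B₂_le
    linarith
  · exact one_le_common_mul_prob (hb₂.trans hb) e1 h.B₁_le (hq0.trans_le (le_max_left _ _)) hsim

/-! ### Random words as coefficients -/

theorem coefficients_succ (f : ℕ → ℕ) (k : ℕ) :
    coefficients f (k + 1) = (f 0, f 1, f 2) :: coefficients (fun i => f (i + 3)) k := by
  rw [coefficients, List.range_succ_eq_map, List.map_cons, List.map_map]
  rfl

theorem coefficients_congr {f f' : ℕ → ℕ} {k : ℕ} (h : ∀ i < 3 * k, f i = f' i) :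
    coefficients f k = coefficients f' k := by
  refine List.map_congr_left fun i hi => ?_
  have := List.mem_range.1 hi
  rw [h _ (by omega), h _ (by omega), h _ (by omega)]

theorem exists_coefficients {W k : ℕ} {ts : List (ℕ × ℕ × ℕ)} (h : ts ∈ Shape.tripleLists W k) :
    ∃ f : ℕ → Fin (2 ^ W), coefficients (fun i => f i) k = ts := by
  induction k generalizing ts with
  | zero =>
    simp only [Shape.tripleLists, Finset.mem_singleton] at h
    exact ⟨fun _ => ⟨0, by positivity⟩, by simp [coefficients, h]⟩
  | succ k ih =>
    simp only [Shape.tripleLists, Finset.mem_image, Finset.mem_product, Prod.exists] at h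
    obtain ⟨A, B, C, ts', ⟨ht, hts⟩, rfl⟩ := h
    obtain ⟨f, rfl⟩ := ih hts
    simp only [triples, Finset.mem_product, Finset.mem_range] at ht
    refine ⟨fun i => match i with
      | 0 => ⟨A, ht.1⟩
      | 1 => ⟨B, ht.2.1⟩
      | 2 => ⟨C, ht.2.2⟩
      | i + 3 => f i, ?_⟩
    rw [coefficients_succ]

theorem card_tripleLists (W k : ℕ) : (Shape.tripleLists W k).card = (2 ^ W) ^ (3 * k) := by
  induction k with
  | zero => simp [Shape.tripleLists]
  | succ k ih =>
    rw [Shape.tripleLists, Finset.card_image_of_injective, Finset.card_product, ih, card_triples,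
      ← pow_add]
    · congr 1; omega
    · rintro ⟨t, ts⟩ ⟨t', ts'⟩ h
      simpa using h

theorem randomWords_pi (W m : ℕ) (f : ℕ → Fin (2 ^ W)) :
    randomWords W (Set.pi (Finset.range m) fun i => {f i}) = ((2 ^ W : ENNReal)⁻¹) ^ m := by
  rw [randomWords, Measure.infinitePi_pi]
  · simp
  · intro i _; exact MeasurableSet.singleton _

/-- Events that depend on the coefficients. -/
theorem ofReal_chance_le (W k : ℕ) (p : List (ℕ × ℕ × ℕ) → Prop) :
    ENNReal.ofReal (chance W k p) ≤ randomWords W {ω | p (coefficients (fun i => ω i) k)} := by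
  classical
  choose! f hf using fun ts (h : ts ∈ Shape.tripleLists W k) => exists_coefficients h
  -- One cylinder for each list of coefficients, fixing the first `3 * k` words. The cylinders are
  -- disjoint and equally likely; only a lower bound is needed, so the event itself need not be
  -- measurable.
  set B : List (ℕ × ℕ × ℕ) → Set (ℕ → Fin (2 ^ W)) := fun ts =>
    Set.pi (Finset.range (3 * k)) fun i => {f ts i} with hB
  have hBmem : ∀ ts ∈ Shape.tripleLists W k, ∀ ω ∈ B ts, coefficients (fun i => ω i) k = ts := by
    intro ts hts ω hω
    rw [← hf ts hts]
    refine coefficients_congr fun i hi => ?_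
    have := hω i (by simpa using hi)
    simp only [Set.mem_singleton_iff] at this
    rw [this]
  have hsub : (⋃ ts ∈ (Shape.tripleLists W k).filter p, B ts) ⊆
      {ω | p (coefficients (fun i => ω i) k)} := by
    intro ω hω
    simp only [Set.mem_iUnion] at hω
    obtain ⟨ts, hts, hω⟩ := hω
    obtain ⟨h1, h2⟩ := Finset.mem_filter.1 hts
    simp only [Set.mem_ofPred_eq, hBmem ts h1 ω hω, h2]
  refine le_trans ?_ (measure_mono hsub)
  rw [measure_biUnion_finset]
  · simp only [hB, randomWords_pi, Finset.sum_const, nsmul_eq_mul]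
    rw [chance, Finset.expect_eq_sum_div_card, Finset.sum_boole, card_tripleLists,
      ENNReal.ofReal_div_of_pos (by positivity), ENNReal.ofReal_natCast, ENNReal.ofReal_natCast,
      div_eq_mul_inv]
    push_cast
    rw [ENNReal.inv_pow]
  · intro ts hts ts' hts' hne
    refine Set.disjoint_left.2 fun ω h h' => hne ?_
    rw [← hBmem ts (Finset.mem_filter.1 hts).1 ω h, hBmem ts' (Finset.mem_filter.1 hts').1 ω h']
  · intro ts _
    exact MeasurableSet.pi (Finset.countable_toSet _) fun i _ => MeasurableSet.singleton _

/-! ### Inputs -/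

theorem reads_toInput {W : ℕ} (l : List (BitVec W)) :
    Reads (fun i => (toInput l i).toNat) 0 (l.map BitVec.toNat) := by
  intro i h
  rw [List.length_map] at h
  simp [toInput, h]

theorem map_toNat_encodeSet {W d : ℕ} (x : Finset (Fin d)) (hd : d < 2 ^ W) :
    (encodeSet W x).map BitVec.toNat = (elems x).length :: elems x := by
  have hx : x.card < 2 ^ W := (card_finset_fin_le x).trans_lt hd
  rw [encodeSet, List.map_cons, List.map_map, length_elems, BitVec.toNat_ofNat,
    Nat.mod_eq_of_lt hx, elems]
  congr 1
  simp only [bind_pure_comp, List.map_eq_map, List.map_map]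
  refine List.map_congr_left fun j _ => ?_
  simp [Nat.mod_eq_of_lt (j.2.trans hd)]

/-- A family of sets as a family of lists, indexed by natural numbers. -/
def family {n d : ℕ} (P : Fin n → Finset (Fin d)) (i : ℕ) : List ℕ :=
  if h : i < n then elems (P ⟨i, h⟩) else []

section Family

variable {n d : ℕ} (P : Fin n → Finset (Fin d))

theorem family_of_lt {i : ℕ} (h : i < n) : family P i = elems (P ⟨i, h⟩) := dif_pos h

theorem lt_of_mem_family {i j : ℕ} (h : j ∈ family P i) : j < d := by
  unfold family at h
  split_ifs at h
  · exact lt_of_mem_elems _ h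
  · simp at h

theorem pairwise_family (i : ℕ) : (family P i).Pairwise (· < ·) := by
  unfold family
  split_ifs
  · exact pairwise_elems _
  · exact List.Pairwise.nil

theorem length_family_le (i : ℕ) : (family P i).length ≤ d := by
  unfold family
  split_ifs
  · rw [length_elems]; exact card_finset_fin_le _
  · simp

theorem sum_length_family (f : ℕ → ℕ) :
    ∑ i ∈ Finset.range n, f (family P i).length = ∑ i, f (P i).card := by
  rw [Finset.sum_range]
  refine Finset.sum_congr rfl fun i _ => ?_
  rw [family_of_lt P i.2, length_elems]

end Family

theorem reads_flatten {f : ℕ → ℕ} {p n : ℕ} {G : ℕ → List ℕ}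
    (h : Reads f p ((List.range n).map G).flatten) {i : ℕ} (hi : i < n) :
    Reads f (p + ∑ j ∈ Finset.range i, (G j).length) (G i) := by
  induction n with
  | zero => omega
  | succ n ih =>
    rw [List.range_succ, List.map_append, List.flatten_append, Reads.append_iff] at h
    by_cases hin : i < n
    · exact ih h.1 hin
    · obtain rfl : i = n := by omega
      have : ((List.range i).map G).flatten.length = ∑ j ∈ Finset.range i, (G j).length := by
        clear h ih hi hin
        induction i with
        | zero => simp
        | succ i ih => simp [List.range_succ, Finset.sum_range_succ] at ih ⊢; omega
      rw [this] at h
      simpa using h.2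

theorem map_toNat_encodeData {W n d : ℕ} {b₁ b₂ : ℝ} (P : Fin n → Finset (Fin d))
    (hd : d < 2 ^ W) :
    (encodeData W b₁ b₂ P).map BitVec.toNat = [n % 2 ^ W, d % 2 ^ W, W % 2 ^ W,
      ⌊b₁ * 2 ^ W⌋₊ % 2 ^ W, ⌊b₂ * 2 ^ W⌋₊ % 2 ^ W] ++
      ((List.range n).map fun i => (family P i).length :: family P i).flatten := by
  rw [encodeData, List.map_append]
  congr 1
  rw [List.map_flatten]
  congr 1
  refine List.ext_getElem (by simp) fun i h1 h2 => ?_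
  have hi : i < n := by simpa using h2
  simp only [List.getElem_map, List.getElem_ofFn, List.getElem_range]
  rw [map_toNat_encodeSet _ hd, family_of_lt P hi]

theorem floor_digits {b : ℝ} {W u : ℕ} (hu : u ≤ W) :
    ⌊b * 2 ^ W⌋₊ / 2 ^ (W - u) = ⌊b * 2 ^ u⌋₊ := by
  rw [← Nat.floor_div_natCast]
  congr 1
  have : (2 : ℝ) ^ W = 2 ^ u * 2 ^ (W - u) := by rw [← pow_add]; congr 1; omega
  rw [this]
  push_cast
  field_simp

theorem floor_lt_pow {b : ℝ} (hb0 : 0 < b) (hb : b < 1) (W : ℕ) : ⌊b * 2 ^ W⌋₊ < 2 ^ W := by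
  rw [Nat.floor_lt (by positivity)]
  push_cast
  have : (0 : ℝ) < 2 ^ W := by positivity
  nlinarith

/-- The store that describes the start of a computation. -/
def startStore {W : ℕ} (D : ℕ → BitVec W) : Store where
  var := fun _ => 0
  mem := fun m i => ((State.start D).mem m i).toNat
  used := 0

theorem describes_start {W : ℕ} (D : ℕ → BitVec W) : Describes (State.start D) (startStore D) :=
  ⟨fun _ => rfl, fun _ _ => rfl, rfl⟩

/-! ### Correctness of the programs -/

/-- The number of memory words. -/
def memorySize {n d : ℕ} (P : Fin n → Finset (Fin d)) (k v cap : ℕ) : ℕ :=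
  22 + 3 * k + 2 ^ v + ∑ i, ((P i).card + 1 + 3 * cap) + cap

section Correctness

variable {b₁ b₂ ρ : ℝ} {n d W k r v : ℕ} {P : Fin n → Finset (Fin d)}

/-- The size of the queue. -/
noncomputable def queueSize (b₁ b₂ : ℝ) (k r : ℕ) : ℕ := queueConst b₁ b₂ * (16 * k * r)

/-- The conditions on the parameters under which the programs are analysed. -/
structure Setting (b₁ b₂ ρ : ℝ) (n d W k r v : ℕ) : Prop where
  b₂_pos : 0 < b₂
  b₂_lt : b₂ < b₁
  b₁_lt : b₁ < 1
  two_le : 2 ≤ n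
  large : Large b₁ b₂ n (W / 4) d
  tuned : Tuned b₁ b₂ ρ n (W / 4) d ⌊b₁ * 2 ^ (W / 4)⌋₊ ⌊b₂ * 2 ^ (W / 4)⌋₊ k r v

namespace Setting

variable (h : Setting b₁ b₂ ρ n d W k r v)

include h

theorem sets_le : 2 * n * (d + 1) ≤ 2 ^ (W / 4) := by exact_mod_cast h.large.sets_le

theorem d_le : d + 1 ≤ 2 ^ (W / 4) := by
  have h1 := h.sets_le
  have h2 := h.two_le
  have : 1 * (d + 1) ≤ 2 * n * (d + 1) := Nat.mul_le_mul_right _ (by omega)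
  omega

theorem n_le : n ≤ 2 ^ (W / 4) := by
  have h1 := h.sets_le
  have : n * 1 ≤ 2 * n * (d + 1) := Nat.mul_le_mul (by omega) (by omega)
  omega

theorem word_pos : 0 < W / 4 := by
  by_contra! hc
  have h1 := h.large.sixteen_le
  rw [Nat.le_zero.1 hc] at h1
  norm_num at h1

theorem sixteen_le : 16 ≤ 2 ^ (W / 4) := by exact_mod_cast h.large.sixteen_le

theorem lt_pow {x : ℕ} (hx : x ≤ 2 ^ (W / 4)) : x < 2 ^ W :=
  hx.trans_lt (Nat.pow_lt_pow_right (by norm_num) (by have := h.word_pos; omega))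

theorem r_pos : 0 < r := by
  rw [Nat.pos_iff_ne_zero]
  intro h0
  have := h.tuned.cap_pos
  simp [h0] at this

theorem queueConst_pos : 0 < queueConst b₁ b₂ :=
  WordRAM.queueConst_pos b₁ b₂ h.b₂_pos (h.b₂_lt.trans h.b₁_lt) h.b₁_lt

theorem queueSize_pos : 0 < queueSize b₁ b₂ k r := h.tuned.cap_pos

theorem table_le : n * queueSize b₁ b₂ k r ≤ 2 ^ (W / 4) :=
  h.tuned.v_spec.trans (Nat.pow_le_pow_right (by norm_num) h.tuned.v_le)

theorem queueSize_le_mul : queueSize b₁ b₂ k r ≤ n * queueSize b₁ b₂ k r :=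
  Nat.le_mul_of_pos_left _ (by have := h.two_le; omega)

theorem levels_le : 16 * k ≤ queueSize b₁ b₂ k r := by
  have h1 : 16 * k * 1 ≤ 16 * k * r := Nat.mul_le_mul_left _ h.r_pos
  have h2 : 1 * (16 * k * r) ≤ queueConst b₁ b₂ * (16 * k * r) :=
    Nat.mul_le_mul_right _ h.queueConst_pos
  unfold queueSize; omega

theorem r_le : r ≤ queueSize b₁ b₂ k r := by
  have h1 : 1 * r ≤ 16 * k * r := Nat.mul_le_mul_right _ (by have := h.tuned.k_pos; omega)
  have h2 : 1 * (16 * k * r) ≤ queueConst b₁ b₂ * (16 * k * r) :=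
    Nat.mul_le_mul_right _ h.queueConst_pos
  unfold queueSize; omega

theorem const_le : queueConst b₁ b₂ ≤ queueSize b₁ b₂ k r :=
  Nat.le_mul_of_pos_right _ (by have := h.tuned.k_pos; have := h.r_pos; positivity)

/-- Every part of the memory is bounded by a constant multiple of `2 ^ (W / 4)`, so addresses fit
into words with much room to spare. -/
theorem memorySize_lt (P : Fin n → Finset (Fin d)) :
    memorySize P k v (queueSize b₁ b₂ k r) < 2 ^ W := by
  have h1 := h.table_le
  have h2 := h.queueSize_le_mul
  have h3 := h.levels_le
  have h4 : 2 ^ v ≤ 2 ^ (W / 4) := Nat.pow_le_pow_right (by norm_num) h.tuned.v_le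
  have h5 : ∑ i, ((P i).card + 1 + 3 * queueSize b₁ b₂ k r) ≤
      n * (d + 1) + 3 * (n * queueSize b₁ b₂ k r) := by
    calc _ ≤ ∑ i : Fin n, (d + 1 + 3 * queueSize b₁ b₂ k r) :=
          Finset.sum_le_sum fun i _ => by have := card_finset_fin_le (P i); omega
      _ = _ := by simp; ring
  have h6 := h.sets_le
  have h7 : n * (d + 1) ≤ 2 * n * (d + 1) := Nat.mul_le_mul_right _ (by omega)
  have h8 := h.sixteen_le
  have h9 : (2 ^ (W / 4)) ^ 4 ≤ 2 ^ W := by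
    rw [← pow_mul]
    exact Nat.pow_le_pow_right (by norm_num) (by omega)
  set N := 2 ^ (W / 4)
  have h10 : 16 * 16 * N ≤ N ^ 4 := by
    calc 16 * 16 * N ≤ N * N * N := by gcongr
      _ = N ^ 3 * 1 := by ring
      _ ≤ N ^ 3 * N := by gcongr; omega
      _ = N ^ 4 := by ring
  unfold memorySize
  omega

theorem parameters (ω : ℕ → Fin (2 ^ W)) (P : Fin n → Finset (Fin d)) :
    Parameters (env (memorySize P k v (queueSize b₁ b₂ k r)) (toInput (encodeData W b₁ b₂ P)) ω)
      ⟨W, W / 4, v⟩ (queueConst b₁ b₂) n k r (16 * k) (queueSize b₁ b₂ k r)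
      ⌊b₁ * 2 ^ (W / 4)⌋₊ ⌊b₂ * 2 ^ (W / 4)⌋₊ (family P) := by
  have hb₁0 := h.b₂_pos.trans h.b₂_lt
  have hb₂1 := h.b₂_lt.trans h.b₁_lt
  have hd : d < 2 ^ W := h.lt_pow (by have := h.d_le; omega)
  have hread := reads_toInput (encodeData W b₁ b₂ P)
  rw [map_toNat_encodeData P hd, Reads.append_iff] at hread
  obtain ⟨hr1, hr2⟩ := hread
  simp only [Reads.cons_iff, List.length_cons, List.length_nil] at hr1 hr2
  obtain ⟨i0, i1, i2, i3, i4, -⟩ := hr1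
  have hu : W / 4 ≤ W := Nat.div_le_self _ _
  have hcapN := h.queueSize_le_mul
  have hv0 : 0 < 2 ^ v := by positivity
  have hsum (c : ℕ) : ∑ i ∈ Finset.range n, ((family P i).length + c) = ∑ i, ((P i).card + c) :=
    sum_length_family P fun m => m + c
  refine
    { word := rfl, u_eq := rfl, u_pos := h.word_pos, inp_n := ?_, inp_W := ?_, inp_b1 := ?_,
      inp_b2 := ?_, inp_sets := ?_, b1_lt := floor_lt_pow hb₁0 h.b₁_lt _,
      b2_lt := floor_lt_pow h.b₂_pos hb₂1 _, n_lt := h.n_le, k_min := h.tuned.k_min,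
      k_spec := h.tuned.k_spec, r_min := h.tuned.r_min, r_spec := h.tuned.r_spec, w_eq := rfl,
      cap_eq := rfl, w_le := h.levels_le, r_le := h.r_le, K_le := h.const_le,
      v_min := h.tuned.v_min, v_spec := h.tuned.v_spec, v_le := h.tuned.v_le,
      cap_le := hcapN, k_le := h.levels_le, cap_lt := ?_, S_lt := h.memorySize_lt P, S_ge := ?_,
      pos_lt := ?_, card_le := ?_ }
  · exact i0.trans (Nat.mod_eq_of_lt (h.lt_pow h.n_le))
  · exact i2.trans (Nat.mod_eq_of_lt Nat.lt_two_pow_self)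
  · refine Eq.trans ?_ (floor_digits (b := b₁) hu)
    congr 1
    exact i3.trans (Nat.mod_eq_of_lt (floor_lt_pow hb₁0 h.b₁_lt _))
  · refine Eq.trans ?_ (floor_digits (b := b₂) hu)
    congr 1
    exact i4.trans (Nat.mod_eq_of_lt (floor_lt_pow h.b₂_pos hb₂1 _))
  · intro i hi
    have := reads_flatten hr2 hi
    simpa only [inputPos, env, List.length_cons, zero_add, Nat.reduceAdd] using this
  · simp only [env, memorySize]; omega
  · have e := hsum (1 + 3 * queueSize b₁ b₂ k r)
    simp only [← add_assoc] at e
    simp only [env, memorySize]; omega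
  · simp only [env, memorySize, inputPos, hsum]
    have : ∑ i, ((P i).card + 1) ≤ ∑ i, ((P i).card + 1 + 3 * queueSize b₁ b₂ k r) :=
      Finset.sum_le_sum fun i _ => by omega
    omega
  · intro i _
    have := length_family_le P i
    have := h.d_le
    simp only; omega

theorem bounds (ω : ℕ → Fin (2 ^ W)) (P : Fin n → Finset (Fin d)) (q : Finset (Fin d)) {fp : ℕ}
    (hfp : fp ≤ memorySize P k v (queueSize b₁ b₂ k r)) :
    Bounds (env (memorySize P k v (queueSize b₁ b₂ k r)) (toInput (encodeSet W q)) ω)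
      ⟨W, W / 4, v⟩ (16 * k) (queueSize b₁ b₂ k r) ⌊b₁ * 2 ^ (W / 4)⌋₊ ⌊b₂ * 2 ^ (W / 4)⌋₊ n k
      (family P) (elems q) fp ⌈1 / b₂⌉₊ := by
  have hb₁0 := h.b₂_pos.trans h.b₂_lt
  have hb₂1 := h.b₂_lt.trans h.b₁_lt
  have hd' := h.d_le
  have hd : d < 2 ^ W := h.lt_pow (by omega)
  have hv0 : 0 < 2 ^ v := by positivity
  have hread := reads_toInput (encodeSet W q)
  rw [map_toNat_encodeSet q hd] at hread
  refine
    { word := rfl, S_le := (h.memorySize_lt P).le, fp_le := hfp, w_le := h.levels_le, cap_lt := ?_,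
      cells_le := ?_, three_u := ?_, u_pos := h.word_pos, b1_lt := floor_lt_pow hb₁0 h.b₁_lt _,
      b2_lt := floor_lt_pow h.b₂_pos hb₂1 _, ratio := ?_,
      w_le_cells := h.levels_le.trans (h.queueSize_le_mul.trans h.tuned.v_spec),
      sorted := fun i _ => pairwise_family P i,
      card_le := fun i _ => (length_family_le P i).trans (by simp only; omega),
      elem_lt := fun i _ j hj => (lt_of_mem_family P hj).trans_le (by simp only; omega),
      q_sorted := pairwise_elems q, q_card_le := ?_,
      q_elem_lt := fun j hj => (lt_of_mem_elems q hj).trans_le (by simp only; omega),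
      inp := hread }
  · simp only [env, memorySize]; omega
  · simp only [env, memorySize]; omega
  · simp only; omega
  · have h1 : (1 : ℝ) / b₂ ≤ ⌈1 / b₂⌉₊ := Nat.le_ceil _
    have h2 := Nat.lt_floor_add_one (b₂ * 2 ^ (W / 4))
    have h3 : ((2 : ℝ) ^ (W / 4)) ≤ ⌈1 / b₂⌉₊ * (⌊b₂ * 2 ^ (W / 4)⌋₊ + 1) := by
      have := h.b₂_pos
      calc (2 : ℝ) ^ (W / 4) = 1 / b₂ * (b₂ * 2 ^ (W / 4)) := by field_simp
        _ ≤ _ := by gcongr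
    exact_mod_cast h3
  · rw [length_elems]
    have := card_finset_fin_le q
    simp only; omega

/-- The coefficients drawn by the preprocessing. -/
def draws (_ : Setting b₁ b₂ ρ n d W k r v) (ω : ℕ → Fin (2 ^ W)) : List (ℕ × ℕ × ℕ) :=
  coefficients (fun i => ω i) k

theorem preprocess_spec (ω : ℕ → Fin (2 ^ W)) (P : Fin n → Finset (Fin d)) :
    ∃ D, Preprocessed (memorySize P k v (queueSize b₁ b₂ k r))
      (preprocess (queueConst b₁ b₂)).compile b₁ b₂ P ω D ∧
      ∃ fp ≤ memorySize P k v (queueSize b₁ b₂ k r), Stored ⟨W, W / 4, v⟩ (h.draws ω) (16 * k)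
        (queueSize b₁ b₂ k r) ⌊b₁ * 2 ^ (W / 4)⌋₊ ⌊b₂ * 2 ^ (W / 4)⌋₊ n (family P) fp
        (chainsOf (fun i => keysOf ⟨W, W / 4, v⟩ (h.draws ω) (16 * k) (queueSize b₁ b₂ k r)
          ⌊b₁ * 2 ^ (W / 4)⌋₊ (family P i)) n) fun i => (D i).toNat := by
  obtain ⟨t, a', hrun, fp, hfp, hst⟩ := wp_preprocess (h.parameters ω P)
    (a := startStore fun _ => 0#W) (fun i => by simp [startStore, State.start]) rfl
    (Q := fun _ a' => ∃ fp ≤ memorySize P k v (queueSize b₁ b₂ k r), Stored ⟨W, W / 4, v⟩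
      (h.draws ω) (16 * k) (queueSize b₁ b₂ k r) ⌊b₁ * 2 ^ (W / 4)⌋₊ ⌊b₂ * 2 ^ (W / 4)⌋₊ n
      (family P) fp (chainsOf (fun i => keysOf ⟨W, W / 4, v⟩ (h.draws ω) (16 * k)
        (queueSize b₁ b₂ k r) ⌊b₁ * 2 ^ (W / 4)⌋₊ (family P i)) n) (a'.mem .data))
    fun T a' fp hfp hst => ⟨fp, hfp, hst⟩
  obtain ⟨s', hexec, hdesc⟩ := hrun.exec _ (describes_start _)
  refine ⟨s'.mem .data, ⟨t, s', hexec, rfl⟩, fp, hfp, ?_⟩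
  have : (fun i => (s'.mem .data i).toNat) = a'.mem .data := funext fun i => hdesc.mem _ _
  rw [this]; exact hst

theorem query_spec (ω ω' : ℕ → Fin (2 ^ W)) (P : Fin n → Finset (Fin d)) (q : Finset (Fin d))
    {D : ℕ → BitVec W} (hD : Preprocessed (memorySize P k v (queueSize b₁ b₂ k r))
      (preprocess (queueConst b₁ b₂)).compile b₁ b₂ P ω D) :
    ∃ t a, Queried (memorySize P k v (queueSize b₁ b₂ k r)) query.compile D q ω' t a ∧
      t ≤ (300 * (⌈1 / b₂⌉₊ + 2)) * (q.card + 1) * (queueSize b₁ b₂ k r + 1) + 60 * k ∧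
      (HasCandidate (fun i => i < n ∧
          Similar (⌊b₂ * 2 ^ (W / 4)⌋₊ + 1) (2 ^ (W / 4)) (elems q) (family P i))
        ((keysOf ⟨W, W / 4, v⟩ (h.draws ω) (16 * k) (queueSize b₁ b₂ k r) ⌊b₁ * 2 ^ (W / 4)⌋₊
          (elems q)).flatMap (chainsOf (fun i => keysOf ⟨W, W / 4, v⟩ (h.draws ω) (16 * k)
          (queueSize b₁ b₂ k r) ⌊b₁ * 2 ^ (W / 4)⌋₊ (family P i)) n)) (queueSize b₁ b₂ k r) →
        a.toNat < n ∧ Similar (⌊b₂ * 2 ^ (W / 4)⌋₊ + 1) (2 ^ (W / 4)) (elems q)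
          (family P a.toNat)) := by
  obtain ⟨D', hD', fp, hfp, hst⟩ := h.preprocess_spec ω P
  -- Computations are deterministic, so the memory described by `preprocess_spec` is the given one.
  obtain rfl : D' = D := by
    obtain ⟨t, s, he, rfl⟩ := hD
    obtain ⟨t', s', he', rfl⟩ := hD'
    rw [(he.unique he').2]
  have hlen : (h.draws ω).length = k := by simp [draws, coefficients]
  have hB := h.bounds ω' P q hfp
  rw [← hlen] at hB
  obtain ⟨t, a', hrun, ht, hmem, hcand⟩ := wp_query (by rw [hlen] at hB ⊢; exact hB)
    (a := startStore D') rfl hst (Q := fun t a' =>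
      t ≤ (300 * (⌈1 / b₂⌉₊ + 2)) * (q.card + 1) * (queueSize b₁ b₂ k r + 1) + 60 * k ∧
      a'.mem .data = (fun i => (D' i).toNat) ∧ _) fun T a' h1 h2 h3 => ⟨by
        rw [length_elems, hlen] at h1; exact h1, h2, h3⟩
  obtain ⟨s', hexec, hdesc⟩ := hrun.exec _ (describes_start _)
  refine ⟨t, s'.reg 0, ⟨s', hexec, ?_, rfl⟩, ht, ?_⟩
  · funext i
    refine BitVec.eq_of_toNat_eq ?_
    rw [hdesc.mem, hmem]
  · intro hc
    have : (s'.reg 0).toNat = a'.var .ans := hdesc.var .ans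
    rw [this]; exact hcand hc

end Setting

end Correctness

/-! ### Success probability, space and time of the programs -/

instance (W : ℕ) : IsProbabilityMeasure (randomWords W) := by
  unfold randomWords; infer_instance

theorem braunBlanquet_eq {d : ℕ} (x q : Finset (Fin d)) : braunBlanquet x q =
    common (elems q) (elems x) / (max (elems q).length (elems x).length : ℕ) := by
  rw [braunBlanquet, common_elems, length_elems, length_elems, Finset.inter_comm, max_comm]

/-- Two empty sets have similarity 0, and an empty query has no common elements with any set;
positive similarity therefore excludes an empty query. -/
theorem le_common_of_le_braunBlanquet {d : ℕ} {x q : Finset (Fin d)} {s : ℝ} (hs : 0 < s)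
    (h : s ≤ braunBlanquet x q) :
    s * (max (elems q).length (elems x).length : ℕ) ≤ common (elems q) (elems x) ∧
      0 < (elems q).length := by
  rw [braunBlanquet_eq] at h
  rcases Nat.eq_zero_or_pos (max (elems q).length (elems x).length) with h0 | h0
  · rw [h0] at h; simp at h; linarith
  · have h0' : (0 : ℝ) < (max (elems q).length (elems x).length : ℕ) := by exact_mod_cast h0
    rw [le_div_iff₀ h0'] at h
    refine ⟨h, ?_⟩
    by_contra! hq
    have h1 : common (elems q) (elems x) ≤ (elems q).length := common_le_left _ _
    have h2 : common (elems q) (elems x) = 0 := by omega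
    rw [h2] at h
    have : 0 < s * (max (elems q).length (elems x).length : ℕ) := by positivity
    simp only [Nat.cast_zero] at h
    linarith

section Solution

variable {b₁ b₂ ρ : ℝ} {n d W k r v : ℕ}

/-- The query draws no random words. Success is decided by the coefficients of the preprocessing, so
the event contains a product set whose second factor is the whole space. -/
theorem Setting.correct (h : Setting b₁ b₂ ρ n d W k r v) (P : Fin n → Finset (Fin d))
    (q : Finset (Fin d)) (hq : ∃ i, b₁ ≤ braunBlanquet (P i) q) :
    1 / 2 ≤ ((randomWords W).prod (randomWords W))
      {ω | ∃ D t a, Preprocessed (memorySize P k v (queueSize b₁ b₂ k r))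
          (preprocess (queueConst b₁ b₂)).compile b₁ b₂ P ω.1 D ∧
        Queried (memorySize P k v (queueSize b₁ b₂ k r)) query.compile D q ω.2 t a ∧
        ∃ i : Fin n, a.toNat = i ∧ b₂ < braunBlanquet (P i) q} := by
  obtain ⟨i₀, hi₀⟩ := hq
  have hb₁0 := h.b₂_pos.trans h.b₂_lt
  obtain ⟨hsim, hq0⟩ := le_common_of_le_braunBlanquet hb₁0 hi₀
  rw [← family_of_lt P i₀.2] at hsim
  have hd := h.d_le
  have hchance := h.tuned.half_le_chance (g := ⟨W, W / 4, v⟩) h.b₂_pos h.b₂_lt h.b₁_lt h.two_le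
    h.large (by simp only; omega) (by simp only; omega) rfl rfl
    (h.levels_le.trans (h.queueSize_le_mul.trans h.table_le)) (X := family P) (q := elems q)
    (fun i _ j hj => lt_of_mem_family P hj) (fun i _ => (pairwise_family P i).imp fun h => h.ne)
    (fun i _ => length_family_le P i) (fun j hj => lt_of_mem_elems q hj) (nodup_elems q)
    (by rw [length_elems]; exact card_finset_fin_le q) i₀.2 hsim hq0
  set p := fun ts => HasCandidate (fun i => i < n ∧
      Similar (⌊b₂ * 2 ^ (W / 4)⌋₊ + 1) (2 ^ (W / 4)) (elems q) (family P i))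
    ((keysOf ⟨W, W / 4, v⟩ ts (16 * k) (queueSize b₁ b₂ k r) ⌊b₁ * 2 ^ (W / 4)⌋₊
      (elems q)).flatMap (chainsOf (fun i => keysOf ⟨W, W / 4, v⟩ ts (16 * k)
      (queueSize b₁ b₂ k r) ⌊b₁ * 2 ^ (W / 4)⌋₊ (family P i)) n)) (queueSize b₁ b₂ k r) with hp
  have hmeas : 1 / 2 ≤ randomWords W {ω | p (coefficients (fun i => ω i) k)} := by
    refine le_trans ?_ (ofReal_chance_le W k p)
    have := ENNReal.ofReal_le_ofReal hchance
    refine le_trans (le_of_eq ?_) this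
    rw [ENNReal.ofReal_div_of_pos (by norm_num)]; simp
  calc (1 / 2 : ENNReal) ≤ randomWords W {ω | p (coefficients (fun i => ω i) k)} := hmeas
    _ = ((randomWords W).prod (randomWords W))
        ({ω | p (coefficients (fun i => ω i) k)} ×ˢ Set.univ) := by
      rw [Measure.prod_prod, measure_univ, mul_one]
    _ ≤ _ := by
      refine measure_mono ?_
      rintro ⟨ω, ω'⟩ ⟨hω, -⟩
      obtain ⟨D, hD, -⟩ := h.preprocess_spec ω P
      obtain ⟨t, a, hQ, -, hans⟩ := h.query_spec ω ω' P q hD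
      obtain ⟨hlt, hs⟩ := hans hω
      refine ⟨D, t, a, hD, hQ, ⟨a.toNat, hlt⟩, rfl, ?_⟩
      have h1 := lt_of_similar (s := b₂) ((pairwise_family P _).imp fun h => h.ne) (nodup_elems q)
        (by positivity) (by
          push_cast
          exact Nat.lt_floor_add_one _) hq0 hs
      rw [family_of_lt P hlt] at h1
      rw [braunBlanquet_eq, lt_div_iff₀]
      · exact h1
      · exact_mod_cast hq0.trans_le (le_max_left _ _)

/-- The constant in the bounds on space and time. -/
noncomputable def resourceConst (b₁ b₂ : ℝ) : ℝ :=
  1 + (32 + (1200 * (⌈1 / b₂⌉₊ + 2) + 60)) * (48 * queueConst b₁ b₂ * levelConst b₂ / b₁)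

theorem memorySize_eq {n d : ℕ} (P : Fin n → Finset (Fin d)) (k v cap : ℕ) :
    memorySize P k v cap = 22 + 3 * k + 2 ^ v + (∑ i, (P i).card + n + 3 * (n * cap)) + cap := by
  have : ∑ i, ((P i).card + 1 + 3 * cap) = ∑ i, (P i).card + n + 3 * (n * cap) := by
    simp only [Finset.sum_add_distrib, Finset.sum_const, Finset.card_univ, Fintype.card_fin,
      smul_eq_mul]
    ring
  rw [memorySize, this]

/-- Apart from the sets themselves, the dominant term is `n * cap`, for the entries of the chains
and, up to a factor 2, for the table. -/
theorem Setting.space_le (h : Setting b₁ b₂ ρ n d W k r v) (P : Fin n → Finset (Fin d)) :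
    (memorySize P k v (queueSize b₁ b₂ k r) : ℝ) ≤
      resourceConst b₁ b₂ * ((n : ℝ) ^ (1 + ρ) * Real.log n + ∑ i, ((P i).card : ℝ)) := by
  have hC := levelConst_pos h.b₂_pos (h.b₂_lt.trans h.b₁_lt)
  have hb₁0 := h.b₂_pos.trans h.b₂_lt
  have hn0 : (0 : ℝ) < n := by exact_mod_cast (by have := h.two_le; omega)
  have hlog : 0 ≤ Real.log n := Real.log_natCast_nonneg n
  have h1 := h.queueSize_le_mul
  have h2 := h.queueSize_pos
  have h3 := h.levels_le
  have h4 : 2 ^ v ≤ 2 * (n * queueSize b₁ b₂ k r) := h.tuned.pow_v_le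
  have h5 : n * 1 ≤ n * queueSize b₁ b₂ k r := Nat.mul_le_mul_left _ h2
  have h7 : memorySize P k v (queueSize b₁ b₂ k r) ≤
      ∑ i, (P i).card + 32 * (n * queueSize b₁ b₂ k r) := by
    have := memorySize_eq P k v (queueSize b₁ b₂ k r)
    omega
  have h8 : (memorySize P k v (queueSize b₁ b₂ k r) : ℝ) ≤
      ∑ i, ((P i).card : ℝ) + 32 * (n * queueSize b₁ b₂ k r) := by exact_mod_cast h7
  have h9 : (queueSize b₁ b₂ k r : ℝ) ≤
      48 * queueConst b₁ b₂ * levelConst b₂ / b₁ * ((n : ℝ) ^ ρ * Real.log n) := h.tuned.cap_le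
  have h10 : (n : ℝ) ^ (1 + ρ) = n * (n : ℝ) ^ ρ := by rw [Real.rpow_add hn0, Real.rpow_one]
  have h11 : 0 ≤ (n : ℝ) ^ (1 + ρ) * Real.log n := mul_nonneg (Real.rpow_nonneg hn0.le _) hlog
  have h12 : (0 : ℝ) ≤ ∑ i, ((P i).card : ℝ) := Finset.sum_nonneg fun i _ => Nat.cast_nonneg _
  have hA0 : 0 ≤ 48 * (queueConst b₁ b₂ : ℝ) * levelConst b₂ / b₁ := by positivity
  have hR : resourceConst b₁ b₂ = 1 + (32 + (1200 * ((⌈1 / b₂⌉₊ : ℝ) + 2) + 60)) *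
    (48 * queueConst b₁ b₂ * levelConst b₂ / b₁) := rfl
  have hc : (0 : ℝ) ≤ ⌈1 / b₂⌉₊ := Nat.cast_nonneg _
  rw [hR]
  rw [h10] at h11 ⊢
  clear hR h10 h7 h5 h4
  generalize 48 * (queueConst b₁ b₂ : ℝ) * levelConst b₂ / b₁ = A at *
  generalize (queueSize b₁ b₂ k r : ℝ) = cap at *
  generalize (⌈1 / b₂⌉₊ : ℝ) = c at *
  generalize ∑ i, ((P i).card : ℝ) = s at *
  generalize (n : ℝ) ^ ρ = N at *
  have h13 : (n : ℝ) * cap ≤ A * (n * N * Real.log n) :=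
    (mul_le_mul_of_nonneg_left h9 hn0.le).trans_eq (by ring)
  have h14 : 0 ≤ A * (n * N * Real.log n) := mul_nonneg hA0 h11
  have h15 : 0 ≤ A * s := mul_nonneg hA0 h12
  have h16 : 0 ≤ c * (A * s) := mul_nonneg hc h15
  have h17 : 0 ≤ c * (A * (n * N * Real.log n)) := mul_nonneg hc h14
  calc _ ≤ s + 32 * (n * cap) := h8
    _ ≤ s + 32 * (A * (n * N * Real.log n)) := by linarith
    _ ≤ n * N * Real.log n + s + 32 * (A * (n * N * Real.log n)) +
        2460 * (A * (n * N * Real.log n)) + 1200 * (c * (A * (n * N * Real.log n))) +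
        2492 * (A * s) + 1200 * (c * (A * s)) := by linarith
    _ = _ := by ring

/-- Enumeration handles at most `cap` keys and the search at most `cap` candidates, each at a cost
of `O(|q| + 1)`; the maximum with 1 covers the empty query. -/
theorem Setting.time_le (h : Setting b₁ b₂ ρ n d W k r v) (m : ℕ) {t : ℕ}
    (ht : t ≤ (300 * (⌈1 / b₂⌉₊ + 2)) * (m + 1) * (queueSize b₁ b₂ k r + 1) + 60 * k) :
    (t : ℝ) ≤ resourceConst b₁ b₂ * (((max 1 m : ℕ) : ℝ) * (n : ℝ) ^ ρ * Real.log n) := by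
  have hC := levelConst_pos h.b₂_pos (h.b₂_lt.trans h.b₁_lt)
  have hb₁0 := h.b₂_pos.trans h.b₂_lt
  have hlog : 0 ≤ Real.log n := Real.log_natCast_nonneg n
  have h2 := h.queueSize_pos
  have h3 := h.levels_le
  have h9 : (queueSize b₁ b₂ k r : ℝ) ≤
      48 * queueConst b₁ b₂ * levelConst b₂ / b₁ * ((n : ℝ) ^ ρ * Real.log n) := h.tuned.cap_le
  set A := 48 * (queueConst b₁ b₂ : ℝ) * levelConst b₂ / b₁ with hA
  set c := queueSize b₁ b₂ k r
  set R := ⌈1 / b₂⌉₊ with hR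
  have h4 : t ≤ (1200 * (R + 2) + 60) * (max 1 m * c) := by
    have e1 : m + 1 ≤ 2 * max 1 m := by omega
    have e2 : c + 1 ≤ 2 * c := by omega
    have e3 : 1 * c ≤ max 1 m * c := Nat.mul_le_mul_right _ (le_max_left _ _)
    calc t ≤ (300 * (R + 2)) * (m + 1) * (c + 1) + 60 * k := ht
      _ ≤ (300 * (R + 2)) * (2 * max 1 m) * (2 * c) + 60 * (max 1 m * c) := by
        gcongr
        omega
      _ = _ := by ring
  have h5 : (t : ℝ) ≤ (1200 * (R + 2) + 60) * (((max 1 m : ℕ) : ℝ) * c) := by exact_mod_cast h4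
  have hA0 : 0 ≤ A := by positivity
  calc (t : ℝ) ≤ (1200 * (R + 2) + 60) * (((max 1 m : ℕ) : ℝ) * c) := h5
    _ ≤ (1200 * (R + 2) + 60) * (((max 1 m : ℕ) : ℝ) * (A * ((n : ℝ) ^ ρ * Real.log n))) := by
      gcongr
    _ = (1200 * (R + 2) + 60) * A * (((max 1 m : ℕ) : ℝ) * (n : ℝ) ^ ρ * Real.log n) := by ring
    _ ≤ _ := by
      gcongr
      rw [resourceConst, ← hA, ← hR]
      have e2 : 0 ≤ 32 * A := by positivity
      linarith

end Solution

/-- Braun-Blanquet similarity search on the word RAM. -/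
theorem exists_solvesSearch {b₁ b₂ ρ : ℝ} (hb₂ : 0 < b₂) (hb : b₂ < b₁) (hb₁ : b₁ < 1)
    (hρ : ρ = Real.log (1 / b₁) / Real.log (1 / b₂)) (a : ℕ) :
    ∃ c₀ : ℝ, 0 < c₀ ∧ ∀ c : ℝ, ∃ (pre qry : WordRAM.Prog) (C : ℝ),
      ∀ (n d W : ℕ) (P : Fin n → Finset (Fin d)), 2 ≤ n → d ≤ n ^ a →
        c₀ * Real.logb 2 n ≤ W → W ≤ c * Real.logb 2 n → Function.Injective P →
        ∃ S : ℕ,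
          S ≤ C * ((n : ℝ) ^ (1 + ρ) * Real.log n + ∑ i, ((P i).card : ℝ)) ∧
          SolvesSearch W braunBlanquet b₁ b₂ P pre qry S
            fun m => C * (max 1 m * (n : ℝ) ^ ρ * Real.log n) := by
  obtain ⟨c₀, hc₀, hlarge⟩ := exists_large hb₂ hb hb₁ a
  refine ⟨c₀, hc₀, fun _ => ⟨(preprocess (queueConst b₁ b₂)).compile, query.compile,
    resourceConst b₁ b₂, ?_⟩⟩
  intro n d W P hn hd hW _ _
  have hb₁0 := hb₂.trans hb
  have hL := hlarge n W d hn hd hW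
  obtain ⟨k, r, v, ht⟩ := exists_tuned hb₂ hb hb₁ hρ hn
    (B₁ := ⌊b₁ * 2 ^ (W / 4)⌋₊) (B₂ := ⌊b₂ * 2 ^ (W / 4)⌋₊) (Nat.floor_le (by positivity))
    (Nat.sub_one_lt_floor _).le (Nat.floor_le (by positivity)) (Nat.sub_one_lt_floor _).le hL
  have h : Setting b₁ b₂ ρ n d W k r v := ⟨hb₂, hb, hb₁, hn, hL, ht⟩
  refine ⟨memorySize P k v (queueSize b₁ b₂ k r), h.space_le P, ?_, ?_,
    fun q hq => h.correct P q hq⟩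
  · intro ω
    obtain ⟨D, hD, -⟩ := h.preprocess_spec ω P
    exact ⟨D, hD⟩
  · intro ω D hD q ω'
    obtain ⟨t, a, hQ, ht, -⟩ := h.query_spec ω ω' P q hD
    refine ⟨t, a, hQ, ?_⟩
    have := h.time_le q.card ht
    simpa using this

end WordRAM

namespace ChosenPath

open ProbabilityTheory

variable {w d : ℕ}

/-! ### Chosen Path with arbitrary thresholds -/

open Classical in
/-- The extensions by one vertex of the paths in `S` that survive if an extension by `v` survives
when its hash value is below `t v`. -/
noncomputable def extensions (t : Fin d → ℝ) (h : Hash w d) (i : ℕ) (S : Finset (Path w d i)) :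
    Finset (Path w d (i + 1)) :=
  Finset.univ.filter fun p =>
    (p.1, Fin.init p.2) ∈ S ∧ (h ⟨i + 1, p⟩ : ℝ) < t (p.2 (Fin.last i))

/-- The paths of length `i` all of whose prefixes survive. -/
noncomputable def survivors (t : Fin d → ℝ) (h : Hash w d) : (i : ℕ) → Finset (Path w d i)
  | 0 => Finset.univ
  | i + 1 => extensions t h i (survivors t h i)

/-- The threshold for extending a path of `x` by `v`. -/
noncomputable def threshold (b₁ : ℝ) (x : Finset (Fin d)) (v : Fin d) : ℝ :=
  (if v ∈ x then 1 else 0) / (b₁ * (x.card : ℝ))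

theorem chosen_eq_survivors (b₁ : ℝ) (h : Hash w d) (x : Finset (Fin d)) (i : ℕ) :
    chosen b₁ h x i = survivors (threshold b₁ x) h i := by
  induction i with
  | zero => rfl
  | succ i ih =>
    ext p
    simp only [chosen, survivors, extensions, Finset.mem_filter, Finset.mem_univ, true_and, ih]
    exact Iff.rfl

/-- A hash value lies below both thresholds exactly if it lies below their minimum. The common paths
of two sets thus form a process of the same kind, and it suffices to analyse one process. -/
theorem survivors_inter (s t : Fin d → ℝ) (h : Hash w d) (i : ℕ) (p : Path w d i) :
    p ∈ survivors s h i ∧ p ∈ survivors t h i ↔ p ∈ survivors (fun v => min (s v) (t v)) h i := by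
  induction i with
  | zero => simp [survivors]
  | succ i ih =>
    simp only [survivors, extensions, Finset.mem_filter, Finset.mem_univ, true_and, lt_min_iff,
      ← ih]
    tauto

/-- Splitting off the last vertex. -/
def splitLast (w d i : ℕ) : Path w d (i + 1) ≃ Path w d i × Fin d where
  toFun q := ((q.1, Fin.init q.2), q.2 (Fin.last i))
  invFun r := (r.1.1, Fin.snoc (α := fun _ => Fin d) r.1.2 r.2)
  left_inv q := by simp
  right_inv r := by simp

/-! ### Independence of the levels -/

/-- The σ-algebra generated by the hash values at the paths with length in `L`. -/
abbrev hashes (w d : ℕ) (L : Set ℕ) : MeasurableSpace (Hash w d) :=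
  ⨆ s ∈ {s : Σ i : ℕ, Path w d i | s.1 ∈ L},
    MeasurableSpace.comap (fun h : Hash w d => h s) inferInstance

theorem hashes_le (L : Set ℕ) : hashes w d L ≤ MeasurableSpace.pi :=
  iSup₂_le fun s _ => Measurable.comap_le (measurable_pi_apply s)

theorem measurable_hashes {L : Set ℕ} {i : ℕ} (hi : i ∈ L) (p : Path w d i) :
    Measurable[hashes w d L] fun h : Hash w d => h ⟨i, p⟩ :=
  Measurable.mono (comap_measurable _)
    (le_iSup₂_of_le (f := fun (s : Σ i : ℕ, Path w d i)
      (_ : s ∈ {s : Σ i : ℕ, Path w d i | s.1 ∈ L}) =>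
        MeasurableSpace.comap (fun h : Hash w d => h s) inferInstance) ⟨i, p⟩ hi le_rfl) le_rfl

instance isProbabilityMeasure_hashMeasure : IsProbabilityMeasure (hashMeasure w d) := by
  unfold hashMeasure; infer_instance

theorem iIndepFun_hash :
    iIndepFun (fun (s : Σ i : ℕ, Path w d i) (h : Hash w d) => h s) (hashMeasure w d) := by
  rw [iIndepFun_iff_map_fun_eq_infinitePi_map (by fun_prop), Measure.map_id', hashMeasure]
  congr
  funext s
  exact ((measurePreserving_eval_infinitePi (fun _ => (volume : Measure unitInterval))
    s).map_eq).symm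

theorem indep_hashes {L L' : Set ℕ} (h : Disjoint L L') :
    Indep (hashes w d L) (hashes w d L') (hashMeasure w d) :=
  indep_iSup_of_disjoint (fun s => Measurable.comap_le (measurable_pi_apply s)) iIndepFun_hash
    (Set.disjoint_left.2 fun _ h1 h2 => Set.disjoint_left.1 h h1 h2)

theorem measurableSet_mem_survivors (t : Fin d → ℝ) (i : ℕ) (p : Path w d i) :
    MeasurableSet[hashes w d (Set.Iic i)] {h | p ∈ survivors t h i} := by
  induction i with
  | zero => simp [survivors]
  | succ i ih =>
    simp only [survivors, extensions, Finset.mem_filter, Finset.mem_univ, true_and]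
    refine MeasurableSet.inter ?_ ?_
    · refine (?_ : hashes w d (Set.Iic i) ≤ hashes w d (Set.Iic (i + 1))) _ (ih _)
      exact biSup_mono fun s hs => (le_trans hs (Nat.le_succ i) : s.1 ≤ i + 1)
    · exact (measurable_subtype_coe.comp (measurable_hashes Set.self_mem_Iic p)) measurableSet_Iio

theorem measurableSet_survivors_eq (t : Fin d → ℝ) (i : ℕ) (S : Finset (Path w d i)) :
    MeasurableSet[hashes w d (Set.Iic i)] {h | survivors t h i = S} := by
  have : {h : Hash w d | survivors t h i = S} =
      ⋂ p, {h | p ∈ survivors t h i ↔ p ∈ S} := by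
    ext h; simp [Finset.ext_iff]
  rw [this]
  refine MeasurableSet.iInter fun p => ?_
  by_cases hp : p ∈ S
  · simpa [hp] using measurableSet_mem_survivors t i p
  · simpa only [hp, iff_false, Set.compl_ofPred] using (measurableSet_mem_survivors t i p).compl

theorem measurable_extensions (t : Fin d → ℝ) (i : ℕ) (S : Finset (Path w d i))
    (f : Finset (Path w d (i + 1)) → ENNReal) :
    Measurable[hashes w d {i + 1}] fun h : Hash w d => f (extensions t h i S) := by
  have hm (q : Path w d (i + 1)) :
      MeasurableSet[hashes w d {i + 1}] {h : Hash w d | q ∈ extensions t h i S} := by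
    simp only [extensions, Finset.mem_filter, Finset.mem_univ, true_and]
    refine MeasurableSet.inter (MeasurableSet.const _) ?_
    exact (measurable_subtype_coe.comp (measurable_hashes (Set.mem_singleton _) q))
      measurableSet_Iio
  let _ : MeasurableSpace (Finset (Path w d (i + 1))) := ⊤
  refine Measurable.comp (g := f) measurable_from_top ?_
  refine @measurable_to_countable' _ _ _ _ (hashes w d {i + 1}) _ fun T => ?_
  have : (fun h : Hash w d => extensions t h i S) ⁻¹' {T} =
      ⋂ p, {h | p ∈ extensions t h i S ↔ p ∈ T} := by
    ext h; simp [Finset.ext_iff]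
  rw [this]
  refine MeasurableSet.iInter fun p => ?_
  by_cases hp : p ∈ T
  · simpa [hp] using hm p
  · simpa only [hp, iff_false, Set.compl_ofPred] using (hm p).compl

/-- The expectation of a function of the next level can be computed by first averaging over the
hash values of that level. -/
theorem lintegral_survivors_succ (t : Fin d → ℝ) (i : ℕ)
    (f : Finset (Path w d (i + 1)) → ENNReal) (g : Finset (Path w d i) → ENNReal)
    (hg : ∀ S, ∫⁻ h, f (extensions t h i S) ∂hashMeasure w d = g S) :
    ∫⁻ h, f (survivors t h (i + 1)) ∂hashMeasure w d =
      ∫⁻ h, g (survivors t h i) ∂hashMeasure w d := by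
  have hI (S : Finset (Path w d i)) : Measurable[hashes w d (Set.Iic i)]
      ({h : Hash w d | survivors t h i = S}.indicator 1 : Hash w d → ENNReal) :=
    Measurable.indicator (@measurable_one _ _ _ (hashes w d (Set.Iic i)) _)
      (measurableSet_survivors_eq t i S)
  have hI' (S : Finset (Path w d i)) : Measurable
      ({h : Hash w d | survivors t h i = S}.indicator 1 : Hash w d → ENNReal) :=
    (hI S).mono (hashes_le _) le_rfl
  have hF (S : Finset (Path w d i)) := measurable_extensions t i S f
  -- Split according to the set `S` of survivors on level `i`. Its indicator depends on hash values
  -- at lengths up to `i`, the extensions of a fixed `S` on those at length `i + 1`, and the two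
  -- families are independent.
  have e1 (h : Hash w d) : f (survivors t h (i + 1)) =
      ∑ S, ({h : Hash w d | survivors t h i = S}.indicator 1 h : ENNReal) *
        f (extensions t h i S) := by
    rw [Finset.sum_eq_single (survivors t h i)]
    · simp [survivors]
    · intro S _ hS
      rw [Set.indicator_of_notMem (by simpa using hS.symm), zero_mul]
    · simp
  have e2 (h : Hash w d) : g (survivors t h i) =
      ∑ S, ({h : Hash w d | survivors t h i = S}.indicator 1 h : ENNReal) * g S := by
    rw [Finset.sum_eq_single (survivors t h i)]
    · simp
    · intro S _ hS
      rw [Set.indicator_of_notMem (by simpa using hS.symm), zero_mul]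
    · simp
  have hP (S : Finset (Path w d i)) : Measurable fun h : Hash w d =>
      ({h : Hash w d | survivors t h i = S}.indicator 1 h : ENNReal) * f (extensions t h i S) :=
    (hI' S).mul ((hF S).mono (hashes_le _) le_rfl)
  simp_rw [e1, e2]
  rw [lintegral_finsetSum _ fun S _ => hP S, lintegral_finsetSum _ fun S _ => (hI' S).mul_const _]
  refine Finset.sum_congr rfl fun S _ => ?_
  rw [lintegral_mul_const _ (hI' S), ← hg S]
  exact lintegral_mul_eq_lintegral_mul_lintegral_of_independent_measurableSpace (hashes_le _)
    (hashes_le _) (indep_hashes (by simp)) (hI S) (hF S)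

/-! ### First moment and generating function of the number of paths -/

/-- The probability that a hash value is below `s`. -/
noncomputable def keepProb (s : ℝ) : ℝ := max 0 (min 1 s)

theorem keepProb_nonneg (s : ℝ) : 0 ≤ keepProb s := le_max_left _ _

theorem keepProb_le_one (s : ℝ) : keepProb s ≤ 1 := max_le zero_le_one (min_le_left _ _)

theorem volume_lt (s : ℝ) :
    volume {u : unitInterval | (u : ℝ) < s} = ENNReal.ofReal (keepProb s) := by
  rcases lt_or_ge 1 s with h1 | h1
  · have : {u : unitInterval | (u : ℝ) < s} = Set.univ :=
      Set.eq_univ_of_forall fun u => u.2.2.trans_lt h1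
    rw [this, measure_univ, keepProb, min_eq_left h1.le, max_eq_right zero_le_one,
      ENNReal.ofReal_one]
  rcases lt_or_ge s 0 with h0 | h0
  · have : {u : unitInterval | (u : ℝ) < s} = ∅ :=
      Set.eq_empty_of_forall_notMem fun u hu => (h0.trans_le u.2.1).not_gt hu
    rw [this, measure_empty, keepProb, min_eq_right h1, max_eq_left h0.le, ENNReal.ofReal_zero]
  · have : {u : unitInterval | (u : ℝ) < s} = Set.Iio ⟨s, h0, h1⟩ := rfl
    rw [this, unitInterval.volume_Iio, keepProb, min_eq_right h1, max_eq_right h0]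

theorem hashMeasure_lt (q : Σ i : ℕ, Path w d i) (s : ℝ) :
    hashMeasure w d {h | (h q : ℝ) < s} = ENNReal.ofReal (keepProb s) := by
  rw [← volume_lt]
  exact (measurePreserving_eval_infinitePi
    (fun _ : Σ i : ℕ, Path w d i => (volume : Measure unitInterval)) q).measure_preimage
    (measurableSet_lt measurable_subtype_coe measurable_const).nullMeasurableSet

theorem measurableSet_hash_lt (q : Σ i : ℕ, Path w d i) (s : ℝ) :
    MeasurableSet {h : Hash w d | (h q : ℝ) < s} :=
  measurableSet_lt (measurable_subtype_coe.comp (measurable_pi_apply q)) measurable_const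

theorem lintegral_card_extensions (t : Fin d → ℝ) (i : ℕ) (S : Finset (Path w d i)) :
    ∫⁻ h, ((extensions t h i S).card : ENNReal) ∂hashMeasure w d =
      ENNReal.ofReal (∑ v, keepProb (t v)) * S.card := by
  classical
  have hm (q : Path w d (i + 1)) :
      MeasurableSet {h : Hash w d | (h ⟨i + 1, q⟩ : ℝ) < t (q.2 (Fin.last i))} :=
    measurableSet_hash_lt _ _
  have e (h : Hash w d) : ((extensions t h i S).card : ENNReal) =
      ∑ q : Path w d (i + 1), if (q.1, Fin.init q.2) ∈ S then
        {h : Hash w d | (h ⟨i + 1, q⟩ : ℝ) < t (q.2 (Fin.last i))}.indicator 1 h else 0 := by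
    rw [extensions, Finset.card_filter, Nat.cast_sum]
    refine Finset.sum_congr rfl fun q _ => ?_
    by_cases h1 : (q.1, Fin.init q.2) ∈ S <;>
      by_cases h2 : (h ⟨i + 1, q⟩ : ℝ) < t (q.2 (Fin.last i)) <;> simp [h1, h2]
  have e2 (q : Path w d (i + 1)) : ∫⁻ h, (if (q.1, Fin.init q.2) ∈ S then
        {h : Hash w d | (h ⟨i + 1, q⟩ : ℝ) < t (q.2 (Fin.last i))}.indicator 1 h else 0)
        ∂hashMeasure w d =
      if ((splitLast w d i q).1 ∈ S) then
        ENNReal.ofReal (keepProb (t (splitLast w d i q).2)) else 0 := by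
    change _ = if (q.1, Fin.init q.2) ∈ S then
        ENNReal.ofReal (keepProb (t (q.2 (Fin.last i)))) else 0
    split_ifs
    · rw [lintegral_indicator_one (hm q), hashMeasure_lt]
    · simp
  simp_rw [e]
  rw [lintegral_finsetSum]
  · simp_rw [e2]
    rw [Equiv.sum_comp (splitLast w d i) fun r => if r.1 ∈ S then
        ENNReal.ofReal (keepProb (t r.2)) else 0, Fintype.sum_prod_type,
      ENNReal.ofReal_sum_of_nonneg fun v _ => keepProb_nonneg _]
    have (p : Path w d i) : (∑ v, if p ∈ S then ENNReal.ofReal (keepProb (t v)) else 0) =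
        if p ∈ S then ∑ v, ENNReal.ofReal (keepProb (t v)) else 0 := by
      split_ifs <;> simp
    simp only [this]
    rw [Finset.sum_ite_mem, Finset.univ_inter, Finset.sum_const, nsmul_eq_mul, mul_comm]
  · intro q _
    split_ifs
    · exact measurable_one.indicator (hm q)
    · exact measurable_const

/-- Each level multiplies the expected size by the mean number of surviving extensions of one path.
-/
theorem lintegral_card_survivors (t : Fin d → ℝ) (i : ℕ) :
    ∫⁻ h, ((survivors t h i).card : ENNReal) ∂hashMeasure w d =
      ENNReal.ofReal ((∑ v, keepProb (t v)) ^ i * w) := by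
  have h0 : 0 ≤ ∑ v, keepProb (t v) := Finset.sum_nonneg fun v _ => keepProb_nonneg _
  induction i with
  | zero => simp [survivors, Path]
  | succ i ih =>
    rw [lintegral_survivors_succ t i (fun S => (S.card : ENNReal)) _
      (lintegral_card_extensions t i)]
    have hm : Measurable fun h : Hash w d => ((survivors t h i).card : ENNReal) := by
      have (h : Hash w d) : ((survivors t h i).card : ENNReal) =
          ∑ p, {h | p ∈ survivors t h i}.indicator 1 h := by
        classical
        simp [Set.indicator_apply]
      simp_rw [this]
      exact Finset.measurable_sum _ fun p _ =>
        measurable_one.indicator (hashes_le _ _ (measurableSet_mem_survivors t i p))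
    rw [lintegral_const_mul _ hm, ih, ← ENNReal.ofReal_mul h0]
    congr 1
    ring

/-- Hash values of distinct paths are independent, so the generating function factors: an extension
by `v` contributes `1 - (1 - z) p`, and every path of `S` contributes the same product over `v`. -/
theorem lintegral_pow_extensions (t : Fin d → ℝ) (i : ℕ) (S : Finset (Path w d i)) {z : ℝ}
    (hz0 : 0 ≤ z) :
    ∫⁻ h, ENNReal.ofReal z ^ (extensions t h i S).card ∂hashMeasure w d =
      ENNReal.ofReal (∏ v, (1 - (1 - z) * keepProb (t v))) ^ S.card := by
  classical
  let X (q : Path w d (i + 1)) (u : unitInterval) : ENNReal :=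
    if (q.1, Fin.init q.2) ∈ S ∧ (u : ℝ) < t (q.2 (Fin.last i)) then ENNReal.ofReal z else 1
  have hX (q) : Measurable (X q) :=
    Measurable.ite ((MeasurableSet.const _).inter (measurable_subtype_coe measurableSet_Iio))
      measurable_const measurable_const
  have e (h : Hash w d) : ENNReal.ofReal z ^ (extensions t h i S).card =
      ∏ q : Path w d (i + 1), X q (h ⟨i + 1, q⟩) := by
    rw [extensions, Finset.prod_ite, Finset.prod_const, Finset.prod_const_one, mul_one]
  have e2 (q : Path w d (i + 1)) : ∫⁻ h, X q (h ⟨i + 1, q⟩) ∂hashMeasure w d =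
      if (splitLast w d i q).1 ∈ S then
        ENNReal.ofReal (1 - (1 - z) * keepProb (t (splitLast w d i q).2)) else 1 := by
    change _ = if (q.1, Fin.init q.2) ∈ S then
        ENNReal.ofReal (1 - (1 - z) * keepProb (t (q.2 (Fin.last i)))) else 1
    split_ifs with hq
    · have hm := measurableSet_hash_lt (w := w) (d := d) ⟨i + 1, q⟩ (t (q.2 (Fin.last i)))
      have hp := hashMeasure_lt (w := w) (d := d) ⟨i + 1, q⟩ (t (q.2 (Fin.last i)))
      have hp0 := keepProb_nonneg (t (q.2 (Fin.last i)))
      have hp1 := keepProb_le_one (t (q.2 (Fin.last i)))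
      set A := {h : Hash w d | (h ⟨i + 1, q⟩ : ℝ) < t (q.2 (Fin.last i))} with hA
      have e3 (h : Hash w d) : X q (h ⟨i + 1, q⟩) =
          A.indicator (fun _ => ENNReal.ofReal z) h + Aᶜ.indicator (fun _ => 1) h := by
        by_cases hh : (h ⟨i + 1, q⟩ : ℝ) < t (q.2 (Fin.last i)) <;> simp [X, hq, hA, hh]
      simp_rw [e3]
      rw [lintegral_add_left (measurable_const.indicator hm), lintegral_indicator_const hm,
        lintegral_indicator_const hm.compl, prob_compl_eq_one_sub hm, hp, one_mul,
        ← ENNReal.ofReal_one, ← ENNReal.ofReal_sub _ hp0, ← ENNReal.ofReal_mul hz0,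
        ← ENNReal.ofReal_add (mul_nonneg hz0 hp0) (sub_nonneg.2 hp1)]
      congr 1
      ring
    · simp [X, hq]
  have hind : iIndepFun (fun (q : Path w d (i + 1)) (h : Hash w d) => X q (h ⟨i + 1, q⟩))
      (hashMeasure w d) :=
    (iIndepFun_hash.precomp (g := fun q : Path w d (i + 1) => (⟨i + 1, q⟩ : Σ i, Path w d i))
      (fun a b hab => by simpa using hab)).comp X hX
  simp_rw [e]
  rw [lintegral_prod_eq_prod_lintegral_of_indepFun _ _ hind
    fun q => (hX q).comp (measurable_pi_apply _)]
  simp_rw [e2]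
  rw [Equiv.prod_comp (splitLast w d i) fun r => if r.1 ∈ S then
        ENNReal.ofReal (1 - (1 - z) * keepProb (t r.2)) else 1, Fintype.prod_prod_type,
      ENNReal.ofReal_prod_of_nonneg fun v _ =>
      sub_nonneg.2 (mul_le_one₀ (sub_le_self _ hz0) (keepProb_nonneg _) (keepProb_le_one _))]
  have (p : Path w d i) :
      (∏ v, if p ∈ S then ENNReal.ofReal (1 - (1 - z) * keepProb (t v)) else 1) =
        if p ∈ S then ∏ v, ENNReal.ofReal (1 - (1 - z) * keepProb (t v)) else 1 := by
    split_ifs <;> simp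
  simp only [this]
  rw [Finset.prod_ite_mem, Finset.univ_inter, Finset.prod_const]

/-- `1 - a ≤ exp (-a)` gathers the factors into one exponential of the sum, and `exp y ≥ 1 + y`
returns to a rational bound that can be iterated. -/
theorem prod_one_sub_le {ι : Type*} (s : Finset ι) (p : ι → ℝ) (hp1 : ∀ v ∈ s, p v ≤ 1)
    (hp : 1 ≤ ∑ v ∈ s, p v) {y : ℝ} (hy0 : 0 ≤ y) (hy1 : y ≤ 1) :
    ∏ v ∈ s, (1 - y * p v) ≤ 1 / (1 + y) := by
  calc ∏ v ∈ s, (1 - y * p v) ≤ ∏ v ∈ s, Real.exp (-(y * p v)) := by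
        refine Finset.prod_le_prod (fun v hv => ?_) fun v hv => ?_
        · nlinarith [hp1 v hv]
        · have := Real.add_one_le_exp (-(y * p v)); linarith
    _ = Real.exp (-(y * ∑ v ∈ s, p v)) := by
        rw [← Real.exp_sum, Finset.sum_neg_distrib, Finset.mul_sum]
    _ ≤ Real.exp (-y) := Real.exp_le_exp.2 (by nlinarith)
    _ ≤ 1 / (1 + y) := by
        rw [Real.exp_neg, ← one_div]
        exact one_div_le_one_div_of_le (by positivity) (by linarith [Real.add_one_le_exp y])

/-- For `y = 1 / (j + 1)` the bound `1 / (1 + y)` equals `1 - 1 / (j + 2)`, so averaging over one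
level raises `j` by one. -/
theorem lintegral_pow_survivors_le {t : Fin d → ℝ} (ht : 1 ≤ ∑ v, keepProb (t v)) (i j : ℕ) :
    ∫⁻ h, ENNReal.ofReal (1 - 1 / ((j : ℝ) + 1)) ^ (survivors t h i).card ∂hashMeasure w d ≤
      ENNReal.ofReal (1 - 1 / ((j + i : ℕ) + 1 : ℝ)) ^ w := by
  induction i generalizing j with
  | zero => simp [survivors]
  | succ i ih =>
    have hj : (0 : ℝ) < (j : ℝ) + 1 := by positivity
    have hj1 : 1 / ((j : ℝ) + 1) ≤ 1 := by rw [div_le_one hj]; linarith [j.cast_nonneg (α := ℝ)]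
    rw [lintegral_survivors_succ t i (fun S => ENNReal.ofReal (1 - 1 / ((j : ℝ) + 1)) ^ S.card) _
      fun S => lintegral_pow_extensions t i S (sub_nonneg.2 hj1)]
    refine le_trans (lintegral_mono fun h => pow_le_pow_left' (ENNReal.ofReal_le_ofReal ?_) _)
      ((ih (j + 1)).trans_eq (by rw [add_right_comm, add_assoc]))
    have := prod_one_sub_le Finset.univ (fun v => keepProb (t v)) (fun v _ => keepProb_le_one _) ht
      (y := 1 / ((j : ℝ) + 1)) (by positivity) hj1
    simp only [sub_sub_cancel]
    refine this.trans_eq ?_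
    push_cast
    field_simp
    ring

theorem half_le_survivors_nonempty {t : Fin d → ℝ} (ht : 1 ≤ ∑ v, keepProb (t v)) {k : ℕ}
    (hk : 1 ≤ k) :
    1 / 2 ≤ hashMeasure (2 * k) d {h | (survivors t h k).Nonempty} := by
  have hm : MeasurableSet {h : Hash (2 * k) d | survivors t h k = ∅} :=
    hashes_le _ _ (measurableSet_survivors_eq t k ∅)
  have hc : {h : Hash (2 * k) d | (survivors t h k).Nonempty} =
      {h | survivors t h k = ∅}ᶜ := by
    ext h; simp [Finset.nonempty_iff_ne_empty]
  -- At `j = 0` the base is 0, and `0 ^ 0 = 1` makes the integrand the indicator of extinction.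
  have h1 : hashMeasure (2 * k) d {h | survivors t h k = ∅} ≤
      ∫⁻ h, ENNReal.ofReal (1 - 1 / (((0 : ℕ) : ℝ) + 1)) ^ (survivors t h k).card
        ∂hashMeasure (2 * k) d := by
    rw [← lintegral_indicator_one hm]
    refine lintegral_mono fun h => ?_
    by_cases h0 : survivors t h k = ∅ <;> simp [h0]
  have h2 := h1.trans (lintegral_pow_survivors_le ht k 0)
  have h3 : ENNReal.ofReal (1 - 1 / ((0 + k : ℕ) + 1 : ℝ)) ^ (2 * k) ≤ 1 / 2 := by
    have hk0 : (0 : ℝ) < k := by exact_mod_cast hk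
    have e : (1 : ℝ) - 1 / ((0 + k : ℕ) + 1 : ℝ) = (1 + 1 / k : ℝ)⁻¹ := by
      push_cast; field_simp; ring
    -- Bernoulli's inequality gives `(1 + 1 / k) ^ (2 k) ≥ 3`; this is where the choice `w = 2 k`
    -- enters.
    have hB := one_add_mul_le_pow (a := 1 / (k : ℝ)) (by have : 0 < 1 / (k : ℝ) := by positivity
                                                         linarith) (2 * k)
    have h4 : (2 : ℝ) ≤ (1 + 1 / (k : ℝ)) ^ (2 * k) := by
      refine le_trans ?_ hB
      push_cast
      rw [mul_assoc, mul_one_div_cancel hk0.ne']; norm_num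
    rw [e, ← ENNReal.ofReal_pow (by positivity), inv_pow]
    calc ENNReal.ofReal ((1 + 1 / (k : ℝ)) ^ (2 * k))⁻¹ ≤ ENNReal.ofReal (2⁻¹) :=
          ENNReal.ofReal_le_ofReal (inv_anti₀ (by norm_num) h4)
      _ = 1 / 2 := by rw [ENNReal.ofReal_inv_of_pos (by norm_num)]; simp
  rw [hc, prob_compl_eq_one_sub hm]
  refine le_trans ?_ (tsub_le_tsub_left (h2.trans h3) 1)
  rw [ENNReal.sub_half ENNReal.one_ne_top]

/-! ### Thresholds and Braun-Blanquet similarity -/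

theorem sum_keepProb_ite (s : Finset (Fin d)) {c : ℝ} :
    ∑ v, keepProb (if v ∈ s then c else 0) = s.card * keepProb c := by
  have (v : Fin d) : keepProb (if v ∈ s then c else 0) = if v ∈ s then keepProb c else 0 := by
    split_ifs <;> simp [keepProb]
  simp [this]

theorem threshold_eq (b₁ : ℝ) (x : Finset (Fin d)) :
    threshold b₁ x = fun v => if v ∈ x then 1 / (b₁ * (x.card : ℝ)) else 0 := by
  funext v
  unfold threshold
  split_ifs <;> simp

/-- On the intersection the smaller threshold belongs to the larger set; this is how the maximum in
Braun-Blanquet similarity arises. -/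
theorem min_threshold {b₁ : ℝ} (hb₁ : 0 < b₁) (x y : Finset (Fin d)) :
    (fun v => min (threshold b₁ x v) (threshold b₁ y v)) =
      fun v => if v ∈ x ∩ y then 1 / (b₁ * (max x.card y.card : ℕ)) else 0 := by
  funext v
  rw [threshold_eq, threshold_eq]
  have hp (z : Finset (Fin d)) : 0 ≤ 1 / (b₁ * (z.card : ℝ)) := by positivity
  have hle {z z' : Finset (Fin d)} (hz : v ∈ z) (h : z.card ≤ z'.card) :
      1 / (b₁ * (z'.card : ℝ)) ≤ 1 / (b₁ * (z.card : ℝ)) := by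
    have : (0 : ℝ) < z.card := by exact_mod_cast Finset.card_pos.2 ⟨v, hz⟩
    exact one_div_le_one_div_of_le (by positivity) (by gcongr)
  by_cases hx : v ∈ x <;> by_cases hy : v ∈ y <;> simp only [hx, hy, Finset.mem_inter, if_true,
    if_false, true_and, and_self, and_true]
  · rcases le_total x.card y.card with h | h
    · rw [max_eq_right h, min_eq_right (hle hx h)]
    · rw [max_eq_left h, min_eq_left (hle hy h)]
  · exact min_eq_right (hp x)
  · exact min_eq_left (hp y)
  · exact min_self 0

theorem sum_keepProb_min_threshold {b₁ : ℝ} (hb₁ : 0 < b₁) (x y : Finset (Fin d)) :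
    ∑ v, keepProb (min (threshold b₁ x v) (threshold b₁ y v)) =
      (x ∩ y).card * keepProb (1 / (b₁ * (max x.card y.card : ℕ))) := by
  rw [← sum_keepProb_ite]
  exact Finset.sum_congr rfl fun v _ => congrArg keepProb (congrFun (min_threshold hb₁ x y) v)

theorem keepProb_le {s : ℝ} (hs : 0 ≤ s) : keepProb s ≤ s := max_le hs (min_le_right _ _)

theorem sum_keepProb_threshold_le {b₁ : ℝ} (hb₁ : 0 < b₁) (x : Finset (Fin d)) :
    ∑ v, keepProb (threshold b₁ x v) ≤ 1 / b₁ := by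
  rw [threshold_eq, sum_keepProb_ite]
  calc (x.card : ℝ) * keepProb (1 / (b₁ * (x.card : ℝ)))
      ≤ x.card * (1 / (b₁ * (x.card : ℝ))) := by gcongr; exact keepProb_le (by positivity)
    _ = (x.card : ℝ) / x.card * (1 / b₁) := by ring
    -- The inequality is strict for the empty set, where the quotient `0 / 0` is 0.
    _ ≤ 1 * (1 / b₁) := by gcongr; exact div_self_le_one _
    _ = 1 / b₁ := one_mul _

theorem sum_keepProb_min_threshold_le {b₁ : ℝ} (hb₁ : 0 < b₁) (x y : Finset (Fin d)) :
    ∑ v, keepProb (min (threshold b₁ x v) (threshold b₁ y v)) ≤ braunBlanquet x y / b₁ := by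
  rw [sum_keepProb_min_threshold hb₁]
  calc ((x ∩ y).card : ℝ) * keepProb (1 / (b₁ * (max x.card y.card : ℕ)))
      ≤ (x ∩ y).card * (1 / (b₁ * (max x.card y.card : ℕ))) := by
        gcongr; exact keepProb_le (by positivity)
    _ = _ := by unfold braunBlanquet; ring

/-- If the common threshold is at least 1, every common element survives with certainty and one of
them suffices; otherwise the sum is exactly the similarity divided by `b₁`. -/
theorem one_le_sum_keepProb_min_threshold {b₁ : ℝ} (hb₁ : 0 < b₁) {x y : Finset (Fin d)}
    (h : b₁ ≤ braunBlanquet x y) :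
    1 ≤ ∑ v, keepProb (min (threshold b₁ x v) (threshold b₁ y v)) := by
  rw [sum_keepProb_min_threshold hb₁]
  have hpos := hb₁.trans_le h
  unfold braunBlanquet at h hpos
  have hM : (0 : ℝ) < (max x.card y.card : ℕ) := by
    by_contra h0
    have : ((max x.card y.card : ℕ) : ℝ) = 0 := le_antisymm (not_lt.1 h0) (Nat.cast_nonneg _)
    simp [this] at hpos
  have hm : (0 : ℝ) < (x ∩ y).card := by
    by_contra h0
    have : ((x ∩ y).card : ℝ) = 0 := le_antisymm (not_lt.1 h0) (Nat.cast_nonneg _)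
    simp [this] at hpos
  have hm1 : (1 : ℝ) ≤ (x ∩ y).card := by exact_mod_cast hm
  rw [le_div_iff₀ hM] at h
  rcases le_total 1 (1 / (b₁ * (max x.card y.card : ℕ) : ℝ)) with h1 | h1
  · rw [keepProb, min_eq_left h1, max_eq_right zero_le_one, mul_one]; exact hm1
  · rw [keepProb, min_eq_right h1, max_eq_right (by positivity), mul_one_div,
      le_div_iff₀ (by positivity), one_mul]
    exact h

theorem chosen_inter {b₁ : ℝ} [DecidableEq (Path w d i)] (h : Hash w d) (x y : Finset (Fin d)) :
    chosen b₁ h x i ∩ chosen b₁ h y i =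
      survivors (fun v => min (threshold b₁ x v) (threshold b₁ y v)) h i := by
  ext p
  rw [Finset.mem_inter, chosen_eq_survivors, chosen_eq_survivors, survivors_inter]

/-- Chosen Path is a sensitive family of maps for Braun-Blanquet similarity. -/
theorem isSensitiveFamily {b₁ b₂ ρ : ℝ} (hb₂ : 0 < b₂) (hb : b₂ < b₁) (hb₁ : b₁ < 1)
    (hρ : ρ = Real.log (1 / b₁) / Real.log (1 / b₂)) {n d k w : ℕ} (hn : 2 ≤ n)
    (hk : k = ⌈Real.log n / Real.log (1 / b₂)⌉₊) (hw : w = 2 * k) :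
    IsSensitiveFamily (d := d) braunBlanquet b₁ b₂
      ((n : ℝ) ^ ρ * w / b₁) ((n : ℝ) ^ (ρ - 1) * w)
      (hashMeasure w d) (fun h x => chosen b₁ h x k) := by
  have hb₁0 := hb₂.trans hb
  have hb₂1 := hb.trans hb₁
  have hn0 : (0 : ℝ) < n := by positivity
  have hN : 0 < (n : ℝ) ^ ρ := Real.rpow_pos_of_pos hn0 _
  have hinv : (1 / b₁) ^ k ≤ (n : ℝ) ^ ρ / b₁ := by
    have := le_pow_ceil hb₁0 hb₁ hb₂ hb₂1 hρ hn
    rw [← hk] at this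
    rw [one_div, inv_pow, ← inv_div]
    exact inv_anti₀ (by positivity) this
  refine ⟨inferInstance, fun x => ?_, fun x y hxy => ?_, fun x y hxy => ?_⟩
  · simp_rw [chosen_eq_survivors, lintegral_card_survivors]
    refine ENNReal.ofReal_le_ofReal ?_
    calc (∑ v, keepProb (threshold b₁ x v)) ^ k * w ≤ (1 / b₁) ^ k * w := by
          gcongr
          · exact Finset.sum_nonneg fun v _ => keepProb_nonneg _
          · exact sum_keepProb_threshold_le hb₁0 x
      _ ≤ (n : ℝ) ^ ρ / b₁ * w := by gcongr
      _ = _ := by ring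
  · simp_rw [chosen_inter, lintegral_card_survivors]
    refine ENNReal.ofReal_le_ofReal ?_
    refine mul_le_mul_of_nonneg_right ?_ (Nat.cast_nonneg w)
    have hL := log_inv_pos hb₂ hb₂1
    have hρ1 := (rho_mem hb₂ hb hb₁ hρ).2
    -- With `b₁ = b₂ ^ ρ` the rate `b₂ / b₁` is `b₂ ^ (1 - ρ)`, and since `1 - ρ ≥ 0` the bound `b₂
    -- ^ k ≤ 1 / n` can be inserted.
    have hb₁ρ : b₁ = b₂ ^ ρ := by
      rw [← Real.log_injOn_pos.eq_iff hb₁0 (Real.rpow_pos_of_pos hb₂ _), Real.log_rpow hb₂, hρ,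
        one_div, one_div, Real.log_inv, Real.log_inv, neg_div_neg_eq,
        div_mul_cancel₀ _ (Real.log_neg hb₂ hb₂1).ne]
    have hpow : b₂ ^ k ≤ 1 / n := hk ▸ pow_ceil_le hb₂ hb₂1 hn
    calc (∑ v, keepProb (min (threshold b₁ x v) (threshold b₁ y v))) ^ k ≤ (b₂ / b₁) ^ k := by
          refine pow_le_pow_left₀ (Finset.sum_nonneg fun v _ => keepProb_nonneg _) ?_ k
          exact (sum_keepProb_min_threshold_le hb₁0 x y).trans (by gcongr)
      _ = (b₂ ^ k) ^ (1 - ρ) := by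
          have e : b₁ ^ k = (b₂ ^ k) ^ ρ := by rw [hb₁ρ, Real.rpow_pow_comm hb₂.le]
          rw [Real.rpow_sub (by positivity), Real.rpow_one, div_pow, e]
      _ ≤ (1 / (n : ℝ)) ^ (1 - ρ) :=
          Real.rpow_le_rpow (by positivity) hpow (sub_nonneg.2 hρ1)
      _ = (n : ℝ) ^ (ρ - 1) := by
          rw [one_div, Real.inv_rpow hn0.le, ← Real.rpow_neg hn0.le, neg_sub]
  · subst hw
    simp_rw [chosen_inter]
    refine half_le_survivors_nonempty (one_le_sum_keepProb_min_threshold hb₁0 hxy) ?_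
    rw [hk]
    exact Nat.ceil_pos.2 (div_pos (Real.log_pos (by exact_mod_cast hn)) (log_inv_pos hb₂ hb₂1))

end ChosenPath

theorem theorem1 (b₁ b₂ ρ : ℝ) (hb₂ : 0 < b₂) (hb : b₂ < b₁) (hb₁ : b₁ < 1)
    (hρ : ρ = Real.log (1 / b₁) / Real.log (1 / b₂)) :
    (∀ a : ℕ, ∃ c₀ : ℝ, 0 < c₀ ∧ ∀ c : ℝ, ∃ (pre qry : WordRAM.Prog) (C : ℝ),
      ∀ (n d W : ℕ) (P : Fin n → Finset (Fin d)), 2 ≤ n → d ≤ n ^ a →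
        c₀ * Real.logb 2 n ≤ W → W ≤ c * Real.logb 2 n → Function.Injective P →
        ∃ S : ℕ,
          S ≤ C * ((n : ℝ) ^ (1 + ρ) * Real.log n + ∑ i, ((P i).card : ℝ)) ∧
          SolvesSearch W braunBlanquet b₁ b₂ P pre qry S
            fun m => C * (max 1 m * (n : ℝ) ^ ρ * Real.log n)) ∧
    (∀ (n d k w : ℕ), 2 ≤ n → k = ⌈Real.log n / Real.log (1 / b₂)⌉₊ → w = 2 * k →
      IsSensitiveFamily (d := d) braunBlanquet b₁ b₂
        ((n : ℝ) ^ ρ * w / b₁) ((n : ℝ) ^ (ρ - 1) * w)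
        (ChosenPath.hashMeasure w d) (fun h x => ChosenPath.chosen b₁ h x k)) :=
  ⟨exists_solvesSearch hb₂ hb hb₁ hρ, fun _ _ _ _ => ChosenPath.isSensitiveFamily hb₂ hb hb₁ hρ⟩
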